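/- Let $d\in\{1,2,3\}$ and let $f(z)=g(|z|^2)z$ for $z\in\mathbb C$, where $g\in C([0,\infty),\mathbb R)\cap C^2((0,\infty),\mathbb R)$, $g(0)=0$, and for some $C_0>0$ and $0<\alpha_1\le\alpha_2$ (with $\alpha_2<4$ if $d=3$) $$|sg'(s)|+|s^2g''(s)|\le C_0\,(s^{\alpha_1/2}+s^{\alpha_2/2})\qquad(s>0).$$ Assume that there are $\omega_*>0$, $0<a<1$, $D>0$ such that for every $0<\omega<\omega_*$ there is a nontrivial (differentiable, real-valued) solution $\varphi\in H^1(\mathbb R^d)$ of $-\Delta\varphi+\omega\varphi=f(\varphi)$ with $$|\varphi(x)|+\omega^{-1/2}|\nabla\varphi(x)|\le D\,\omega^{1/\alpha_1}e^{-a\omega^{1/2}|x|}\qquad\text{for all }x\in\mathbb R^d.\tag{1}$$ Suppose moreover that $2\left(\tfrac12-\tfrac1d\right)<\alpha_1<2$. Then for every $\rho\in(0,\infty)$ there are constants $r\in(d,\infty)$, $\lambda_0>0$ and $c_1\in(0,1]$ such that for every $\lambda\ge\lambda_0$ the following holds. There exist frequencies $\omega_j\in(0,\omega_*)$, nontrivial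 real $H^1$ solutions $\varphi_j$ of $-\Delta\varphi_j+\omega_j\varphi_j=f(\varphi_j)$ satisfying (1) with $\omega=\omega_j$, velocities $v_j\in\mathbb R^d$ and phases $\gamma_j\in\mathbb R$ ($j\in\mathbb N$), with $\sum_j\omega_j^{1/\alpha_1}<\infty$ and $$\inf_{j<k}\tfrac12\min(1,\omega_j^{1/2},\omega_k^{1/2})\,|v_j-v_k|>0,$$ and a function $\eta\in C([0,\infty),L^2(\mathbb R^d,\mathbb C))$ whose weak gradient $\nabla\eta(t)$ lies in $L^2\cap L^r$ for each $t\ge0$, such that, with $$T(t,x)=\sum_{j\in\mathbb N}e^{i(\omega_jt+\frac12v_j\cdot x-\frac14|v_j|^2t+\gamma_j)}\,\varphi_j(x-v_jt),$$ the function $u=T+\eta$ is a solution of $$i\partial_tu+\Delta u+f(u)=0$$ on $(0,\infty)\times\mathbb R^d$ in the sense of distributions ($u$ and $f(u)$ being locally integrable there), and $$\sup_{t\ge0}\bigl\{e^{\lambda t}\|\eta(t)\|_{L^2}+e^{c_1\lambda t}\|\nabla\eta(t)\|_{L^2\cap L^r}\bigr\}\le\rho,$$ where $\|\cdot\|_{L^2\cap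 L^r}=\max(\|\cdot\|_{L^2},\|\cdot\|_{L^r})$. If moreover $d=1$ and $\alpha_1\ge1$, then the same assertion also holds with $r=\infty$ (for suitable $\lambda_0>0$ and $c_1\in(0,1]$ depending on $\rho$). -/

import Mathlib

open MeasureTheory Filter Topology
open scoped ENNReal

noncomputable section

namespace SolitonTrain

/-- `ℝ^d` with the Euclidean norm and Lebesgue measure. -/
abbrev Space (d : ℕ) : Type := EuclideanSpace ℝ (Fin d)

/-- The nonlinearity `f(z) = g(|z|²) z`. -/
def nonlin (g : ℝ → ℝ) (z : ℂ) : ℂ := (g (‖z‖ ^ 2) : ℂ) * z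

/-- Structural assumption on the nonlinearity `f(z) = g(|z|²) z` in dimension `d`. The values of
`g` on the negative axis play no role. -/
structure AssumptionF (d : ℕ) (g : ℝ → ℝ) (C₀ α₁ α₂ : ℝ) : Prop where
  continuousOn : ContinuousOn g (Set.Ici 0)
  contDiffOn : ContDiffOn ℝ 2 g (Set.Ioi 0)
  zero : g 0 = 0
  const_pos : 0 < C₀
  exponent_pos : 0 < α₁
  exponent_le : α₁ ≤ α₂
  subcritical : 3 ≤ d → α₂ < 4 / ((d : ℝ) - 2)
  bound : ∀ s : ℝ, 0 < s →
    |s * deriv g s| + |s ^ 2 * deriv (deriv g) s| ≤ C₀ * (s ^ (α₁ / 2) + s ^ (α₂ / 2))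

/-- `φ` is a nontrivial real solution in `H¹(ℝ^d)` of `-Δφ + ω φ = f(φ)`, the equation being
understood in the sense of distributions. -/
structure IsBoundState (d : ℕ) (g : ℝ → ℝ) (ω : ℝ) (φ : Space d → ℝ) : Prop where
  differentiable : Differentiable ℝ φ
  memLp : MemLp φ 2 volume
  memLp_gradient : MemLp (gradient φ) 2 volume
  nontrivial : φ ≠ 0
  equation : ∀ ψ : Space d → ℝ, ContDiff ℝ (⊤ : ℕ∞) ψ → HasCompactSupport ψ →
    ∫ x, (φ x * (-(Laplacian.laplacian ψ x)) + ω * φ x * ψ x - g (φ x ^ 2) * φ x * ψ x) = 0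

/-- The bound `|φ(x)| + ω^{-1/2} |∇φ(x)| ≤ D ω^{1/α₁} e^{-a ω^{1/2} |x|}` for all `x`. -/
def HasDecay (d : ℕ) (α₁ a D ω : ℝ) (φ : Space d → ℝ) : Prop :=
  ∀ x : Space d, |φ x| + ω ^ (-(1 / 2 : ℝ)) * ‖gradient φ x‖ ≤
    D * ω ^ (1 / α₁) * Real.exp (-(a * ω ^ (1 / 2 : ℝ) * ‖x‖))

/-- Existence, for all frequencies `0 < ω < ωs`, of bound states with uniform decay. -/
structure AssumptionT (d : ℕ) (g : ℝ → ℝ) (α₁ ωs a D : ℝ) : Prop where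
  freq_pos : 0 < ωs
  rate_pos : 0 < a
  rate_lt_one : a < 1
  const_pos : 0 < D
  exists_boundState : ∀ ω : ℝ, 0 < ω → ω < ωs →
    ∃ φ : Space d → ℝ, IsBoundState d g ω φ ∧ HasDecay d α₁ a D ω φ

/-- The soliton with profile `φ`, frequency `ω`, velocity `v`, initial position `x₀` and
phase `γ`:
`R(t,x) = exp(i(ω t + v·x/2 - |v|² t/4 + γ)) φ(x - x₀ - v t)`. -/
def soliton {d : ℕ} (φ : Space d → ℝ) (ω : ℝ) (v x₀ : Space d) (γ : ℝ) (t : ℝ) (x : Space d) :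
    ℂ :=
  Complex.exp (Complex.I *
      ((ω * t + (1 / 2) * inner ℝ v x - (1 / 4) * ‖v‖ ^ 2 * t + γ : ℝ) : ℂ)) *
    (φ (x - x₀ - t • v) : ℂ)

/-- `u` solves `i ∂ₜu + Δu + f(u) = 0` on `(0,∞) × ℝ^d` in the sense of distributions. -/
structure IsNLSSolution (d : ℕ) (g : ℝ → ℝ) (u : ℝ → Space d → ℂ) : Prop where
  locallyIntegrableOn :
    LocallyIntegrableOn (fun z : ℝ × Space d => u z.1 z.2) (Set.Ioi 0 ×ˢ Set.univ) volume
  locallyIntegrableOn_nonlin :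
    LocallyIntegrableOn (fun z : ℝ × Space d => nonlin g (u z.1 z.2))
      (Set.Ioi 0 ×ˢ Set.univ) volume
  equation : ∀ ψ : ℝ × Space d → ℂ, ContDiff ℝ (⊤ : ℕ∞) ψ → HasCompactSupport ψ →
    tsupport ψ ⊆ Set.Ioi 0 ×ˢ Set.univ →
    ∫ z : ℝ × Space d,
      (u z.1 z.2 * (-(Complex.I * deriv (fun s => ψ (s, z.2)) z.1)
          + Laplacian.laplacian (fun y => ψ (z.1, y)) z.2)
        + nonlin g (u z.1 z.2) * ψ z) = 0

/-- `G` is the weak (distributional) gradient of the complex-valued function `w`. -/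
structure HasWeakGradient {d : ℕ} (w : Space d → ℂ) (G : Space d → EuclideanSpace ℂ (Fin d)) :
    Prop where
  locallyIntegrable : LocallyIntegrable w volume
  locallyIntegrable_gradient : LocallyIntegrable G volume
  integral_eq : ∀ ψ : Space d → ℂ, ContDiff ℝ (⊤ : ℕ∞) ψ → HasCompactSupport ψ → ∀ i : Fin d,
    ∫ x, w x * fderiv ℝ ψ x (EuclideanSpace.single i 1) = -∫ x, G x i * ψ x

/-- Admissible parameters of an infinite family of solitons: each `φ j` is a bound state of
frequency `ω j ∈ (0, ωs)` with the decay bound; `∑ ω_j^{1/α₁} < ∞`, so that the sum of the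
solitons converges absolutely and uniformly; and the solitons are separated:
`inf_{j<k} ½ min(1, ω_j^{1/2}, ω_k^{1/2}) |v_j - v_k| > 0`. -/
structure IsTrainData (d : ℕ) (g : ℝ → ℝ) (α₁ ωs a D : ℝ)
    (φ : ℕ → Space d → ℝ) (ω : ℕ → ℝ) (v : ℕ → Space d) : Prop where
  freq_pos : ∀ j, 0 < ω j
  freq_lt : ∀ j, ω j < ωs
  boundState : ∀ j, IsBoundState d g (ω j) (φ j)
  decay : ∀ j, HasDecay d α₁ a D (ω j) (φ j)
  summable : Summable fun j => ω j ^ (1 / α₁)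
  separated : ∃ κ : ℝ, 0 < κ ∧ ∀ j k : ℕ, j < k →
    κ ≤ 1 / 2 * min 1 (min (ω j ^ (1 / 2 : ℝ)) (ω k ^ (1 / 2 : ℝ))) * ‖v j - v k‖

/-- The profile `T = ∑_j R_j`, all solitons being initially centred at the origin. -/
def trainProfile {d : ℕ} (φ : ℕ → Space d → ℝ) (ω : ℕ → ℝ) (v : ℕ → Space d) (γ : ℕ → ℝ)
    (t : ℝ) (x : Space d) : ℂ :=
  ∑' j, soliton (φ j) (ω j) (v j) 0 (γ j) t x

/-- There is a solution `T + η` of the nonlinear Schrödinger equation, with `T` an infinite sum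
of solitons and `η ∈ C([0,∞), L²)`, such that for all `t ≥ 0`
`e^{lam t} ‖η(t)‖_{L²} + e^{c₁ lam t} ‖∇η(t)‖_{L² ∩ L^r} ≤ ρ`,
the norm of `L² ∩ L^r` being the maximum of the two norms. -/
def ExistsTrain (d : ℕ) (g : ℝ → ℝ) (α₁ ωs a D : ℝ) (r : ℝ≥0∞) (ρ lam c₁ : ℝ) : Prop :=
  ∃ (φ : ℕ → Space d → ℝ) (ω : ℕ → ℝ) (v : ℕ → Space d) (γ : ℕ → ℝ)
    (η : ℝ → Space d → ℂ) (Dη : ℝ → Space d → EuclideanSpace ℂ (Fin d)),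
    IsTrainData d g α₁ ωs a D φ ω v ∧
    IsNLSSolution d g (fun t x => trainProfile φ ω v γ t x + η t x) ∧
    (∀ t : ℝ, 0 ≤ t → MemLp (η t) 2 volume ∧ HasWeakGradient (η t) (Dη t) ∧
      MemLp (Dη t) 2 volume ∧ MemLp (Dη t) r volume) ∧
    (∀ t : ℝ, 0 ≤ t →
      Tendsto (fun s => eLpNorm (η s - η t) 2 volume) (𝓝[Set.Ici 0] t) (𝓝 0)) ∧
    ∀ t : ℝ, 0 ≤ t →
      ENNReal.ofReal (Real.exp (lam * t)) * eLpNorm (η t) 2 volume +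
        ENNReal.ofReal (Real.exp (c₁ * lam * t)) *
          max (eLpNorm (Dη t) 2 volume) (eLpNorm (Dη t) r volume) ≤ ENNReal.ofReal ρ

end SolitonTrain

end

/-! Write `u = T + η`. Each soliton `R_j` is an exact solution, so `η` must solve `i∂ₜη + Δη + N =
0` with `N = f(T + η) - f(T) + H` and interaction error `H = f(T) - ∑ f(R_j)`. A solution vanishing
at infinite time is a fixed point of the backward integral `η(t) = -i ∫_t^∞ e^{i(t-s)Δ} N(s) ds`
(`duhamel`). If `H` decays like `e^{-λt}`, integrating the exponential gains a factor `1/λ`, so for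
large `λ` this map is a contraction (`exists_eq_duhamel`, `AssumptionF.exists_remainder`).

Because `f` is only locally Lipschitz, `η` must be bounded. This follows from Morrey's inequality
when the gradient lies in `L^r` with `r > d`. The contraction metric involves only `L²` norms; the
gradient bounds are a closed constraint preserved by the map. They are expressed through difference
quotients, which commute with the free group and pass to `L²` limits. The `L^r` bound uses a
dispersive estimate from `L^{2/(1+β)} ∩ L²` to `L^{2/(1-θ)}` with time singularity `|t|^{-dθ/2}`,
`dθ/2 < 1`. Since `f'` is merely Hölder continuous, `(f'(T+η) - f'(T))∇T` is controlled by `|η|^β`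
and decays only like `e^{-βλt}`. This is why the gradient has the slower rate with `c₁ = β`.

The train is explicit. With `μ_j = e 2^{-j}` the frequencies are `μ_j²` and the velocities `(Λ/μ_j)
n` for one fixed unit vector `n`. Each soliton is dominated by `w_j = μ_j^{2/α₁} exp(-a μ_j |x - t
v_j|)`. Measured in units of the width `1/μ_j`, all solitons move at the same speed `Λ`, so products
of distinct `w_j` decay at a rate uniform over all pairs (`bump_mul_le`). Fractional powers are
summed through a common envelope `V = (∑ w_j^δ)^{1/δ}` with small `δ`, and Hölder continuity of `g`
and `f'` turns separation into decay of `H` and of its derivative (`Waves.norm_interactionError_le`,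
`Waves.norm_fderiv_interactionError_le`).

The order of choices is essential. The threshold for `λ` depends on the size bound `D` but not on
the gradient of `T`. Given `λ`, the parameter `Λ` is taken proportional to it, which makes `∇T`
large, of order `1 + Λ`. Finally `e` is shrunk: the relevant norms of powers of `V` tend to zero
with `e` and defeat the factor `1 + Λ` (`eventually_eLpNorm_envelope_le`,
`AssumptionT.exists_background`). The scaling condition for this is `d c/4 < M/α₁` for `V^M` in
`L^{2/c}`.

The hypothesis `α₁ > 1 - 2/d` leaves room for a Hölder exponent `β ≤ α₁` with `1 - 2/d < θ < β`,
which is what `r = 2/(1-θ) > d` requires. The hypothesis `α₁ < 2` makes the exponent `κ = 1 - α₁/2`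
in `|∇R_j| ≲ w_j^κ` positive. If `d = 1` and `α₁ ≥ 1`, the choice `β = 1` permits the endpoint `L¹ →
L^∞`. -/

namespace SolitonTrain

/-! ### Dominated convergence in `L²` and the free Schrödinger group. -/

noncomputable section

open FourierTransform Complex

/-- `L²(ℝ^d; ℂ)`. -/
abbrev L2 (d : ℕ) : Type := Lp ℂ 2 (volume : Measure (Space d))

section DominatedConvergence

variable {X : Type*} [MeasurableSpace X] {μ : Measure X} {ι : Type*} {l : Filter ι}
  [l.IsCountablyGenerated] {E : Type*} [NormedAddCommGroup E]

theorem tendsto_eLpNorm_two_of_dominated {F : ι → X → E} {f : X → E} {B : X → ℝ}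
    (hB : MemLp B 2 μ) (hF : ∀ᶠ n in l, AEStronglyMeasurable (F n) μ)
    (hf : AEStronglyMeasurable f μ) (hle : ∀ᶠ n in l, ∀ᵐ x ∂μ, ‖F n x - f x‖ ≤ B x)
    (hlim : ∀ᵐ x ∂μ, Tendsto (fun n => F n x) l (𝓝 (f x))) :
    Tendsto (fun n => eLpNorm (fun x => F n x - f x) 2 μ) l (𝓝 0) := by
  have key : Tendsto (fun n => ∫ x, ‖F n x - f x‖ ^ 2 ∂μ) l (𝓝 (∫ _, (0 : ℝ) ∂μ)) := by
    refine tendsto_integral_filter_of_dominated_convergence (fun x => B x ^ 2) ?_ ?_ hB.integrable_sq ?_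
    · filter_upwards [hF] with n hn
      exact ((hn.sub hf).norm).pow 2
    · filter_upwards [hle] with n hn
      filter_upwards [hn] with x hx
      rw [Real.norm_of_nonneg (by positivity)]
      gcongr
    · filter_upwards [hlim] with x hx
      have := ((tendsto_sub_nhds_zero_iff.2 hx).norm).pow 2
      simpa using this
  simp only [integral_zero] at key
  have key2 := ENNReal.tendsto_ofReal key
  have key3 : Tendsto (fun n => (ENNReal.ofReal (∫ x, ‖F n x - f x‖ ^ 2 ∂μ)) ^ (1 / 2 : ℝ)) l
      (𝓝 0) := by
    have := (ENNReal.continuous_rpow_const (y := (1 / 2 : ℝ))).tendsto _ |>.comp key2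
    simpa [Function.comp_def] using this
  refine key3.congr' ?_
  filter_upwards [hle, hF] with n hn hm
  have hmem : MemLp (fun x => F n x - f x) 2 μ := by
    refine hB.mono (hm.sub hf) ?_
    filter_upwards [hn] with x hx
    exact hx.trans (le_abs_self _)
  rw [eLpNorm_eq_lintegral_rpow_enorm_toReal (by norm_num) (by norm_num),
    ofReal_integral_eq_lintegral_ofReal (hmem.integrable_norm_pow (by norm_num))
      (Eventually.of_forall fun x => by positivity)]
  congr 1
  · refine lintegral_congr fun x => ?_
    rw [ENNReal.ofReal_pow (norm_nonneg _), ofReal_norm]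
    norm_num

/-- Dominated convergence in `L²`, for classes with given representatives. -/
theorem tendsto_L2_of_dominated {F : ι → Lp E 2 μ} {f : Lp E 2 μ} {F' : ι → X → E} {f' : X → E}
    {B : X → ℝ} (hB : MemLp B 2 μ) (hF : ∀ n, F n =ᵐ[μ] F' n) (hf : f =ᵐ[μ] f')
    (hle : ∀ᶠ n in l, ∀ᵐ x ∂μ, ‖F' n x - f' x‖ ≤ B x)
    (hlim : ∀ᵐ x ∂μ, Tendsto (fun n => F' n x) l (𝓝 (f' x))) : Tendsto F l (𝓝 f) := by
  rw [Lp.tendsto_Lp_iff_tendsto_eLpNorm']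
  refine (tendsto_eLpNorm_two_of_dominated hB
    (Eventually.of_forall fun n => (Lp.aestronglyMeasurable (F n)).congr (hF n))
    ((Lp.aestronglyMeasurable f).congr hf) hle hlim).congr fun n => ?_
  exact eLpNorm_congr_ae ((hF n).symm.sub hf.symm)

end DominatedConvergence

variable {d : ℕ}

theorem memLp_phase (θ : Space d → ℝ) (hθ : Measurable θ) (U : L2 d) :
    MemLp (fun x => cexp (I * θ x) * U x) 2 volume := by
  refine (Lp.memLp U).of_le (by fun_prop) (Eventually.of_forall fun x => ?_)
  rw [norm_mul, mul_comm I, norm_exp_ofReal_mul_I, one_mul]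

/-- Multiplication by the unimodular function `e^{iθ}` on `L²`. -/
def phaseMul (θ : Space d → ℝ) (hθ : Measurable θ) : L2 d →ₗᵢ[ℂ] L2 d where
  toFun U := (memLp_phase θ hθ U).toLp _
  map_add' U W := by
    apply Lp.ext
    filter_upwards [(memLp_phase θ hθ (U + W)).coeFn_toLp, (memLp_phase θ hθ U).coeFn_toLp,
      (memLp_phase θ hθ W).coeFn_toLp, Lp.coeFn_add U W,
      Lp.coeFn_add ((memLp_phase θ hθ U).toLp _) ((memLp_phase θ hθ W).toLp _)] with x h1 h2 h3 h4 h5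
    rw [h1, h5, Pi.add_apply, h2, h3, h4, Pi.add_apply, mul_add]
  map_smul' c U := by
    apply Lp.ext
    filter_upwards [(memLp_phase θ hθ (c • U)).coeFn_toLp, (memLp_phase θ hθ U).coeFn_toLp,
      Lp.coeFn_smul c U, Lp.coeFn_smul c ((memLp_phase θ hθ U).toLp _)] with x h1 h2 h3 h4
    simp only [RingHom.id_apply]
    rw [h1, h4, Pi.smul_apply, h2, h3, Pi.smul_apply, smul_eq_mul, smul_eq_mul, mul_left_comm]
  norm_map' U := by
    simp only [LinearMap.coe_mk, AddHom.coe_mk]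
    rw [Lp.norm_toLp, Lp.norm_def]
    congr 1
    refine eLpNorm_congr_norm_ae (Eventually.of_forall fun x => ?_)
    rw [norm_mul, mul_comm I, norm_exp_ofReal_mul_I, one_mul]

theorem coeFn_phaseMul (θ : Space d → ℝ) (hθ : Measurable θ) (U : L2 d) :
    phaseMul θ hθ U =ᵐ[volume] fun x => cexp (I * θ x) * U x :=
  (memLp_phase θ hθ U).coeFn_toLp

theorem phaseMul_phaseMul (θ θ' : Space d → ℝ) (hθ : Measurable θ) (hθ' : Measurable θ')
    (U : L2 d) : phaseMul θ hθ (phaseMul θ' hθ' U) = phaseMul (θ + θ') (hθ.add hθ') U := by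
  apply Lp.ext
  filter_upwards [coeFn_phaseMul θ hθ (phaseMul θ' hθ' U), coeFn_phaseMul θ' hθ' U,
    coeFn_phaseMul (θ + θ') (hθ.add hθ') U] with x h1 h2 h3
  rw [h1, h2, h3, ← mul_assoc, ← Complex.exp_add]
  simp [mul_add]

/-- The symbol `-4π²|ξ|²` of the Laplacian. -/
def symbol (d : ℕ) (ξ : Space d) : ℝ := -(4 * Real.pi ^ 2 * ‖ξ‖ ^ 2)

theorem measurable_mul_symbol (t : ℝ) : Measurable fun ξ : Space d => t * symbol d ξ := by
  unfold symbol; fun_prop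

/-- The free Schrödinger group `e^{itΔ}` on `L²`. -/
def schrodinger (t : ℝ) : L2 d →ₗᵢ[ℂ] L2 d :=
  (Lp.fourierTransformₗᵢ (Space d) ℂ).symm.toLinearIsometry.comp
    ((phaseMul (fun ξ => t * symbol d ξ) (measurable_mul_symbol t)).comp
      (Lp.fourierTransformₗᵢ (Space d) ℂ).toLinearIsometry)

theorem schrodinger_apply (t : ℝ) (U : L2 d) : schrodinger t U =
    𝓕⁻ (phaseMul (fun ξ => t * symbol d ξ) (measurable_mul_symbol t) (𝓕 U)) := rfl

theorem fourier_schrodinger (t : ℝ) (U : L2 d) : 𝓕 (schrodinger t U) =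
    phaseMul (fun ξ => t * symbol d ξ) (measurable_mul_symbol t) (𝓕 U) := by
  rw [schrodinger_apply, fourier_fourierInv_eq]

theorem fourier_L2_injective {U W : L2 d} (h : 𝓕 U = 𝓕 W) : U = W :=
  (Lp.fourierTransformₗᵢ (Space d) ℂ).injective h

theorem schrodinger_add (s t : ℝ) (U : L2 d) :
    schrodinger (s + t) U = schrodinger s (schrodinger t U) := by
  apply fourier_L2_injective
  rw [fourier_schrodinger, fourier_schrodinger, fourier_schrodinger, phaseMul_phaseMul]
  congr 2
  ext ξ
  simp [add_mul]

theorem schrodinger_zero (U : L2 d) : schrodinger 0 U = U := by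
  apply fourier_L2_injective
  rw [fourier_schrodinger]
  apply Lp.ext
  filter_upwards [coeFn_phaseMul (fun ξ => 0 * symbol d ξ) (measurable_mul_symbol 0) (𝓕 U)]
    with x h1
  rw [h1]; simp

theorem continuous_schrodinger_apply (U : L2 d) : Continuous fun t => schrodinger t U := by
  have : Continuous fun t : ℝ =>
      phaseMul (fun ξ => t * symbol d ξ) (measurable_mul_symbol t) (𝓕 U) := by
    rw [continuous_iff_continuousAt]
    intro t₀
    refine tendsto_L2_of_dominated (B := fun x => 2 * ‖(𝓕 U : L2 d) x‖)
      ((Lp.memLp _).norm.const_mul 2) (fun t => coeFn_phaseMul _ _ _) (coeFn_phaseMul _ _ _)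
      (Eventually.of_forall fun t => Eventually.of_forall fun x => ?_)
      (Eventually.of_forall fun x => ?_)
    · refine (norm_sub_le _ _).trans ?_
      rw [norm_mul, norm_mul, mul_comm I, mul_comm I, norm_exp_ofReal_mul_I,
        norm_exp_ofReal_mul_I]
      linarith
    · exact Continuous.tendsto (by fun_prop) t₀
  exact (Lp.fourierTransformₗᵢ (Space d) ℂ).symm.continuous.comp this

/-- Strong continuity upgrades to joint continuity because every member of the group is an isometry.
-/
theorem continuous_schrodinger : Continuous fun p : ℝ × L2 d => schrodinger p.1 p.2 := by
  rw [continuous_iff_continuousAt]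
  rintro ⟨t₀, U₀⟩
  rw [ContinuousAt, tendsto_iff_norm_sub_tendsto_zero]
  have h1 : Tendsto (fun p : ℝ × L2 d => ‖p.2 - U₀‖ + ‖schrodinger p.1 U₀ - schrodinger t₀ U₀‖)
      (𝓝 (t₀, U₀)) (𝓝 0) := by
    have : Continuous fun p : ℝ × L2 d =>
        ‖p.2 - U₀‖ + ‖schrodinger p.1 U₀ - schrodinger t₀ U₀‖ :=
      (by fun_prop : Continuous fun p : ℝ × L2 d => ‖p.2 - U₀‖).add
        (((continuous_schrodinger_apply U₀).comp continuous_fst).sub continuous_const).norm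
    simpa using this.tendsto (t₀, U₀)
  refine squeeze_zero (fun _ => norm_nonneg _) (fun p => ?_) h1
  calc ‖schrodinger p.1 p.2 - schrodinger t₀ U₀‖
      = ‖schrodinger p.1 (p.2 - U₀) + (schrodinger p.1 U₀ - schrodinger t₀ U₀)‖ := by
        rw [map_sub]; congr 1; abel
    _ ≤ _ := (norm_add_le _ _).trans (by rw [LinearIsometry.norm_map])

end

end SolitonTrain

/-! ### Time derivative of the group and commutation with translations. -/

namespace SolitonTrain

noncomputable section

open FourierTransform Complex

variable {d : ℕ}

/-- Induction for closed properties on `L²`, from Schwartz functions. -/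
theorem L2_induction {p : L2 d → Prop} (hp : IsClosed {U | p U})
    (h : ∀ f : SchwartzMap (Space d) ℂ, p (f.toLp 2)) (U : L2 d) : p U :=
  DenseRange.induction_on (p := p) (SchwartzMap.denseRange_toLpCLM (p := 2) ENNReal.ofNat_ne_top)
    U hp h

theorem fourier_laplacian_apply (f : SchwartzMap (Space d) ℂ) (ξ : Space d) :
    𝓕 (Laplacian.laplacian f) ξ = symbol d ξ * 𝓕 f ξ := by
  have hg : Function.HasTemperateGrowth (fun x : Space d => ((‖x‖ ^ 2 : ℝ))) := by fun_prop
  rw [SchwartzMap.laplacian_eq_fourierMultiplierCLM, SchwartzMap.fourierMultiplierCLM_apply]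
  rw [FourierTransform.fourier_smul, fourier_fourierInv_eq]
  rw [smul_apply, SchwartzMap.smulLeftCLM_apply_apply hg]
  simp only [symbol, Complex.real_smul]
  push_cast
  ring

theorem hasDerivAt_phase (y t : ℝ) :
    HasDerivAt (fun s : ℝ => cexp (I * (s * y : ℝ))) (I * y * cexp (I * (t * y : ℝ))) t := by
  have h1 : HasDerivAt (fun s : ℝ => I * ((s * y : ℝ) : ℂ)) (I * y) t := by
    have := ((hasDerivAt_id t).mul_const y).ofReal_comp.const_mul I
    simpa using this
  rw [mul_comm (I * (y : ℂ))]
  exact h1.cexp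

/-- The bound is uniform in `s` and `t`; it supplies the dominating function when difference
quotients of a phase are taken in `L²`. -/
theorem norm_slope_phase_le (y t s : ℝ) :
    ‖slope (fun s : ℝ => cexp (I * (s * y : ℝ))) t s‖ ≤ |y| := by
  have hl := Convex.norm_image_sub_le_of_norm_hasDerivWithin_le (𝕜 := ℝ)
    (s := Set.univ) (C := |y|) (x := t) (y := s)
    (fun r _ => (hasDerivAt_phase y r).hasDerivWithinAt) (fun r _ => by
      rw [norm_mul, mul_comm I (((r * y : ℝ)) : ℂ), norm_exp_ofReal_mul_I, mul_one, norm_mul,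
        norm_I, one_mul, Complex.norm_real, Real.norm_eq_abs]) convex_univ trivial trivial
  rw [slope_def_module, norm_smul, norm_inv]
  rcases eq_or_ne s t with rfl | hst
  · simp
  · rw [inv_mul_le_iff₀ (norm_pos_iff.2 (sub_ne_zero.2 hst)), mul_comm ‖s - t‖]
    exact hl

/-- Membership of `θ F` in `L²`, witnessed by `G`, is the domain condition for the generator. It
serves twice: for the Schrödinger group and for translations, both of which are phase
multiplications after Fourier transform. -/
theorem hasDerivAt_phaseMul (θ : Space d → ℝ) (hθ : ∀ s : ℝ, Measurable fun x => s * θ x)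
    {F G : L2 d} (hG : G =ᵐ[volume] fun x => θ x * F x) (t : ℝ) :
    HasDerivAt (fun s : ℝ => phaseMul (fun x => s * θ x) (hθ s) F)
      (I • phaseMul (fun x => t * θ x) (hθ t) G) t := by
  rw [hasDerivAt_iff_tendsto_slope]
  refine tendsto_L2_of_dominated (B := fun x => 2 * ‖G x‖)
    (F' := fun s x => slope (fun s : ℝ => cexp (I * (s * θ x : ℝ))) t s * F x)
    (f' := fun x => I * (cexp (I * (t * θ x : ℝ)) * G x))
    ((Lp.memLp G).norm.const_mul 2) (fun s => ?_) ?_ (Eventually.of_forall fun s => ?_) ?_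
  · simp only [slope_def_module]
    filter_upwards [coeFn_phaseMul _ (hθ s) F, coeFn_phaseMul _ (hθ t) F,
      Lp.coeFn_smul (s - t)⁻¹ (phaseMul _ (hθ s) F - phaseMul _ (hθ t) F),
      Lp.coeFn_sub (phaseMul _ (hθ s) F) (phaseMul _ (hθ t) F)] with x h1 h2 h3 h4
    rw [h3, Pi.smul_apply, h4, Pi.sub_apply, h1, h2]
    simp only [Complex.real_smul]
    ring
  · filter_upwards [coeFn_phaseMul _ (hθ t) G, Lp.coeFn_smul I (phaseMul _ (hθ t) G)] with x h1 h2
    rw [h2, Pi.smul_apply, h1, smul_eq_mul]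
  · filter_upwards [hG] with x hx
    refine (norm_sub_le _ _).trans ?_
    rw [norm_mul, norm_mul, norm_mul, norm_I, one_mul, mul_comm I (((t * θ x : ℝ)) : ℂ),
      norm_exp_ofReal_mul_I, one_mul, hx, norm_mul, Complex.norm_real, Real.norm_eq_abs]
    nlinarith [mul_le_mul_of_nonneg_right (norm_slope_phase_le (θ x) t s) (norm_nonneg (F x))]
  · filter_upwards [hG] with x hx
    have h := (hasDerivAt_iff_tendsto_slope.1 (hasDerivAt_phase (θ x) t)).mul_const (F x)
    rw [hx]
    convert h using 2
    ring

theorem hasDerivAt_linearIsometry {E F : Type*} [NormedAddCommGroup E] [NormedSpace ℂ E]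
    [NormedAddCommGroup F] [NormedSpace ℂ F] (A : E →ₗᵢ[ℂ] F) {f : ℝ → E} {f' : E} {t : ℝ}
    (h : HasDerivAt f f' t) : HasDerivAt (fun s => A (f s)) (A f') t :=
  (A.toContinuousLinearMap.restrictScalars ℝ).hasFDerivAt.comp_hasDerivAt t h

theorem hasDerivAt_schrodinger (f : SchwartzMap (Space d) ℂ) (t : ℝ) :
    HasDerivAt (fun s => schrodinger s (f.toLp 2))
      (I • schrodinger t ((Laplacian.laplacian f).toLp 2)) t := by
  have hsym : ((𝓕 (Laplacian.laplacian f)).toLp 2 : L2 d) =ᵐ[volume]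
      fun x => symbol d x * ((𝓕 f).toLp 2 : L2 d) x := by
    filter_upwards [(𝓕 f).coeFn_toLp 2 volume,
      (𝓕 (Laplacian.laplacian f)).coeFn_toLp 2 volume] with x h1 h2
    rw [h1, h2, fourier_laplacian_apply]
  have key := hasDerivAt_phaseMul (symbol d) measurable_mul_symbol hsym t
  have h2 := hasDerivAt_linearIsometry (Lp.fourierTransformₗᵢ (Space d) ℂ).symm.toLinearIsometry key
  rw [LinearIsometry.map_smul] at h2
  simp only [schrodinger_apply, SchwartzMap.toLp_fourier_eq]
  exact h2

/-- Translation `U ↦ U(· + h)` on `L²`. -/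
def translate (h : Space d) : L2 d →ₗᵢ[ℂ] L2 d :=
  Lp.compMeasurePreservingₗᵢ ℂ (fun x => x + h) (measurePreserving_add_right volume h)

theorem coeFn_translate (h : Space d) (U : L2 d) :
    translate h U =ᵐ[volume] fun x => U (x + h) :=
  Lp.coeFn_compMeasurePreserving U (measurePreserving_add_right volume h)

theorem ae_comp_add {p : Space d → Prop} (h : Space d) (hp : ∀ᵐ x, p x) : ∀ᵐ x, p (x + h) :=
  (measurePreserving_add_right volume h).quasiMeasurePreserving.ae hp

theorem measurable_phase_inner (h : Space d) :
    Measurable fun ξ : Space d => 2 * Real.pi * inner ℝ h ξ := by fun_prop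

theorem fourier_translate (h : Space d) (U : L2 d) : 𝓕 (translate h U) =
    phaseMul (fun ξ => 2 * Real.pi * inner ℝ h ξ) (measurable_phase_inner h) (𝓕 U) := by
  induction U using L2_induction with
  | hp =>
    exact isClosed_eq ((Lp.fourierTransformₗᵢ (Space d) ℂ).continuous.comp (translate h).continuous)
      ((phaseMul _ _).continuous.comp (Lp.fourierTransformₗᵢ (Space d) ℂ).continuous)
  | h f =>
    have h1 : translate h (f.toLp 2) = (SchwartzMap.compSubConstCLM ℂ (-h) f).toLp 2 := by
      apply Lp.ext
      filter_upwards [coeFn_translate h (f.toLp 2), ae_comp_add h (f.coeFn_toLp 2 volume),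
        (SchwartzMap.compSubConstCLM ℂ (-h) f).coeFn_toLp 2 volume] with x h1 h2 h3
      rw [h1, h2, h3]; simp
    rw [h1, SchwartzMap.toLp_fourier_eq, SchwartzMap.toLp_fourier_eq]
    apply Lp.ext
    filter_upwards [(𝓕 (SchwartzMap.compSubConstCLM ℂ (-h) f)).coeFn_toLp 2 volume,
      coeFn_phaseMul _ (measurable_phase_inner h) ((𝓕 f).toLp 2),
      (𝓕 f).coeFn_toLp 2 volume] with x h1 h2 h3
    rw [h1, h2, h3]
    have := congrFun (VectorFourier.fourierIntegral_comp_add_right Real.fourierChar volume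
      (innerₗ (Space d)) f h) x
    have e : (⇑(SchwartzMap.compSubConstCLM ℂ (-h) f)) = (f ∘ fun v => v + h) := by
      ext v; simp
    rw [SchwartzMap.fourier_coe, SchwartzMap.fourier_coe, e]
    refine this.trans ?_
    rw [Circle.smul_def, smul_eq_mul, Real.fourierChar_apply]
    congr 2
    simp [mul_comm I]

theorem schrodinger_translate (t : ℝ) (h : Space d) (U : L2 d) :
    schrodinger t (translate h U) = translate h (schrodinger t U) := by
  apply fourier_L2_injective
  rw [fourier_schrodinger, fourier_translate, fourier_translate, fourier_schrodinger,
    phaseMul_phaseMul, phaseMul_phaseMul]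
  congr 2
  rw [add_comm]

end

end SolitonTrain

/-! ### The dispersive estimate from `L¹` to `L^∞`. -/

namespace SolitonTrain

noncomputable section

open FourierTransform Complex

variable {d : ℕ}

/-- The set of `L²` functions whose `L^p` norm is at most `c` is closed in `L²`. -/
theorem isClosed_eLpNorm_le (p c : ℝ≥0∞) : IsClosed {U : L2 d | eLpNorm U p volume ≤ c} := by
  refine IsSeqClosed.isClosed fun u U hu hlim => ?_
  -- An `L²` limit is an almost everywhere limit along a subsequence, and Fatou's lemma applies
  -- there.
  obtain ⟨ns, hns, hae⟩ := (tendstoInMeasure_of_tendsto_Lp hlim).exists_seq_tendsto_ae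
  refine (Lp.eLpNorm_lim_le_liminf_eLpNorm (fun n => Lp.aestronglyMeasurable (u (ns n))) _ hae).trans ?_
  exact liminf_le_of_le (by isBoundedDefault) fun b hb => by
    obtain ⟨n, hn⟩ := hb.exists
    exact hn.trans (hu (ns n))

/-- The transform on `L²` is an abstract extension. Both transforms satisfy the multiplication
formula against test functions, so they agree as distributions and hence almost everywhere. -/
theorem fourier_ae_eq_of_integrable (U : L2 d) (hU : Integrable U volume) :
    (𝓕 U : L2 d) =ᵐ[volume] 𝓕 (U : Space d → ℂ) := by
  have hcont : Continuous (𝓕 (U : Space d → ℂ)) :=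
    VectorFourier.fourierIntegral_continuous Real.continuous_fourierChar
      (by exact continuous_inner) hU
  refine ae_eq_of_integral_contDiff_smul_eq
    ((Lp.memLp _).locallyIntegrable (by norm_num)) hcont.locallyIntegrable fun g hg hgc => ?_
  have hc : ContDiff ℝ (⊤ : ℕ∞) fun x => (g x : ℂ) := ofRealCLM.contDiff.comp hg
  have hcs : HasCompactSupport fun x => (g x : ℂ) := hgc.comp_left (g := ofReal) ofReal_zero
  let G : SchwartzMap (Space d) ℂ := hcs.toSchwartzMap hc
  have h1 := Lp.toTemperedDistribution_apply (𝓕 U : L2 d) G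
  rw [← Lp.fourier_toTemperedDistribution_eq, TemperedDistribution.fourier_apply,
    Lp.toTemperedDistribution_apply] at h1
  have h2 := VectorFourier.integral_fourierIntegral_smul_eq_flip (e := Real.fourierChar)
    (μ := (volume : Measure (Space d))) (ν := volume) (L := innerₗ (Space d)) (f := G) (g := U)
    Real.continuous_fourierChar (by exact continuous_inner) G.integrable hU
  rw [flip_innerₗ] at h2
  calc ∫ x, g x • (𝓕 U : L2 d) x = ∫ x, G x • (𝓕 U : L2 d) x := rfl
    _ = ∫ x, (𝓕 G) x • U x := h1.symm
    _ = ∫ x, G x • 𝓕 (U : Space d → ℂ) x := h2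
    _ = _ := rfl

theorem fourierInv_ae_eq_of_integrable (U : L2 d) (hU : Integrable U volume) :
    (𝓕⁻ U : L2 d) =ᵐ[volume] 𝓕⁻ (U : Space d → ℂ) := by
  have hcont : Continuous (𝓕⁻ (U : Space d → ℂ)) := by
    have : Continuous (𝓕 (U : Space d → ℂ)) :=
      VectorFourier.fourierIntegral_continuous Real.continuous_fourierChar
        (by exact continuous_inner) hU
    have e : 𝓕⁻ (U : Space d → ℂ) = fun w => 𝓕 (U : Space d → ℂ) (-w) := by
      ext w; exact Real.fourierInv_eq_fourier_neg _ _
    rw [e]; exact this.comp continuous_neg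
  refine ae_eq_of_integral_contDiff_smul_eq
    ((Lp.memLp _).locallyIntegrable (by norm_num)) hcont.locallyIntegrable fun g hg hgc => ?_
  have hc : ContDiff ℝ (⊤ : ℕ∞) fun x => (g x : ℂ) := ofRealCLM.contDiff.comp hg
  have hcs : HasCompactSupport fun x => (g x : ℂ) := hgc.comp_left (g := ofReal) ofReal_zero
  let G : SchwartzMap (Space d) ℂ := hcs.toSchwartzMap hc
  have h1 := Lp.toTemperedDistribution_apply (𝓕⁻ U : L2 d) G
  rw [← Lp.fourierInv_toTemperedDistribution_eq, TemperedDistribution.fourierInv_apply,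
    Lp.toTemperedDistribution_apply] at h1
  have h2 := VectorFourier.integral_fourierIntegral_smul_eq_flip (e := Real.fourierChar)
    (μ := (volume : Measure (Space d))) (ν := volume) (L := -innerₗ (Space d)) (f := G) (g := U)
    Real.continuous_fourierChar (by exact (continuous_inner (𝕜 := ℝ) (E := Space d)).neg) G.integrable hU
  have e3 : ∀ F : Space d → ℂ, VectorFourier.fourierIntegral Real.fourierChar volume
      (-innerₗ (Space d)) F = 𝓕⁻ F := by
    intro F; ext w
    rw [Real.fourierInv_eq]
    simp [VectorFourier.fourierIntegral]
  have e4 : (-innerₗ (Space d)).flip = -innerₗ (Space d) := by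
    ext x y; simp [real_inner_comm]
  rw [e4, e3, e3] at h2
  calc ∫ x, g x • (𝓕⁻ U : L2 d) x = ∫ x, G x • (𝓕⁻ U : L2 d) x := rfl
    _ = ∫ x, (𝓕⁻ G) x • U x := h1.symm
    _ = ∫ x, 𝓕⁻ (G : Space d → ℂ) x • U x := by rw [SchwartzMap.fourierInv_coe]
    _ = ∫ x, G x • 𝓕⁻ (U : Space d → ℂ) x := h2
    _ = _ := rfl

/-- The multiplication formula moves the transform from `U` onto the modulated Gaussian. That
transform is again Gaussian, with modulus at most `(π/|b|)^{d/2}` even for complex `b`. -/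
theorem norm_fourierInv_gaussian_mul_le {U : Space d → ℂ} (hU : Integrable U volume) {b : ℂ}
    (hb : 0 < b.re) (x : Space d) :
    ‖𝓕⁻ (fun ξ => cexp (-b * ‖ξ‖ ^ 2) * 𝓕 U ξ) x‖ ≤
      (Real.pi / ‖b‖) ^ ((d : ℝ) / 2) * ∫ y, ‖U y‖ := by
  set h : Space d → ℂ := fun ξ => cexp (-b * ‖ξ‖ ^ 2 + 2 * Real.pi * I * inner ℝ x ξ) with hh
  have hint : Integrable h volume := by
    have := GaussianFourier.integrable_cexp_neg_mul_sq_norm_add hb (2 * Real.pi * I) x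
    exact this
  have e1 : 𝓕⁻ (fun ξ => cexp (-b * ‖ξ‖ ^ 2) * 𝓕 U ξ) x = ∫ ξ, 𝓕 U ξ • h ξ := by
    rw [Real.fourierInv_eq]
    refine integral_congr_ae (Eventually.of_forall fun ξ => ?_)
    simp only [hh, Circle.smul_def, Real.fourierChar_apply, smul_eq_mul, Complex.exp_add]
    rw [real_inner_comm]
    push_cast
    ring_nf
  have h2 := VectorFourier.integral_fourierIntegral_smul_eq_flip (e := Real.fourierChar)
    (μ := (volume : Measure (Space d))) (ν := volume) (L := innerₗ (Space d)) (f := U) (g := h)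
    Real.continuous_fourierChar (by exact continuous_inner) hU hint
  rw [flip_innerₗ] at h2
  have e2 : ∫ ξ, 𝓕 U ξ • h ξ = ∫ y, U y • 𝓕 h y := h2
  rw [e1, e2]
  have hk : ∀ y, ‖𝓕 h y‖ ≤ (Real.pi / ‖b‖) ^ ((d : ℝ) / 2) := by
    intro y
    have hb0 : b ≠ 0 := by rintro rfl; simp at hb
    rw [hh, fourier_gaussian_innerProductSpace' hb x y, norm_mul]
    have h3 : ‖cexp (-(Real.pi : ℂ) ^ 2 * ‖x - y‖ ^ 2 / b)‖ ≤ 1 := by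
      rw [Complex.norm_exp, Real.exp_le_one_iff]
      have : (-(Real.pi : ℂ) ^ 2 * ‖x - y‖ ^ 2 / b).re = -(Real.pi ^ 2 * ‖x - y‖ ^ 2) * (b⁻¹).re := by
        rw [div_eq_mul_inv]
        have : (-(Real.pi : ℂ) ^ 2 * ‖x - y‖ ^ 2) = ((-(Real.pi ^ 2 * ‖x - y‖ ^ 2) : ℝ) : ℂ) := by
          push_cast; ring
        rw [this, Complex.re_ofReal_mul]
      rw [this, Complex.inv_re]
      have := Complex.normSq_pos.2 hb0
      have : 0 ≤ b.re / normSq b := by positivity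
      nlinarith [mul_nonneg (sq_nonneg (Real.pi * ‖x - y‖)) this]
    have h4 : ‖((Real.pi : ℂ) / b) ^ ((Module.finrank ℝ (Space d) : ℂ) / 2)‖ =
        (Real.pi / ‖b‖) ^ ((d : ℝ) / 2) := by
      have hne : (Real.pi : ℂ) / b ≠ 0 := div_ne_zero (ofReal_ne_zero.2 Real.pi_ne_zero) hb0
      have e5 : ((Module.finrank ℝ (Space d) : ℂ) / 2) = (((d : ℝ) / 2 : ℝ) : ℂ) := by
        simp
      rw [e5, Complex.norm_cpow_of_ne_zero hne]
      simp [abs_of_pos Real.pi_pos]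
    rw [h4]
    exact mul_le_of_le_one_right (by positivity) h3
  refine (norm_integral_le_integral_norm _).trans ?_
  rw [← integral_const_mul]
  refine integral_mono_of_nonneg (Eventually.of_forall fun y => norm_nonneg _)
    (hU.norm.const_mul _) (Eventually.of_forall fun y => ?_)
  simp only [norm_smul]
  rw [mul_comm]
  exact mul_le_mul_of_nonneg_right (hk y) (norm_nonneg _)

/-- The dispersive estimate `‖e^{itΔ}U‖_∞ ≤ C |t|^{-d/2} ‖U‖₁`. -/
theorem eLpNorm_schrodinger_top_le (U : L2 d) (hU : Integrable U volume) {t : ℝ} (ht : t ≠ 0) :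
    eLpNorm (schrodinger t U) ⊤ volume ≤
      ENNReal.ofReal (|t| ^ (-((d : ℝ) / 2))) * eLpNorm U 1 volume := by
  -- The Schrödinger multiplier is a Gaussian with purely imaginary coefficient; the real part `ε >
  -- 0` makes it integrable and is removed at the end by closedness of `L^∞` balls in `L²`.
  set b : ℝ → ℂ := fun ε => ε + 4 * Real.pi ^ 2 * t * I with hb
  have hbre : ∀ ε, (b ε).re = ε := fun ε => by simp [hb, ← ofReal_pow]
  have hbim : ∀ ε, (b ε).im = 4 * Real.pi ^ 2 * t := fun ε => by simp [hb, ← ofReal_pow]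
  have hm1 : ∀ ε, 0 ≤ ε → ∀ ξ : Space d, ‖cexp (-b ε * ‖ξ‖ ^ 2)‖ ≤ 1 := fun ε hε ξ => by
    rw [Complex.norm_exp, Real.exp_le_one_iff]
    have : (-b ε * (‖ξ‖ : ℂ) ^ 2).re = -ε * ‖ξ‖ ^ 2 := by
      rw [← ofReal_pow, Complex.re_mul_ofReal, neg_re, hbre]
    rw [this]; nlinarith [sq_nonneg ‖ξ‖]
  have hmem : ∀ ε : ℝ, MemLp (fun ξ => cexp (-b (|ε|) * ‖ξ‖ ^ 2) * (𝓕 U : L2 d) ξ) 2 volume :=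
    fun ε => (Lp.memLp (𝓕 U)).of_le (by fun_prop) (Eventually.of_forall fun ξ => by
      rw [norm_mul]
      exact mul_le_of_le_one_left (norm_nonneg _) (hm1 _ (abs_nonneg _) ξ))
  have hlim : Tendsto (fun ε : ℝ => (hmem ε).toLp _) (𝓝[>] 0)
      (𝓝 (phaseMul (fun ξ => t * symbol d ξ) (measurable_mul_symbol t) (𝓕 U))) := by
    refine tendsto_L2_of_dominated (B := fun ξ => 2 * ‖(𝓕 U : L2 d) ξ‖)
      ((Lp.memLp _).norm.const_mul 2) (fun ε => (hmem ε).coeFn_toLp) (coeFn_phaseMul _ _ _)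
      (Eventually.of_forall fun ε => Eventually.of_forall fun ξ => ?_)
      (Eventually.of_forall fun ξ => ?_)
    · refine (norm_sub_le _ _).trans ?_
      rw [norm_mul, norm_mul, mul_comm I, norm_exp_ofReal_mul_I]
      nlinarith [mul_le_mul_of_nonneg_right (hm1 _ (abs_nonneg ε) ξ) (norm_nonneg ((𝓕 U : L2 d) ξ))]
    · have hc : Continuous fun ε : ℝ => cexp (-b (|ε|) * ‖ξ‖ ^ 2) * (𝓕 U : L2 d) ξ := by
        simp only [hb]; fun_prop
      have := (hc.tendsto 0).mono_left (nhdsWithin_le_nhds (s := Set.Ioi 0))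
      convert this using 3
      simp only [hb, symbol]
      push_cast
      simp
      ring_nf
  have hlim2 : Tendsto (fun ε : ℝ => (𝓕⁻ ((hmem ε).toLp _) : L2 d)) (𝓝[>] 0)
      (𝓝 (schrodinger t U)) :=
    ((Lp.fourierTransformₗᵢ (Space d) ℂ).symm.continuous.tendsto _).comp hlim
  refine (isClosed_eLpNorm_le _ _).mem_of_tendsto hlim2 ?_
  filter_upwards [self_mem_nhdsWithin] with ε hε
  have hε : 0 < ε := hε
  change eLpNorm _ _ _ ≤ _
  have hbε : 0 < (b |ε|).re := by rw [hbre]; exact abs_pos.2 hε.ne'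
  have hF := fourier_ae_eq_of_integrable U hU
  have hFcont : Continuous (𝓕 (U : Space d → ℂ)) :=
      VectorFourier.fourierIntegral_continuous Real.continuous_fourierChar
        (by exact continuous_inner) hU
  have hint0 : Integrable (fun ξ => cexp (-b |ε| * ‖ξ‖ ^ 2) * 𝓕 (U : Space d → ℂ) ξ) volume := by
    have hg : Integrable (fun ξ : Space d => cexp (-b |ε| * ‖ξ‖ ^ 2)) volume := by
      simpa using GaussianFourier.integrable_cexp_neg_mul_sq_norm_add hbε 0 (0 : Space d)
    refine hg.mul_bdd (c := ∫ v, ‖U v‖) hFcont.aestronglyMeasurable (Eventually.of_forall fun ξ => ?_)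
    exact VectorFourier.norm_fourierIntegral_le_integral_norm _ _ _ _ _
  have hae : ((hmem ε).toLp _ : L2 d) =ᵐ[volume]
      fun ξ => cexp (-b |ε| * ‖ξ‖ ^ 2) * 𝓕 (U : Space d → ℂ) ξ := by
    filter_upwards [(hmem ε).coeFn_toLp, hF] with ξ h1 h2
    rw [h1, h2]
  have hae2 := fourierInv_ae_eq_of_integrable _ (hint0.congr hae.symm)
  have hI : (∫ v, ‖U v‖) = (eLpNorm U 1 volume).toReal := by
    rw [integral_norm_eq_lintegral_enorm hU.1, eLpNorm_one_eq_lintegral_enorm]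
  have hfin : eLpNorm U 1 volume ≠ ⊤ := (memLp_one_iff_integrable.2 hU).eLpNorm_ne_top
  have hbound : ∀ᵐ x, ‖(𝓕⁻ ((hmem ε).toLp _) : L2 d) x‖ ≤
      |t| ^ (-((d : ℝ) / 2)) * (eLpNorm U 1 volume).toReal := by
    filter_upwards [hae2] with x hx
    rw [hx]
    have : 𝓕⁻ (((hmem ε).toLp _ : L2 d) : Space d → ℂ) x =
        𝓕⁻ (fun ξ => cexp (-b |ε| * ‖ξ‖ ^ 2) * 𝓕 (U : Space d → ℂ) ξ) x := by
      rw [Real.fourierInv_eq, Real.fourierInv_eq]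
      refine integral_congr_ae ?_
      filter_upwards [hae] with ξ h1
      rw [h1]
    rw [this]
    refine (norm_fourierInv_gaussian_mul_le hU hbε x).trans ?_
    rw [hI]
    refine mul_le_mul_of_nonneg_right ?_ ENNReal.toReal_nonneg
    rw [Real.rpow_neg (abs_nonneg _), ← Real.inv_rpow (abs_nonneg _)]
    refine Real.rpow_le_rpow (by positivity) ?_ (by positivity)
    -- Only the imaginary part is used, so the bound is uniform in `ε`. The sharp factor
    -- `(4π)^{-d/2}` is at most one and is discarded.
    have h5 : 4 * Real.pi ^ 2 * |t| ≤ ‖b |ε|‖ := by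
      have := Complex.abs_im_le_norm (b |ε|)
      rwa [hbim, abs_mul, abs_of_pos (by positivity : 0 < 4 * Real.pi ^ 2)] at this
    have ht' : 0 < |t| := abs_pos.2 ht
    rw [div_le_iff₀ (lt_of_lt_of_le (by positivity) h5)]
    have h6 : |t|⁻¹ * (4 * Real.pi ^ 2 * |t|) ≤ |t|⁻¹ * ‖b |ε|‖ := by gcongr
    have h7 : |t|⁻¹ * (4 * Real.pi ^ 2 * |t|) = 4 * Real.pi ^ 2 := by field_simp
    nlinarith [Real.pi_gt_three]
  refine (eLpNorm_le_of_ae_bound hbound).trans ?_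
  simp only [ENNReal.rpow_zero, one_mul, ENNReal.toReal_top, inv_zero]
  rw [ENNReal.ofReal_mul (by positivity), ENNReal.ofReal_toReal hfin]

end

end SolitonTrain

/-! ### Lebesgue exponents and intermediate dispersive estimates. -/

namespace SolitonTrain

noncomputable section

variable {d : ℕ}

/-- The Lebesgue exponent with inverse `b / 2`. -/
def lexp (b : ℝ) : ℝ≥0∞ := 2 / ENNReal.ofReal b

theorem lexp_zero : lexp 0 = ⊤ := by simp [lexp, ENNReal.div_zero]

theorem lexp_one : lexp 1 = 2 := by simp [lexp]

theorem lexp_two : lexp 2 = 1 := by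
  simp [lexp]; exact ENNReal.div_self (by norm_num) (by norm_num)

theorem lexp_inv (b : ℝ) : (lexp b)⁻¹ = ENNReal.ofReal b / 2 := by
  rw [lexp, ENNReal.inv_div (Or.inl (by simp)) (Or.inr (by norm_num))]

theorem lexp_of_pos {b : ℝ} (hb : 0 < b) : lexp b = ENNReal.ofReal (2 / b) := by
  rw [lexp, ENNReal.ofReal_div_of_pos hb, ENNReal.ofReal_ofNat]

/-- The parametrisation by `b` makes Hölder exponents additive, with `0`, `1`, `2` standing for
`L^∞`, `L²`, `L¹`. All later exponent bookkeeping becomes linear. -/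
theorem holderTriple_lexp {b c : ℝ} (hb : 0 ≤ b) (hc : 0 ≤ c) :
    ENNReal.HolderTriple (lexp b) (lexp c) (lexp (b + c)) where
  inv_add_inv_eq_inv := by
    rw [lexp_inv, lexp_inv, lexp_inv, ENNReal.ofReal_add hb hc, ENNReal.add_div]

theorem lexp_mul {b γ : ℝ} (hb : 0 ≤ b) (hγ : 0 < γ) : lexp (b * γ) * ENNReal.ofReal γ = lexp b := by
  have hγ' : ENNReal.ofReal γ ≠ 0 := by simpa using hγ
  rw [lexp, lexp, ENNReal.ofReal_mul hb]
  rcases hb.eq_or_lt with rfl | hb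
  · simp [ENNReal.div_zero, ENNReal.top_mul, hγ]
  · have hb' : ENNReal.ofReal b ≠ 0 := by simpa using hb
    rw [← ENNReal.ofReal_mul hb.le, ← ENNReal.ofReal_ofNat 2,
      ← ENNReal.ofReal_div_of_pos (by positivity), ← ENNReal.ofReal_div_of_pos hb,
      ← ENNReal.ofReal_mul (by positivity)]
    congr 1
    field_simp

section
variable {X : Type*} [MeasurableSpace X] {μ : Measure X} {E : Type*} [NormedAddCommGroup E]

theorem eLpNorm_rpow_lexp (f : X → E) {b γ : ℝ} (hb : 0 ≤ b) (hγ : 0 < γ) :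
    eLpNorm (fun x => ‖f x‖ ^ γ) (lexp (b * γ)) μ = eLpNorm f (lexp b) μ ^ γ := by
  rw [eLpNorm_norm_rpow f hγ, lexp_mul hb hγ]

/-- Hölder's inequality with real valued factors. -/
theorem eLpNorm_mul_lexp_le {f g : X → ℝ} {b c : ℝ} (hb : 0 ≤ b) (hc : 0 ≤ c)
    (hf : AEStronglyMeasurable f μ) (hg : AEStronglyMeasurable g μ) :
    eLpNorm (fun x => f x * g x) (lexp (b + c)) μ ≤
      eLpNorm f (lexp b) μ * eLpNorm g (lexp c) μ := by
  have := holderTriple_lexp hb hc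
  have h : eLpNorm (f • g) (lexp (b + c)) μ ≤ eLpNorm f (lexp b) μ * eLpNorm g (lexp c) μ :=
    eLpNorm_smul_le_mul_eLpNorm hg hf
  exact h

theorem eLpNorm_le_two_top {f : X → E} (hf : AEStronglyMeasurable f μ) {θ : ℝ} (h0 : 0 < θ)
    (h1 : θ < 1) : eLpNorm f (lexp (1 - θ)) μ ≤ eLpNorm f 2 μ ^ (1 - θ) * eLpNorm f ⊤ μ ^ θ := by
  have h2 := eLpNorm_mul_lexp_le (μ := μ) (f := fun x => ‖f x‖ ^ (1 - θ)) (g := fun x => ‖f x‖ ^ θ)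
    (b := 1 * (1 - θ)) (c := 0 * θ) (by linarith) (by simp)
    (hf.norm.aemeasurable.pow_const _).aestronglyMeasurable
    (hf.norm.aemeasurable.pow_const _).aestronglyMeasurable
  rw [eLpNorm_rpow_lexp f zero_le_one (by linarith), eLpNorm_rpow_lexp f le_rfl h0, lexp_one,
    lexp_zero] at h2
  refine le_trans (le_of_eq ?_) h2
  rw [one_mul, zero_mul, add_zero]
  refine eLpNorm_congr_norm_ae (Eventually.of_forall fun x => ?_)
  rw [← Real.rpow_add' (norm_nonneg _) (by simp)]
  simp

end

/-- `U` is cut into the pieces where `2^{-n-1} < |U| ≤ 2^{-n}`. With `p = 2/(1+β)`, such a piece has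
`L¹` norm at most `2^{(n+1)(p-1)}` and squared `L²` norm at most `2^{-n(2-p)}`. Interpolating the
image between `L²` (isometry) and `L^∞` (hypothesis) gives a geometric series, convergent because `θ
< β` is strict. The small loss in `θ` replaces complex interpolation. -/
theorem exists_eLpNorm_interpolation {β θ : ℝ} (hθ : 0 < θ) (hθβ : θ < β) (hβ : β ≤ 1) :
    ∃ C : ℝ, 0 < C ∧ ∀ (S : L2 d →ₗᵢ[ℂ] L2 d) (K : ℝ≥0∞),
      (∀ U : L2 d, Integrable U volume → eLpNorm (S U) ⊤ volume ≤ K * eLpNorm U 1 volume) →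
      ∀ U : L2 d, eLpNorm U (lexp (1 + β)) volume ≤ 1 → eLpNorm U 2 volume ≤ 1 →
        eLpNorm (S U) (lexp (1 - θ)) volume ≤ ENNReal.ofReal C * K ^ θ := by
  set p : ℝ := 2 / (1 + β) with hp
  have hβ0 : 0 < β := hθ.trans hθβ
  have hp1 : 1 ≤ p := by rw [hp, le_div_iff₀ (by linarith)]; linarith
  have hp2 : p ≤ 2 := by rw [hp, div_le_iff₀ (by linarith)]; linarith
  -- The ratio of the geometric series: its exponent equals `-(β - θ)/(1 + β)`, which is negative.
  set x : ℝ := 2 ^ (-((1 - p / 2) * (1 - θ) - (p - 1) * θ)) with hx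
  have hx0 : 0 < x := by positivity
  have hx1 : x < 1 := by
    refine Real.rpow_lt_one_of_one_lt_of_neg (by norm_num) ?_
    have : (1 - p / 2) * (1 - θ) - (p - 1) * θ = (β - θ) / (1 + β) := by
      rw [hp]; field_simp; ring
    rw [this]
    have : 0 < (β - θ) / (1 + β) := div_pos (by linarith) (by linarith)
    linarith
  set c₀ : ℝ := 2 ^ ((p - 1) * θ) with hc₀
  have hc₀0 : 0 < c₀ := by positivity
  refine ⟨1 + c₀ * (1 - x)⁻¹, by have := sub_pos.2 hx1; positivity, fun S K hS U hUp hU2 => ?_⟩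
  have hple : lexp (1 + β) = ENNReal.ofReal p := by rw [lexp_of_pos (by linarith)]
  have hp0 : 0 < p := by linarith
  have hUp' : ∫⁻ y, ‖U y‖ₑ ^ p ≤ 1 := by
    rw [hple, eLpNorm_eq_lintegral_rpow_enorm_toReal (by simpa using hp0) (by simp),
      ENNReal.toReal_ofReal hp0.le] at hUp
    have := ENNReal.rpow_le_rpow hUp hp0.le
    rwa [← ENNReal.rpow_mul, one_div_mul_cancel hp0.ne', ENNReal.rpow_one, ENNReal.one_rpow] at this
  have hU2' : ∫⁻ y, ‖U y‖ₑ ^ (2 : ℝ) ≤ 1 := by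
    rw [eLpNorm_eq_lintegral_rpow_enorm_toReal (by norm_num) (by norm_num)] at hU2
    have := ENNReal.rpow_le_rpow hU2 (zero_le_two (α := ℝ))
    rw [← ENNReal.rpow_mul, ENNReal.toReal_ofNat, one_div_mul_cancel (by norm_num),
      ENNReal.rpow_one, ENNReal.one_rpow] at this
    exact this
  have hmeas : StronglyMeasurable (U : Space d → ℂ) := Lp.stronglyMeasurable U
  have hstep : ∀ (s : Set (Space d)) (hs : MeasurableSet s) (a b : ℝ≥0∞), a ≠ ⊤ → b ≠ ⊤ →
      ∫⁻ y in s, ‖U y‖ₑ ≤ a → ∫⁻ y in s, ‖U y‖ₑ ^ (2 : ℝ) ≤ b →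
      eLpNorm (S (((Lp.memLp U).indicator hs).toLp _)) (lexp (1 - θ)) volume ≤
        b ^ ((1 - θ) / 2) * a ^ θ * K ^ θ := by
    intro s hs a b ha hb h1 h2
    have hae := ((Lp.memLp U).indicator hs).coeFn_toLp
    set F : L2 d := ((Lp.memLp U).indicator hs).toLp _ with hF
    have e1 : eLpNorm F 1 volume ≤ a := by
      rw [eLpNorm_congr_ae hae, eLpNorm_one_eq_lintegral_enorm]
      simp only [enorm_indicator_eq_indicator_enorm]
      rwa [lintegral_indicator hs]
    have e2 : eLpNorm F 2 volume ≤ b ^ (1 / 2 : ℝ) := by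
      rw [eLpNorm_congr_ae hae, eLpNorm_indicator_eq_eLpNorm_restrict hs,
        eLpNorm_eq_lintegral_rpow_enorm_toReal (by norm_num) (by norm_num)]
      simp only [ENNReal.toReal_ofNat]
      exact ENNReal.rpow_le_rpow h2 (by norm_num)
    have hint : Integrable F volume :=
      memLp_one_iff_integrable.1 ⟨Lp.aestronglyMeasurable _, e1.trans_lt ha.lt_top⟩
    refine (eLpNorm_le_two_top (Lp.aestronglyMeasurable _) hθ (by linarith)).trans ?_
    have e3 : eLpNorm (S F) 2 volume = eLpNorm F 2 volume := by
      have := S.norm_map F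
      rw [Lp.norm_def, Lp.norm_def] at this
      exact (ENNReal.toReal_eq_toReal_iff' (Lp.eLpNorm_ne_top _) (Lp.eLpNorm_ne_top _)).1 this
    rw [e3]
    calc _ ≤ (b ^ (1 / 2 : ℝ)) ^ (1 - θ) * (K * a) ^ θ := by
          gcongr
          · linarith
          · exact (hS F hint).trans (by gcongr)
      _ = _ := by
          rw [← ENNReal.rpow_mul, ENNReal.mul_rpow_of_nonneg _ _ hθ.le, mul_comm (K ^ θ), mul_assoc]
          congr 2; ring
  set s : ℕ → Set (Space d) := fun n => {y | (2 : ℝ) ^ (-(n : ℝ)) < ‖U y‖} with hs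
  have hsm : ∀ n, MeasurableSet (s n) := fun n =>
    measurableSet_lt measurable_const hmeas.norm.measurable
  have hmono : ∀ n, s n ⊆ s (n + 1) := fun n y hy => by
    have hy : (2 : ℝ) ^ (-(n : ℝ)) < ‖U y‖ := hy
    refine lt_of_le_of_lt ?_ hy
    exact Real.rpow_le_rpow_of_exponent_le (by norm_num) (by push_cast; linarith)
  have hind : ∀ n : ℕ, eLpNorm (S (((Lp.memLp U).indicator (hsm n)).toLp _)) (lexp (1 - θ)) volume ≤
      ENNReal.ofReal (1 + c₀ * ∑ k ∈ Finset.range n, x ^ k) * K ^ θ := by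
    intro n
    induction n with
    | zero =>
      -- All values above one form a single piece: there `|U| ≤ |U|²`, so the `L²` bound also
      -- controls the `L¹` norm.
      refine (hstep (s 0) (hsm 0) 1 1 (by simp) (by simp) ?_ ?_).trans (by simp)
      · refine le_trans ?_ hU2'
        refine (setLIntegral_mono' (hsm 0) fun y hy => ?_).trans (setLIntegral_le_lintegral _ _)
        have : (1 : ℝ≥0∞) ≤ ‖U y‖ₑ := by
          rw [← ofReal_norm, ← ENNReal.ofReal_one]
          refine ENNReal.ofReal_le_ofReal ?_
          have : (2 : ℝ) ^ (-((0 : ℕ) : ℝ)) < ‖U y‖ := hy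
          simpa using this.le
        calc ‖U y‖ₑ = ‖U y‖ₑ ^ (1 : ℝ) := (ENNReal.rpow_one _).symm
          _ ≤ _ := ENNReal.rpow_le_rpow_of_exponent_le this (by norm_num)
      · exact (setLIntegral_le_lintegral _ _).trans hU2'
    | succ n ih =>
      have hsd := (hsm (n + 1)).diff (hsm n)
      have hsplit : ((Lp.memLp U).indicator (hsm (n + 1))).toLp _ =
          ((Lp.memLp U).indicator (hsm n)).toLp _ + ((Lp.memLp U).indicator hsd).toLp _ := by
        rw [← MemLp.toLp_add]
        congr 1
        ext y
        by_cases h1 : y ∈ s n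
        · simp [h1, hmono n h1]
        · by_cases h2 : y ∈ s (n + 1) <;> simp [h1, h2]
      rw [hsplit, map_add, eLpNorm_congr_ae (Lp.coeFn_add _ _)]
      have hr1 : 1 ≤ lexp (1 - θ) := by
        rw [lexp_of_pos (by linarith), ← ENNReal.ofReal_one]
        refine ENNReal.ofReal_le_ofReal ?_
        rw [le_div_iff₀ (by linarith)]; linarith
      refine (eLpNorm_add_le (Lp.aestronglyMeasurable _) (Lp.aestronglyMeasurable _) hr1).trans ?_
      have hm : ∀ y ∈ s (n + 1) \ s n, (2 : ℝ) ^ (-((n : ℝ) + 1)) < ‖U y‖ ∧ ‖U y‖ ≤ 2 ^ (-(n : ℝ)) := by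
        rintro y ⟨h1, h2⟩
        have h1 : (2 : ℝ) ^ (-((n + 1 : ℕ) : ℝ)) < ‖U y‖ := h1
        exact ⟨by simpa using h1, not_lt.1 h2⟩
      have hpw : ∀ y ∈ s (n + 1) \ s n, ∀ q : ℝ, ∀ w : ℝ,
          ‖U y‖ ^ q ≤ w * ‖U y‖ ^ p → ‖U y‖ₑ ^ q ≤ ENNReal.ofReal w * ‖U y‖ₑ ^ p := by
        intro y hy q w h
        have h0 : 0 < ‖U y‖ := lt_trans (by positivity) (hm y hy).1
        have hw : 0 ≤ w := by
          by_contra hw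
          have : 0 < ‖U y‖ ^ q := by positivity
          nlinarith [Real.rpow_pos_of_pos h0 p]
        rw [← ofReal_norm, ENNReal.ofReal_rpow_of_pos h0, ENNReal.ofReal_rpow_of_pos h0,
          ← ENNReal.ofReal_mul hw]
        exact ENNReal.ofReal_le_ofReal h
      have hint : ∀ q : ℝ, ∀ w : ℝ, (∀ y ∈ s (n + 1) \ s n, ‖U y‖ ^ q ≤ w * ‖U y‖ ^ p) →
          ∫⁻ y in s (n + 1) \ s n, ‖U y‖ₑ ^ q ≤ ENNReal.ofReal w := by
        intro q w h
        calc _ ≤ ∫⁻ y in s (n + 1) \ s n, ENNReal.ofReal w * ‖U y‖ₑ ^ p :=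
              setLIntegral_mono' hsd fun y hy => hpw y hy q w (h y hy)
          _ ≤ ENNReal.ofReal w * ∫⁻ y, ‖U y‖ₑ ^ p := by
              rw [lintegral_const_mul' _ _ (by simp)]
              gcongr
              exact Measure.restrict_le_self
          _ ≤ _ := mul_le_of_le_one_right (by simp) hUp'
      have h1 := hint 1 ((2 : ℝ) ^ (((n : ℝ) + 1) * (p - 1))) fun y hy => by
        obtain ⟨h1, h2⟩ := hm y hy
        have h0 : 0 < ‖U y‖ := lt_trans (by positivity) h1
        have : ((2 : ℝ) ^ (-((n : ℝ) + 1))) ^ (p - 1) ≤ ‖U y‖ ^ (p - 1) :=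
          Real.rpow_le_rpow (by positivity) h1.le (by linarith)
        calc ‖U y‖ ^ (1 : ℝ) = ‖U y‖ ^ (1 : ℝ) * ((2 : ℝ) ^ (((n : ℝ) + 1) * (p - 1)) *
              ((2 : ℝ) ^ (-((n : ℝ) + 1))) ^ (p - 1)) := by
              rw [← Real.rpow_mul (by norm_num), ← Real.rpow_add (by norm_num),
                show ((n : ℝ) + 1) * (p - 1) + -((n : ℝ) + 1) * (p - 1) = 0 by ring,
                Real.rpow_zero, mul_one]
          _ ≤ ‖U y‖ ^ (1 : ℝ) * ((2 : ℝ) ^ (((n : ℝ) + 1) * (p - 1)) * ‖U y‖ ^ (p - 1)) := by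
              gcongr
          _ = (2 : ℝ) ^ (((n : ℝ) + 1) * (p - 1)) * (‖U y‖ ^ (1 : ℝ) * ‖U y‖ ^ (p - 1)) := by ring
          _ = _ := by rw [← Real.rpow_add h0]; ring_nf
      have h2 := hint 2 ((2 : ℝ) ^ (-(n : ℝ) * (2 - p))) fun y hy => by
        obtain ⟨h1, h2⟩ := hm y hy
        have h0 : 0 < ‖U y‖ := lt_trans (by positivity) h1
        have : ‖U y‖ ^ (2 - p) ≤ ((2 : ℝ) ^ (-(n : ℝ))) ^ (2 - p) :=
          Real.rpow_le_rpow (by positivity) h2 (by linarith)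
        rw [← Real.rpow_mul (by norm_num)] at this
        calc ‖U y‖ ^ (2 : ℝ) = ‖U y‖ ^ (2 - p) * ‖U y‖ ^ p := by
              rw [← Real.rpow_add h0]; ring_nf
          _ ≤ _ := by gcongr
      simp only [ENNReal.rpow_one] at h1
      have h3 := hstep _ hsd _ _ (by simp) (by simp) h1 h2
      rw [Finset.sum_range_succ, mul_add c₀, ← add_assoc, ENNReal.ofReal_add, add_mul]
      · refine add_le_add ih (h3.trans (le_of_eq ?_))
        congr 1
        rw [ENNReal.ofReal_rpow_of_pos (by positivity), ENNReal.ofReal_rpow_of_pos (by positivity),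
          ← ENNReal.ofReal_mul (by positivity)]
        congr 1
        rw [← Real.rpow_mul (by norm_num), ← Real.rpow_mul (by norm_num),
          ← Real.rpow_add (by norm_num), hc₀, hx, ← Real.rpow_natCast, ← Real.rpow_mul (by norm_num),
          ← Real.rpow_add (by norm_num)]
        congr 1
        ring
      · positivity
      · positivity
  have hlim : Tendsto (fun n => ((Lp.memLp U).indicator (hsm n)).toLp _) atTop (𝓝 U) := by
    refine tendsto_L2_of_dominated (B := fun y => ‖U y‖) (Lp.memLp U).norm
      (fun n => ((Lp.memLp U).indicator (hsm n)).coeFn_toLp) (Eventually.of_forall fun _ => rfl)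
      (Eventually.of_forall fun n => Eventually.of_forall fun y => ?_)
      (Eventually.of_forall fun y => ?_)
    · by_cases hy : y ∈ s n <;> simp [hy]
    · rcases eq_or_ne (U y) 0 with h0 | h0
      · have : ∀ n, (s n).indicator U y = U y := fun n => by
          by_cases hy : y ∈ s n <;> simp [hy, h0]
        simp only [this]; exact tendsto_const_nhds
      · have h2 : Tendsto (fun n : ℕ => (2 : ℝ) ^ (-(n : ℝ))) atTop (𝓝 0) := by
          have := tendsto_pow_atTop_nhds_zero_of_lt_one (r := (1 / 2 : ℝ)) (by norm_num) (by norm_num)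
          refine this.congr fun n => ?_
          rw [Real.rpow_neg (by norm_num), Real.rpow_natCast]; simp
        have h3 := h2.eventually_lt_const (norm_pos_iff.2 h0)
        refine tendsto_const_nhds.congr' ?_
        filter_upwards [h3] with n hn
        rw [Set.indicator_of_mem]
        exact hn
  refine (isClosed_eLpNorm_le _ _).mem_of_tendsto ((S.continuous.tendsto U).comp hlim) ?_
  refine Eventually.of_forall fun n => (hind n).trans ?_
  gcongr
  rw [← tsum_geometric_of_lt_one hx0.le hx1]
  exact (summable_geometric_of_lt_one hx0.le hx1).sum_le_tsum _ fun k _ => by positivity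

/-- `e^{itΔ}` maps `L^p ∩ L²` to `L^r` with norm at most `C |t|^{-σ}`. -/
def DispersiveBound (d : ℕ) (p r : ℝ≥0∞) (σ C : ℝ) : Prop :=
  ∀ t : ℝ, t ≠ 0 → ∀ (U : L2 d) (A : ℝ), 0 ≤ A → eLpNorm U p volume ≤ ENNReal.ofReal A →
    eLpNorm U 2 volume ≤ ENNReal.ofReal A →
      eLpNorm (schrodinger t U) r volume ≤ ENNReal.ofReal (C * |t| ^ (-σ) * A)

/-- By homogeneity it suffices to treat `U/A`. The `L¹ → L^∞` norm `|t|^{-d/2}` enters with power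
`θ`, which gives the rate `dθ/2`. -/
theorem exists_dispersiveBound {β θ : ℝ} (hθ : 0 < θ) (hθβ : θ < β) (hβ : β ≤ 1) :
    ∃ C : ℝ, 0 < C ∧ DispersiveBound d (lexp (1 + β)) (lexp (1 - θ)) (d * θ / 2) C := by
  obtain ⟨C, hC, h⟩ := exists_eLpNorm_interpolation (d := d) hθ hθβ hβ
  refine ⟨C, hC, fun t ht U A hA hp h2 => ?_⟩
  rcases hA.eq_or_lt with rfl | hA
  · have h0 : U = 0 := by
      rw [ENNReal.ofReal_zero, nonpos_iff_eq_zero,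
        eLpNorm_eq_zero_iff (Lp.aestronglyMeasurable U) (by norm_num)] at h2
      exact (Lp.eq_zero_iff_ae_eq_zero).2 h2
    rw [h0, map_zero, eLpNorm_congr_ae (Lp.coeFn_zero _ _ _)]
    simp
  have hscale : ∀ q, eLpNorm U q volume ≤ ENNReal.ofReal A →
      eLpNorm (((A⁻¹ : ℝ) : ℂ) • U : L2 d) q volume ≤ 1 := fun q hq => by
    rw [eLpNorm_congr_ae (Lp.coeFn_smul _ _), eLpNorm_const_smul]
    have : ‖((A⁻¹ : ℝ) : ℂ)‖ₑ = (ENNReal.ofReal A)⁻¹ := by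
      rw [← ofReal_norm, Complex.norm_real, Real.norm_of_nonneg (by positivity),
        ENNReal.ofReal_inv_of_pos hA]
    rw [this]
    calc _ ≤ (ENNReal.ofReal A)⁻¹ * ENNReal.ofReal A := by gcongr
      _ = 1 := ENNReal.inv_mul_cancel (by simpa using hA) (by simp)
  have := h (schrodinger t) (ENNReal.ofReal (|t| ^ (-((d : ℝ) / 2))))
    (fun W hW => eLpNorm_schrodinger_top_le W hW ht) _ (hscale _ hp) (hscale _ h2)
  rw [map_smul, eLpNorm_congr_ae (Lp.coeFn_smul _ _), eLpNorm_const_smul] at this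
  have hn : ‖((A⁻¹ : ℝ) : ℂ)‖ₑ = (ENNReal.ofReal A)⁻¹ := by
      rw [← ofReal_norm, Complex.norm_real, Real.norm_of_nonneg (by positivity),
        ENNReal.ofReal_inv_of_pos hA]
  have ht' : 0 < |t| := abs_pos.2 ht
  rw [hn, ENNReal.inv_mul_le_iff (by simpa using hA) (by simp)] at this
  refine this.trans (le_of_eq ?_)
  rw [ENNReal.ofReal_rpow_of_pos (by positivity), ← ENNReal.ofReal_mul hC.le,
    ← ENNReal.ofReal_mul hA.le, ← Real.rpow_mul ht'.le]
  congr 1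
  rw [show -((d : ℝ) / 2) * θ = -(d * θ / 2) by ring]
  ring

theorem dispersiveBound_one_top : DispersiveBound d 1 ⊤ (d / 2) 1 := by
  intro t ht U A hA hp h2
  refine (eLpNorm_schrodinger_top_le U (memLp_one_iff_integrable.1
    ⟨Lp.aestronglyMeasurable _, hp.trans_lt (by simp)⟩) ht).trans ?_
  rw [one_mul, ENNReal.ofReal_mul (by positivity)]
  gcongr

end

end SolitonTrain

/-! ### Difference quotients and averages over dyadic cubes. -/

namespace SolitonTrain

noncomputable section

variable {d : ℕ}

/-- `L²` functions whose difference quotients are bounded by `K` in `L^p`. -/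
def DiffBound (p : ℝ≥0∞) (K : ℝ) : Set (L2 d) :=
  {U | ∀ h : Space d, ‖h‖ ≤ 1 →
    eLpNorm (translate h U - U : L2 d) p volume ≤ ENNReal.ofReal (K * ‖h‖)}

theorem isClosed_diffBound (p : ℝ≥0∞) (K : ℝ) : IsClosed (DiffBound (d := d) p K) := by
  have : DiffBound (d := d) p K = ⋂ h : Space d, ⋂ _ : ‖h‖ ≤ 1,
      (fun U : L2 d => translate h U - U) ⁻¹'
        {U : L2 d | eLpNorm U p volume ≤ ENNReal.ofReal (K * ‖h‖)} := by
    ext U; simp [DiffBound]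
  rw [this]
  exact isClosed_iInter fun h => isClosed_iInter fun _ =>
    (isClosed_eLpNorm_le _ _).preimage ((translate h).continuous.sub continuous_id)

theorem continuous_translate : Continuous fun p : Space d × L2 d => translate p.1 p.2 := by
  have hg : Continuous fun p : Space d × L2 d =>
      (⟨fun x => x + p.1, by fun_prop⟩ : C(Space d, Space d)) :=
    ContinuousMap.continuous_of_continuous_uncurry _
      (by exact continuous_snd.add (continuous_fst.comp continuous_fst))
  exact Continuous.compMeasurePreservingLp (p := 2) (μ := volume) (ν := volume) continuous_snd hg
    (fun p => measurePreserving_add_right volume p.1) (by norm_num)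

/-- The dyadic cube `[0, 2⁻ᵏ)^d`. -/
def cube (d k : ℕ) : Set (Space d) := {y | ∀ i, y i ∈ Set.Ico (0 : ℝ) ((1 / 2) ^ k)}

theorem measurableSet_cube (k : ℕ) : MeasurableSet (cube d k) := by
  have : cube d k = ⋂ i, (fun y : Space d => y i) ⁻¹' Set.Ico (0 : ℝ) ((1 / 2) ^ k) := by
    ext y; simp [cube]
  rw [this]
  exact MeasurableSet.iInter fun i => measurableSet_Ico.preimage (by fun_prop)

theorem volume_cube (k : ℕ) : volume (cube d k) = ENNReal.ofReal (((1 / 2) ^ k) ^ d) := by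
  have h := (EuclideanSpace.volume_preserving_symm_measurableEquiv_toLp (Fin d)).measure_preimage
    (s := Set.univ.pi fun _ => Set.Ico (0 : ℝ) ((1 / 2) ^ k))
    (MeasurableSet.univ_pi fun _ => measurableSet_Ico).nullMeasurableSet
  rw [Real.volume_pi_Ico] at h
  have e : cube d k = (MeasurableEquiv.toLp 2 (Fin d → ℝ)).symm ⁻¹'
      (Set.univ.pi fun _ => Set.Ico (0 : ℝ) ((1 / 2) ^ k)) := by
    ext y; simp [cube]
  rw [e, h, ENNReal.ofReal_pow (by positivity)]
  simp only [sub_zero, Finset.prod_const, Finset.card_univ, Fintype.card_fin]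

theorem volume_cube_ne_top (k : ℕ) : volume (cube d k) ≠ ⊤ := by rw [volume_cube]; simp

/-- The average of `U` over the cube `x + [0, 2⁻ᵏ)^d`. -/
def avg (k : ℕ) (U : L2 d) (x : Space d) : ℂ :=
  (2 ^ k) ^ d * inner ℂ (indicatorConstLp 2 (measurableSet_cube k) (volume_cube_ne_top k) 1)
    (translate x U)

theorem avg_eq (k : ℕ) (U : L2 d) (x : Space d) :
    avg k U x = (2 ^ k) ^ d * ∫ y in cube d k, U (y + x) := by
  rw [avg, MeasureTheory.L2.inner_indicatorConstLp_one]
  congr 1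
  exact setIntegral_congr_ae (measurableSet_cube k)
    ((coeFn_translate x U).mono fun y hy _ => hy)

/-- This is the benefit of writing an average as an inner product with a translate: joint continuity
in the point and in the function is inherited from translations on `L²`. -/
theorem continuous_avg (k : ℕ) : Continuous fun p : Space d × L2 d => avg k p.2 p.1 :=
  continuous_const.mul (continuous_const.inner continuous_translate)

/-- The vertex of the unit cube given by `ε`. -/
def vertex (ε : Fin d → Bool) : Space d := WithLp.toLp 2 fun i => if ε i then 1 else 0

theorem norm_vertex_sq_le (ε : Fin d → Bool) : ‖vertex ε‖ ^ 2 ≤ d := by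
  rw [EuclideanSpace.norm_sq_eq]
  calc _ ≤ ∑ _i : Fin d, (1 : ℝ) := by
        refine Finset.sum_le_sum fun i _ => ?_
        simp only [vertex]
        split_ifs <;> simp
    _ = d := by simp

/-- A dyadic cube is the disjoint union of `2^d` shifted half-size cubes. In terms of indicators
this is the product over coordinates of the splitting of one half-open interval. -/
theorem indicator_cube_eq (k : ℕ) (y : Space d) :
    (cube d k).indicator (fun _ => (1 : ℝ)) y = ∑ ε : Fin d → Bool,
      (cube d (k + 1)).indicator (fun _ => (1 : ℝ)) (y - ((1 / 2 : ℝ) ^ (k + 1)) • vertex ε) := by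
  classical
  have hprod : ∀ (m : ℕ) (z : Space d), (cube d m).indicator (fun _ => (1 : ℝ)) z =
      ∏ i, (Set.Ico (0 : ℝ) ((1 / 2) ^ m)).indicator (fun _ => (1 : ℝ)) (z i) := by
    intro m z
    by_cases hz : z ∈ cube d m
    · rw [Set.indicator_of_mem hz]
      exact (Finset.prod_eq_one fun i _ => Set.indicator_of_mem (hz i) _).symm
    · rw [Set.indicator_of_notMem hz]
      simp only [cube, Set.mem_ofPred_eq, not_forall] at hz
      obtain ⟨i, hi⟩ := hz
      exact (Finset.prod_eq_zero (Finset.mem_univ i) (Set.indicator_of_notMem hi _)).symm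
  have hone : ∀ t : ℝ, (Set.Ico (0 : ℝ) ((1 / 2) ^ k)).indicator (fun _ => (1 : ℝ)) t =
      ∑ b : Bool, (Set.Ico (0 : ℝ) ((1 / 2) ^ (k + 1))).indicator (fun _ => (1 : ℝ))
        (t - (1 / 2) ^ (k + 1) * if b then 1 else 0) := by
    intro t
    have hs : (0 : ℝ) < (1 / 2) ^ (k + 1) := by positivity
    have h2 : ((1 : ℝ) / 2) ^ k = 2 * (1 / 2) ^ (k + 1) := by rw [pow_succ]; ring
    rw [h2]
    generalize ((1 : ℝ) / 2) ^ (k + 1) = s at hs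
    simp only [Fintype.sum_bool, Set.indicator_apply, Set.mem_Ico]
    simp only [Bool.false_eq_true, if_true, if_false, mul_one, mul_zero, sub_zero]
    split_ifs <;> first | (exfalso; grind) | norm_num
  rw [hprod]
  simp only [hone]
  rw [Fintype.prod_sum]
  refine Finset.sum_congr rfl fun ε _ => ?_
  rw [hprod]
  rfl

/-- Hölder's inequality on the cube. For `r = ⊤` the conventions `r.toReal = 0` and `1 / 0 = 0` give
the correct exponent one, so the endpoint needs no separate treatment. -/
theorem norm_setIntegral_cube_le (k : ℕ) (F : L2 d) {r : ℝ≥0∞} (hr : 1 ≤ r) {B : ℝ} (hB : 0 ≤ B)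
    (h : eLpNorm F r volume ≤ ENNReal.ofReal B) :
    ‖∫ y in cube d k, F y‖ ≤ B * (((1 / 2) ^ k) ^ d) ^ (1 - 1 / r.toReal) := by
  have hae : AEStronglyMeasurable F (volume.restrict (cube d k)) :=
    (Lp.aestronglyMeasurable F).restrict
  have h1 := eLpNorm_le_eLpNorm_mul_rpow_measure_univ hr hae
  rw [Measure.restrict_apply_univ, volume_cube, eLpNorm_one_eq_lintegral_enorm,
    ENNReal.ofReal_rpow_of_pos (by positivity)] at h1
  have h2 := h1.trans (mul_le_mul_left ((eLpNorm_mono_measure F Measure.restrict_le_self).trans h) _)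
  rw [← ENNReal.ofReal_mul hB] at h2
  have h3 := (enorm_integral_le_lintegral_enorm (μ := volume.restrict (cube d k)) F).trans h2
  rw [← ofReal_norm] at h3
  simpa using (ENNReal.ofReal_le_ofReal_iff (by positivity)).1 h3

/-- Once the large cube is subdivided, every subcube is compared with the one at the corner. Only
differences of `U` under translations of length comparable to `2^{-k}` remain. -/
theorem avg_sub_avg (k : ℕ) (U : L2 d) (x : Space d) : avg k U x - avg (k + 1) U x =
    (2 ^ k) ^ d * ∑ ε : Fin d → Bool, ∫ y in cube d (k + 1),
      (translate x (translate (((1 / 2 : ℝ) ^ (k + 1)) • vertex ε) U - U) : L2 d) y := by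
  have hint : ∀ (m : ℕ) (z : Space d), Integrable
      (fun y => (cube d m).indicator (fun _ => (1 : ℝ)) y • U (y + z)) volume := by
    intro m z
    have h1 : IntegrableOn (fun y => U (y + z)) (cube d m) volume := by
      have : MemLp (fun y => U (y + z)) 2 (volume.restrict (cube d m)) :=
        ((Lp.memLp U).comp_measurePreserving (measurePreserving_add_right volume z)).restrict _
      have hf : IsFiniteMeasure (volume.restrict (cube d m)) :=
        ⟨by rw [Measure.restrict_apply_univ]; exact (volume_cube_ne_top m).lt_top⟩
      exact this.integrable (by norm_num)
    refine ((integrable_indicator_iff (measurableSet_cube m)).2 h1).congr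
      (Eventually.of_forall fun y => ?_)
    by_cases hy : y ∈ cube d m <;> simp [hy]
  have hset : ∀ (m : ℕ) (F : Space d → ℂ), ∫ y in cube d m, F y =
      ∫ y, (cube d m).indicator (fun _ => (1 : ℝ)) y • F y := by
    intro m F
    rw [← integral_indicator (measurableSet_cube m)]
    congr 1
    ext y
    by_cases hy : y ∈ cube d m <;> simp [hy]
  set s : ℝ := (1 / 2) ^ (k + 1) with hs
  have e1 : ∫ y in cube d k, U (y + x) =
      ∑ ε : Fin d → Bool, ∫ y in cube d (k + 1), U (y + (s • vertex ε + x)) := by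
    rw [hset]
    have hexp : (fun y => (cube d k).indicator (fun _ => (1 : ℝ)) y • U (y + x)) = fun y =>
        ∑ ε : Fin d → Bool, (cube d (k + 1)).indicator (fun _ => (1 : ℝ))
          (y - s • vertex ε) • U (y + x) := by
      ext y
      rw [indicator_cube_eq, Finset.sum_smul]
    rw [hexp]
    have hsh : ∀ ε : Fin d → Bool, (fun y => (cube d (k + 1)).indicator (fun _ => (1 : ℝ))
        (y - s • vertex ε) • U (y + x)) = fun y =>
        (fun z => (cube d (k + 1)).indicator (fun _ => (1 : ℝ)) z • U (z + (s • vertex ε + x)))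
          (y - s • vertex ε) := by
      intro ε; ext y
      simp only
      congr 2
      abel
    rw [integral_finsetSum]
    · refine Finset.sum_congr rfl fun ε _ => ?_
      rw [hsh ε, integral_sub_right_eq_self (fun z => (cube d (k + 1)).indicator
        (fun _ => (1 : ℝ)) z • U (z + (s • vertex ε + x))), hset]
    · intro ε _
      rw [hsh ε]
      exact (hint (k + 1) (s • vertex ε + x)).comp_sub_right _
  have e2 : ∀ ε : Fin d → Bool, ∫ y in cube d (k + 1),
      (translate x (translate (s • vertex ε) U - U) : L2 d) y =
      (∫ y in cube d (k + 1), U (y + (s • vertex ε + x))) - ∫ y in cube d (k + 1), U (y + x) := by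
    intro ε
    have hi : ∀ z, IntegrableOn (fun y => U (y + z)) (cube d (k + 1)) volume := fun z => by
      have := hint (k + 1) z
      refine (integrable_indicator_iff (measurableSet_cube (k + 1))).1
        (this.congr (Eventually.of_forall fun y => ?_))
      by_cases hy : y ∈ cube d (k + 1) <;> simp [hy]
    rw [← integral_sub (hi _) (hi _)]
    refine setIntegral_congr_ae (measurableSet_cube _) ?_
    filter_upwards [coeFn_translate x (translate (s • vertex ε) U - U),
      ae_comp_add x (Lp.coeFn_sub (translate (s • vertex ε) U) U),
      ae_comp_add x (coeFn_translate (s • vertex ε) U)] with y h1 h2 h3 _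
    rw [h1, h2, Pi.sub_apply, h3]
    congr 2
    abel
  simp only [e2, Finset.sum_sub_distrib, ← e1]
  rw [avg_eq, avg_eq]
  simp only [Finset.sum_const, Finset.card_univ, Fintype.card_fun, Fintype.card_bool,
    Fintype.card_fin, nsmul_eq_mul]
  push_cast
  rw [pow_succ (2 : ℂ) k, mul_pow]
  ring

/-- The difference quotient gains the side length `s` and Hölder's inequality on the cube loses
`s^{-d/r}`. The net exponent `1 - d/r` is positive exactly in the Morrey range `r > d`. -/
theorem norm_avg_sub_avg_le (hd : d ≤ 3) {r : ℝ≥0∞} (hr : 1 ≤ r) {K : ℝ} (hK : 0 ≤ K) {U : L2 d}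
    (hU : U ∈ DiffBound r K) (k : ℕ) (x : Space d) : ‖avg (k + 1) U x - avg k U x‖ ≤
      2 * K * ((1 / 2) ^ (1 - d * (1 / r.toReal))) ^ (k + 1) := by
  set s : ℝ := (1 / 2) ^ (k + 1) with hs
  have hs0 : 0 < s := by positivity
  have hs1 : s ≤ 1 / 2 := by
    rw [hs, pow_succ]
    have : ((1 : ℝ) / 2) ^ k ≤ 1 := pow_le_one₀ (by norm_num) (by norm_num)
    linarith
  -- For `d ≤ 3` the diagonal `√d` is at most `2`. With `s ≤ 1/2` all shifts stay in the unit ball,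
  -- where difference quotients are controlled.
  have hv : ∀ ε : Fin d → Bool, ‖vertex ε‖ ≤ 2 := fun ε => by
    have h1 := norm_vertex_sq_le ε
    have h2 : (d : ℝ) ≤ 3 := by exact_mod_cast hd
    nlinarith [norm_nonneg (vertex ε)]
  have hb : ∀ ε : Fin d → Bool, ‖∫ y in cube d (k + 1),
      (translate x (translate (s • vertex ε) U - U) : L2 d) y‖ ≤
      K * (s * 2) * (s ^ d) ^ (1 - 1 / r.toReal) := by
    intro ε
    have hn : ‖s • vertex ε‖ ≤ s * 2 := by
      rw [norm_smul, Real.norm_of_nonneg hs0.le]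
      exact mul_le_mul_of_nonneg_left (hv ε) hs0.le
    refine norm_setIntegral_cube_le (k + 1) _ hr (by positivity) ?_
    rw [eLpNorm_congr_ae (coeFn_translate x _)]
    have e : eLpNorm (fun y => (translate (s • vertex ε) U - U : L2 d) (y + x)) r volume =
        eLpNorm (translate (s • vertex ε) U - U : L2 d) r volume :=
      eLpNorm_comp_measurePreserving (Lp.aestronglyMeasurable _)
        (measurePreserving_add_right volume x)
    rw [e]
    refine (hU _ (hn.trans (by linarith))).trans (ENNReal.ofReal_le_ofReal ?_)
    gcongr
  rw [norm_sub_rev, avg_sub_avg, norm_mul]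
  have h2 : ‖((2 : ℂ) ^ k) ^ d‖ = (2 ^ k) ^ d := by simp
  rw [h2]
  refine (mul_le_mul_of_nonneg_left (norm_sum_le _ _) (by positivity)).trans ?_
  refine (mul_le_mul_of_nonneg_left (Finset.sum_le_sum fun ε _ => hb ε) (by positivity)).trans
    (le_of_eq ?_)
  simp only [Finset.sum_const, Finset.card_univ, Fintype.card_fun, Fintype.card_bool,
    Fintype.card_fin, nsmul_eq_mul]
  push_cast
  have h3 : ((2 : ℝ) ^ k) ^ d * 2 ^ d = (s ^ d)⁻¹ := by
    rw [hs, ← mul_pow, ← pow_succ, ← inv_pow, ← inv_pow]; norm_num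
  have h4 : (s ^ d)⁻¹ * (s ^ d) ^ (1 - 1 / r.toReal) = s ^ (-(d * (1 / r.toReal))) := by
    rw [← Real.rpow_natCast s d, ← Real.rpow_neg hs0.le, ← Real.rpow_mul hs0.le,
      ← Real.rpow_add hs0]
    congr 1; ring
  have h5 : (((1 : ℝ) / 2) ^ (1 - d * (1 / r.toReal))) ^ (k + 1) = s * s ^ (-(d * (1 / r.toReal))) := by
    rw [hs, ← Real.rpow_natCast, ← Real.rpow_mul (by norm_num), ← Real.rpow_natCast,
      ← Real.rpow_mul (by norm_num), ← Real.rpow_add (by norm_num)]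
    congr 1; ring
  rw [h5, ← h4, ← h3]
  ring

theorem ae_tendsto_avg (hd : d ≤ 3) (U : L2 d) :
    ∀ᵐ x, Tendsto (fun k => avg k U x) atTop (𝓝 (U x)) := by
  have hloc : LocallyIntegrable U volume := (Lp.memLp U).locallyIntegrable (by norm_num)
  filter_upwards [IsUnifLocDoublingMeasure.ae_tendsto_average_norm_sub (volume : Measure (Space d))
    hloc 1] with x hx
  -- Radii of balls containing the cubes, since `√d ≤ 2`. Cube and ball have comparable volumes, so
  -- Lebesgue differentiation over balls carries over to the cubes.
  set δ : ℕ → ℝ := fun k => 2 * (1 / 2) ^ k with hδ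
  have hδ0 : ∀ k, 0 < δ k := fun k => by positivity
  have hδlim : Tendsto δ atTop (𝓝[>] 0) := by
    refine tendsto_nhdsWithin_iff.2 ⟨?_, Eventually.of_forall hδ0⟩
    have := (tendsto_pow_atTop_nhds_zero_of_lt_one (r := (1 / 2 : ℝ)) (by norm_num)
      (by norm_num)).const_mul 2
    simpa [hδ] using this
  have h1 := hx (fun _ : ℕ => x) δ hδlim (Eventually.of_forall fun k => by
    simp [(hδ0 k).le])
  set v : ℝ := (volume (Metric.ball (0 : Space d) 1)).toReal with hv
  rw [tendsto_iff_norm_sub_tendsto_zero]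
  have h2 := h1.const_mul (2 ^ d * v)
  rw [mul_zero] at h2
  refine squeeze_zero (fun _ => norm_nonneg _) (fun k => ?_) h2
  have hcube : ∀ y ∈ cube d k, y + x ∈ Metric.closedBall x (δ k) := by
    intro y hy
    rw [Metric.mem_closedBall, dist_eq_norm, add_sub_cancel_right]
    refine abs_le_of_sq_le_sq' ?_ (hδ0 k).le |>.2
    rw [EuclideanSpace.norm_sq_eq]
    calc ∑ i, ‖y i‖ ^ 2 ≤ ∑ _i : Fin d, ((1 / 2 : ℝ) ^ k) ^ 2 := by
          refine Finset.sum_le_sum fun i _ => ?_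
          rw [Real.norm_of_nonneg (hy i).1]
          exact pow_le_pow_left₀ (hy i).1 (hy i).2.le 2
      _ = d * ((1 / 2 : ℝ) ^ k) ^ 2 := by simp
      _ ≤ _ := by
          have h2 : (d : ℝ) ≤ 3 := by exact_mod_cast hd
          rw [hδ, mul_pow]
          nlinarith [sq_nonneg ((1 / 2 : ℝ) ^ k)]
  have hvol : (volume (cube d k)).toReal = ((1 / 2) ^ k) ^ d := by
    rw [volume_cube, ENNReal.toReal_ofReal (by positivity)]
  have hball : volume.real (Metric.closedBall x (δ k)) = δ k ^ d * v := by
    rw [Measure.real, Measure.addHaar_closedBall _ _ (hδ0 k).le, ENNReal.toReal_mul,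
      ENNReal.toReal_ofReal (by have := hδ0 k; positivity)]
    simp [hv]
  have hv0 : 0 < v := ENNReal.toReal_pos (Metric.measure_ball_pos _ _ one_pos).ne'
    measure_ball_lt_top.ne
  have hU1 : IntegrableOn (fun y => U (y + x)) (cube d k) volume := by
    have : MemLp (fun y => U (y + x)) 2 (volume.restrict (cube d k)) :=
      ((Lp.memLp U).comp_measurePreserving (measurePreserving_add_right volume x)).restrict _
    have hf : IsFiniteMeasure (volume.restrict (cube d k)) :=
      ⟨by rw [Measure.restrict_apply_univ]; exact (volume_cube_ne_top k).lt_top⟩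
    exact this.integrable (by norm_num)
  have hc1 : IntegrableOn (fun _ : Space d => U x) (cube d k) volume :=
    integrableOn_const (volume_cube_ne_top k)
  have hid : avg k U x - U x = (2 ^ k) ^ d * ∫ y in cube d k, (U (y + x) - U x) := by
    rw [avg_eq, integral_sub hU1 hc1, setIntegral_const, Measure.real, hvol, mul_sub]
    congr 1
    rw [Complex.real_smul]
    push_cast
    rw [← mul_assoc, ← mul_pow, ← mul_pow]
    norm_num
  have hU2 : IntegrableOn (fun y => ‖U y - U x‖) (Metric.closedBall x (δ k)) volume :=
    ((hloc.integrableOn_isCompact (isCompact_closedBall x (δ k))).sub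
      (integrableOn_const measure_closedBall_lt_top.ne)).norm
  rw [hid, norm_mul, norm_pow, norm_pow, Complex.norm_ofNat, setAverage_eq, hball, smul_eq_mul]
  have hle : ‖∫ y in cube d k, (U (y + x) - U x)‖ ≤
      ∫ y in Metric.closedBall x (δ k), ‖U y - U x‖ := by
    refine (norm_integral_le_integral_norm _).trans ?_
    rw [← integral_indicator (measurableSet_cube k),
      ← integral_indicator Metric.isClosed_closedBall.measurableSet,
      ← integral_add_right_eq_self (μ := volume) (fun y => (Metric.closedBall x (δ k)).indicator
        (fun y => ‖U y - U x‖) y) x]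
    refine integral_mono ((integrable_indicator_iff (measurableSet_cube k)).2 (hU1.sub hc1).norm)
      (((integrable_indicator_iff Metric.isClosed_closedBall.measurableSet).2 hU2).comp_add_right x)
      fun y => ?_
    by_cases hy : y ∈ cube d k
    · simp [hy, hcube y hy]
    · simp only [hy, not_false_eq_true, Set.indicator_of_notMem]
      exact Set.indicator_nonneg (fun _ _ => norm_nonneg _) _
  refine (mul_le_mul_of_nonneg_left hle (by positivity)).trans (le_of_eq ?_)
  have : δ k ^ d = 2 ^ d * ((2 ^ k) ^ d)⁻¹ := by
    rw [hδ, mul_pow, ← inv_pow, ← inv_pow]; norm_num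
  rw [this]
  field_simp

end

end SolitonTrain

/-! ### Morrey's inequality and weak gradients. -/

namespace SolitonTrain

noncomputable section

open FourierTransform

variable {d : ℕ}

/-- The continuous representative of an `L²` function with bounded difference quotients. -/
def rep (U : L2 d) (x : Space d) : ℂ := avg 0 U x + ∑' k, (avg (k + 1) U x - avg k U x)

/-- The constant in the Morrey inequality. -/
def morreyConst (d : ℕ) (r : ℝ≥0∞) : ℝ :=
  ∑' k : ℕ, 2 * ((1 / 2 : ℝ) ^ (1 - d * (1 / r.toReal))) ^ (k + 1)

section Morrey

variable {r : ℝ≥0∞}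

theorem summable_morrey (hdr : d * (1 / r.toReal) < 1) :
    Summable fun k : ℕ => 2 * ((1 / 2 : ℝ) ^ (1 - d * (1 / r.toReal))) ^ (k + 1) := by
  have h1 : ((1 / 2 : ℝ) ^ (1 - d * (1 / r.toReal))) < 1 :=
    Real.rpow_lt_one (by norm_num) (by norm_num) (by linarith)
  exact ((summable_nat_add_iff 1).2 (summable_geometric_of_lt_one (by positivity) h1)).mul_left 2

theorem morreyConst_nonneg : 0 ≤ morreyConst d r := tsum_nonneg fun k => by positivity

theorem rep_ae_eq (hd : d ≤ 3) (hr : 1 ≤ r) (hdr : d * (1 / r.toReal) < 1)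
    {K : ℝ} (hK : 0 ≤ K) {U : L2 d} (hU : U ∈ DiffBound r K) :
    rep U =ᵐ[volume] U := by
  filter_upwards [ae_tendsto_avg hd U] with x hx
  have hs : Summable fun k => avg (k + 1) U x - avg k U x :=
    Summable.of_norm_bounded ((summable_morrey hdr).mul_left K) fun k =>
      (norm_avg_sub_avg_le hd hr hK hU k x).trans (le_of_eq (by ring))
  have h2 := hs.hasSum.tendsto_sum_nat
  simp only [Finset.sum_range_sub (fun k => avg k U x)] at h2
  have h3 := h2.const_add (avg 0 U x)
  simp only [add_sub_cancel] at h3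
  exact tendsto_nhds_unique h3 hx

theorem norm_avg_zero_le (U : L2 d) (x : Space d) : ‖avg 0 U x‖ ≤ ‖U‖ := by
  rw [avg, norm_mul]
  simp only [pow_zero, one_pow, norm_one, one_mul]
  refine (norm_inner_le_norm _ _).trans ?_
  rw [norm_indicatorConstLp (by norm_num) (by norm_num), Measure.real, volume_cube,
    LinearIsometry.norm_map]
  simp

theorem norm_rep_le (hd : d ≤ 3) (hr : 1 ≤ r) (hdr : d * (1 / r.toReal) < 1)
    {K : ℝ} (hK : 0 ≤ K) {U : L2 d} (hU : U ∈ DiffBound r K) (x : Space d) :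
    ‖rep U x‖ ≤ ‖U‖ + K * morreyConst d r := by
  refine (norm_add_le _ _).trans (add_le_add (norm_avg_zero_le U x) ?_)
  rw [morreyConst, ← tsum_mul_left]
  exact tsum_of_norm_bounded ((summable_morrey hdr).mul_left K).hasSum fun k =>
    (norm_avg_sub_avg_le hd hr hK hU k x).trans (le_of_eq (by ring))

/-- The telescoping series converges uniformly in both arguments. Applied to a curve in `L²`, it
produces a representative continuous in space-time, which makes the distributional equation a
statement about continuous functions. -/
theorem continuous_rep (hd : d ≤ 3) (hr : 1 ≤ r) (hdr : d * (1 / r.toReal) < 1)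
    {Z : Type*} [TopologicalSpace Z] {K : ℝ} (hK : 0 ≤ K) {U : Z → L2 d}
    (hUc : Continuous U) (hU : ∀ z, U z ∈ DiffBound r K) :
    Continuous fun p : Z × Space d => rep (U p.1) p.2 := by
  have h1 : Continuous fun p : Z × Space d => ((p.2, U p.1) : Space d × L2 d) :=
    Continuous.prodMk continuous_snd (hUc.comp continuous_fst)
  have hc : ∀ k, Continuous fun p : Z × Space d => avg k (U p.1) p.2 := fun k =>
    Continuous.comp (g := fun p : Space d × L2 d => avg k p.2 p.1)
      (f := fun p : Z × Space d => ((p.2, U p.1) : Space d × L2 d)) (continuous_avg k) h1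
  have h : Continuous fun p : Z × Space d =>
      ∑' k, (avg (k + 1) (U p.1) p.2 - avg k (U p.1) p.2) :=
    continuous_tsum (fun k => (hc (k + 1)).sub (hc k)) ((summable_morrey hdr).mul_left K)
      fun k p => (norm_avg_sub_avg_le hd hr hK (hU p.1) k p.2).trans (le_of_eq (by ring))
  exact Continuous.add (hc 0) h

theorem ae_norm_le (hd : d ≤ 3) (hr : 1 ≤ r) (hdr : d * (1 / r.toReal) < 1)
    {K : ℝ} (hK : 0 ≤ K) {U : L2 d} (hU : U ∈ DiffBound r K) :
    ∀ᵐ x, ‖U x‖ ≤ ‖U‖ + K * morreyConst d r := by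
  filter_upwards [rep_ae_eq hd hr hdr hK hU] with x hx
  rw [← hx]
  exact norm_rep_le hd hr hdr hK hU x

end Morrey

section WeakGradient

theorem fourier_translate_smul (e : Space d) (s : ℝ) (U : L2 d)
    (hθ : ∀ s : ℝ, Measurable fun ξ : Space d => s * (2 * Real.pi * inner ℝ e ξ)) :
    𝓕 (translate (s • e) U) = phaseMul (fun ξ => s * (2 * Real.pi * inner ℝ e ξ)) (hθ s) (𝓕 U) := by
  rw [fourier_translate]
  congr 2
  ext ξ
  rw [real_inner_smul_left]; ring

/-- An `L²` function with bounded difference quotients is differentiable in `L²` along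
translations. -/
theorem exists_hasDerivAt_translate {K : ℝ} {U : L2 d} (hU : U ∈ DiffBound 2 K) (e : Space d)
    (he : ‖e‖ = 1) : ∃ W : L2 d, HasDerivAt (fun s : ℝ => translate (s • e) U) W 0 := by
  have hθ : ∀ s : ℝ, Measurable fun ξ : Space d => s * (2 * Real.pi * inner ℝ e ξ) := by
    intro s; fun_prop
  set θ : Space d → ℝ := fun ξ => 2 * Real.pi * inner ℝ e ξ with hθdef
  set F : L2 d := 𝓕 U with hF
  set sq : ℕ → ℝ := fun n => 1 / ((n : ℝ) + 1) with hsq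
  have hsq0 : ∀ n, 0 < sq n := fun n => by positivity
  have hsq1 : ∀ n, sq n ≤ 1 := fun n => by
    rw [hsq]; simp only; rw [div_le_one (by positivity)]; linarith [(Nat.cast_nonneg n : (0:ℝ) ≤ n)]
  have hslim : Tendsto sq atTop (𝓝[≠] 0) := by
    refine tendsto_nhdsWithin_iff.2 ⟨tendsto_one_div_add_atTop_nhds_zero_nat,
      Eventually.of_forall fun n => (hsq0 n).ne'⟩
  have hbd : ∀ n, eLpNorm (fun ξ => slope (fun s : ℝ => Complex.exp (Complex.I * (s * θ ξ : ℝ))) 0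
      (sq n) * F ξ) 2 volume ≤ ENNReal.ofReal K := by
    intro n
    have h1 := hU (sq n • e) (by rw [norm_smul, he, mul_one, Real.norm_of_nonneg (hsq0 n).le]
                                 exact hsq1 n)
    have h2 : eLpNorm (𝓕 (translate (sq n • e) U - U) : L2 d) 2 volume ≤
        ENNReal.ofReal (K * sq n) := by
      have e1 : ‖(𝓕 (translate (sq n • e) U - U) : L2 d)‖ = ‖translate (sq n • e) U - U‖ :=
        Lp.norm_fourier_eq _
      rw [Lp.norm_def, Lp.norm_def,
        ENNReal.toReal_eq_toReal_iff' (Lp.eLpNorm_ne_top _) (Lp.eLpNorm_ne_top _)] at e1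
      rw [e1]
      refine h1.trans (le_of_eq ?_)
      rw [norm_smul, he, mul_one, Real.norm_of_nonneg (hsq0 n).le]
    have h3 : (fun ξ => slope (fun s : ℝ => Complex.exp (Complex.I * (s * θ ξ : ℝ))) 0
        (sq n) * F ξ) =ᵐ[volume] (sq n)⁻¹ • ⇑(𝓕 (translate (sq n • e) U - U) : L2 d) := by
      have e4 : (𝓕 (translate (sq n • e) U - U) : L2 d) = phaseMul _ (hθ (sq n)) F - F := by
        rw [← fourier_translate_smul e (sq n) U hθ]
        exact map_sub (Lp.fourierTransformₗᵢ (Space d) ℂ) _ _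
      rw [e4]
      filter_upwards [Lp.coeFn_sub (phaseMul _ (hθ (sq n)) F) F, coeFn_phaseMul _ (hθ (sq n)) F]
        with ξ h5 h6
      rw [Pi.smul_apply, h5, Pi.sub_apply, h6, slope_def_module]
      simp only [sub_zero, Complex.real_smul, hθdef]
      simp
      ring
    rw [eLpNorm_congr_ae h3, eLpNorm_const_smul]
    calc _ ≤ ‖(sq n)⁻¹‖ₑ * ENNReal.ofReal (K * sq n) := by gcongr
      _ = ENNReal.ofReal K := by
        rw [← ofReal_norm, ← ENNReal.ofReal_mul (norm_nonneg _),
          Real.norm_of_nonneg (inv_nonneg.2 (hsq0 n).le)]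
        congr 1
        have := (hsq0 n).ne'
        field_simp
  -- Fatou's lemma along shifts of length `1/(n+1)` shows that `2π⟨e,ξ⟩ 𝓕U` is square integrable,
  -- which is the domain condition needed in `hasDerivAt_phaseMul`.
  have hfatou := Lp.eLpNorm_lim_le_liminf_eLpNorm (p := 2) (μ := (volume : Measure (Space d)))
    (f := fun n ξ => slope (fun s : ℝ => Complex.exp (Complex.I * (s * θ ξ : ℝ))) 0
      (sq n) * F ξ) (fun n => by
        simp only [slope_def_module]
        have : Measurable θ := by rw [hθdef]; fun_prop
        have h1 : Measurable fun ξ => ((sq n - 0)⁻¹ • (Complex.exp (Complex.I * (sq n * θ ξ : ℝ)) -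
          Complex.exp (Complex.I * (0 * θ ξ : ℝ)))) := by fun_prop
        exact h1.aestronglyMeasurable.mul (Lp.aestronglyMeasurable F))
    (fun ξ => Complex.I * θ ξ * F ξ) (Eventually.of_forall fun ξ => by
      have h := (hasDerivAt_iff_tendsto_slope.1 (hasDerivAt_phase (θ ξ) 0)).mul_const (F ξ)
      have := h.comp hslim
      simpa [Function.comp_def] using this)
  have hle : eLpNorm (fun ξ => Complex.I * θ ξ * F ξ) 2 volume ≤ ENNReal.ofReal K := by
    refine hfatou.trans (liminf_le_of_le (by isBoundedDefault) fun b hb => ?_)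
    obtain ⟨n, hn⟩ := hb.exists
    exact hn.trans (hbd n)
  have hmem : MemLp (fun ξ => (θ ξ : ℂ) * F ξ) 2 volume := by
    refine ⟨?_, lt_of_le_of_lt ?_ (hle.trans_lt (by simp))⟩
    · have : Measurable θ := by rw [hθdef]; fun_prop
      exact (by fun_prop : Measurable fun ξ => (θ ξ : ℂ)).aestronglyMeasurable.mul
        (Lp.aestronglyMeasurable F)
    · refine le_of_eq (eLpNorm_congr_norm_ae (Eventually.of_forall fun ξ => ?_))
      simp
  have hd1 := hasDerivAt_phaseMul θ hθ (F := F) (G := hmem.toLp _) hmem.coeFn_toLp 0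
  have hd2 := hasDerivAt_linearIsometry
    (Lp.fourierTransformₗᵢ (Space d) ℂ).symm.toLinearIsometry hd1
  refine ⟨_, hd2.congr_of_eventuallyEq (Eventually.of_forall fun s => ?_)⟩
  simp only [hF, hθdef]
  rw [← fourier_translate_smul e s U hθ]
  exact ((Lp.fourierTransformₗᵢ (Space d) ℂ).symm_apply_apply _).symm

/-- The derivative is an `L²` limit of difference quotients lying in an `L^p` ball that is closed in
`L²`. The exponent `p` is therefore arbitrary, including `⊤`. -/
theorem eLpNorm_deriv_translate_le {p : ℝ≥0∞} {K : ℝ} {U W : L2 d} (hU : U ∈ DiffBound p K)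
    {e : Space d} (he : ‖e‖ = 1) (hW : HasDerivAt (fun s : ℝ => translate (s • e) U) W 0) :
    eLpNorm W p volume ≤ ENNReal.ofReal K := by
  have h := (hasDerivAt_iff_tendsto_slope.1 hW).mono_left
    (nhdsWithin_mono (s := Set.Ioi (0 : ℝ)) 0 fun x hx => ne_of_gt hx)
  refine (isClosed_eLpNorm_le p _).mem_of_tendsto h ?_
  have hev : ∀ᶠ s : ℝ in 𝓝[>] 0, s < 1 := nhdsWithin_le_nhds (Iio_mem_nhds one_pos)
  filter_upwards [self_mem_nhdsWithin, hev] with s hs hs1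
  have hs : 0 < s := hs
  change eLpNorm (slope (fun s : ℝ => translate (s • e) U) 0 s) p volume ≤ _
  have h0 : translate ((0 : ℝ) • e) U = U := by
    apply Lp.ext
    filter_upwards [coeFn_translate ((0 : ℝ) • e) U] with x hx
    rw [hx]; simp
  rw [slope_def_module, h0, sub_zero, eLpNorm_congr_ae (Lp.coeFn_smul _ _), eLpNorm_const_smul]
  have hn : ‖s • e‖ = s := by rw [norm_smul, he, mul_one, Real.norm_of_nonneg hs.le]
  calc _ ≤ ‖s⁻¹‖ₑ * ENNReal.ofReal (K * s) := by
        gcongr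
        have := hU (s • e) (by rw [hn]; exact hs1.le)
        rwa [hn] at this
    _ = ENNReal.ofReal K := by
        rw [← ofReal_norm, ← ENNReal.ofReal_mul (norm_nonneg _),
          Real.norm_of_nonneg (inv_nonneg.2 hs.le)]
        congr 1
        field_simp

/-- The pairing of `U(· + s e)` with `ψ` equals that of `U` with `ψ(· - s e)`; differentiating both
forms at `s = 0` identifies the translation derivative with the weak derivative. -/
theorem integral_mul_deriv_translate {U W : L2 d} {e : Space d}
    (hW : HasDerivAt (fun s : ℝ => translate (s • e) U) W 0) {ψ : Space d → ℂ}
    (hψ : ContDiff ℝ (⊤ : ℕ∞) ψ) (hc : HasCompactSupport ψ) :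
    ∫ x, U x * fderiv ℝ ψ x e = -∫ x, W x * ψ x := by
  have hψm : MemLp ψ 2 volume := hψ.continuous.memLp_of_hasCompactSupport hc
  have hψs : MemLp (star ψ) 2 volume := hψm.star
  -- the pairing with `ψ` as a continuous linear functional
  have hpair : ∀ V : L2 d, inner ℂ (hψs.toLp _) V = ∫ x, V x * ψ x := by
    intro V
    rw [MeasureTheory.L2.inner_def]
    refine integral_congr_ae ?_
    filter_upwards [hψs.coeFn_toLp] with x hx
    rw [hx]
    simp
  have h1 : HasDerivAt (fun s : ℝ => inner ℂ (hψs.toLp (star ψ)) (translate (s • e) U))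
      (inner ℂ (hψs.toLp (star ψ)) W) 0 := by
    have := (hasDerivAt_const (0 : ℝ) (hψs.toLp (star ψ))).inner ℂ hW
    simpa using this
  simp only [hpair] at h1
  have h2 : ∀ s : ℝ, ∫ x, (translate (s • e) U : L2 d) x * ψ x = ∫ x, U x * ψ (x - s • e) := by
    intro s
    rw [← integral_add_right_eq_self (fun x => U x * ψ (x - s • e)) (s • e)]
    refine integral_congr_ae ?_
    filter_upwards [coeFn_translate (s • e) U] with x hx
    rw [hx, add_sub_cancel_right]
  simp only [h2] at h1
  obtain ⟨C, hC⟩ := (hψ.continuous_fderiv (by simp)).bounded_above_of_compact_support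
    (hc.fderiv (𝕜 := ℝ))
  have hC0 : 0 ≤ C := (norm_nonneg _).trans (hC 0)
  set S : Set (Space d) := Metric.cthickening ‖e‖ (tsupport ψ) with hS
  have hScomp : IsCompact S := hc.isCompact.cthickening
  have hder : ∀ x : Space d, ∀ s : ℝ, HasDerivAt (fun s : ℝ => U x * ψ (x - s • e))
      (U x * -(fderiv ℝ ψ (x - s • e) e)) s := by
    intro x s
    have h3 : HasDerivAt (fun s : ℝ => x - s • e) (-e) s := by
      simpa using ((hasDerivAt_id s).smul_const e).const_sub x
    have h4 := ((hψ.differentiable (by simp)) (x - s • e)).hasFDerivAt.comp_hasDerivAt s h3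
    simpa using h4.const_mul (U x)
  have h3 := hasDerivAt_integral_of_dominated_loc_of_deriv_le (μ := (volume : Measure (Space d)))
    (F := fun s x => U x * ψ (x - s • e)) (F' := fun s x => U x * -(fderiv ℝ ψ (x - s • e) e))
    (x₀ := (0 : ℝ)) (s := Set.Icc (-1) 1) (bound := fun x => ‖U x‖ * S.indicator (fun _ => C * ‖e‖) x)
    (Icc_mem_nhds (by norm_num) (by norm_num))
    (Eventually.of_forall fun s => (Lp.aestronglyMeasurable U).mul
      (hψ.continuous.comp (by fun_prop)).aestronglyMeasurable)
    (by
      simp only [zero_smul, sub_zero]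
      exact (Lp.memLp U).integrable_mul hψm)
    (by
      refine (Lp.aestronglyMeasurable U).mul (Continuous.aestronglyMeasurable ?_)
      have := hψ.continuous_fderiv (by simp)
      fun_prop)
    (Eventually.of_forall fun x s hs => by
      rw [norm_mul, norm_neg]
      refine mul_le_mul_of_nonneg_left ?_ (norm_nonneg _)
      by_cases hx : x ∈ S
      · rw [Set.indicator_of_mem hx]
        exact ((fderiv ℝ ψ (x - s • e)).le_opNorm e).trans
          (mul_le_mul_of_nonneg_right (hC _) (norm_nonneg _))
      · rw [Set.indicator_of_notMem hx]
        have : x - s • e ∉ tsupport ψ := by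
          intro hmem
          refine hx (Metric.mem_cthickening_of_dist_le x (x - s • e) _ _ hmem ?_)
          rw [dist_eq_norm, sub_sub_cancel, norm_smul]
          exact mul_le_of_le_one_left (norm_nonneg _) (abs_le.2 ⟨by linarith [hs.1], hs.2⟩)
        have h5 : fderiv ℝ ψ (x - s • e) = 0 :=
          image_eq_zero_of_notMem_tsupport fun h => this (tsupport_fderiv_subset ℝ h)
        simp [h5])
    (by
      have : MemLp (S.indicator fun _ => C * ‖e‖) 2 (volume : Measure (Space d)) :=
        memLp_indicator_const 2 hScomp.measurableSet _ (Or.inr hScomp.measure_lt_top.ne)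
      exact (Lp.memLp U).norm.integrable_mul this)
    (Eventually.of_forall fun x s _ => hder x s)
  have h4 := h1.unique h3.2
  simp only [zero_smul, sub_zero, mul_neg, integral_neg] at h4
  rw [h4, neg_neg]

/-- An `L²` function with difference quotients bounded by `K` in `L² ∩ L^r` has a weak gradient,
with norms at most `d K`. -/
theorem exists_hasWeakGradient {r : ℝ≥0∞} (hr : 1 ≤ r) {K : ℝ} {U : L2 d}
    (h2 : U ∈ DiffBound 2 K) (hUr : U ∈ DiffBound r K) {u : Space d → ℂ} (hu : u =ᵐ[volume] U) :
    ∃ G : Space d → EuclideanSpace ℂ (Fin d), HasWeakGradient u G ∧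
      AEStronglyMeasurable G volume ∧ eLpNorm G 2 volume ≤ ENNReal.ofReal (d * K) ∧
      eLpNorm G r volume ≤ ENNReal.ofReal (d * K) := by
  have hn : ∀ i : Fin d, ‖(EuclideanSpace.single i 1 : Space d)‖ = 1 := fun i => by simp
  choose W hW using fun i : Fin d => exists_hasDerivAt_translate h2 _ (hn i)
  let G : Space d → EuclideanSpace ℂ (Fin d) := fun x => ∑ i, EuclideanSpace.single i (W i x)
  have hG : ∀ x i, G x i = W i x := fun x i => by
    simp [G]
  have hGm : AEStronglyMeasurable G volume := by
    have hc : ∀ i : Fin d, Continuous fun z : ℂ => (EuclideanSpace.single i z : EuclideanSpace ℂ (Fin d)) := by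
      intro i
      have : Isometry fun z : ℂ => (EuclideanSpace.single i z : EuclideanSpace ℂ (Fin d)) :=
        Isometry.of_dist_eq fun a b => by simp
      exact this.continuous
    exact Finset.aestronglyMeasurable_fun_sum _ fun i _ =>
      (hc i).comp_aestronglyMeasurable (Lp.aestronglyMeasurable (W i))
  have hGp : ∀ p : ℝ≥0∞, 1 ≤ p → U ∈ DiffBound p K → eLpNorm G p volume ≤ ENNReal.ofReal (d * K) := by
    intro p hp hUp
    have h3 : eLpNorm G p volume ≤ eLpNorm (∑ i, fun x => ‖W i x‖) p volume := by
      refine eLpNorm_mono_real fun x => ?_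
      rw [Finset.sum_apply]
      refine (norm_sum_le _ _).trans (le_of_eq (Finset.sum_congr rfl fun i _ => ?_))
      simp
    refine h3.trans ((eLpNorm_sum_le (fun i _ => (Lp.aestronglyMeasurable (W i)).norm) hp).trans ?_)
    calc ∑ i, eLpNorm (fun x => ‖W i x‖) p volume ≤ ∑ _i : Fin d, ENNReal.ofReal K := by
          refine Finset.sum_le_sum fun i _ => ?_
          rw [eLpNorm_norm]
          exact eLpNorm_deriv_translate_le hUp (hn i) (hW i)
      _ = ENNReal.ofReal (d * K) := by
          rw [ENNReal.ofReal_mul (by positivity)]; simp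
  have h2G := hGp 2 (by norm_num) h2
  refine ⟨G, ⟨?_, ?_, ?_⟩, hGm, h2G, hGp r hr hUr⟩
  · exact ((memLp_congr_ae hu).2 (Lp.memLp U)).locallyIntegrable (by norm_num)
  · have : MemLp G 2 volume := ⟨hGm, h2G.trans_lt ENNReal.ofReal_lt_top⟩
    exact this.locallyIntegrable (by norm_num)
  · intro ψ hψ hψc i
    have := integral_mul_deriv_translate (hW i) hψ hψc
    simp only [hG]
    rw [← this]
    refine integral_congr_ae ?_
    filter_upwards [hu] with x hx
    rw [hx]

end WeakGradient

end

end SolitonTrain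

/-! ### Minkowski's inequality and the backward Duhamel integral. -/

namespace SolitonTrain

noncomputable section

open Complex (I)

variable {d : ℕ}

theorem convex_eLpNorm_le {q : ℝ≥0∞} (hq : 1 ≤ q) (c : ℝ≥0∞) :
    Convex ℝ {U : L2 d | eLpNorm U q volume ≤ c} := by
  intro U hU W hW a b ha hb hab
  change eLpNorm (a • U + b • W : L2 d) q volume ≤ c
  have hU : eLpNorm U q volume ≤ c := hU
  have hW : eLpNorm W q volume ≤ c := hW
  rw [eLpNorm_congr_ae (Lp.coeFn_add _ _)]
  refine (eLpNorm_add_le (Lp.aestronglyMeasurable _) (Lp.aestronglyMeasurable _) hq).trans ?_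
  rw [eLpNorm_congr_ae (Lp.coeFn_smul a U), eLpNorm_congr_ae (Lp.coeFn_smul b W),
    eLpNorm_const_smul, eLpNorm_const_smul]
  calc _ ≤ ‖a‖ₑ * c + ‖b‖ₑ * c := by gcongr
    _ = c := by
      rw [← add_mul, Real.enorm_of_nonneg ha, Real.enorm_of_nonneg hb,
        ← ENNReal.ofReal_add ha hb, hab, ENNReal.ofReal_one, one_mul]

/-- Minkowski's integral inequality for `L²`-valued integrals and the `L^q` norm. -/
theorem eLpNorm_integral_le {X : Type*} [MeasurableSpace X] {μ : Measure X} {q : ℝ≥0∞} (hq : 1 ≤ q)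
    {g : X → L2 d} {m : X → ℝ} (hg : Integrable g μ) (hm : Integrable m μ)
    (hpos : ∀ᵐ s ∂μ, 0 < m s) (hle : ∀ᵐ s ∂μ, eLpNorm (g s) q volume ≤ ENNReal.ofReal (m s)) :
    eLpNorm (∫ s, g s ∂μ : L2 d) q volume ≤ ENNReal.ofReal (∫ s, m s ∂μ) := by
  rcases eq_or_ne μ 0 with rfl | hμ
  · simp only [integral_zero_measure]
    rw [eLpNorm_congr_ae (Lp.coeFn_zero _ _ _)]; simp
  set M : ℝ := ∫ s, m s ∂μ with hM
  have hM0 : 0 < M := by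
    rw [hM, integral_pos_iff_support_of_nonneg_ae (hpos.mono fun s hs => hs.le) hm]
    rw [pos_iff_ne_zero]
    intro h0
    have h1 : ∀ᵐ s ∂μ, s ∉ Function.support m := measure_eq_zero_iff_ae_notMem.1 h0
    have h2 : ∀ᵐ s ∂μ, False := by
      filter_upwards [hpos, h1] with s h3 h4
      exact h4 h3.ne'
    rw [ae_iff] at h2
    simp at h2
    exact hμ h2
  -- The majorant is normalised to a probability density. The integral becomes the mean of `(M/m)
  -- g`, whose values lie in a closed convex ball of radius `M`. The division explains why `m` must
  -- be positive.
  set ρ : X → ℝ≥0∞ := fun s => ENNReal.ofReal (m s / M) with hρ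
  have hρm : AEMeasurable ρ μ := (hm.1.aemeasurable.div_const M).ennreal_ofReal
  have hprob : IsProbabilityMeasure (μ.withDensity ρ) := by
    refine ⟨?_⟩
    rw [withDensity_apply _ MeasurableSet.univ, Measure.restrict_univ,
      ← ofReal_integral_eq_lintegral_ofReal (hm.div_const M)
        (hpos.mono fun s hs => by simp only [Pi.zero_apply]; positivity),
      integral_div, div_self hM0.ne', ENNReal.ofReal_one]
  have hac : μ.withDensity ρ ≪ μ := withDensity_absolutelyContinuous _ _
  have hkey : ∀ᵐ s ∂μ, (ρ s).toReal • ((M / m s) • g s) = g s := by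
    filter_upwards [hpos] with s hs
    rw [hρ, ENNReal.toReal_ofReal (by positivity), smul_smul]
    field_simp
    rw [one_smul]
  have hint : Integrable (fun s => (M / m s) • g s) (μ.withDensity ρ) := by
    rw [integrable_withDensity_iff_integrable_smul₀' hρm (Eventually.of_forall fun s => by simp [hρ])]
    exact hg.congr (hkey.mono fun s hs => hs.symm)
  have hbd : ∀ᵐ s ∂μ, (M / m s) • g s ∈ {U : L2 d | eLpNorm U q volume ≤ ENNReal.ofReal M} := by
    filter_upwards [hpos, hle] with s h1 h2
    rw [eLpNorm_congr_ae (Lp.coeFn_smul _ _), eLpNorm_const_smul,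
      Real.enorm_of_nonneg (by positivity)]
    calc _ ≤ ENNReal.ofReal (M / m s) * ENNReal.ofReal (m s) := by gcongr
      _ = ENNReal.ofReal M := by
        rw [← ENNReal.ofReal_mul (by positivity), div_mul_cancel₀ _ h1.ne']
  have hmem := (convex_eLpNorm_le (d := d) hq (ENNReal.ofReal M)).integral_mem
    (isClosed_eLpNorm_le q _) (hac.ae_le hbd) hint
  rw [integral_withDensity_eq_integral_toReal_smul₀ hρm
    (Eventually.of_forall fun s => by simp [hρ]), integral_congr_ae hkey] at hmem
  exact hmem

section Duhamel

theorem eLpNorm_two_le_iff {U : L2 d} {A : ℝ} (hA : 0 ≤ A) :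
    eLpNorm U 2 volume ≤ ENNReal.ofReal A ↔ ‖U‖ ≤ A := by
  rw [Lp.norm_def, ENNReal.le_ofReal_iff_toReal_le (Lp.eLpNorm_ne_top U) hA]

/-- The backward Duhamel integral `-i ∫_t^∞ e^{i(t-s)Δ} F(s) ds`. -/
def duhamel (F : ℝ → L2 d) (t : ℝ) : L2 d :=
  -I • ∫ s in Set.Ioi t, schrodinger (t - s) (F s)

variable {F : ℝ → L2 d} {lam μ A : ℝ}

theorem integrableOn_exp_neg (hμ : 0 < μ) (A t : ℝ) :
    IntegrableOn (fun s => A * Real.exp (-(μ * s))) (Set.Ioi t) volume := by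
  have := (integrableOn_exp_mul_Ioi (neg_lt_zero.2 hμ) t).const_mul A
  simpa [neg_mul, IntegrableOn] using this

theorem integral_exp_neg_Ioi (hμ : 0 < μ) (A t : ℝ) :
    ∫ s in Set.Ioi t, A * Real.exp (-(μ * s)) = A / μ * Real.exp (-(μ * t)) := by
  rw [integral_const_mul]
  have := integral_exp_mul_Ioi (neg_lt_zero.2 hμ) t
  simp only [neg_mul] at this
  rw [this]
  field_simp

theorem continuousOn_schrodinger_comp (hFc : ContinuousOn F (Set.Ici 0)) (t : ℝ) :
    ContinuousOn (fun s => schrodinger (t - s) (F s)) (Set.Ici 0) :=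
  Continuous.comp_continuousOn (g := fun p : ℝ × L2 d => schrodinger p.1 p.2)
    (f := fun s => (t - s, F s)) continuous_schrodinger
    (ContinuousOn.prodMk (by fun_prop) hFc)

theorem integrableOn_duhamel (hμ : 0 < μ) (hFc : ContinuousOn F (Set.Ici 0))
    (hFb : ∀ s, 0 ≤ s → ‖F s‖ ≤ A * Real.exp (-(μ * s))) {t : ℝ} (ht : 0 ≤ t) (τ : ℝ) :
    IntegrableOn (fun s => schrodinger (τ - s) (F s)) (Set.Ioi t) volume := by
  refine (integrableOn_exp_neg hμ A t).mono'
    (((continuousOn_schrodinger_comp hFc τ).mono fun s hs => ht.trans (le_of_lt hs)).aestronglyMeasurable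
      measurableSet_Ioi) ?_
  filter_upwards [ae_restrict_mem measurableSet_Ioi] with s hs
  rw [LinearIsometry.norm_map]
  exact hFb s (ht.trans (le_of_lt hs))

theorem norm_duhamel_le (hμ : 0 < μ) (hFb : ∀ s, 0 ≤ s → ‖F s‖ ≤ A * Real.exp (-(μ * s))) {t : ℝ}
    (ht : 0 ≤ t) : ‖duhamel F t‖ ≤ A / μ * Real.exp (-(μ * t)) := by
  rw [duhamel, norm_smul, norm_neg, Complex.norm_I, one_mul, ← integral_exp_neg_Ioi hμ A t]
  refine norm_integral_le_of_norm_le (integrableOn_exp_neg hμ A t) ?_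
  filter_upwards [ae_restrict_mem measurableSet_Ioi] with s hs
  rw [LinearIsometry.norm_map]
  exact hFb s (ht.trans (le_of_lt hs))

/-- With `e^{itΔ}` factored out, `t` enters the integral only through its lower limit, so the
fundamental theorem of calculus applies. -/
theorem duhamel_eq (F : ℝ → L2 d) (t : ℝ) :
    duhamel F t = -I • schrodinger t (∫ s in Set.Ioi t, schrodinger (-s) (F s)) := by
  have h : ∀ s, schrodinger (t - s) (F s) = schrodinger t (schrodinger (-s) (F s)) := fun s => by
    rw [← schrodinger_add, sub_eq_add_neg]
  simp only [duhamel, h]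
  exact congrArg (-I • ·) ((schrodinger t).integral_comp_comm _)

theorem hasDerivWithinAt_integral_Ioi {E : Type*} [NormedAddCommGroup E] [NormedSpace ℝ E]
    [CompleteSpace E] {G : ℝ → E} (hG : ContinuousOn G (Set.Ici 0))
    (hGi : IntegrableOn G (Set.Ioi 0) volume) {t : ℝ} (ht : 0 ≤ t) :
    HasDerivWithinAt (fun t => ∫ s in Set.Ioi t, G s) (-G t) (Set.Ici 0) t := by
  have hint : ∀ a b : ℝ, 0 ≤ a → 0 ≤ b → IntervalIntegrable G volume a b := fun a b ha hb =>
    (hG.mono fun x hx => (le_inf ha hb).trans hx.1).intervalIntegrable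
  -- A constant continuation to negative times makes the integrand continuous everywhere, so the
  -- endpoint `t = 0` is covered too.
  set G' : ℝ → E := fun s => G (max s 0) with hG'
  have hG'c : Continuous G' := hG.comp_continuous (by fun_prop) fun s => le_max_right s 0
  have heq : ∀ x ∈ Set.Ici (0 : ℝ), ∫ s in Set.Ioi x, G s =
      (∫ s in Set.Ioi 0, G s) - ∫ s in (0)..x, G' s := by
    intro x hx
    have h1 := intervalIntegral.integral_Ioi_sub_Ioi hGi hx
    rw [eq_sub_iff_add_eq', ← eq_sub_iff_add_eq, h1]
    refine intervalIntegral.integral_congr fun s hs => ?_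
    rw [Set.uIcc_of_le hx] at hs
    simp [hG', max_eq_left hs.1]
  have h2 : HasDerivAt (fun x => (∫ s in Set.Ioi 0, G s) - ∫ s in (0)..x, G' s) (-G' t) t := by
    have := (hG'c.integral_hasStrictDerivAt 0 t).hasDerivAt.const_sub (∫ s in Set.Ioi 0, G s)
    exact this
  have h3 : G' t = G t := by simp [hG', max_eq_left ht]
  rw [h3] at h2
  exact h2.hasDerivWithinAt.congr heq (heq t ht)

theorem continuousOn_duhamel (hμ : 0 < μ) (hFc : ContinuousOn F (Set.Ici 0))
    (hFb : ∀ s, 0 ≤ s → ‖F s‖ ≤ A * Real.exp (-(μ * s))) :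
    ContinuousOn (duhamel F) (Set.Ici 0) := by
  have h1 : ContinuousOn (fun t => ∫ s in Set.Ioi t, schrodinger (-s) (F s)) (Set.Ici 0) := by
    intro t ht
    refine (hasDerivWithinAt_integral_Ioi ?_ ?_ ht).continuousWithinAt
    · simpa using continuousOn_schrodinger_comp hFc 0
    · simpa using integrableOn_duhamel hμ hFc hFb le_rfl 0
  have h2 := Continuous.comp_continuousOn (g := fun p : ℝ × L2 d => schrodinger p.1 p.2)
    (f := fun t => (t, ∫ s in Set.Ioi t, schrodinger (-s) (F s))) continuous_schrodinger
    (continuousOn_id.prodMk h1)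
  refine (h2.const_smul (-I)).congr fun t _ => ?_
  rw [duhamel_eq]
  rfl

theorem translate_duhamel_sub (hμ : 0 < μ) (hFc : ContinuousOn F (Set.Ici 0))
    (hFb : ∀ s, 0 ≤ s → ‖F s‖ ≤ A * Real.exp (-(μ * s))) {t : ℝ} (ht : 0 ≤ t) (h : Space d) :
    translate h (duhamel F t) - duhamel F t =
      -I • ∫ s in Set.Ioi t, schrodinger (t - s) (translate h (F s) - F s) := by
  have hi := integrableOn_duhamel hμ hFc hFb ht t
  have e1 : translate h (duhamel F t) =
      -I • ∫ s in Set.Ioi t, translate h (schrodinger (t - s) (F s)) := by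
    rw [duhamel, map_smul]
    congr 1
    exact ((translate h).toContinuousLinearMap.integral_comp_comm hi).symm
  have hi2 : IntegrableOn (fun s => translate h (schrodinger (t - s) (F s))) (Set.Ioi t) volume :=
    (translate h).toContinuousLinearMap.integrable_comp hi
  rw [e1, duhamel, ← smul_sub, ← integral_sub hi2 hi]
  congr 1
  refine integral_congr_ae (Eventually.of_forall fun s => ?_)
  simp only [map_sub, schrodinger_translate]

/-- Translations commute with the group, so difference quotients pass inside the integral and
Minkowski's inequality applies. The function `m` is whatever time majorant the chosen exponent `q`
provides. -/
theorem duhamel_mem_diffBound_of_le (hμ : 0 < μ) (hFc : ContinuousOn F (Set.Ici 0))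
    (hFb : ∀ s, 0 ≤ s → ‖F s‖ ≤ A * Real.exp (-(μ * s))) {t : ℝ} (ht : 0 ≤ t) {q : ℝ≥0∞}
    (hq : 1 ≤ q) {m : ℝ → ℝ} (hm : IntegrableOn m (Set.Ioi t) volume)
    (hpos : ∀ s, t < s → 0 < m s)
    (hle : ∀ s, t < s → ∀ h : Space d, ‖h‖ ≤ 1 →
      eLpNorm (schrodinger (t - s) (translate h (F s) - F s)) q volume ≤ ENNReal.ofReal (m s * ‖h‖))
    {B : ℝ} (hB : ∫ s in Set.Ioi t, m s ≤ B) : duhamel F t ∈ DiffBound q B := by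
  intro h hh
  -- The zero shift is separate because Minkowski's inequality above requires a strictly positive
  -- majorant, here `m s * ‖h‖`.
  rcases eq_or_ne h 0 with rfl | h0
  · have : translate 0 (duhamel F t) - duhamel F t = 0 := by
      rw [sub_eq_zero]
      apply Lp.ext
      filter_upwards [coeFn_translate 0 (duhamel F t)] with x hx
      rw [hx, add_zero]
    rw [this, eLpNorm_congr_ae (Lp.coeFn_zero _ _ _)]
    simp
  have hn : 0 < ‖h‖ := norm_pos_iff.2 h0
  rw [translate_duhamel_sub hμ hFc hFb ht h, eLpNorm_congr_ae (Lp.coeFn_smul _ _),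
    eLpNorm_const_smul, enorm_neg]
  have hI : ‖I‖ₑ = 1 := by rw [← ofReal_norm]; simp
  rw [hI, one_mul]
  have hFc' : ContinuousOn (fun s => translate h (F s) - F s) (Set.Ici 0) :=
    ((translate h).continuous.comp_continuousOn hFc).sub hFc
  have hFb' : ∀ s, 0 ≤ s → ‖translate h (F s) - F s‖ ≤ (2 * A) * Real.exp (-(μ * s)) := by
    intro s hs
    refine (norm_sub_le _ _).trans ?_
    rw [LinearIsometry.norm_map]
    linarith [hFb s hs]
  refine (eLpNorm_integral_le hq (integrableOn_duhamel hμ hFc' hFb' ht t) (hm.mul_const ‖h‖)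
    ?_ ?_).trans ?_
  · filter_upwards [ae_restrict_mem measurableSet_Ioi] with s hs
    exact mul_pos (hpos s hs) hn
  · filter_upwards [ae_restrict_mem measurableSet_Ioi] with s hs
    exact hle s hs h hh
  · rw [integral_mul_const]
    exact ENNReal.ofReal_le_ofReal (mul_le_mul_of_nonneg_right hB hn.le)

/-- After a shift by `t` this is a Gamma integral. The condition `σ < 1` makes the dispersive
singularity integrable, and the factor `μ^{σ-1}` is small for large rates. -/
theorem integrableOn_rpow_mul_exp {σ : ℝ} (hσ : σ < 1) (hμ : 0 < μ) (t : ℝ) :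
    IntegrableOn (fun s => (s - t) ^ (-σ) * Real.exp (-(μ * s))) (Set.Ioi t) volume ∧
    ∫ s in Set.Ioi t, (s - t) ^ (-σ) * Real.exp (-(μ * s)) =
      (1 / μ) ^ (1 - σ) * Real.Gamma (1 - σ) * Real.exp (-(μ * t)) := by
  have h1 : IntegrableOn (fun x : ℝ => Real.exp (-(μ * t)) * (x ^ (-σ) * Real.exp (-(μ * x))))
      (Set.Ioi 0) volume := by
    have := integrableOn_rpow_mul_exp_neg_mul_rpow (p := 1) (s := -σ) (by linarith) one_pos hμ
    refine Integrable.const_mul ?_ _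
    simpa [neg_mul, IntegrableOn] using this
  have h2 := Real.integral_rpow_mul_exp_neg_mul_Ioi (a := 1 - σ) (by linarith) hμ
  have hmp := measurePreserving_sub_right (volume : Measure ℝ) t
  have hemb : MeasurableEmbedding fun x : ℝ => x - t :=
    (Homeomorph.subRight t).measurableEmbedding
  have hpre : (fun x : ℝ => x - t) ⁻¹' Set.Ioi 0 = Set.Ioi t := by ext; simp
  have hfun : ∀ s : ℝ, Real.exp (-(μ * t)) * ((s - t) ^ (-σ) * Real.exp (-(μ * (s - t)))) =
      (s - t) ^ (-σ) * Real.exp (-(μ * s)) := by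
    intro s
    rw [show -(μ * s) = -(μ * t) + -(μ * (s - t)) by ring, Real.exp_add]
    ring
  constructor
  · have := (hmp.integrableOn_comp_preimage hemb).2 h1
    rw [hpre] at this
    refine this.congr (Eventually.of_forall fun s => ?_)
    simp only [Function.comp]
    exact hfun s
  · have := hmp.setIntegral_preimage_emb hemb
      (fun x : ℝ => Real.exp (-(μ * t)) * (x ^ (-σ) * Real.exp (-(μ * x)))) (Set.Ioi 0)
    rw [hpre] at this
    simp only [hfun] at this
    rw [this, integral_const_mul]
    rw [show 1 - σ - 1 = -σ by ring] at h2
    rw [h2]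
    ring

end Duhamel

end

end SolitonTrain

/-! ### The contraction argument. -/

namespace SolitonTrain

noncomputable section

open BoundedContinuousFunction

variable {d : ℕ}

/-- The states of size `K e^{-λt}` whose difference quotients have `L²` and `L^r` norms of size
`K e^{-ct}`. -/
def decaySet (d : ℕ) (r : ℝ≥0∞) (K lam c t : ℝ) : Set (L2 d) :=
  {U | ‖U‖ ≤ K * Real.exp (-(lam * t)) ∧ U ∈ DiffBound 2 (K * Real.exp (-(c * t))) ∧
    U ∈ DiffBound r (K * Real.exp (-(c * t)))}

theorem isClosed_decaySet (r : ℝ≥0∞) (K lam c t : ℝ) : IsClosed (decaySet d r K lam c t) :=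
  (isClosed_le continuous_norm continuous_const).inter
    ((isClosed_diffBound _ _).inter (isClosed_diffBound _ _))

theorem zero_mem_diffBound (p : ℝ≥0∞) (K : ℝ) : (0 : L2 d) ∈ DiffBound p K := by
  intro h _
  rw [map_zero, sub_zero, eLpNorm_congr_ae (Lp.coeFn_zero _ _ _)]
  simp

theorem zero_mem_decaySet (r : ℝ≥0∞) {K : ℝ} (hK : 0 ≤ K) (lam c t : ℝ) :
    (0 : L2 d) ∈ decaySet d r K lam c t :=
  ⟨by rw [norm_zero]; positivity, zero_mem_diffBound _ _, zero_mem_diffBound _ _⟩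

/-- The `L²` bounds use only the isometry property, the `L^r` bound the dispersive estimate. For
fixed `A`, the left sides of `h1`, `h2`, `h3` tend to zero as the rates grow, which is how large
decay rates replace smallness of the data. -/
theorem duhamel_mem_decaySet {F : ℝ → L2 d} {p r : ℝ≥0∞} {σ Cd A K lam c : ℝ} (hlam : 0 < lam)
    (hc : 0 < c) (hσ : σ < 1) (hr : 1 ≤ r) (hA : 0 < A) (hCd : 0 < Cd)
    (hdisp : DispersiveBound d p r σ Cd) (hFc : ContinuousOn F (Set.Ici 0))
    (hF0 : ∀ s, 0 ≤ s → ‖F s‖ ≤ A * Real.exp (-(lam * s)))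
    (hF2 : ∀ s, 0 ≤ s → F s ∈ DiffBound 2 (A * Real.exp (-(c * s))))
    (hFp : ∀ s, 0 ≤ s → F s ∈ DiffBound p (A * Real.exp (-(c * s))))
    (h1 : A / lam ≤ K) (h2 : A / c ≤ K)
    (h3 : Cd * A * ((1 / c) ^ (1 - σ) * Real.Gamma (1 - σ)) ≤ K) {t : ℝ} (ht : 0 ≤ t) :
    duhamel F t ∈ decaySet d r K lam c t := by
  refine ⟨(norm_duhamel_le hlam hF0 ht).trans (by gcongr), ?_, ?_⟩
  · refine duhamel_mem_diffBound_of_le hlam hFc hF0 ht one_le_two (integrableOn_exp_neg hc A t)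
      (fun s _ => by positivity) (fun s hs h hh => ?_) ?_
    · rw [eLpNorm_two_le_iff (by positivity), LinearIsometry.norm_map,
        ← eLpNorm_two_le_iff (by positivity)]
      exact hF2 s (ht.trans hs.le) h hh
    · rw [integral_exp_neg_Ioi hc]
      gcongr
  · obtain ⟨hi, he⟩ := integrableOn_rpow_mul_exp hσ hc t
    refine duhamel_mem_diffBound_of_le hlam hFc hF0 ht hr (hi.const_mul (Cd * A))
      (fun s hs => ?_) (fun s hs h hh => ?_) ?_
    · have : 0 < s - t := sub_pos.2 hs
      positivity
    · refine (hdisp (t - s) (by linarith [hs] |> fun h : t - s < 0 => h.ne) _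
        (A * Real.exp (-(c * s)) * ‖h‖) (by positivity) (hFp s (ht.trans hs.le) h hh)
        (hF2 s (ht.trans hs.le) h hh)).trans (ENNReal.ofReal_le_ofReal (le_of_eq ?_))
      rw [abs_sub_comm, abs_of_pos (sub_pos.2 hs)]
      ring
    · rw [integral_const_mul, he, ← mul_assoc]
      gcongr

theorem norm_duhamel_sub_le {F G : ℝ → L2 d} {A B lam : ℝ} (hlam : 0 < lam)
    (hFc : ContinuousOn F (Set.Ici 0)) (hF : ∀ s, 0 ≤ s → ‖F s‖ ≤ A * Real.exp (-(lam * s)))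
    (hGc : ContinuousOn G (Set.Ici 0)) (hG : ∀ s, 0 ≤ s → ‖G s‖ ≤ A * Real.exp (-(lam * s)))
    (hFG : ∀ s, 0 ≤ s → ‖F s - G s‖ ≤ B * Real.exp (-(lam * s))) {t : ℝ} (ht : 0 ≤ t) :
    ‖duhamel F t - duhamel G t‖ ≤ B / lam * Real.exp (-(lam * t)) := by
  have : duhamel F t - duhamel G t = duhamel (fun s => F s - G s) t := by
    simp only [duhamel, map_sub]
    rw [integral_sub (integrableOn_duhamel hlam hFc hF ht t) (integrableOn_duhamel hlam hGc hG ht t),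
      smul_sub]
  rw [this]
  exact norm_duhamel_le hlam hFG ht

/-- Solvability of the integral equation `U(t) = -i ∫_t^∞ e^{i(t-s)Δ} N(s, U(s)) ds` by the
contraction principle, for a nonlinearity that is Lipschitz in `L²` and small compared to the decay
rates. -/
theorem exists_eq_duhamel {N : ℝ → L2 d → L2 d} {p r : ℝ≥0∞} {σ Cd A B K lam c : ℝ}
    (hlam : 0 < lam) (hc : 0 < c) (hσ : σ < 1) (hr : 1 ≤ r) (hA : 0 < A) (hB : 0 ≤ B) (hCd : 0 < Cd)
    (hK : 0 ≤ K) (hdisp : DispersiveBound d p r σ Cd)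
    (hN0 : ∀ t, 0 ≤ t → ∀ U ∈ decaySet d r K lam c t, ‖N t U‖ ≤ A * Real.exp (-(lam * t)))
    (hN2 : ∀ t, 0 ≤ t → ∀ U ∈ decaySet d r K lam c t,
      N t U ∈ DiffBound 2 (A * Real.exp (-(c * t))))
    (hNp : ∀ t, 0 ≤ t → ∀ U ∈ decaySet d r K lam c t,
      N t U ∈ DiffBound p (A * Real.exp (-(c * t))))
    (hNL : ∀ t, 0 ≤ t → ∀ U ∈ decaySet d r K lam c t, ∀ V ∈ decaySet d r K lam c t,
      ‖N t U - N t V‖ ≤ B * ‖U - V‖)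
    (hNc : ∀ U : ℝ → L2 d, Continuous U → (∀ t, 0 ≤ t → U t ∈ decaySet d r K lam c t) →
      ContinuousOn (fun t => N t (U t)) (Set.Ici 0))
    (h1 : A / lam ≤ K) (h2 : A / c ≤ K)
    (h3 : Cd * A * ((1 / c) ^ (1 - σ) * Real.Gamma (1 - σ)) ≤ K) (h4 : B / lam ≤ 1 / 2) :
    ∃ U : ℝ → L2 d, Continuous U ∧ (∀ t, 0 ≤ t → U t ∈ decaySet d r K lam c t) ∧
      ∀ t, 0 ≤ t → U t = duhamel (fun s => N s (U s)) t := by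
  -- The unknown is `ξ(t) = e^{λt} U(t)`, so the weighted `L²` metric becomes the sup metric.
  let E : (ℝ →ᵇ L2 d) → ℝ → L2 d := fun ξ t => Real.exp (-(lam * t)) • ξ t
  have hEc : ∀ ξ, Continuous (E ξ) := fun ξ =>
    (by fun_prop : Continuous fun t : ℝ => Real.exp (-(lam * t))).smul ξ.continuous
  -- The gradient bounds enter only as a constraint. It is closed under `L²` convergence, so `S` is
  -- complete although the metric sees no derivatives.
  let S : Set (ℝ →ᵇ L2 d) := {ξ | ∀ t, 0 ≤ t → E ξ t ∈ decaySet d r K lam c t}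
  have hSc : IsClosed S := by
    have : S = ⋂ (t : ℝ) (_ : 0 ≤ t), (fun ξ => E ξ t) ⁻¹' decaySet d r K lam c t := by
      ext ξ; simp [S]
    rw [this]
    refine isClosed_iInter fun t => isClosed_iInter fun _ => ?_
    have h0 : Continuous fun ξ : ℝ →ᵇ L2 d => ξ t := continuous_eval_const t
    have h1 : Continuous fun ξ : ℝ →ᵇ L2 d => E ξ t := h0.const_smul (Real.exp (-(lam * t)))
    exact IsClosed.preimage h1 (isClosed_decaySet r K lam c t)
  have hS0 : (0 : ℝ →ᵇ L2 d) ∈ S := fun t _ => by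
    simpa [E] using zero_mem_decaySet (d := d) r hK lam c t
  have hDm : ∀ ξ ∈ S, ∀ t, 0 ≤ t →
      duhamel (fun s => N s (E ξ s)) t ∈ decaySet d r K lam c t := fun ξ hξ t ht =>
    duhamel_mem_decaySet hlam hc hσ hr hA hCd hdisp (hNc _ (hEc ξ) hξ)
      (fun s hs => hN0 s hs _ (hξ s hs)) (fun s hs => hN2 s hs _ (hξ s hs))
      (fun s hs => hNp s hs _ (hξ s hs)) h1 h2 h3 ht
  -- The image is frozen at its value at time zero for negative times, so that it is defined and
  -- continuous on all of `ℝ`.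
  have hex : ∀ ξ : S, ∃ ζ : S, ∀ t, (ζ : ℝ →ᵇ L2 d) t =
      Real.exp (lam * max t 0) • duhamel (fun s => N s (E ξ s)) (max t 0) := by
    intro ξ
    have hcont : Continuous fun t : ℝ =>
        Real.exp (lam * max t 0) • duhamel (fun s => N s (E ξ s)) (max t 0) := by
      refine (by fun_prop : Continuous fun t : ℝ => Real.exp (lam * max t 0)).smul ?_
      exact (continuousOn_duhamel hlam (hNc _ (hEc ξ) ξ.2)
        (fun s hs => hN0 s hs _ (ξ.2 s hs))).comp_continuous (by fun_prop) fun t => le_max_right t 0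
    refine ⟨⟨BoundedContinuousFunction.ofNormedAddCommGroup _ hcont K fun t => ?_, fun t ht => ?_⟩,
      fun t => rfl⟩
    · rw [norm_smul, Real.norm_of_nonneg (Real.exp_pos _).le]
      calc _ ≤ Real.exp (lam * max t 0) * (K * Real.exp (-(lam * max t 0))) := by
            gcongr
            exact (hDm ξ ξ.2 _ (le_max_right t 0)).1
        _ = K := by rw [mul_left_comm, ← Real.exp_add, add_neg_cancel, Real.exp_zero, mul_one]
    · have := hDm ξ ξ.2 t ht
      simpa only [E, BoundedContinuousFunction.coe_ofNormedAddCommGroup, max_eq_left ht, smul_smul,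
        ← Real.exp_add, neg_add_cancel, Real.exp_zero, one_smul] using this
  choose Φ hΦ using hex
  have hcontr : ContractingWith (1 / 2) Φ := by
    refine ⟨by norm_num [← NNReal.coe_lt_coe], LipschitzWith.of_dist_le_mul fun ξ ζ => ?_⟩
    rw [Subtype.dist_eq, Subtype.dist_eq, BoundedContinuousFunction.dist_le (by positivity)]
    intro t
    set τ := max t 0
    have hτ : 0 ≤ τ := le_max_right t 0
    rw [hΦ, hΦ, dist_eq_norm, ← smul_sub, norm_smul, Real.norm_of_nonneg (Real.exp_pos _).le]
    have hdiff : ∀ s, 0 ≤ s → ‖N s (E ξ s) - N s (E ζ s)‖ ≤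
        (B * dist (ξ : ℝ →ᵇ L2 d) ζ) * Real.exp (-(lam * s)) := by
      intro s hs
      refine (hNL s hs _ (ξ.2 s hs) _ (ζ.2 s hs)).trans ?_
      simp only [E, ← smul_sub]
      rw [norm_smul, Real.norm_of_nonneg (Real.exp_pos _).le, ← dist_eq_norm, mul_assoc,
        mul_comm (dist _ _)]
      gcongr
      exact BoundedContinuousFunction.dist_coe_le_dist s
    have := norm_duhamel_sub_le hlam (hNc _ (hEc ξ) ξ.2) (fun s hs => hN0 s hs _ (ξ.2 s hs))
      (hNc _ (hEc ζ) ζ.2) (fun s hs => hN0 s hs _ (ζ.2 s hs)) hdiff hτ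
    calc _ ≤ Real.exp (lam * τ) * (B * dist (ξ : ℝ →ᵇ L2 d) ζ / lam * Real.exp (-(lam * τ))) := by
          gcongr
      _ = B / lam * dist (ξ : ℝ →ᵇ L2 d) ζ := by
          rw [mul_left_comm, ← Real.exp_add, add_neg_cancel, Real.exp_zero]; ring
      _ ≤ _ := by
          gcongr
          simpa using h4
  have : CompleteSpace S := hSc.isComplete.completeSpace_coe
  have : Nonempty S := ⟨⟨0, hS0⟩⟩
  set ξ := ContractingWith.fixedPoint Φ hcontr
  have hfix : Φ ξ = ξ := hcontr.fixedPoint_isFixedPt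
  refine ⟨E ξ, hEc ξ, ξ.2, fun t ht => ?_⟩
  have := hΦ ξ t
  rw [hfix, max_eq_left ht] at this
  simp only [E]
  rw [this, smul_smul, ← Real.exp_add, neg_add_cancel, Real.exp_zero, one_smul]

end

end SolitonTrain

/-! ### Calculus of the nonlinearity on bounded sets. -/

namespace SolitonTrain

noncomputable section

/-- The real derivative of `z ↦ g(|z|²) z`. -/
def dnonlin (g : ℝ → ℝ) (z : ℂ) : ℂ →L[ℝ] ℂ :=
  g (‖z‖ ^ 2) • ContinuousLinearMap.id ℝ ℂ +
    (2 * deriv g (‖z‖ ^ 2)) • (innerSL ℝ z).smulRight z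

variable {d : ℕ} {g : ℝ → ℝ} {C₀ α₁ α₂ : ℝ}

section Profile

/-- For bounded amplitudes the power `α₂` is absorbed into `α₁`, so only the behaviour of `g` near
zero matters from here on. The variable `x` stands for `|z|`, with `s = x²`. -/
theorem AssumptionF.exists_deriv_le (hF : AssumptionF d g C₀ α₁ α₂) {M : ℝ} (hM : 0 < M) :
    ∃ C : ℝ, 0 < C ∧ ∀ x : ℝ, 0 < x → x ≤ M →
      |deriv g (x ^ 2)| ≤ C * x ^ (α₁ - 2) ∧ |deriv (deriv g) (x ^ 2)| ≤ C * x ^ (α₁ - 4) := by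
  have hC := hF.const_pos
  refine ⟨C₀ * (1 + M ^ (α₂ - α₁)), by positivity, fun x hx hxM => ?_⟩
  have h := hF.bound (x ^ 2) (by positivity)
  have e1 : (x ^ 2) ^ (α₁ / 2) = x ^ α₁ := by
    rw [← Real.rpow_natCast, ← Real.rpow_mul hx.le]; norm_num; ring_nf
  have e2 : (x ^ 2) ^ (α₂ / 2) = x ^ α₂ := by
    rw [← Real.rpow_natCast, ← Real.rpow_mul hx.le]; norm_num; ring_nf
  have e3 : x ^ α₂ ≤ x ^ α₁ * M ^ (α₂ - α₁) := by
    have h0 : x ^ α₂ = x ^ α₁ * x ^ (α₂ - α₁) := by rw [← Real.rpow_add hx]; ring_nf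
    have := hF.exponent_le
    rw [h0]
    gcongr
  rw [e1, e2, abs_mul, abs_mul, abs_of_pos (by positivity : 0 < x ^ 2),
    abs_of_pos (by positivity : 0 < (x ^ 2) ^ 2)] at h
  have h' : C₀ * (x ^ α₁ + x ^ α₂) ≤ C₀ * (1 + M ^ (α₂ - α₁)) * x ^ α₁ := by
    rw [mul_assoc]
    gcongr
    linarith
  have e4 : x ^ (α₁ - 2) = x ^ α₁ / x ^ 2 := by
    rw [Real.rpow_sub hx]; norm_num
  have e5 : x ^ (α₁ - 4) = x ^ α₁ / (x ^ 2) ^ 2 := by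
    rw [Real.rpow_sub hx, ← pow_mul]; norm_num
  have h1 : 0 ≤ x ^ 2 * |deriv g (x ^ 2)| := by positivity
  have h2 : 0 ≤ (x ^ 2) ^ 2 * |deriv (deriv g) (x ^ 2)| := by positivity
  constructor
  · rw [e4, ← mul_div_assoc, le_div_iff₀ (by positivity)]
    linarith
  · rw [e5, ← mul_div_assoc, le_div_iff₀ (by positivity)]
    linarith

theorem AssumptionF.hasDerivAt (hF : AssumptionF d g C₀ α₁ α₂) {s : ℝ} (hs : 0 < s) :
    HasDerivAt g (deriv g s) s :=
  ((hF.contDiffOn.contDiffAt (Ioi_mem_nhds hs)).differentiableAt (by norm_num)).hasDerivAt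

theorem AssumptionF.hasDerivAt_deriv (hF : AssumptionF d g C₀ α₁ α₂) {s : ℝ} (hs : 0 < s) :
    HasDerivAt (deriv g) (deriv (deriv g) s) s := by
  have h := (contDiffOn_succ_iff_deriv_of_isOpen (n := 1) isOpen_Ioi).1
    (by simpa [one_add_one_eq_two] using hF.contDiffOn)
  exact ((h.2.2.contDiffAt (Ioi_mem_nhds hs)).differentiableAt (by norm_num)).hasDerivAt

theorem AssumptionF.continuous_sq (hF : AssumptionF d g C₀ α₁ α₂) :
    Continuous fun x : ℝ => g (x ^ 2) :=
  hF.continuousOn.comp_continuous (by fun_prop) fun x => sq_nonneg x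

theorem AssumptionF.hasDerivAt_sq (hF : AssumptionF d g C₀ α₁ α₂) {x : ℝ} (hx : 0 < x) :
    HasDerivAt (fun x => g (x ^ 2)) (deriv g (x ^ 2) * (2 * x)) x := by
  have h : HasDerivAt (fun x : ℝ => x ^ 2) (2 * x) x := by simpa using hasDerivAt_pow 2 x
  exact HasDerivAt.comp (h₂ := g) (h := fun x : ℝ => x ^ 2) x (hF.hasDerivAt (pow_pos hx 2)) h

theorem AssumptionF.hasDerivAt_deriv_sq (hF : AssumptionF d g C₀ α₁ α₂) {x : ℝ} (hx : 0 < x) :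
    HasDerivAt (fun x => deriv g (x ^ 2)) (deriv (deriv g) (x ^ 2) * (2 * x)) x := by
  have h : HasDerivAt (fun x : ℝ => x ^ 2) (2 * x) x := by simpa using hasDerivAt_pow 2 x
  exact HasDerivAt.comp (h₂ := deriv g) (h := fun x : ℝ => x ^ 2) x
    (hF.hasDerivAt_deriv (pow_pos hx 2)) h

/-- The exponents that occur are `α₁ - 1` and `α₁ - 3` with `α₁ > 0`, hence the threshold `-3` and
the factor `2³`. -/
theorem rpow_le_eight_mul {x t e : ℝ} (hx : 0 < x) (h1 : x / 2 ≤ t) (h2 : t ≤ x) (he : -3 ≤ e) :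
    t ^ e ≤ 8 * x ^ e := by
  rcases le_total 0 e with h | h
  · have : t ^ e ≤ x ^ e := by gcongr; linarith
    linarith [Real.rpow_nonneg hx.le e]
  · calc t ^ e ≤ (x / 2) ^ e := Real.rpow_le_rpow_of_nonpos (by positivity) h1 h
      _ = 2 ^ (-e) * x ^ e := by
        rw [Real.div_rpow hx.le (by norm_num), Real.rpow_neg (by norm_num)]; field_simp
      _ ≤ 2 ^ (3 : ℝ) * x ^ e := by
        gcongr
        · norm_num
        · linarith
      _ = 8 * x ^ e := by norm_num

theorem abs_sub_le_of_deriv_bound {F F' : ℝ → ℝ} {x y B : ℝ} (hyx : y ≤ x)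
    (hF : ∀ t ∈ Set.Icc y x, HasDerivAt F (F' t) t) (hb : ∀ t ∈ Set.Icc y x, |F' t| ≤ B) :
    |F x - F y| ≤ B * |x - y| :=
  (convex_Icc y x).norm_image_sub_le_of_norm_hasDerivWithin_le
    (fun t ht => (hF t ht).hasDerivWithinAt) hb (Set.left_mem_Icc.2 hyx) (Set.right_mem_Icc.2 hyx)

/-- Mean value inequality on `[y, x] ⊆ [x/2, x]`. All powers are comparable there, so the possible
singularity of the derivatives at zero is not felt. -/
theorem AssumptionF.abs_sub_le (hF : AssumptionF d g C₀ α₁ α₂) {M C : ℝ} (hC0 : 0 < C)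
    (hC : ∀ x : ℝ, 0 < x → x ≤ M →
      |deriv g (x ^ 2)| ≤ C * x ^ (α₁ - 2) ∧ |deriv (deriv g) (x ^ 2)| ≤ C * x ^ (α₁ - 4))
    {x y : ℝ} (hx : 0 < x) (hxM : x ≤ M) (hy : x / 2 ≤ y) (hyx : y ≤ x) :
    |g (x ^ 2) - g (y ^ 2)| ≤ 16 * C * x ^ (α₁ - 1) * |x - y| ∧
      |deriv g (x ^ 2) - deriv g (y ^ 2)| ≤ 16 * C * x ^ (α₁ - 3) * |x - y| := by
  have hα := hF.exponent_pos
  have hpos : ∀ t ∈ Set.Icc y x, 0 < t := fun t ht => by linarith [ht.1]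
  have hmul : ∀ t ∈ Set.Icc y x, ∀ e D : ℝ, -3 ≤ e + 1 → |D| ≤ C * t ^ e →
      |D * (2 * t)| ≤ 16 * C * x ^ (e + 1) := by
    intro t ht e D he hD
    have ht0 := hpos t ht
    have h8 := rpow_le_eight_mul hx (hy.trans ht.1) ht.2 he
    rw [abs_mul, abs_of_pos (by linarith : 0 < 2 * t)]
    calc |D| * (2 * t) ≤ C * t ^ e * (2 * t) := by gcongr
      _ = 2 * C * t ^ (e + 1) := by rw [Real.rpow_add ht0, Real.rpow_one]; ring
      _ ≤ 2 * C * (8 * x ^ (e + 1)) := by gcongr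
      _ = _ := by ring
  constructor
  · refine abs_sub_le_of_deriv_bound hyx (fun t ht => hF.hasDerivAt_sq (hpos t ht)) fun t ht => ?_
    have := hmul t ht (α₁ - 2) _ (by linarith) (hC t (hpos t ht) (ht.2.trans hxM)).1
    rwa [show α₁ - 2 + 1 = α₁ - 1 by ring] at this
  · refine abs_sub_le_of_deriv_bound hyx (fun t ht => hF.hasDerivAt_deriv_sq (hpos t ht))
      fun t ht => ?_
    have := hmul t ht (α₁ - 4) _ (by linarith) (hC t (hpos t ht) (ht.2.trans hxM)).2
    rwa [show α₁ - 4 + 1 = α₁ - 3 by ring] at this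

/-- The functions `2C/α₁ · y^{α₁} ∓ g(y²)` are nondecreasing and vanish at zero. Only continuity of
`g` at the origin is used, where `g'` may blow up. -/
theorem AssumptionF.abs_le (hF : AssumptionF d g C₀ α₁ α₂) {M C : ℝ}
    (hC : ∀ x : ℝ, 0 < x → x ≤ M → |deriv g (x ^ 2)| ≤ C * x ^ (α₁ - 2)) {x : ℝ} (hx0 : 0 ≤ x)
    (hxM : x ≤ M) : |g (x ^ 2)| ≤ 2 * C / α₁ * x ^ α₁ := by
  have hα := hF.exponent_pos
  have key : ∀ σ : ℝ, |σ| = 1 → MonotoneOn (fun y => 2 * C / α₁ * y ^ α₁ - σ * g (y ^ 2))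
      (Set.Icc 0 x) := by
    intro σ hσ
    refine monotoneOn_of_hasDerivWithinAt_nonneg
      (f' := fun y => 2 * C / α₁ * (α₁ * y ^ (α₁ - 1)) - σ * (deriv g (y ^ 2) * (2 * y)))
      (convex_Icc 0 x) ?_ ?_ ?_
    · refine ContinuousOn.sub (ContinuousOn.mul continuousOn_const ?_) ?_
      · exact continuousOn_id.rpow_const fun y _ => Or.inr hα.le
      · exact (hF.continuous_sq.const_mul σ).continuousOn
    · intro y hy
      rw [interior_Icc] at hy
      refine HasDerivAt.hasDerivWithinAt (((Real.hasDerivAt_rpow_const (Or.inl hy.1.ne')).const_mul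
        _).sub (HasDerivAt.const_mul σ ?_))
      exact hF.hasDerivAt_sq hy.1
    · intro y hy
      rw [interior_Icc] at hy
      have h1 := hC y hy.1 (hy.2.le.trans hxM)
      have e : y ^ (α₁ - 1) = y ^ (α₁ - 2) * y := by
        rw [show α₁ - 1 = α₁ - 2 + 1 by ring, Real.rpow_add hy.1, Real.rpow_one]
      have h2 : σ * (deriv g (y ^ 2) * (2 * y)) ≤ C * y ^ (α₁ - 2) * (2 * y) := by
        refine (le_abs_self _).trans ?_
        rw [abs_mul, hσ, one_mul, abs_mul, abs_of_pos (by linarith [hy.1] : 0 < 2 * y)]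
        exact mul_le_mul_of_nonneg_right h1 (by linarith [hy.1])
      have h3 : 2 * C / α₁ * (α₁ * y ^ (α₁ - 1)) = C * y ^ (α₁ - 2) * (2 * y) := by
        rw [e]; field_simp
      linarith
  have h0 : ∀ σ : ℝ, |σ| = 1 → σ * g (x ^ 2) ≤ 2 * C / α₁ * x ^ α₁ := by
    intro σ hσ
    have := key σ hσ (Set.left_mem_Icc.2 hx0) (Set.right_mem_Icc.2 hx0) hx0
    simp only [Real.zero_rpow hα.ne', hF.zero, ne_eq, OfNat.ofNat_ne_zero, not_false_eq_true,
      zero_pow, mul_zero, sub_zero] at this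
    linarith
  rw [_root_.abs_le]
  constructor
  · linarith [h0 (-1) (by simp)]
  · linarith [h0 1 (by simp)]

end Profile

section Nonlin

theorem dnonlin_apply (g : ℝ → ℝ) (z k : ℂ) :
    dnonlin g z k = g (‖z‖ ^ 2) • k + (2 * deriv g (‖z‖ ^ 2)) • (inner ℝ z k • z) := by
  simp [dnonlin]

theorem norm_smulRight_innerSL_sub_le (z w : ℂ) :
    ‖(innerSL ℝ z).smulRight z - (innerSL ℝ w).smulRight w‖ ≤ (‖z‖ + ‖w‖) * ‖z - w‖ := by
  refine ContinuousLinearMap.opNorm_le_bound _ (by positivity) fun k => ?_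
  have : ((innerSL ℝ z).smulRight z - (innerSL ℝ w).smulRight w) k =
      (inner ℝ z k : ℝ) • (z - w) + (inner ℝ (z - w) k : ℝ) • w := by
    simp [inner_sub_left]; ring
  rw [this]
  refine (norm_add_le _ _).trans ?_
  rw [norm_smul, norm_smul]
  have h1 := norm_inner_le_norm (𝕜 := ℝ) z k
  have h2 := norm_inner_le_norm (𝕜 := ℝ) (z - w) k
  calc _ ≤ ‖z‖ * ‖k‖ * ‖z - w‖ + ‖z - w‖ * ‖k‖ * ‖w‖ := by gcongr
    _ = _ := by ring

theorem norm_smulRight_innerSL_le (z : ℂ) : ‖(innerSL ℝ z).smulRight z‖ ≤ ‖z‖ ^ 2 := by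
  rw [ContinuousLinearMap.norm_smulRight_apply, innerSL_apply_norm, sq]

theorem AssumptionF.hasFDerivAt_nonlin (hF : AssumptionF d g C₀ α₁ α₂) (z : ℂ) :
    HasFDerivAt (nonlin g) (dnonlin g z) z := by
  have hα := hF.exponent_pos
  have hsm : nonlin g = fun z => g (‖z‖ ^ 2) • z := by
    ext1 z; simp [nonlin]
  rcases eq_or_ne z 0 with rfl | hz
  -- The value of `deriv g 0` is meaningless but harmless, as it multiplies a term vanishing at `z =
  -- 0`; the other term vanishes because `g 0 = 0`.
  · have h0 : dnonlin g 0 = 0 := by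
      ext k; simp [dnonlin_apply, hF.zero]
    rw [h0, hasFDerivAt_iff_isLittleO_nhds_zero, hsm]
    simp only [zero_add, norm_zero, smul_zero, zero_apply, sub_zero]
    have h1 : Tendsto (fun z : ℂ => g (‖z‖ ^ 2)) (𝓝 0) (𝓝 0) := by
      have : Continuous fun z : ℂ => g (‖z‖ ^ 2) := hF.continuous_sq.comp continuous_norm
      simpa [hF.zero] using this.tendsto 0
    rw [← Asymptotics.isLittleO_one_iff ℝ] at h1
    simpa using h1.smul_isBigO (Asymptotics.isBigO_refl (fun z : ℂ => z) (𝓝 0))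
  · have hz' : 0 < ‖z‖ ^ 2 := by positivity
    have h1 : HasFDerivAt (fun z : ℂ => ‖z‖ ^ 2) (2 • innerSL ℝ z) z :=
      (hasStrictFDerivAt_norm_sq z).hasFDerivAt
    have h2 := (hF.hasDerivAt hz').comp_hasFDerivAt z h1
    have h3 := h2.smul (hasFDerivAt_id z)
    rw [hsm]
    refine h3.congr_fderiv ?_
    ext k
    simp [dnonlin]
    ring

theorem norm_dnonlin_le (g : ℝ → ℝ) (z : ℂ) :
    ‖dnonlin g z‖ ≤ |g (‖z‖ ^ 2)| + 2 * |deriv g (‖z‖ ^ 2)| * ‖z‖ ^ 2 := by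
  refine (norm_add_le _ _).trans ?_
  rw [norm_smul, norm_smul, Real.norm_eq_abs, Real.norm_eq_abs, abs_mul, abs_two]
  have := norm_smulRight_innerSL_le z
  have h2 : ‖ContinuousLinearMap.id ℝ ℂ‖ ≤ 1 := ContinuousLinearMap.norm_id_le
  calc _ ≤ |g (‖z‖ ^ 2)| * 1 + 2 * |deriv g (‖z‖ ^ 2)| * ‖z‖ ^ 2 := by gcongr
    _ = _ := by ring

theorem norm_dnonlin_sub_le (g : ℝ → ℝ) (z w : ℂ) :
    ‖dnonlin g z - dnonlin g w‖ ≤ |g (‖z‖ ^ 2) - g (‖w‖ ^ 2)| +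
      2 * |deriv g (‖z‖ ^ 2) - deriv g (‖w‖ ^ 2)| * ‖w‖ ^ 2 +
        2 * |deriv g (‖z‖ ^ 2)| * ((‖z‖ + ‖w‖) * ‖z - w‖) := by
  have : dnonlin g z - dnonlin g w = (g (‖z‖ ^ 2) - g (‖w‖ ^ 2)) • ContinuousLinearMap.id ℝ ℂ +
      (2 * (deriv g (‖z‖ ^ 2) - deriv g (‖w‖ ^ 2))) • (innerSL ℝ w).smulRight w +
      (2 * deriv g (‖z‖ ^ 2)) •
        ((innerSL ℝ z).smulRight z - (innerSL ℝ w).smulRight w) := by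
    simp only [dnonlin]; module
  rw [this]
  refine (norm_add₃_le).trans ?_
  simp only [norm_smul, Real.norm_eq_abs, abs_mul, abs_two]
  have h1 := norm_smulRight_innerSL_le w
  have h2 : ‖ContinuousLinearMap.id ℝ ℂ‖ ≤ 1 := ContinuousLinearMap.norm_id_le
  have h3 := norm_smulRight_innerSL_sub_le z w
  calc _ ≤ |g (‖z‖ ^ 2) - g (‖w‖ ^ 2)| * 1 +
      2 * |deriv g (‖z‖ ^ 2) - deriv g (‖w‖ ^ 2)| * ‖w‖ ^ 2 +
        2 * |deriv g (‖z‖ ^ 2)| * ((‖z‖ + ‖w‖) * ‖z - w‖) := by gcongr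
    _ = _ := by ring

/-- Bounds for the nonlinearity on the ball of radius `M`: size and Hölder continuity of
`z ↦ g(|z|²)` and of the derivative of `z ↦ g(|z|²) z`. -/
structure NonlinBounds (g : ℝ → ℝ) (α M C : ℝ) : Prop where
  abs_le : ∀ z : ℂ, ‖z‖ ≤ M → |g (‖z‖ ^ 2)| ≤ C * ‖z‖ ^ α
  norm_dnonlin_le : ∀ z : ℂ, ‖z‖ ≤ M → ‖dnonlin g z‖ ≤ C * ‖z‖ ^ α
  abs_sub_le : ∀ δ : ℝ, 0 < δ → δ ≤ 1 → δ ≤ α → ∀ z w : ℂ, ‖z‖ ≤ M → ‖w‖ ≤ M →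
    |g (‖z‖ ^ 2) - g (‖w‖ ^ 2)| ≤ C * ((‖z‖ + ‖w‖) ^ (α - δ) * ‖z - w‖ ^ δ)
  norm_dnonlin_sub_le : ∀ δ : ℝ, 0 < δ → δ ≤ 1 → δ ≤ α → ∀ z w : ℂ, ‖z‖ ≤ M → ‖w‖ ≤ M →
    ‖dnonlin g z - dnonlin g w‖ ≤ C * ((‖z‖ + ‖w‖) ^ (α - δ) * ‖z - w‖ ^ δ)

/-- A symmetric function controlled by `|z|^α` for distant arguments and Lipschitz with constant
`|z|^{α-1}` for close ones satisfies a Hölder bound. -/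
theorem holder_of_near {ρ : ℂ → ℂ → ℝ} {α M B : ℝ} (hB : 0 ≤ B)
    (hsymm : ∀ z w, ρ z w = ρ w z)
    (hsize : ∀ z w, ‖w‖ ≤ ‖z‖ → ‖z‖ ≤ M → ρ z w ≤ B * ‖z‖ ^ α)
    (hnear : ∀ z w, 0 < ‖z‖ → ‖w‖ ≤ ‖z‖ → ‖z‖ / 2 ≤ ‖w‖ → ‖z‖ ≤ M →
      ρ z w ≤ B * ‖z‖ ^ (α - 1) * ‖z - w‖)
    {δ : ℝ} (hδ : 0 < δ) (hδ1 : δ ≤ 1) (hδα : δ ≤ α) {z w : ℂ} (hz : ‖z‖ ≤ M) (hw : ‖w‖ ≤ M) :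
    ρ z w ≤ 2 * B * ((‖z‖ + ‖w‖) ^ (α - δ) * ‖z - w‖ ^ δ) := by
  wlog h : ‖w‖ ≤ ‖z‖ generalizing z w
  · rw [hsymm, norm_sub_rev, add_comm]
    exact this hw hz (le_of_not_ge h)
  suffices h2 : ρ z w ≤ 2 * B * (‖z‖ ^ (α - δ) * ‖z - w‖ ^ δ) by
    refine h2.trans ?_
    have : ‖z‖ ^ (α - δ) ≤ (‖z‖ + ‖w‖) ^ (α - δ) :=
      Real.rpow_le_rpow (norm_nonneg _) (by linarith [norm_nonneg w]) (by linarith)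
    gcongr
  rcases (norm_nonneg z).eq_or_lt with h0 | h0
  · have hw0 : ‖w‖ = 0 := le_antisymm (h.trans h0.symm.le) (norm_nonneg _)
    have h1 := hsize z w h hz
    rw [← h0, Real.zero_rpow (by linarith), mul_zero] at h1
    exact h1.trans (by positivity)
  -- For distant points `|z|^δ ≤ 2|z - w|^δ`, so the size bound suffices. For close points `|w| ≥
  -- |z|/2`, and `|z - w|^{1-δ} ≤ |z|^{1-δ}` trades Lipschitz for Hölder.
  rcases le_or_gt (‖z‖ / 2) ‖z - w‖ with h1 | h1
  · refine (hsize z w h hz).trans ?_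
    have e : ‖z‖ ^ α = ‖z‖ ^ (α - δ) * ‖z‖ ^ δ := by rw [← Real.rpow_add h0]; ring_nf
    have h3 : ‖z‖ ^ δ ≤ 2 * ‖z - w‖ ^ δ := by
      calc ‖z‖ ^ δ ≤ (2 * ‖z - w‖) ^ δ := by gcongr; linarith
        _ = 2 ^ δ * ‖z - w‖ ^ δ := Real.mul_rpow (by norm_num) (norm_nonneg _)
        _ ≤ 2 ^ (1 : ℝ) * ‖z - w‖ ^ δ := by gcongr; norm_num
        _ = _ := by norm_num
    rw [e]
    calc _ ≤ B * (‖z‖ ^ (α - δ) * (2 * ‖z - w‖ ^ δ)) := by gcongr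
      _ = _ := by ring
  · have h2 : ‖z‖ / 2 ≤ ‖w‖ := by
      have := norm_sub_norm_le z w
      linarith
    refine (hnear z w h0 h h2 hz).trans ?_
    rcases (norm_nonneg (z - w)).eq_or_lt with h4 | h4
    · rw [← h4, mul_zero, Real.zero_rpow hδ.ne', mul_zero, mul_zero]
    have e1 : ‖z - w‖ = ‖z - w‖ ^ (1 - δ) * ‖z - w‖ ^ δ := by
      rw [← Real.rpow_add h4]; simp
    have e2 : ‖z‖ ^ (α - δ) = ‖z‖ ^ (α - 1) * ‖z‖ ^ (1 - δ) := by
      rw [← Real.rpow_add h0]; ring_nf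
    have h5 : ‖z - w‖ ^ (1 - δ) ≤ ‖z‖ ^ (1 - δ) := by
      gcongr
      linarith
    rw [e2]
    calc B * ‖z‖ ^ (α - 1) * ‖z - w‖ = B * ‖z‖ ^ (α - 1) * (‖z - w‖ ^ (1 - δ) * ‖z - w‖ ^ δ) := by
          rw [← e1]
      _ ≤ B * ‖z‖ ^ (α - 1) * (‖z‖ ^ (1 - δ) * ‖z - w‖ ^ δ) := by gcongr
      _ ≤ _ := by
        have : 0 ≤ B * (‖z‖ ^ (α - 1) * ‖z‖ ^ (1 - δ) * ‖z - w‖ ^ δ) := by positivity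
        linarith

theorem AssumptionF.exists_nonlinBounds (hF : AssumptionF d g C₀ α₁ α₂) {M : ℝ} (hM : 0 < M) :
    ∃ C : ℝ, 0 < C ∧ NonlinBounds g α₁ M C := by
  obtain ⟨C, hC0, hC⟩ := hF.exists_deriv_le hM
  have hα := hF.exponent_pos
  have hg : ∀ z : ℂ, ‖z‖ ≤ M → |g (‖z‖ ^ 2)| ≤ 2 * C / α₁ * ‖z‖ ^ α₁ := fun z hz =>
    hF.abs_le (fun x h1 h2 => (hC x h1 h2).1) (norm_nonneg z) hz
  have hg' : ∀ z : ℂ, ‖z‖ ≤ M → |deriv g (‖z‖ ^ 2)| * ‖z‖ ^ 2 ≤ C * ‖z‖ ^ α₁ := by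
    intro z hz
    rcases (norm_nonneg z).eq_or_lt with h0 | h0
    · rw [← h0, Real.zero_rpow hα.ne']; simp
    calc _ ≤ C * ‖z‖ ^ (α₁ - 2) * ‖z‖ ^ 2 := by
          gcongr
          exact (hC _ h0 hz).1
      _ = C * ‖z‖ ^ α₁ := by
          rw [mul_assoc, ← Real.rpow_natCast, ← Real.rpow_add h0]; norm_num
  have hdn : ∀ z : ℂ, ‖z‖ ≤ M → ‖dnonlin g z‖ ≤ (2 * C / α₁ + 2 * C) * ‖z‖ ^ α₁ := by
    intro z hz
    refine (SolitonTrain.norm_dnonlin_le g z).trans ?_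
    linarith [hg z hz, hg' z hz]
  -- The first part covers the sum of two sizes. The second covers the Lipschitz constant for close
  -- points, where the estimate below gives `16 + 2·16 + 2·2 = 52` times `C`.
  set B := 2 * (2 * C / α₁ + 2 * C) + 100 * C with hB
  have hB1 : 2 * (2 * C / α₁ + 2 * C) ≤ B := by linarith
  have hB2 : 100 * C ≤ B := by
    have : 0 < 2 * C / α₁ := by positivity
    linarith
  have hB0 : 0 < B := by positivity
  have hmono : ∀ z w : ℂ, ‖w‖ ≤ ‖z‖ → ‖w‖ ^ α₁ ≤ ‖z‖ ^ α₁ := fun z w h => by gcongr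
  have hA0 : 0 < 2 * C / α₁ := by positivity
  have hnear : ∀ z w : ℂ, 0 < ‖z‖ → ‖w‖ ≤ ‖z‖ → ‖z‖ / 2 ≤ ‖w‖ → ‖z‖ ≤ M →
      |g (‖z‖ ^ 2) - g (‖w‖ ^ 2)| ≤ 16 * C * ‖z‖ ^ (α₁ - 1) * ‖z - w‖ ∧
      ‖dnonlin g z - dnonlin g w‖ ≤ 100 * C * ‖z‖ ^ (α₁ - 1) * ‖z - w‖ := by
    intro z w h0 h1 h2 h3
    obtain ⟨h4, h5⟩ := hF.abs_sub_le hC0 hC h0 h3 h2 h1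
    have h6 : |‖z‖ - ‖w‖| ≤ ‖z - w‖ := abs_norm_sub_norm_le z w
    have h7 : |g (‖z‖ ^ 2) - g (‖w‖ ^ 2)| ≤ 16 * C * ‖z‖ ^ (α₁ - 1) * ‖z - w‖ :=
      h4.trans (by gcongr)
    refine ⟨h7, (SolitonTrain.norm_dnonlin_sub_le g z w).trans ?_⟩
    have h8 : |deriv g (‖z‖ ^ 2) - deriv g (‖w‖ ^ 2)| * ‖w‖ ^ 2 ≤
        16 * C * ‖z‖ ^ (α₁ - 1) * ‖z - w‖ := by
      calc _ ≤ 16 * C * ‖z‖ ^ (α₁ - 3) * ‖z - w‖ * ‖z‖ ^ 2 := by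
            gcongr
            exact h5.trans (by gcongr)
        _ = 16 * C * (‖z‖ ^ (α₁ - 3) * ‖z‖ ^ (2 : ℝ)) * ‖z - w‖ := by
            rw [Real.rpow_two]; ring
        _ = _ := by rw [← Real.rpow_add h0]; ring_nf
    have h9 : |deriv g (‖z‖ ^ 2)| * ((‖z‖ + ‖w‖) * ‖z - w‖) ≤
        2 * C * ‖z‖ ^ (α₁ - 1) * ‖z - w‖ := by
      calc _ ≤ C * ‖z‖ ^ (α₁ - 2) * ((‖z‖ + ‖z‖) * ‖z - w‖) := by
            gcongr
            exact (hC _ h0 h3).1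
        _ = 2 * C * (‖z‖ ^ (α₁ - 2) * ‖z‖ ^ (1 : ℝ)) * ‖z - w‖ := by
            rw [Real.rpow_one]; ring
        _ = _ := by rw [← Real.rpow_add h0]; ring_nf
    have h10 : 0 ≤ C * ‖z‖ ^ (α₁ - 1) * ‖z - w‖ := by positivity
    linarith
  refine ⟨2 * B, by positivity, fun z hz => (hg z hz).trans ?_, fun z hz => (hdn z hz).trans ?_,
    fun δ h1 h2 h3 z w hz hw => ?_, fun δ h1 h2 h3 z w hz hw => ?_⟩
  · gcongr; linarith
  · gcongr; linarith
  · refine holder_of_near (ρ := fun z w : ℂ => |g (‖z‖ ^ 2) - g (‖w‖ ^ 2)|) hB0.le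
      (fun z w => abs_sub_comm _ _) (fun z w h hz => ?_) (fun z w h4 h5 h6 h7 => ?_) h1 h2 h3 hz hw
    · refine (abs_sub _ _).trans ?_
      have e1 := hg z hz
      have e2 := (hg w (h.trans hz)).trans (mul_le_mul_of_nonneg_left (hmono z w h) hA0.le)
      calc _ ≤ 2 * (2 * C / α₁) * ‖z‖ ^ α₁ := by linarith
        _ ≤ _ := by gcongr; linarith
    · refine (hnear z w h4 h5 h6 h7).1.trans ?_
      gcongr
      linarith
  · refine holder_of_near (ρ := fun z w : ℂ => ‖dnonlin g z - dnonlin g w‖) hB0.le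
      (fun z w => norm_sub_rev _ _) (fun z w h hz => ?_) (fun z w h4 h5 h6 h7 => ?_) h1 h2 h3 hz hw
    · refine (norm_sub_le _ _).trans ?_
      have e1 := hdn z hz
      have e2 := (hdn w (h.trans hz)).trans (mul_le_mul_of_nonneg_left (hmono z w h)
        (by positivity))
      calc _ ≤ 2 * (2 * C / α₁ + 2 * C) * ‖z‖ ^ α₁ := by linarith
        _ ≤ _ := by gcongr
    · refine (hnear z w h4 h5 h6 h7).2.trans ?_
      gcongr

theorem AssumptionF.continuous_nonlin (hF : AssumptionF d g C₀ α₁ α₂) : Continuous (nonlin g) :=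
  continuous_iff_continuousAt.2 fun z => (hF.hasFDerivAt_nonlin z).continuousAt

/-- First difference of the nonlinearity. -/
theorem NonlinBounds.norm_nonlin_sub_le (hF : AssumptionF d g C₀ α₁ α₂) {α M C : ℝ} (hα : 0 ≤ α)
    (hC : 0 ≤ C) (hB : NonlinBounds g α M C) {z w : ℂ} (hz : ‖z‖ ≤ M) (hw : ‖w‖ ≤ M) :
    ‖nonlin g z - nonlin g w‖ ≤ C * (‖z‖ + ‖w‖) ^ α * ‖z - w‖ := by
  refine (convex_segment w z).norm_image_sub_le_of_norm_hasFDerivWithin_le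
    (fun y _ => (hF.hasFDerivAt_nonlin y).hasFDerivWithinAt) (fun y hy => ?_)
    (left_mem_segment ℝ w z) (right_mem_segment ℝ w z)
  obtain ⟨a, b, ha, hb, hab, rfl⟩ := hy
  have hle : ‖a • w + b • z‖ ≤ a * ‖w‖ + b * ‖z‖ := by
    refine (norm_add_le _ _).trans ?_
    rw [norm_smul, norm_smul, Real.norm_of_nonneg ha, Real.norm_of_nonneg hb]
  have h1 : a * ‖w‖ ≤ 1 * ‖w‖ := by gcongr; linarith
  have h2 : b * ‖z‖ ≤ 1 * ‖z‖ := by gcongr; linarith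
  have h3 : a * ‖w‖ + b * ‖z‖ ≤ a * M + b * M := by gcongr
  refine (hB.norm_dnonlin_le _ (hle.trans (h3.trans (by rw [← add_mul, hab, one_mul])))).trans ?_
  gcongr
  linarith

/-- Second difference of the nonlinearity. -/
theorem NonlinBounds.norm_nonlin_sub_sub_le (hF : AssumptionF d g C₀ α₁ α₂) {α M C δ : ℝ}
    (hC : 0 ≤ C) (hB : NonlinBounds g α M C) (hδ : 0 < δ) (hδ1 : δ ≤ 1) (hδα : δ ≤ α)
    {z z' w : ℂ} (hz : ‖z‖ + ‖w‖ ≤ M) (hz' : ‖z'‖ + ‖w‖ ≤ M) :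
    ‖(nonlin g (z' + w) - nonlin g z') - (nonlin g (z + w) - nonlin g z)‖ ≤
      C * ((2 * (‖z‖ + ‖z'‖ + ‖w‖)) ^ (α - δ) * ‖w‖ ^ δ) * ‖z' - z‖ := by
  refine (convex_segment z z').norm_image_sub_le_of_norm_hasFDerivWithin_le
    (f := fun y => nonlin g (y + w) - nonlin g y) (f' := fun y => dnonlin g (y + w) - dnonlin g y)
    (fun y _ => ?_) (fun y hy => ?_) (left_mem_segment ℝ z z') (right_mem_segment ℝ z z')
  · refine HasFDerivAt.hasFDerivWithinAt (HasFDerivAt.sub ?_ (hF.hasFDerivAt_nonlin y))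
    have := (hF.hasFDerivAt_nonlin (y + w)).comp y ((hasFDerivAt_id y).add_const w)
    rwa [ContinuousLinearMap.comp_id] at this
  · obtain ⟨a, b, ha, hb, hab, rfl⟩ := hy
    have hle : ‖a • z + b • z'‖ ≤ a * ‖z‖ + b * ‖z'‖ := by
      refine (norm_add_le _ _).trans ?_
      rw [norm_smul, norm_smul, Real.norm_of_nonneg ha, Real.norm_of_nonneg hb]
    have h1 : a * ‖z‖ ≤ 1 * ‖z‖ := by gcongr; linarith
    have h2 : b * ‖z'‖ ≤ 1 * ‖z'‖ := by gcongr; linarith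
    have h3 : a * ‖z‖ + b * ‖z'‖ ≤ a * (M - ‖w‖) + b * (M - ‖w‖) := by
      gcongr <;> linarith
    rw [← add_mul, hab, one_mul] at h3
    have h4 := norm_add_le (a • z + b • z') w
    have h5 := hB.norm_dnonlin_sub_le δ hδ hδ1 hδα (a • z + b • z' + w) (a • z + b • z')
      (by linarith) (by linarith [norm_nonneg w])
    rw [add_sub_cancel_left] at h5
    refine h5.trans ?_
    gcongr
    linarith [norm_nonneg w]

end Nonlin

end

end SolitonTrain

/-! ### Increments of `f(T + u) - f(T)` and its `L²` estimates. -/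

namespace SolitonTrain

noncomputable section

variable {d : ℕ} {g : ℝ → ℝ} {C₀ α₁ α₂ : ℝ}

theorem add_rpow_le_two_rpow_mul {a b e : ℝ} (ha : 0 ≤ a) (hb : 0 ≤ b) (he : 0 ≤ e) :
    (a + b) ^ e ≤ 2 ^ e * (a ^ e + b ^ e) := by
  wlog h : b ≤ a generalizing a b
  · rw [add_comm, add_comm (a ^ e)]
    exact this hb ha (le_of_not_ge h)
  calc (a + b) ^ e ≤ (2 * a) ^ e := by gcongr; linarith
    _ = 2 ^ e * a ^ e := Real.mul_rpow (by norm_num) ha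
    _ ≤ _ := by
      gcongr
      linarith [Real.rpow_nonneg hb e]

theorem rpow_le_rpow_mul_rpow {u m α γ : ℝ} (hu : 0 ≤ u) (hum : u ≤ m) (hm : 1 ≤ m) (hγ0 : 0 ≤ γ)
    (hγ : γ ≤ α) : u ^ α ≤ m ^ α * u ^ γ := by
  have e : u ^ α = u ^ (α - γ) * u ^ γ := by
    rw [← Real.rpow_add_of_nonneg hu (by linarith) hγ0, sub_add_cancel]
  rw [e]
  gcongr
  calc u ^ (α - γ) ≤ m ^ (α - γ) := Real.rpow_le_rpow hu hum (by linarith)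
    _ ≤ m ^ α := Real.rpow_le_rpow_of_exponent_le hm (by linarith)

/-- Amplitudes bounded by `m ≥ 1` allow the power `α` to be lowered to `β` at the cost of a
constant. The power `β` is the one that an `L²` function carries into the exponent `lexp β`. -/
theorem envelope_rpow_le {V D m α β x y S : ℝ} (hV : 0 ≤ V) (hD : 0 ≤ D) (hm : 1 ≤ m) (hβ : 0 < β)
    (hβα : β ≤ α) (hx : 0 ≤ x) (hy : 0 ≤ y) (hxm : x ≤ m) (hym : y ≤ m) (hS0 : 0 ≤ S)
    (hS : S ≤ 6 * D * V + (x + y)) :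
    S ^ α ≤ 2 ^ α * ((6 * D) ^ α + 2 ^ α * m ^ α) * (V ^ α + x ^ β + y ^ β) := by
  have hα : 0 ≤ α := by linarith
  have h1 : S ^ α ≤ 2 ^ α * ((6 * D * V) ^ α + (x + y) ^ α) :=
    (Real.rpow_le_rpow hS0 hS hα).trans (add_rpow_le_two_rpow_mul (by positivity) (by positivity) hα)
  rw [Real.mul_rpow (by positivity) hV] at h1
  have h2 := add_rpow_le_two_rpow_mul hx hy hα
  have h3 := rpow_le_rpow_mul_rpow hx hxm hm hβ.le hβα
  have h4 := rpow_le_rpow_mul_rpow hy hym hm hβ.le hβα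
  have a1 : 0 ≤ V ^ α := by positivity
  have a2 : 0 ≤ x ^ β + y ^ β := by positivity
  have a3 : 0 ≤ (6 * D) ^ α := by positivity
  have a4 : 0 ≤ (2 : ℝ) ^ α * m ^ α := by positivity
  have h5 : (x + y) ^ α ≤ 2 ^ α * (m ^ α * (x ^ β + y ^ β)) :=
    h2.trans (mul_le_mul_of_nonneg_left (by linarith) (by positivity))
  have h6 : (6 * D) ^ α * V ^ α + (x + y) ^ α ≤
      ((6 * D) ^ α + 2 ^ α * m ^ α) * (V ^ α + x ^ β + y ^ β) := by
    nlinarith [mul_nonneg a3 a2, mul_nonneg a4 a1]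
  calc S ^ α ≤ _ := h1
    _ ≤ 2 ^ α * (((6 * D) ^ α + 2 ^ α * m ^ α) * (V ^ α + x ^ β + y ^ β)) :=
      mul_le_mul_of_nonneg_left h6 (by positivity)
    _ = _ := by ring

/-- The sum `S` is split into its envelope part and its `x` part. In the latter, `x^α` may be
lowered to any `x^γ` with `γ ≤ α`; this freedom is used to fit the available integrability. -/
theorem envelope_rpow_mul_le {V D m α β γ κ x S : ℝ} (hV : 0 ≤ V) (hD : 0 ≤ D) (hm : 1 ≤ m)
    (hβ : 0 < β) (hβα : β ≤ α) (hγ0 : 0 ≤ γ) (hγ : γ ≤ α) (hκ : 0 ≤ κ) (hx : 0 ≤ x) (hxm : x ≤ m)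
    (hS0 : 0 ≤ S) (hS : S ≤ 8 * D * V + 2 * x) :
    S ^ (α - β) * x ^ β * V ^ κ ≤ 2 ^ (α - β) * ((8 * D) ^ (α - β) + 2 ^ (α - β) * m ^ α) *
      (V ^ (α - β + κ) * x ^ β + V ^ κ * x ^ γ) := by
  have b0 : 0 ≤ α - β := by linarith
  have b1 : S ^ (α - β) ≤ 2 ^ (α - β) * ((8 * D * V) ^ (α - β) + (2 * x) ^ (α - β)) :=
    (Real.rpow_le_rpow hS0 hS b0).trans (add_rpow_le_two_rpow_mul (by positivity) (by positivity) b0)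
  rw [Real.mul_rpow (by positivity) hV, Real.mul_rpow (by positivity) hx] at b1
  have b2 : V ^ (α - β) * V ^ κ = V ^ (α - β + κ) := (Real.rpow_add_of_nonneg hV b0 hκ).symm
  have b3 : x ^ (α - β) * x ^ β ≤ m ^ α * x ^ γ := by
    rw [← Real.rpow_add_of_nonneg hx b0 hβ.le, sub_add_cancel]
    exact rpow_le_rpow_mul_rpow hx hxm hm hγ0 hγ
  have a1 : 0 ≤ V ^ (α - β + κ) * x ^ β := by positivity
  have a2 : 0 ≤ V ^ κ * x ^ γ := by positivity
  have a3 : 0 ≤ (8 * D) ^ (α - β) := by positivity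
  have a4 : 0 ≤ (2 : ℝ) ^ (α - β) * m ^ α := by positivity
  have b4 : 2 ^ (α - β) * (x ^ (α - β) * x ^ β) * V ^ κ ≤ 2 ^ (α - β) * (m ^ α * x ^ γ) * V ^ κ := by
    gcongr
  have b5 : (8 * D) ^ (α - β) * (V ^ (α - β) * V ^ κ) * x ^ β +
      2 ^ (α - β) * (x ^ (α - β) * x ^ β) * V ^ κ ≤
      ((8 * D) ^ (α - β) + 2 ^ (α - β) * m ^ α) * (V ^ (α - β + κ) * x ^ β + V ^ κ * x ^ γ) := by
    rw [b2]
    nlinarith [mul_nonneg a3 a2, mul_nonneg a4 a1]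
  calc S ^ (α - β) * x ^ β * V ^ κ ≤
        2 ^ (α - β) * ((8 * D) ^ (α - β) * V ^ (α - β) + 2 ^ (α - β) * x ^ (α - β)) *
          x ^ β * V ^ κ := by gcongr
    _ = 2 ^ (α - β) * ((8 * D) ^ (α - β) * (V ^ (α - β) * V ^ κ) * x ^ β +
          2 ^ (α - β) * (x ^ (α - β) * x ^ β) * V ^ κ) := by ring
    _ ≤ 2 ^ (α - β) * (((8 * D) ^ (α - β) + 2 ^ (α - β) * m ^ α) *
          (V ^ (α - β + κ) * x ^ β + V ^ κ * x ^ γ)) :=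
      mul_le_mul_of_nonneg_left b5 (by positivity)
    _ = _ := by ring

/-- The increment of `f(z + u) - f(z)` under a simultaneous change of `z` and `u`. -/
theorem NonlinBounds.exists_norm_increment_le (hF : AssumptionF d g C₀ α₁ α₂) {α M C β κ D m : ℝ}
    (hC : 0 < C) (hB : NonlinBounds g α M C) (hβ : 0 < β) (hβ1 : β ≤ 1) (hβα : β ≤ α) (hκ : 0 ≤ κ)
    (hD : 0 ≤ D) (hm : 1 ≤ m) (hM : 3 * D + m ≤ M) :
    ∃ Q : ℝ, 0 < Q ∧ ∀ (V l γ : ℝ) (z z' u u' : ℂ), 0 ≤ V → V ≤ 1 → 0 ≤ l → 0 ≤ γ → γ ≤ α →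
      ‖z‖ ≤ D * V → ‖z'‖ ≤ 3 * (D * V) → ‖u‖ ≤ m → ‖u'‖ ≤ m → ‖z' - z‖ ≤ l * V ^ κ →
      ‖(nonlin g (z' + u') - nonlin g z') - (nonlin g (z + u) - nonlin g z)‖ ≤
        Q * ((V ^ α + ‖u‖ ^ β + ‖u'‖ ^ β) * ‖u' - u‖ +
          l * (V ^ (α - β + κ) * ‖u‖ ^ β + V ^ κ * ‖u‖ ^ γ)) := by
  obtain ⟨Q₁, hQ₁0, hQ₁⟩ : ∃ Q₁ : ℝ, 0 < Q₁ ∧ Q₁ = 2 ^ α * ((6 * D) ^ α + 2 ^ α * m ^ α) :=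
    ⟨_, by positivity, rfl⟩
  obtain ⟨Q₂, hQ₂0, hQ₂⟩ : ∃ Q₂ : ℝ, 0 < Q₂ ∧
      Q₂ = 2 ^ (α - β) * ((8 * D) ^ (α - β) + 2 ^ (α - β) * m ^ α) := ⟨_, by positivity, rfl⟩
  have hα : 0 ≤ α := by linarith
  refine ⟨C * (Q₁ + Q₂), by positivity, ?_⟩
  intro V l γ z z' u u' hV hV1 hl hγ0 hγ hz hz' hu hu' hzz
  have hDV : D * V ≤ D := by nlinarith
  -- First `u` varies at fixed `z'`, which is a first difference of `f`. Then `z` varies at fixed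
  -- `u`, a second difference that only sees the Hölder continuity of `f'`.
  have e1 : (nonlin g (z' + u') - nonlin g z') - (nonlin g (z + u) - nonlin g z) =
      (nonlin g (z' + u') - nonlin g (z' + u)) +
        ((nonlin g (z' + u) - nonlin g z') - (nonlin g (z + u) - nonlin g z)) := by ring
  rw [e1]
  refine (norm_add_le _ _).trans ?_
  have hn1 : ‖z' + u'‖ ≤ 3 * (D * V) + ‖u'‖ := (norm_add_le _ _).trans (by linarith)
  have hn2 : ‖z' + u‖ ≤ 3 * (D * V) + ‖u‖ := (norm_add_le _ _).trans (by linarith)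
  have h1 := hB.norm_nonlin_sub_le hF hα hC.le (z := z' + u') (w := z' + u) (by linarith)
    (by linarith)
  have h2 := hB.norm_nonlin_sub_sub_le hF hC.le hβ hβ1 hβα (z := z) (z' := z') (w := u)
    (by linarith [norm_nonneg z]) (by linarith)
  rw [add_sub_add_left_eq_sub] at h1
  have h3 := envelope_rpow_le (S := ‖z' + u'‖ + ‖z' + u‖) hV hD hm hβ hβα (norm_nonneg u)
    (norm_nonneg u') hu hu' (by positivity) (by linarith)
  have h4 := envelope_rpow_mul_le (S := 2 * (‖z‖ + ‖z'‖ + ‖u‖)) hV hD hm hβ hβα hγ0 hγ hκ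
    (norm_nonneg u) hu (by positivity) (by linarith)
  rw [← hQ₁] at h3
  rw [← hQ₂] at h4
  obtain ⟨P₁, hP₁⟩ : ∃ P₁, P₁ = V ^ α + ‖u‖ ^ β + ‖u'‖ ^ β := ⟨_, rfl⟩
  obtain ⟨P₂, hP₂⟩ : ∃ P₂, P₂ = V ^ (α - β + κ) * ‖u‖ ^ β + V ^ κ * ‖u‖ ^ γ := ⟨_, rfl⟩
  have p1 : 0 ≤ P₁ := by rw [hP₁]; positivity
  have p2 : 0 ≤ P₂ := by rw [hP₂]; positivity
  rw [← hP₁] at h3 ⊢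
  rw [← hP₂] at h4 ⊢
  have h5 : ‖nonlin g (z' + u') - nonlin g (z' + u)‖ ≤ C * Q₁ * (P₁ * ‖u' - u‖) := by
    calc _ ≤ _ := h1
      _ ≤ C * (Q₁ * P₁) * ‖u' - u‖ := by gcongr
      _ = _ := by ring
  have h6 : ‖nonlin g (z' + u) - nonlin g z' - (nonlin g (z + u) - nonlin g z)‖ ≤
      C * l * (Q₂ * P₂) := by
    calc _ ≤ _ := h2
      _ ≤ C * ((2 * (‖z‖ + ‖z'‖ + ‖u‖)) ^ (α - β) * ‖u‖ ^ β) * (l * V ^ κ) := by gcongr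
      _ = C * l * ((2 * (‖z‖ + ‖z'‖ + ‖u‖)) ^ (α - β) * ‖u‖ ^ β * V ^ κ) := by ring
      _ ≤ _ := by gcongr
  have a1 : 0 ≤ C * Q₂ * (P₁ * ‖u' - u‖) := by positivity
  have a2 : 0 ≤ C * Q₁ * (l * P₂) := by positivity
  nlinarith

theorem one_le_lexp {b : ℝ} (hb : b ≤ 2) : 1 ≤ lexp b := by
  rw [lexp, ENNReal.le_div_iff_mul_le (Or.inr (by norm_num)) (Or.inr (by norm_num)), one_mul,
    ← ENNReal.ofReal_ofNat 2]
  exact ENNReal.ofReal_le_ofReal hb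

theorem eLpNorm_norm_rpow_le {U : L2 d} {k γ : ℝ} (hk : 0 ≤ k) (hγ : 0 < γ) (hU : ‖U‖ ≤ k) :
    eLpNorm (fun x => ‖U x‖ ^ γ) (lexp γ) volume ≤ ENNReal.ofReal (k ^ γ) := by
  have := eLpNorm_rpow_lexp (μ := (volume : Measure (Space d))) (U : Space d → ℂ) zero_le_one hγ
  rw [one_mul, lexp_one] at this
  rw [this, ← ENNReal.ofReal_rpow_of_nonneg hk hγ.le]
  gcongr
  rwa [eLpNorm_two_le_iff hk]

/-- The properties of the soliton train `T`, its interaction error `H`, and a common envelope `V`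
that are used for solving the equation for the remainder. -/
structure Background (α κ β D lam L : ℝ) (T H : ℝ → Space d → ℂ) (V : ℝ → Space d → ℝ) :
    Prop where
  continuous_T : Continuous fun z : ℝ × Space d => T z.1 z.2
  continuous_H : Continuous fun z : ℝ × Space d => H z.1 z.2
  continuous_V : ∀ t, Continuous (V t)
  V_nonneg : ∀ t x, 0 ≤ V t x
  V_le_one : ∀ t x, V t x ≤ 1
  V_shift : ∀ t x h, ‖h‖ ≤ 1 → V t (x + h) ≤ 3 * V t x
  T_le : ∀ t x, ‖T t x‖ ≤ D * V t x
  T_diff : ∀ t x h, ‖h‖ ≤ 1 → ‖T t (x + h) - T t x‖ ≤ L * ‖h‖ * V t x ^ κ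
  -- The parameter `b` selects the target space: `b = 0` for `L²`, `b = β` for the source space of
  -- the dispersive bound. The factors `L⁻¹` in the next two fields cancel the large Lipschitz
  -- constant of `T`.
  norm_V_alpha : ∀ t b, b = 0 ∨ b = β → eLpNorm (fun x => V t x ^ α) (lexp b) volume ≤ 1
  norm_V_mid : ∀ t b, b = 0 ∨ b = β →
    eLpNorm (fun x => V t x ^ (α - β + κ)) (lexp (1 + b - β)) volume ≤ ENNReal.ofReal L⁻¹
  norm_V_low : ∀ t b, b = 0 ∨ b = β →
    eLpNorm (fun x => V t x ^ κ) (lexp (1 + b - min α (1 + b))) volume ≤ ENNReal.ofReal L⁻¹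
  norm_H : ∀ t, 0 ≤ t → eLpNorm (H t) 2 volume ≤ ENNReal.ofReal (Real.exp (-(lam * t)))
  norm_H_diff : ∀ t, 0 ≤ t → ∀ b, b = 0 ∨ b = β → ∀ h, ‖h‖ ≤ 1 →
    eLpNorm (fun x => H t (x + h) - H t x) (lexp (1 + b)) volume ≤
      ENNReal.ofReal (Real.exp (-(lam * t)) * ‖h‖)
  tendsto_H : ∀ t, 0 ≤ t →
    Tendsto (fun s => eLpNorm (H s - H t) 2 volume) (𝓝[Set.Ici 0] t) (𝓝 0)

/-- `f(τ + u) - f(τ) + e`. -/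
def remainderFun (g : ℝ → ℝ) (τ e : Space d → ℂ) (u : Space d → ℂ) (x : Space d) : ℂ :=
  nonlin g (τ x + u x) - nonlin g (τ x) + e x

open Classical in
/-- The right-hand side of the equation for the remainder as an element of `L²`. -/
def remainder (g : ℝ → ℝ) (T H : ℝ → Space d → ℂ) (t : ℝ) (U : L2 d) : L2 d :=
  if h : MemLp (remainderFun g (T t) (H t) U) 2 volume then h.toLp else 0

section Estimates

variable {α κ β D lam L : ℝ} {T H : ℝ → Space d → ℂ} {V : ℝ → Space d → ℝ}

theorem Background.norm_T_le (hT : Background α κ β D lam L T H V) (hD : 0 ≤ D) (t : ℝ)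
    (x : Space d) : ‖T t x‖ ≤ D := by
  have h1 := hT.T_le t x
  have h2 := hT.V_le_one t x
  nlinarith

theorem Background.continuous_T_apply (hT : Background α κ β D lam L T H V) (t : ℝ) :
    Continuous (T t) := hT.continuous_T.comp (Continuous.prodMk_right t)

theorem Background.continuous_H_apply (hT : Background α κ β D lam L T H V) (t : ℝ) :
    Continuous (H t) := hT.continuous_H.comp (Continuous.prodMk_right t)

theorem Background.aestronglyMeasurable_increment (hF : AssumptionF d g C₀ α₁ α₂)
    (hT : Background α κ β D lam L T H V) (t : ℝ) (U : L2 d) :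
    AEStronglyMeasurable (fun x => nonlin g (T t x + U x) - nonlin g (T t x)) volume := by
  have hU := Lp.aestronglyMeasurable U
  have hTm := (hT.continuous_T_apply t).aestronglyMeasurable (μ := (volume : Measure (Space d)))
  exact (hF.continuous_nonlin.comp_aestronglyMeasurable (hTm.add hU)).sub
    (hF.continuous_nonlin.comp_aestronglyMeasurable hTm)

theorem NonlinBounds.ae_norm_sub_le (hF : AssumptionF d g C₀ α₁ α₂) {M C m : ℝ} (hα : 0 ≤ α)
    (hC : 0 < C) (hB : NonlinBounds g α M C) (hD : 0 ≤ D) (hM : D + m ≤ M)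
    (hT : Background α κ β D lam L T H V) (t : ℝ) {U W : L2 d} (hU : ∀ᵐ x, ‖U x‖ ≤ m)
    (hW : ∀ᵐ x, ‖W x‖ ≤ m) :
    ∀ᵐ x, ‖nonlin g (T t x + U x) - nonlin g (T t x + W x)‖ ≤
      C * (2 * (D + m)) ^ α * ‖U x - W x‖ := by
  filter_upwards [hU, hW] with x h1 h2
  have h3 := hT.norm_T_le hD t x
  have h4 : ‖T t x + U x‖ ≤ D + m := (norm_add_le _ _).trans (add_le_add h3 h1)
  have h5 : ‖T t x + W x‖ ≤ D + m := (norm_add_le _ _).trans (add_le_add h3 h2)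
  have h6 := hB.norm_nonlin_sub_le hF hα hC.le (h4.trans hM) (h5.trans hM)
  rw [add_sub_add_left_eq_sub] at h6
  refine h6.trans ?_
  gcongr
  linarith

theorem Background.coeFn_remainder (hF : AssumptionF d g C₀ α₁ α₂) {M C m : ℝ} (hα : 0 ≤ α)
    (hC : 0 < C) (hB : NonlinBounds g α M C) (hD : 0 ≤ D) (hm : 0 ≤ m) (hM : D + m ≤ M)
    (hT : Background α κ β D lam L T H V) {t : ℝ} (ht : 0 ≤ t) {U : L2 d}
    (hU : ∀ᵐ x, ‖U x‖ ≤ m) :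
    remainder g T H t U =ᵐ[volume] remainderFun g (T t) (H t) U := by
  have hmem : MemLp (remainderFun g (T t) (H t) U) 2 volume := by
    refine MemLp.add ?_ ⟨(hT.continuous_H_apply t).aestronglyMeasurable,
      (hT.norm_H t ht).trans_lt ENNReal.ofReal_lt_top⟩
    refine MemLp.of_le_mul (c := C * (2 * (D + m)) ^ α) (Lp.memLp U)
      (hT.aestronglyMeasurable_increment hF t U) ?_
    have h0 : ∀ᵐ x, ‖(0 : L2 d) x‖ ≤ m := by
      filter_upwards [Lp.coeFn_zero ℂ 2 (volume : Measure (Space d))] with x hx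
      rw [hx]; simpa using hm
    filter_upwards [hB.ae_norm_sub_le hF hα hC hD hM hT t hU h0,
      Lp.coeFn_zero ℂ 2 (volume : Measure (Space d))] with x hx h1
    simpa [h1] using hx
  rw [remainder, dif_pos hmem]
  exact hmem.coeFn_toLp

theorem Background.norm_remainder_sub_le (hF : AssumptionF d g C₀ α₁ α₂) {M C m : ℝ} (hα : 0 ≤ α)
    (hC : 0 < C) (hB : NonlinBounds g α M C) (hD : 0 ≤ D) (hm : 0 ≤ m) (hM : D + m ≤ M)
    (hT : Background α κ β D lam L T H V) {t : ℝ} (ht : 0 ≤ t) {U W : L2 d}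
    (hU : ∀ᵐ x, ‖U x‖ ≤ m) (hW : ∀ᵐ x, ‖W x‖ ≤ m) :
    ‖remainder g T H t U - remainder g T H t W‖ ≤ C * (2 * (D + m)) ^ α * ‖U - W‖ := by
  refine Lp.norm_le_mul_norm_of_ae_le_mul ?_
  filter_upwards [hT.coeFn_remainder hF hα hC hB hD hm hM ht hU,
    hT.coeFn_remainder hF hα hC hB hD hm hM ht hW, hB.ae_norm_sub_le hF hα hC hD hM hT t hU hW,
    Lp.coeFn_sub (remainder g T H t U) (remainder g T H t W), Lp.coeFn_sub U W] with x h1 h2 h3 h4 h5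
  rw [h4, h5, Pi.sub_apply, Pi.sub_apply, h1, h2]
  simpa [remainderFun] using h3

theorem Background.norm_remainder_le (hF : AssumptionF d g C₀ α₁ α₂) {M C m : ℝ} (hα : 0 ≤ α)
    (hC : 0 < C) (hB : NonlinBounds g α M C) (hD : 0 ≤ D) (hm : 0 ≤ m) (hM : D + m ≤ M)
    (hT : Background α κ β D lam L T H V) {t : ℝ} (ht : 0 ≤ t) {U : L2 d}
    (hU : ∀ᵐ x, ‖U x‖ ≤ m) :
    ‖remainder g T H t U‖ ≤ C * (2 * (D + m)) ^ α * ‖U‖ + Real.exp (-(lam * t)) := by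
  have h0 : ∀ᵐ x, ‖(0 : L2 d) x‖ ≤ m := by
    filter_upwards [Lp.coeFn_zero ℂ 2 (volume : Measure (Space d))] with x hx
    rw [hx]; simpa using hm
  have h1 := hT.norm_remainder_sub_le hF hα hC hB hD hm hM ht hU h0
  have h2 : ‖remainder g T H t 0‖ ≤ Real.exp (-(lam * t)) := by
    rw [← eLpNorm_two_le_iff (Real.exp_pos _).le]
    refine (eLpNorm_congr_ae ?_).trans_le (hT.norm_H t ht)
    filter_upwards [hT.coeFn_remainder hF hα hC hB hD hm hM ht h0,
      Lp.coeFn_zero ℂ 2 (volume : Measure (Space d))] with x h3 h4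
    rw [h3, remainderFun, h4, Pi.zero_apply, add_zero, sub_self, zero_add]
  have h3 := norm_sub_norm_le (remainder g T H t U) (remainder g T H t 0)
  rw [sub_zero] at h1
  linarith

end Estimates

end

end SolitonTrain

/-! ### Difference quotients and time continuity of the remainder nonlinearity. -/

namespace SolitonTrain

noncomputable section

variable {d : ℕ} {g : ℝ → ℝ} {C₀ α₁ α₂ : ℝ}

section Estimates

variable {α κ β D lam L : ℝ} {T H : ℝ → Space d → ℂ} {V : ℝ → Space d → ℝ}

theorem eLpNorm_mul_lexp_le_ofReal {X : Type*} [MeasurableSpace X] {μ : Measure X} {f h : X → ℝ}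
    {b c s A B : ℝ} (hs : s = b + c) (hb : 0 ≤ b) (hc : 0 ≤ c) (hA : 0 ≤ A)
    (hf : AEStronglyMeasurable f μ) (hh : AEStronglyMeasurable h μ)
    (hfA : eLpNorm f (lexp b) μ ≤ ENNReal.ofReal A)
    (hhB : eLpNorm h (lexp c) μ ≤ ENNReal.ofReal B) :
    eLpNorm (fun x => f x * h x) (lexp s) μ ≤ ENNReal.ofReal (A * B) := by
  rw [hs, ENNReal.ofReal_mul hA]
  exact (eLpNorm_mul_lexp_le hb hc hf hh).trans (mul_le_mul' hfA hhB)

theorem eLpNorm_add_le_ofReal {X : Type*} [MeasurableSpace X] {μ : Measure X} {f h : X → ℝ}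
    {p : ℝ≥0∞} {A B : ℝ} (hp : 1 ≤ p) (hA : 0 ≤ A) (hB : 0 ≤ B)
    (hf : AEStronglyMeasurable f μ) (hh : AEStronglyMeasurable h μ)
    (hfA : eLpNorm f p μ ≤ ENNReal.ofReal A) (hhB : eLpNorm h p μ ≤ ENNReal.ofReal B) :
    eLpNorm (fun x => f x + h x) p μ ≤ ENNReal.ofReal (A + B) := by
  rw [ENNReal.ofReal_add hA hB]
  exact (eLpNorm_add_le hf hh hp).trans (add_le_add hfA hhB)

theorem eLpNorm_const_mul_le_ofReal {X : Type*} [MeasurableSpace X] {μ : Measure X} {f : X → ℝ}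
    {p : ℝ≥0∞} {c A : ℝ} (hc : 0 ≤ c) (hfA : eLpNorm f p μ ≤ ENNReal.ofReal A) :
    eLpNorm (fun x => c * f x) p μ ≤ ENNReal.ofReal (c * A) := by
  have : (fun x => c * f x) = c • f := by ext; simp
  rw [this, eLpNorm_const_smul, ENNReal.ofReal_mul hc, Real.enorm_of_nonneg hc]
  gcongr

theorem aestronglyMeasurable_norm_rpow (U : L2 d) (γ : ℝ) :
    AEStronglyMeasurable (fun x => ‖U x‖ ^ γ) volume :=
  ((Lp.aestronglyMeasurable U).norm.aemeasurable.pow_const γ).aestronglyMeasurable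

theorem Background.aestronglyMeasurable_rpow (hT : Background α κ β D lam L T H V) (t γ : ℝ) :
    AEStronglyMeasurable (fun x => V t x ^ γ) volume :=
  ((hT.continuous_V t).aestronglyMeasurable.aemeasurable.pow_const γ).aestronglyMeasurable

theorem eLpNorm_norm_rpow_lexp_le {U : L2 d} {K m b : ℝ} (hm : 0 ≤ m) (hK : 0 ≤ K)
    (hβ : 0 < β) (hβ1 : β ≤ 1) (hU : ‖U‖ ≤ K) (hUm : ∀ᵐ x, ‖U x‖ ≤ m) (hb : b = 0 ∨ b = β) :
    eLpNorm (fun x => ‖U x‖ ^ β) (lexp b) volume ≤ ENNReal.ofReal (m + K + 1) := by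
  have hle : ∀ y : ℝ, 0 ≤ y → y ≤ m + K → y ^ β ≤ m + K + 1 := by
    intro y hy h
    calc y ^ β ≤ (m + K + 1) ^ β := by gcongr; linarith
      _ ≤ (m + K + 1) ^ (1 : ℝ) := Real.rpow_le_rpow_of_exponent_le (by linarith) hβ1
      _ = _ := Real.rpow_one _
  rcases hb with rfl | rfl
  · rw [lexp_zero, eLpNorm_exponent_top]
    refine eLpNormEssSup_le_of_ae_bound ?_
    filter_upwards [hUm] with x hx
    rw [Real.norm_of_nonneg (by positivity)]
    exact hle _ (norm_nonneg _) (by linarith)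
  · exact (eLpNorm_norm_rpow_le hK hβ hU).trans (ENNReal.ofReal_le_ofReal (hle K hK (by linarith)))

/-- This is where the rate `βλ` of the gradients originates: only a power at least `β` of the `L²`
decay survives in the terms containing `∇T`. -/
theorem decay_rpow_le {K R lam t β γ : ℝ} (hK : 0 ≤ K) (hKR : K ≤ R) (hR : 1 ≤ R) (hβγ : β ≤ γ)
    (hγ : 0 ≤ γ) (hγ2 : γ ≤ 2) (hlam : 0 ≤ lam * t) :
    (K * Real.exp (-(lam * t))) ^ γ ≤ R ^ 2 * Real.exp (-(β * lam * t)) := by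
  rw [Real.mul_rpow hK (Real.exp_pos _).le, ← Real.exp_mul]
  have h1 : K ^ γ ≤ R ^ 2 := by
    calc K ^ γ ≤ R ^ γ := by gcongr
      _ ≤ R ^ (2 : ℝ) := Real.rpow_le_rpow_of_exponent_le hR hγ2
      _ = R ^ 2 := Real.rpow_two R
  gcongr
  nlinarith

/-- The increment consists of three terms: a potential times the increment of `u`, a fractional
power of `u` times the increment of `T`, and the increment of `H`. Hölder's inequality places each
in the target space. The constant `A` is chosen before `lam` and `L`, since `L` always meets a
compensating `L⁻¹`. -/
theorem NonlinBounds.exists_remainder_mem_diffBound (hF : AssumptionF d g C₀ α₁ α₂) {M C m K : ℝ}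
    (hC : 0 < C) (hB : NonlinBounds g α M C) (hβ : 0 < β) (hβ1 : β ≤ 1) (hβα : β ≤ α) (hκ : 0 ≤ κ)
    (hD : 0 ≤ D) (hm : 1 ≤ m) (hM : 3 * D + m ≤ M) (hK : 0 ≤ K) :
    ∃ A : ℝ, 0 < A ∧ ∀ (lam L : ℝ) (T H : ℝ → Space d → ℂ) (V : ℝ → Space d → ℝ), 0 ≤ lam → 0 < L →
      Background α κ β D lam L T H V → ∀ t, 0 ≤ t → ∀ U : L2 d, (∀ᵐ x, ‖U x‖ ≤ m) →
      ‖U‖ ≤ K * Real.exp (-(lam * t)) → U ∈ DiffBound 2 (K * Real.exp (-(β * lam * t))) →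
      ∀ b, b = 0 ∨ b = β →
        remainder g T H t U ∈ DiffBound (lexp (1 + b)) (A * Real.exp (-(β * lam * t))) := by
  obtain ⟨Q, hQ0, hQ⟩ := hB.exists_norm_increment_le hF hC hβ hβ1 hβα hκ hD hm hM
  set R : ℝ := m + K + 1 with hR
  have hR0 : 0 < R := by positivity
  refine ⟨Q * ((1 + R + R) * K + (R ^ 2 + R ^ 2)) + 1, by positivity, ?_⟩
  intro lam L T H V hlam hL hT t ht U hUm hU0 hU2 b hb h hh
  have hlt : 0 ≤ lam * t := by positivity
  have hα : 0 ≤ α := by linarith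
  have hb0 : 0 ≤ b := by rcases hb with rfl | rfl <;> linarith
  have hbβ : b ≤ β := by rcases hb with rfl | rfl <;> linarith
  set E := Real.exp (-(β * lam * t)) with hE
  have hE0 : 0 < E := Real.exp_pos _
  have hE1 : Real.exp (-(lam * t)) ≤ E := by
    rw [hE]; gcongr; nlinarith
  have hexp1 : Real.exp (-(lam * t)) ≤ 1 := Real.exp_le_one_iff.2 (by linarith)
  have hUK : ‖U‖ ≤ K := hU0.trans (by nlinarith)
  set U' := translate h U with hU'
  have hU'K : ‖U'‖ ≤ K := by rw [hU', LinearIsometry.norm_map]; exact hUK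
  have hU'm : ∀ᵐ x, ‖U' x‖ ≤ m := by
    filter_upwards [coeFn_translate h U, ae_comp_add h hUm] with x h1 h2
    rw [h1]; exact h2
  set W := U' - U with hW
  -- The largest power of `|u|` allowed both by the nonlinearity and by integrability in `lexp (1 +
  -- b)`. It leaves the weakest integrability demand on `V^κ`, which is absent when `α ≥ 1 + b`.
  set γ := min α (1 + b) with hγ
  have hγα : γ ≤ α := min_le_left _ _
  have hγb : γ ≤ 1 + b := min_le_right _ _
  have hβγ : β ≤ γ := le_min hβα (by linarith)
  have hpt : ∀ᵐ x, ‖(translate h (remainder g T H t U) - remainder g T H t U : L2 d) x‖ ≤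
      Q * ((V t x ^ α + ‖U x‖ ^ β + ‖U' x‖ ^ β) * ‖W x‖ +
          L * ‖h‖ * (V t x ^ (α - β + κ) * ‖U x‖ ^ β + V t x ^ κ * ‖U x‖ ^ γ)) +
        ‖H t (x + h) - H t x‖ := by
    have hc := hT.coeFn_remainder hF hα hC hB hD (by linarith) (by linarith) ht hUm
    filter_upwards [Lp.coeFn_sub (translate h (remainder g T H t U)) (remainder g T H t U),
      coeFn_translate h (remainder g T H t U), hc, ae_comp_add h hc, coeFn_translate h U,
      Lp.coeFn_sub U' U, hUm, hU'm] with x h1 h2 h3 h4 h5 h6 h7 h8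
    rw [h1, Pi.sub_apply, h2, h3, h4]
    have hD1 := hT.T_le t x
    have hD2 : ‖T t (x + h)‖ ≤ 3 * (D * V t x) := by
      refine (hT.T_le t (x + h)).trans ?_
      have := mul_le_mul_of_nonneg_left (hT.V_shift t x h hh) hD
      linarith
    have := hQ (V t x) (L * ‖h‖) γ (T t x) (T t (x + h)) (U x) (U' x) (hT.V_nonneg t x)
      (hT.V_le_one t x) (by positivity) (hβ.le.trans hβγ) hγα hD1 hD2 h7 h8 (hT.T_diff t x h hh)
    rw [← Pi.sub_apply, ← h6] at this
    have e : remainderFun g (T t) (H t) U (x + h) - remainderFun g (T t) (H t) U x =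
        ((nonlin g (T t (x + h) + U' x) - nonlin g (T t (x + h))) -
          (nonlin g (T t x + U x) - nonlin g (T t x))) + (H t (x + h) - H t x) := by
      simp only [remainderFun, hU', h5]; ring
    rw [e]
    exact (norm_add_le _ _).trans (by gcongr)
  refine (eLpNorm_mono_ae_real hpt).trans ?_
  have hp : 1 ≤ lexp (1 + b) := one_le_lexp (by linarith)
  have mU := aestronglyMeasurable_norm_rpow U
  have mU' := aestronglyMeasurable_norm_rpow U'
  have mV := hT.aestronglyMeasurable_rpow t
  have mW := (Lp.aestronglyMeasurable W).norm
  have n1 : eLpNorm (fun x => V t x ^ α + ‖U x‖ ^ β + ‖U' x‖ ^ β) (lexp b) volume ≤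
      ENNReal.ofReal (1 + R + R) :=
    eLpNorm_add_le_ofReal (one_le_lexp (by linarith)) (by positivity) hR0.le ((mV α).add (mU β))
      (mU' β) (eLpNorm_add_le_ofReal (one_le_lexp (by linarith)) zero_le_one hR0.le (mV α) (mU β)
        (by simpa using hT.norm_V_alpha t b hb)
        (eLpNorm_norm_rpow_lexp_le (by linarith) hK hβ hβ1 hUK hUm hb))
      (eLpNorm_norm_rpow_lexp_le (by linarith) hK hβ hβ1 hU'K hU'm hb)
  have n2 : eLpNorm (fun x => ‖W x‖) (lexp 1) volume ≤ ENNReal.ofReal (K * E * ‖h‖) := by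
    rw [lexp_one, eLpNorm_norm]
    exact hU2 h hh
  have n3 := eLpNorm_mul_lexp_le_ofReal (s := 1 + b) (add_comm _ _) hb0 zero_le_one
    (by positivity) ((mV α).add (mU β) |>.add (mU' β)) mW n1 n2
  have n4 := eLpNorm_mul_lexp_le_ofReal (s := 1 + b) (by ring) (by linarith) hβ.le
    (by positivity) (mV (α - β + κ)) (mU β) (hT.norm_V_mid t b hb)
    ((eLpNorm_norm_rpow_le (by positivity) hβ hU0).trans (ENNReal.ofReal_le_ofReal
      (decay_rpow_le (R := R) hK (by linarith) (by linarith) le_rfl hβ.le (by linarith) hlt)))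
  have n5 := eLpNorm_mul_lexp_le_ofReal (s := 1 + b) (by ring) (by linarith) (hβ.le.trans hβγ)
    (by positivity) (mV κ) (mU γ) (hT.norm_V_low t b hb)
    ((eLpNorm_norm_rpow_le (by positivity) (hβ.trans_le hβγ) hU0).trans (ENNReal.ofReal_le_ofReal
      (decay_rpow_le (R := R) hK (by linarith) (by linarith) hβγ (hβ.le.trans hβγ) (by linarith) hlt)))
  have n6 := eLpNorm_const_mul_le_ofReal (c := L * ‖h‖) (by positivity)
    (eLpNorm_add_le_ofReal hp (by positivity) (by positivity) ((mV (α - β + κ)).mul (mU β))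
      ((mV κ).mul (mU γ)) n4 n5)
  have n7 := eLpNorm_const_mul_le_ofReal hQ0.le
    (eLpNorm_add_le_ofReal hp (by positivity) (by positivity)
      (((mV α).add (mU β) |>.add (mU' β)).mul mW)
      ((((mV (α - β + κ)).mul (mU β)).add ((mV κ).mul (mU γ))).const_mul (L * ‖h‖)) n3 n6)
  have mH : AEStronglyMeasurable (fun x => ‖H t (x + h) - H t x‖) volume := by
    have := hT.continuous_H_apply t
    exact (by fun_prop : Continuous fun x => ‖H t (x + h) - H t x‖).aestronglyMeasurable
  have n8 : eLpNorm (fun x => ‖H t (x + h) - H t x‖) (lexp (1 + b)) volume ≤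
      ENNReal.ofReal (Real.exp (-(lam * t)) * ‖h‖) := by
    rw [eLpNorm_norm]
    exact hT.norm_H_diff t ht b hb h hh
  refine (eLpNorm_add_le_ofReal hp (by positivity) (by positivity)
    (((((mV α).add (mU β) |>.add (mU' β)).mul mW).add
      ((((mV (α - β + κ)).mul (mU β)).add ((mV κ).mul (mU γ))).const_mul (L * ‖h‖))).const_mul Q)
    mH n7 n8).trans (ENNReal.ofReal_le_ofReal ?_)
  rw [← hE]
  have hn : 0 ≤ ‖h‖ := norm_nonneg h
  have e1 : L * ‖h‖ * (L⁻¹ * (R ^ 2 * E) + L⁻¹ * (R ^ 2 * E)) = ‖h‖ * ((R ^ 2 + R ^ 2) * E) := by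
    field_simp
  rw [e1]
  have e2 : Real.exp (-(lam * t)) * ‖h‖ ≤ E * ‖h‖ := by gcongr
  linarith

theorem Background.continuousOn_remainder (hF : AssumptionF d g C₀ α₁ α₂) {M C m : ℝ} (hα : 0 ≤ α)
    (hC : 0 < C) (hB : NonlinBounds g α M C) (hD : 0 ≤ D) (hm : 0 ≤ m) (hM : D + m ≤ M)
    (hT : Background α κ β D lam L T H V) {U : ℝ → L2 d} (hUc : Continuous U)
    (hUm : ∀ t, 0 ≤ t → ∀ᵐ x, ‖U t x‖ ≤ m) :
    ContinuousOn (fun t => remainder g T H t (U t)) (Set.Ici 0) := by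
  intro t ht
  have ht0 : 0 ≤ t := ht
  have hself : ∀ᶠ s in 𝓝[Set.Ici 0] t, 0 ≤ s := eventually_mem_nhdsWithin
  -- the dependence on the state
  have h1 : Tendsto (fun s => remainder g T H s (U s) - remainder g T H s (U t))
      (𝓝[Set.Ici 0] t) (𝓝 0) := by
    refine squeeze_zero_norm' (a := fun s => C * (2 * (D + m)) ^ α * ‖U s - U t‖) ?_ ?_
    · filter_upwards [hself] with s hs
      exact hT.norm_remainder_sub_le hF hα hC hB hD hm hM hs (hUm s hs) (hUm t ht0)
    · have : Continuous fun s => C * (2 * (D + m)) ^ α * ‖U s - U t‖ := by fun_prop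
      have h := (this.tendsto t).mono_left (nhdsWithin_le_nhds (s := Set.Ici 0))
      simpa using h
  have h2 : Tendsto (fun s => remainder g T H s (U t)) (𝓝[Set.Ici 0] t)
      (𝓝 (remainder g T H t (U t))) := by
    rw [Lp.tendsto_Lp_iff_tendsto_eLpNorm']
    set F : ℝ → Space d → ℂ := fun s x => nonlin g (T s x + U t x) - nonlin g (T s x) with hFdef
    have h3 : Tendsto (fun s => eLpNorm (fun x => F s x - F t x) 2 volume)
        (𝓝[Set.Ici 0] t) (𝓝 0) := by
      have hb : ∀ s, ∀ᵐ x, ‖F s x‖ ≤ C * (2 * (D + m)) ^ α * ‖U t x‖ := by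
        intro s
        have h0 : ∀ᵐ x, ‖(0 : L2 d) x‖ ≤ m := by
          filter_upwards [Lp.coeFn_zero ℂ 2 (volume : Measure (Space d))] with x hx
          rw [hx]; simpa using hm
        filter_upwards [hB.ae_norm_sub_le hF hα hC hD hM hT s (hUm t ht0) h0,
          Lp.coeFn_zero ℂ 2 (volume : Measure (Space d))] with x hx h1
        simpa [h1] using hx
      refine tendsto_eLpNorm_two_of_dominated
        (B := fun x => 2 * (C * (2 * (D + m)) ^ α) * ‖U t x‖) ((Lp.memLp (U t)).norm.const_mul _)
        (Eventually.of_forall fun s => hT.aestronglyMeasurable_increment hF s (U t))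
        (hT.aestronglyMeasurable_increment hF t (U t)) (Eventually.of_forall fun s => ?_)
        (Eventually.of_forall fun x => ?_)
      · filter_upwards [hb s, hb t] with x e1 e2
        exact (norm_sub_le _ _).trans (by linarith)
      · have hTx : Continuous fun s => T s x := hT.continuous_T.comp (Continuous.prodMk_left x)
        have hN := hF.continuous_nonlin
        have : Continuous fun s => F s x := by simp only [hFdef]; fun_prop
        exact (this.tendsto t).mono_left nhdsWithin_le_nhds
    have h4 := h3.add (hT.tendsto_H t ht0)
    rw [add_zero] at h4
    refine tendsto_of_tendsto_of_tendsto_of_le_of_le' tendsto_const_nhds h4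
      (Eventually.of_forall fun s => zero_le) ?_
    filter_upwards [hself] with s hs
    have e : (remainder g T H s (U t) - remainder g T H t (U t) : Space d → ℂ) =ᵐ[volume]
        (fun x => F s x - F t x) + (H s - H t) := by
      filter_upwards [hT.coeFn_remainder hF hα hC hB hD hm hM hs (hUm t ht0),
        hT.coeFn_remainder hF hα hC hB hD hm hM ht0 (hUm t ht0)] with x e1 e2
      rw [Pi.sub_apply, e1, e2]
      simp only [remainderFun, hFdef, Pi.add_apply, Pi.sub_apply]
      ring
    rw [eLpNorm_congr_ae e]
    exact eLpNorm_add_le ((hT.aestronglyMeasurable_increment hF s (U t)).sub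
      (hT.aestronglyMeasurable_increment hF t (U t)))
      ((hT.continuous_H_apply s).sub (hT.continuous_H_apply t)).aestronglyMeasurable one_le_two
  have := h1.add h2
  simpa [ContinuousWithinAt] using this

end Estimates

end

end SolitonTrain

/-! ### Existence of the remainder for a given background. -/

namespace SolitonTrain

noncomputable section

variable {d : ℕ} {g : ℝ → ℝ} {C₀ α₁ α₂ : ℝ}

theorem diffBound_mono {p : ℝ≥0∞} {K K' : ℝ} (h : K ≤ K') :
    DiffBound (d := d) p K ⊆ DiffBound p K' := fun _ hU y hy =>
  (hU y hy).trans (ENNReal.ofReal_le_ofReal (mul_le_mul_of_nonneg_right h (norm_nonneg y)))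

theorem ae_norm_le_of_mem_decaySet {r : ℝ≥0∞} (hd : d ≤ 3) (hr : 1 ≤ r)
    (hdr : d * (1 / r.toReal) < 1) {K lam c t : ℝ} (hK : 0 ≤ K) (hlam : 0 ≤ lam) (hc : 0 ≤ c)
    (ht : 0 ≤ t) {U : L2 d} (hU : U ∈ decaySet d r K lam c t) :
    ∀ᵐ x, ‖U x‖ ≤ K * (1 + morreyConst d r) := by
  have h1 : Real.exp (-(lam * t)) ≤ 1 := Real.exp_le_one_iff.2 (by nlinarith)
  have h2 : Real.exp (-(c * t)) ≤ 1 := Real.exp_le_one_iff.2 (by nlinarith)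
  have hm := morreyConst_nonneg (d := d) (r := r)
  filter_upwards [ae_norm_le hd hr hdr (by positivity) hU.2.2] with x hx
  refine hx.trans ?_
  have h3 : ‖U‖ ≤ K * 1 := hU.1.trans (by gcongr)
  have h4 : K * Real.exp (-(c * t)) * morreyConst d r ≤ K * 1 * morreyConst d r := by gcongr
  linarith

/-- Existence of the remainder for all sufficiently large decay rates. -/
theorem AssumptionF.exists_remainder (hF : AssumptionF d g C₀ α₁ α₂) (hd : d ≤ 3) {r : ℝ≥0∞}
    (hr : 1 ≤ r) (hdr : d * (1 / r.toReal) < 1) {β κ D K σ Cd : ℝ} (hβ : 0 < β) (hβ1 : β ≤ 1)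
    (hβα : β ≤ α₁) (hκ : 0 ≤ κ) (hD : 0 ≤ D) (hK : 0 < K) (hσ : σ < 1) (hCd : 0 < Cd)
    (hdisp : DispersiveBound d (lexp (1 + β)) r σ Cd) :
    ∃ lam₀ : ℝ, 0 < lam₀ ∧ ∀ lam, lam₀ ≤ lam → ∀ (L : ℝ) (T H : ℝ → Space d → ℂ)
      (V : ℝ → Space d → ℝ), 0 < L → Background α₁ κ β D lam L T H V →
      ∃ (U N : ℝ → L2 d) (A : ℝ), Continuous U ∧
        (∀ t, 0 ≤ t → U t ∈ decaySet d r K lam (β * lam) t) ∧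
        ContinuousOn N (Set.Ici 0) ∧
        (∀ t, 0 ≤ t → ‖N t‖ ≤ A * Real.exp (-(lam * t))) ∧
        (∀ t, 0 ≤ t → N t =ᵐ[volume] remainderFun g (T t) (H t) (U t)) ∧
        ∀ t, 0 ≤ t → U t = duhamel N t := by
  have hα := hF.exponent_pos
  have hmor := morreyConst_nonneg (d := d) (r := r)
  set m : ℝ := K * (1 + morreyConst d r) + 1 with hm
  have hm1 : 1 ≤ m := by
    have : 0 ≤ K * (1 + morreyConst d r) := by positivity
    linarith
  obtain ⟨C, hC, hB⟩ := hF.exists_nonlinBounds (M := 3 * D + m) (by positivity)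
  obtain ⟨A₂, hA₂, hdiff⟩ := hB.exists_remainder_mem_diffBound (d := d) hF hC hβ hβ1 hβα hκ hD hm1 le_rfl hK.le
  set B : ℝ := C * (2 * (D + m)) ^ α₁ with hBdef
  have hB0 : 0 ≤ B := by positivity
  set A : ℝ := max A₂ (B * K + 1) with hA
  have hA0 : 0 < A := hA₂.trans_le (le_max_left _ _)
  have t0 : Tendsto (fun lam : ℝ => β * lam) atTop atTop := tendsto_id.const_mul_atTop hβ
  have t1 : ∀ᶠ lam : ℝ in atTop, A / lam ≤ K :=
    ((tendsto_const_nhds (x := A)).div_atTop tendsto_id).eventually_le_const hK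
  have t2 : ∀ᶠ lam : ℝ in atTop, A / (β * lam) ≤ K :=
    ((tendsto_const_nhds (x := A)).div_atTop t0).eventually_le_const hK
  have t3 : ∀ᶠ lam : ℝ in atTop,
      Cd * A * ((1 / (β * lam)) ^ (1 - σ) * Real.Gamma (1 - σ)) ≤ K := by
    have h1 : Tendsto (fun lam : ℝ => (1 / (β * lam)) ^ (1 - σ)) atTop (𝓝 0) := by
      have := ((tendsto_const_nhds (x := (1 : ℝ))).div_atTop t0).rpow_const (p := 1 - σ)
        (Or.inr (by linarith))
      rwa [Real.zero_rpow (by linarith)] at this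
    have h2 := (h1.mul_const (Real.Gamma (1 - σ))).const_mul (Cd * A)
    rw [zero_mul, mul_zero] at h2
    exact h2.eventually_le_const hK
  have t4 : ∀ᶠ lam : ℝ in atTop, B / lam ≤ 1 / 2 :=
    ((tendsto_const_nhds (x := B)).div_atTop tendsto_id).eventually_le_const (by norm_num)
  -- `A` and `B` do not involve the background, so the threshold is fixed before the train is
  -- chosen; the train is later allowed to depend on `lam`.
  obtain ⟨lam₁, hlam₁⟩ := eventually_atTop.1 (t1.and (t2.and (t3.and t4)))
  refine ⟨max lam₁ 1, by positivity, ?_⟩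
  intro lam hlam L T H V hL hT
  obtain ⟨s1, s2, s3, s4⟩ := hlam₁ lam ((le_max_left _ _).trans hlam)
  have hlam0 : 0 < lam := zero_lt_one.trans_le ((le_max_right _ _).trans hlam)
  have hae : ∀ t, 0 ≤ t → ∀ U ∈ decaySet d r K lam (β * lam) t, ∀ᵐ x, ‖U x‖ ≤ m := by
    intro t ht U hU
    filter_upwards [ae_norm_le_of_mem_decaySet hd hr hdr hK.le hlam0.le (by positivity) ht hU]
      with x hx
    linarith
  have hN0 : ∀ t, 0 ≤ t → ∀ U ∈ decaySet d r K lam (β * lam) t,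
      ‖remainder g T H t U‖ ≤ A * Real.exp (-(lam * t)) := by
    intro t ht U hU
    have h1 := hT.norm_remainder_le hF hα.le hC hB hD (by linarith) (by linarith) ht (hae t ht U hU)
    have h2 : B * ‖U‖ ≤ B * (K * Real.exp (-(lam * t))) := by gcongr; exact hU.1
    have h3 : (B * K + 1) * Real.exp (-(lam * t)) ≤ A * Real.exp (-(lam * t)) := by
      gcongr
      exact le_max_right _ _
    linarith
  have hNc : ∀ U : ℝ → L2 d, Continuous U → (∀ t, 0 ≤ t → U t ∈ decaySet d r K lam (β * lam) t) →
      ContinuousOn (fun t => remainder g T H t (U t)) (Set.Ici 0) := fun U hUc hU =>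
    hT.continuousOn_remainder hF hα.le hC hB hD (by linarith) (by linarith) hUc
      fun t ht => hae t ht _ (hU t ht)
  have hNd : ∀ b, b = 0 ∨ b = β → ∀ t, 0 ≤ t → ∀ U ∈ decaySet d r K lam (β * lam) t,
      remainder g T H t U ∈ DiffBound (lexp (1 + b)) (A * Real.exp (-(β * lam * t))) := by
    intro b hb t ht U hU
    refine diffBound_mono ?_
      (hdiff lam L T H V hlam0.le hL hT t ht U (hae t ht U hU) hU.1 hU.2.1 b hb)
    gcongr
    exact le_max_left _ _
  obtain ⟨U, hUc, hU, hfix⟩ := exists_eq_duhamel (N := remainder g T H) hlam0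
    (by positivity : 0 < β * lam) hσ hr hA0 hB0 hCd hK.le hdisp hN0
    (fun t ht U hU => by simpa [lexp_one] using hNd 0 (Or.inl rfl) t ht U hU)
    (fun t ht U hU => hNd β (Or.inr rfl) t ht U hU)
    (fun t ht U hU W hW => hT.norm_remainder_sub_le hF hα.le hC hB hD (by linarith) (by linarith) ht
      (hae t ht U hU) (hae t ht W hW)) hNc s1 s2 s3 s4
  exact ⟨U, fun t => remainder g T H t (U t), A, hUc, hU, hNc U hUc hU,
    fun t ht => hN0 t ht _ (hU t ht), fun t ht => hT.coeFn_remainder hF hα.le hC hB hD (by linarith)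
      (by linarith) ht (hae t ht _ (hU t ht)), hfix⟩

end

end SolitonTrain

/-! ### Envelopes of bumps and the interaction error. -/

namespace SolitonTrain

noncomputable section

variable {d : ℕ} {g : ℝ → ℝ} {C₀ α₁ α₂ : ℝ}

/-- Countable Minkowski inequality: the finite one for partial sums, then Fatou's lemma. -/
theorem eLpNorm_tsum_le {X : Type*} [MeasurableSpace X] {μ : Measure X} {f : ℕ → X → ℝ} {p : ℝ≥0∞}
    (hp : 1 ≤ p) {c : ℕ → ℝ} (hc0 : ∀ j, 0 ≤ c j) (hc : Summable c)
    (hf : ∀ j, AEStronglyMeasurable (f j) μ) (hfc : ∀ j, eLpNorm (f j) p μ ≤ ENNReal.ofReal (c j))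
    (hs : ∀ x, Summable fun j => f j x) :
    eLpNorm (fun x => ∑' j, f j x) p μ ≤ ENNReal.ofReal (∑' j, c j) := by
  refine (Lp.eLpNorm_lim_le_liminf_eLpNorm (f := fun n x => ∑ j ∈ Finset.range n, f j x)
    (fun n => ?_) _ (Eventually.of_forall fun x => (hs x).hasSum.tendsto_sum_nat)).trans ?_
  · exact Finset.aestronglyMeasurable_fun_sum _ fun j _ => hf j
  · refine liminf_le_of_le (by isBoundedDefault) fun b hb => ?_
    obtain ⟨n, hn⟩ := hb.exists
    refine hn.trans ?_
    have e : (fun x => ∑ j ∈ Finset.range n, f j x) = ∑ j ∈ Finset.range n, f j := by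
      ext x; simp
    rw [e]
    refine (eLpNorm_sum_le (fun j _ => hf j) hp).trans ?_
    refine (Finset.sum_le_sum fun j _ => hfc j).trans ?_
    rw [← ENNReal.ofReal_sum_of_nonneg fun j _ => hc0 j]
    exact ENNReal.ofReal_le_ofReal (hc.sum_le_tsum _ fun j _ => hc0 j)

/-- A family of localized bumps with weak mutual interaction. -/
structure Bumps (δ lam : ℝ) (B : ℕ → ℝ) (w : ℕ → ℝ → Space d → ℝ) : Prop where
  exponent_pos : 0 < δ
  pos : ∀ j t x, 0 < w j t x
  le_bound : ∀ j t x, w j t x ^ δ ≤ B j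
  summable_bound : Summable B
  tsum_bound : ∑' j, B j ≤ 1
  continuous : ∀ j, Continuous fun z : ℝ × Space d => w j z.1 z.2
  shift : ∀ j t x h, ‖h‖ ≤ 1 → w j t (x + h) ≤ 3 * w j t x
  time : ∃ Q : ℝ, 0 < Q ∧ ∀ j s t x, |s - t| ≤ 1 → w j s x ≤ Q * w j t x
  interaction : ∀ j k, j ≠ k → ∀ t, 0 ≤ t → ∀ x,
    (w j t x * w k t x) ^ δ ≤ Real.exp (-(lam * t))

/-- The common envelope `(∑ w_j^δ)^{1/δ}`. -/
def envelope (δ : ℝ) (w : ℕ → ℝ → Space d → ℝ) (t : ℝ) (x : Space d) : ℝ :=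
  (∑' j, w j t x ^ δ) ^ (1 / δ)

section Bumps

variable {δ lam : ℝ} {B : ℕ → ℝ} {w : ℕ → ℝ → Space d → ℝ}

theorem Bumps.summable (hw : Bumps δ lam B w) (t : ℝ) (x : Space d) :
    Summable fun j => w j t x ^ δ :=
  Summable.of_nonneg_of_le (fun j => Real.rpow_nonneg (hw.pos j t x).le _)
    (fun j => hw.le_bound j t x) hw.summable_bound

theorem Bumps.tsum_pos (hw : Bumps δ lam B w) (t : ℝ) (x : Space d) :
    0 < ∑' j, w j t x ^ δ :=
  (hw.summable t x).tsum_pos (fun j => Real.rpow_nonneg (hw.pos j t x).le _) 0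
    (Real.rpow_pos_of_pos (hw.pos 0 t x) _)

theorem Bumps.tsum_le_one (hw : Bumps δ lam B w) (t : ℝ) (x : Space d) :
    ∑' j, w j t x ^ δ ≤ 1 :=
  ((hw.summable t x).tsum_le_tsum (fun j => hw.le_bound j t x) hw.summable_bound).trans hw.tsum_bound

theorem Bumps.envelope_pos (hw : Bumps δ lam B w) (t : ℝ) (x : Space d) :
    0 < envelope δ w t x := Real.rpow_pos_of_pos (hw.tsum_pos t x) _

theorem Bumps.envelope_rpow (hw : Bumps δ lam B w) (t : ℝ) (x : Space d) (M : ℝ) :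
    envelope δ w t x ^ M = (∑' j, w j t x ^ δ) ^ (M / δ) := by
  rw [envelope, ← Real.rpow_mul (hw.tsum_pos t x).le]
  ring_nf

theorem Bumps.envelope_le_one (hw : Bumps δ lam B w) (t : ℝ) (x : Space d) :
    envelope δ w t x ≤ 1 :=
  Real.rpow_le_one (hw.tsum_pos t x).le (hw.tsum_le_one t x) (by
    have := hw.exponent_pos; positivity)

/-- A pointwise form of the embedding of `ℓ^δ` into `ℓ^y`. It is the reason for an `ℓ^δ` envelope
with small `δ`: one function dominates the sums of all powers `y ≥ δ`. -/
theorem Bumps.rpow_le (hw : Bumps δ lam B w) {y : ℝ} (hy : δ ≤ y) (j : ℕ) (t : ℝ) (x : Space d) :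
    w j t x ^ y ≤ w j t x ^ δ * envelope δ w t x ^ (y - δ) := by
  have hδ := hw.exponent_pos
  have h0 := hw.pos j t x
  rw [hw.envelope_rpow]
  have e : w j t x ^ y = w j t x ^ δ * (w j t x ^ δ) ^ ((y - δ) / δ) := by
    rw [← Real.rpow_mul h0.le, ← Real.rpow_add h0]
    congr 1
    field_simp
    ring
  rw [e]
  have h1 : w j t x ^ δ ≤ ∑' j, w j t x ^ δ :=
    (hw.summable t x).le_tsum j fun k _ => Real.rpow_nonneg (hw.pos k t x).le _
  have h2 : 0 ≤ w j t x ^ δ := by positivity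
  gcongr

theorem Bumps.rpow_le_bound (hw : Bumps δ lam B w) {y : ℝ} (hy : δ ≤ y) (j : ℕ) (t : ℝ)
    (x : Space d) : w j t x ^ y ≤ B j := by
  refine (hw.rpow_le hy j t x).trans ?_
  have h1 : envelope δ w t x ^ (y - δ) ≤ 1 :=
    Real.rpow_le_one (hw.envelope_pos t x).le (hw.envelope_le_one t x) (by linarith)
  have h2 : 0 ≤ w j t x ^ δ := Real.rpow_nonneg (hw.pos j t x).le _
  nlinarith [hw.le_bound j t x]

theorem Bumps.summable_rpow (hw : Bumps δ lam B w) {y : ℝ} (hy : δ ≤ y) (t : ℝ) (x : Space d) :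
    Summable fun j => w j t x ^ y :=
  Summable.of_nonneg_of_le (fun j => Real.rpow_nonneg (hw.pos j t x).le _)
    (fun j => hw.rpow_le_bound hy j t x) hw.summable_bound

theorem Bumps.tsum_rpow_le (hw : Bumps δ lam B w) {y : ℝ} (hy : δ ≤ y) (t : ℝ) (x : Space d) :
    ∑' j, w j t x ^ y ≤ envelope δ w t x ^ y := by
  have hδ := hw.exponent_pos
  calc ∑' j, w j t x ^ y ≤ ∑' j, w j t x ^ δ * envelope δ w t x ^ (y - δ) :=
        (hw.summable_rpow hy t x).tsum_le_tsum (fun j => hw.rpow_le hy j t x)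
          ((hw.summable t x).mul_right _)
    _ = envelope δ w t x ^ y := by
        rw [tsum_mul_right]
        have e : ∑' j, w j t x ^ δ = envelope δ w t x ^ δ := by
          rw [hw.envelope_rpow, div_self hδ.ne', Real.rpow_one]
        rw [e, ← Real.rpow_add (hw.envelope_pos t x)]
        ring_nf

theorem Bumps.le_envelope (hw : Bumps δ lam B w) (j : ℕ) (t : ℝ) (x : Space d) :
    w j t x ≤ envelope δ w t x := by
  have hδ := hw.exponent_pos
  have h1 : w j t x ^ δ ≤ ∑' j, w j t x ^ δ :=
    (hw.summable t x).le_tsum j fun k _ => Real.rpow_nonneg (hw.pos k t x).le _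
  have h2 := Real.rpow_le_rpow (Real.rpow_nonneg (hw.pos j t x).le _) h1
    (by positivity : 0 ≤ 1 / δ)
  rwa [← Real.rpow_mul (hw.pos j t x).le, mul_one_div_cancel hδ.ne', Real.rpow_one] at h2

theorem Bumps.continuous_envelope (hw : Bumps δ lam B w) :
    Continuous fun z : ℝ × Space d => envelope δ w z.1 z.2 := by
  refine Continuous.rpow_const ?_ fun z => Or.inl (hw.tsum_pos z.1 z.2).ne'
  refine continuous_tsum (fun j => (hw.continuous j).rpow_const fun z =>
    Or.inl (hw.pos j z.1 z.2).ne') hw.summable_bound fun j z => ?_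
  rw [Real.norm_of_nonneg (Real.rpow_nonneg (hw.pos j _ _).le _)]
  exact hw.le_bound j z.1 z.2

theorem Bumps.envelope_le_of_le (hw : Bumps δ lam B w) {s t Q : ℝ} {x y : Space d} (hQ : 0 ≤ Q)
    (h : ∀ j, w j s x ≤ Q * w j t y) : envelope δ w s x ≤ Q * envelope δ w t y := by
  have hδ := hw.exponent_pos
  have h1 : ∑' j, w j s x ^ δ ≤ Q ^ δ * ∑' j, w j t y ^ δ := by
    rw [← tsum_mul_left]
    refine (hw.summable s x).tsum_le_tsum (fun j => ?_) ((hw.summable t y).mul_left _)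
    rw [← Real.mul_rpow hQ (hw.pos j t y).le]
    exact Real.rpow_le_rpow (hw.pos j s x).le (h j) hδ.le
  calc envelope δ w s x ≤ (Q ^ δ * ∑' j, w j t y ^ δ) ^ (1 / δ) :=
        Real.rpow_le_rpow (hw.tsum_pos s x).le h1 (by positivity)
    _ = Q * envelope δ w t y := by
        rw [Real.mul_rpow (by positivity) (hw.tsum_pos t y).le, ← Real.rpow_mul hQ,
          mul_one_div_cancel hδ.ne', Real.rpow_one, envelope]

theorem Bumps.envelope_shift (hw : Bumps δ lam B w) (t : ℝ) (x h : Space d) (hh : ‖h‖ ≤ 1) :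
    envelope δ w t (x + h) ≤ 3 * envelope δ w t x :=
  hw.envelope_le_of_le (by norm_num) fun j => hw.shift j t x h hh

theorem Bumps.envelope_time (hw : Bumps δ lam B w) :
    ∃ Q : ℝ, 0 < Q ∧ ∀ s t x, |s - t| ≤ 1 → envelope δ w s x ≤ Q * envelope δ w t x := by
  obtain ⟨Q, hQ, h⟩ := hw.time
  exact ⟨Q, hQ, fun s t x hst => hw.envelope_le_of_le hQ.le fun j => h j s t x hst⟩

/-- Half of the power of `w_k` is spent on temporal decay through the interaction bound; the other
half is kept to sum over `k`. -/
theorem Bumps.rpow_half_le (hw : Bumps δ lam B w) {j k : ℕ} (hjk : k ≠ j) {t : ℝ} (ht : 0 ≤ t)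
    (x : Space d) : w k t x ≤
      (Real.exp (-(lam * t)) * w j t x ^ (-δ)) ^ (1 / (2 * δ)) * w k t x ^ (1 / 2 : ℝ) := by
  have hδ := hw.exponent_pos
  have hk := hw.pos k t x
  have hj := hw.pos j t x
  have h1 := hw.interaction k j hjk t ht x
  have h2 : w k t x ^ δ ≤ Real.exp (-(lam * t)) * w j t x ^ (-δ) := by
    rw [Real.mul_rpow hk.le hj.le] at h1
    rw [Real.rpow_neg hj.le, ← div_eq_mul_inv, le_div_iff₀ (by positivity)]
    exact h1
  have h3 := Real.rpow_le_rpow (by positivity) h2 (by positivity : 0 ≤ 1 / (2 * δ))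
  rw [← Real.rpow_mul hk.le] at h3
  have e : δ * (1 / (2 * δ)) = 1 / 2 := by field_simp
  rw [e] at h3
  calc w k t x = w k t x ^ (1 / 2 : ℝ) * w k t x ^ (1 / 2 : ℝ) := by
        rw [← Real.rpow_add hk]; norm_num
    _ ≤ _ := by gcongr

/-- The sum of all but one member of a family dominated by the bumps. -/
theorem Bumps.norm_tsum_sub_le (hw : Bumps δ lam B w) (hδ : δ ≤ 1 / 2) {D : ℝ} (hD : 0 ≤ D)
    {R : ℕ → ℂ} {t : ℝ} (ht : 0 ≤ t) {x : Space d} (hR : ∀ j, ‖R j‖ ≤ D * w j t x) (j : ℕ) :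
    ‖(∑' k, R k) - R j‖ ^ (2 * δ) ≤
      D ^ (2 * δ) * Real.exp (-(lam * t)) * envelope δ w t x ^ δ * w j t x ^ (-δ) := by
  have hδ0 := hw.exponent_pos
  have hj := hw.pos j t x
  have hV := hw.envelope_pos t x
  have hs1 : Summable fun k => w k t x := by
    simpa using hw.summable_rpow (y := 1) (by linarith) t x
  have hs : Summable R := Summable.of_norm_bounded (hs1.mul_left D) hR
  set E := (Real.exp (-(lam * t)) * w j t x ^ (-δ)) ^ (1 / (2 * δ)) with hE
  have h1 : (∑' k, R k) - R j = ∑' k, if k = j then 0 else R k := by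
    rw [hs.tsum_eq_add_tsum_ite j]; ring
  have h2 : ‖(∑' k, R k) - R j‖ ≤ D * (E * envelope δ w t x ^ (1 / 2 : ℝ)) := by
    rw [h1]
    refine (tsum_of_norm_bounded
      (((hw.summable_rpow hδ t x).mul_left E).mul_left D).hasSum fun k => ?_).trans ?_
    · split_ifs with h
      · rw [norm_zero]
        have := hw.pos k t x
        positivity
      · exact (hR k).trans (mul_le_mul_of_nonneg_left (hw.rpow_half_le h ht x) hD)
    · rw [tsum_mul_left, tsum_mul_left]
      gcongr
      exact hw.tsum_rpow_le hδ t x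
  calc _ ≤ (D * (E * envelope δ w t x ^ (1 / 2 : ℝ))) ^ (2 * δ) := by gcongr
    _ = _ := by
      rw [Real.mul_rpow hD (by positivity), Real.mul_rpow (by positivity) (by positivity), hE,
        ← Real.rpow_mul (by positivity), ← Real.rpow_mul hV.le,
        one_div_mul_cancel (by positivity), Real.rpow_one]
      ring_nf

end Bumps

/-- A family of waves dominated by bumps. -/
structure Waves (κ D l : ℝ) (w : ℕ → ℝ → Space d → ℝ) (R : ℕ → ℝ → Space d → ℂ) : Prop where
  continuous : ∀ j, Continuous fun z : ℝ × Space d => R j z.1 z.2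
  norm_le : ∀ j t x, ‖R j t x‖ ≤ D * w j t x
  differentiable : ∀ j t, Differentiable ℝ (R j t)
  norm_fderiv_le : ∀ j t x, ‖fderiv ℝ (R j t) x‖ ≤ l * w j t x ^ κ

section Waves

variable {δ lam κ D l : ℝ} {B : ℕ → ℝ} {w : ℕ → ℝ → Space d → ℝ} {R : ℕ → ℝ → Space d → ℂ}

theorem Waves.norm_le_bound (hR : Waves κ D l w R) (hw : Bumps δ lam B w) (hδ : δ ≤ 1) (hD : 0 ≤ D)
    (j : ℕ) (t : ℝ) (x : Space d) : ‖R j t x‖ ≤ D * B j := by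
  refine (hR.norm_le j t x).trans (mul_le_mul_of_nonneg_left ?_ hD)
  simpa using hw.rpow_le_bound hδ j t x

theorem Waves.summable (hR : Waves κ D l w R) (hw : Bumps δ lam B w) (hδ : δ ≤ 1) (hD : 0 ≤ D)
    (t : ℝ) (x : Space d) : Summable fun j => R j t x :=
  Summable.of_norm_bounded (hw.summable_bound.mul_left D) fun j => hR.norm_le_bound hw hδ hD j t x

theorem Waves.continuous_tsum (hR : Waves κ D l w R) (hw : Bumps δ lam B w) (hδ : δ ≤ 1)
    (hD : 0 ≤ D) : Continuous fun z : ℝ × Space d => ∑' j, R j z.1 z.2 :=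
  _root_.continuous_tsum hR.continuous (hw.summable_bound.mul_left D) fun j z =>
    hR.norm_le_bound hw hδ hD j z.1 z.2

theorem Waves.norm_tsum_le (hR : Waves κ D l w R) (hw : Bumps δ lam B w) (hδ : δ ≤ 1) (hD : 0 ≤ D)
    (t : ℝ) (x : Space d) : ‖∑' j, R j t x‖ ≤ D * envelope δ w t x := by
  have hs1 : Summable fun k => w k t x := by
    simpa using hw.summable_rpow (y := 1) hδ t x
  refine (tsum_of_norm_bounded (hs1.mul_left D).hasSum fun j => hR.norm_le j t x).trans ?_
  rw [tsum_mul_left]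
  gcongr
  simpa using hw.tsum_rpow_le (y := 1) hδ t x

theorem Waves.norm_fderiv_le_bound (hR : Waves κ D l w R) (hw : Bumps δ lam B w) (hκ : δ ≤ κ)
    (hl : 0 ≤ l) (j : ℕ) (t : ℝ) (x : Space d) : ‖fderiv ℝ (R j t) x‖ ≤ l * B j :=
  (hR.norm_fderiv_le j t x).trans (mul_le_mul_of_nonneg_left (hw.rpow_le_bound hκ j t x) hl)

theorem Waves.hasFDerivAt_tsum (hR : Waves κ D l w R) (hw : Bumps δ lam B w) (hδ : δ ≤ 1)
    (hκ : δ ≤ κ) (hD : 0 ≤ D) (hl : 0 ≤ l) (t : ℝ) (x : Space d) :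
    HasFDerivAt (fun x => ∑' j, R j t x) (∑' j, fderiv ℝ (R j t) x) x :=
  _root_.hasFDerivAt_tsum (hw.summable_bound.mul_left l)
    (fun j y => (hR.differentiable j t y).hasFDerivAt)
    (fun j y => hR.norm_fderiv_le_bound hw hκ hl j t y) (hR.summable hw hδ hD t x) x

theorem Waves.norm_tsum_fderiv_le (hR : Waves κ D l w R) (hw : Bumps δ lam B w)
    (hκ : δ ≤ κ) (hl : 0 ≤ l) (t : ℝ) (x : Space d) :
    ‖∑' j, fderiv ℝ (R j t) x‖ ≤ l * envelope δ w t x ^ κ := by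
  refine (tsum_of_norm_bounded ((hw.summable_rpow hκ t x).mul_left l).hasSum
    fun j => hR.norm_fderiv_le j t x).trans ?_
  rw [tsum_mul_left]
  gcongr
  exact hw.tsum_rpow_le hκ t x

/-- A function on `ℝ^d` whose derivative is dominated by a power of the envelope. -/
theorem Bumps.norm_sub_le_of_fderiv_le (hw : Bumps δ lam B w) {F : Space d → ℂ}
    {F' : Space d → Space d →L[ℝ] ℂ} {t c M : ℝ} (hc : 0 ≤ c) (hM : 0 ≤ M)
    (hF : ∀ x, HasFDerivAt F (F' x) x) (hb : ∀ x, ‖F' x‖ ≤ c * envelope δ w t x ^ M)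
    (x h : Space d) (hh : ‖h‖ ≤ 1) :
    ‖F (x + h) - F x‖ ≤ c * 3 ^ M * envelope δ w t x ^ M * ‖h‖ := by
  have hV := hw.envelope_pos t
  have := (convex_segment x (x + h)).norm_image_sub_le_of_norm_hasFDerivWithin_le
    (f := F) (f' := F') (C := c * 3 ^ M * envelope δ w t x ^ M)
    (fun y _ => (hF y).hasFDerivWithinAt) (fun y hy => ?_)
    (left_mem_segment ℝ x (x + h)) (right_mem_segment ℝ x (x + h))
  · simpa using this
  · rw [segment_eq_image'] at hy
    obtain ⟨θ, hθ, rfl⟩ := hy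
    have h1 : ‖θ • (x + h - x)‖ ≤ 1 := by
      rw [add_sub_cancel_left, norm_smul, Real.norm_of_nonneg hθ.1]
      calc θ * ‖h‖ ≤ 1 * 1 := by
            gcongr
            exact hθ.2
        _ = 1 := one_mul 1
    refine (hb _).trans ?_
    rw [mul_assoc]
    gcongr
    rw [← Real.mul_rpow (by norm_num) (hV x).le]
    exact Real.rpow_le_rpow (hV _).le (hw.envelope_shift t x _ h1) hM

/-- The interaction error `f(∑ R_j) - ∑ f(R_j)`. -/
def interactionError (g : ℝ → ℝ) (R : ℕ → ℝ → Space d → ℂ) (t : ℝ) (x : Space d) : ℂ :=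
  nonlin g (∑' j, R j t x) - ∑' j, nonlin g (R j t x)

variable {M C α : ℝ}

theorem Waves.norm_le_D (hR : Waves κ D l w R) (hw : Bumps δ lam B w) (hD : 0 ≤ D)
    (j : ℕ) (t : ℝ) (x : Space d) : ‖R j t x‖ ≤ D := by
  refine (hR.norm_le j t x).trans ?_
  have h1 := hw.le_envelope j t x
  have h2 := hw.envelope_le_one t x
  have := hw.pos j t x
  nlinarith

theorem Waves.norm_tsum_le_D (hR : Waves κ D l w R) (hw : Bumps δ lam B w) (hδ : δ ≤ 1)
    (hD : 0 ≤ D) (t : ℝ) (x : Space d) : ‖∑' j, R j t x‖ ≤ D := by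
  refine (hR.norm_tsum_le hw hδ hD t x).trans ?_
  have h2 := hw.envelope_le_one t x
  nlinarith

theorem Waves.norm_nonlin_le (hR : Waves κ D l w R) (hw : Bumps δ lam B w) (hδ : δ ≤ 1)
    (hD : 0 ≤ D) (hC : 0 ≤ C) (hα : 0 ≤ α) (hB : NonlinBounds g α M C) (hDM : D ≤ M) (j : ℕ) (t : ℝ)
    (x : Space d) : ‖nonlin g (R j t x)‖ ≤ C * D ^ α * (D * B j) := by
  have h1 := hR.norm_le_D hw hD j t x
  rw [nonlin, norm_mul, Complex.norm_real, Real.norm_eq_abs]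
  have h2 := hB.abs_le _ (h1.trans hDM)
  have h3 := hR.norm_le_bound hw hδ hD j t x
  have h4 : ‖R j t x‖ ^ α ≤ D ^ α := by gcongr
  exact mul_le_mul (h2.trans (by gcongr)) h3 (norm_nonneg _) (by positivity)

theorem Waves.summable_nonlin (hR : Waves κ D l w R) (hw : Bumps δ lam B w) (hδ : δ ≤ 1)
    (hD : 0 ≤ D) (hC : 0 ≤ C) (hα : 0 ≤ α) (hB : NonlinBounds g α M C) (hDM : D ≤ M) (t : ℝ)
    (x : Space d) : Summable fun j => nonlin g (R j t x) :=
  Summable.of_norm_bounded ((hw.summable_bound.mul_left D).mul_left (C * D ^ α)) fun j =>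
    hR.norm_nonlin_le hw hδ hD hC hα hB hDM j t x

theorem Waves.continuous_interactionError (hF : AssumptionF d g C₀ α₁ α₂) (hR : Waves κ D l w R)
    (hw : Bumps δ lam B w) (hδ : δ ≤ 1)
    (hD : 0 ≤ D) (hC : 0 ≤ C) (hα : 0 ≤ α) (hB : NonlinBounds g α M C) (hDM : D ≤ M) :
    Continuous fun z : ℝ × Space d => interactionError g R z.1 z.2 :=
  (hF.continuous_nonlin.comp (hR.continuous_tsum hw hδ hD)).sub
    (_root_.continuous_tsum (fun j => hF.continuous_nonlin.comp (hR.continuous j))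
      ((hw.summable_bound.mul_left D).mul_left (C * D ^ α)) fun j z =>
        hR.norm_nonlin_le hw hδ hD hC hα hB hDM j z.1 z.2)

/-- The Hölder exponent `2δ` converts the smallness of `T - R_j` into the full factor `e^{-λt}`. The
price is the singular weight `w_j^{-δ}`, later absorbed by the accompanying factor `R_j` or its
derivative. -/
theorem Waves.interaction_term_le (hR : Waves κ D l w R) (hw : Bumps δ lam B w) (hδ : δ ≤ 1 / 2)
    (hδα : 2 * δ ≤ α) (hD : 0 ≤ D) (hC : 0 ≤ C) {t : ℝ} (ht : 0 ≤ t) (x : Space d) (j : ℕ) :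
    C * ((‖∑' k, R k t x‖ + ‖R j t x‖) ^ (α - 2 * δ) * ‖(∑' k, R k t x) - R j t x‖ ^ (2 * δ)) ≤
      C * ((2 * D) ^ (α - 2 * δ) * D ^ (2 * δ)) * Real.exp (-(lam * t)) *
        envelope δ w t x ^ (α - δ) * w j t x ^ (-δ) := by
  have hV := hw.envelope_pos t x
  have h1 := hw.norm_tsum_sub_le hδ hD ht (fun j => hR.norm_le j t x) j
  have h2 : ‖∑' k, R k t x‖ + ‖R j t x‖ ≤ 2 * D * envelope δ w t x := by
    have e1 := hR.norm_tsum_le hw (by linarith) hD t x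
    have e2 := (hR.norm_le j t x).trans (mul_le_mul_of_nonneg_left (hw.le_envelope j t x) hD)
    linarith
  calc _ ≤ C * ((2 * D * envelope δ w t x) ^ (α - 2 * δ) * (D ^ (2 * δ) * Real.exp (-(lam * t)) *
        envelope δ w t x ^ δ * w j t x ^ (-δ))) := by
        have := hw.pos j t x
        gcongr
    _ = C * ((2 * D) ^ (α - 2 * δ) * D ^ (2 * δ)) * Real.exp (-(lam * t)) *
        (envelope δ w t x ^ (α - 2 * δ) * envelope δ w t x ^ δ) * w j t x ^ (-δ) := by
        rw [Real.mul_rpow (by positivity) hV.le]; ring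
    _ = _ := by rw [← Real.rpow_add hV]; ring_nf

/-- With `y ≥ 2δ`, after absorbing `w_j^{-δ}` there remains a power at least `δ`, which is the
condition for summing against the envelope. -/
theorem Waves.tsum_interaction_le (hw : Bumps δ lam B w) {E : Type*}
    [NormedAddCommGroup E] {t : ℝ} {x : Space d} {a : ℕ → E} {c y : ℝ} (hc : 0 ≤ c) (hy : 2 * δ ≤ y)
    (ha : ∀ j, ‖a j‖ ≤ c * envelope δ w t x ^ (α - δ) * w j t x ^ (-δ) * w j t x ^ y) :
    ‖∑' j, a j‖ ≤ c * envelope δ w t x ^ (α + y - 2 * δ) := by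
  have hV := hw.envelope_pos t x
  have hy' : δ ≤ y - δ := by linarith
  refine (tsum_of_norm_bounded
    ((hw.summable_rpow hy' t x).mul_left (c * envelope δ w t x ^ (α - δ))).hasSum
    fun j => (ha j).trans (le_of_eq ?_)).trans ?_
  · rw [mul_assoc (c * _), ← Real.rpow_add (hw.pos j t x)]
    ring_nf
  · rw [tsum_mul_left]
    calc _ ≤ c * envelope δ w t x ^ (α - δ) * envelope δ w t x ^ (y - δ) := by
          gcongr
          exact hw.tsum_rpow_le hy' t x
      _ = _ := by
          rw [mul_assoc, ← Real.rpow_add hV]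
          ring_nf

theorem Waves.norm_interactionError_le (hR : Waves κ D l w R) (hw : Bumps δ lam B w)
    (hδ : δ ≤ 1 / 2) (hδα : 2 * δ ≤ α) (hD : 0 ≤ D) (hC : 0 ≤ C) (hB : NonlinBounds g α M C)
    (hDM : D ≤ M) {t : ℝ} (ht : 0 ≤ t) (x : Space d) :
    ‖interactionError g R t x‖ ≤
      C * ((2 * D) ^ (α - 2 * δ) * D ^ (2 * δ)) * D * Real.exp (-(lam * t)) *
        envelope δ w t x ^ (α + 1 - 2 * δ) := by
  have hδ0 := hw.exponent_pos
  have hs := hR.summable hw (by linarith) hD t x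
  have hsn := hR.summable_nonlin hw (by linarith) hD hC (by linarith) hB hDM t x
  set S := ∑' k, R k t x with hS
  -- The structure `f(z) = g(|z|²) z` lets `f(∑ R_j)` be distributed over the solitons, so that each
  -- term compares `g` at `T` and at `R_j` only.
  have e : interactionError g R t x =
      ∑' j, ((g (‖S‖ ^ 2) - g (‖R j t x‖ ^ 2) : ℝ) : ℂ) * R j t x := by
    rw [interactionError, ← hS]
    have h1 : nonlin g S = ∑' j, (g (‖S‖ ^ 2) : ℂ) * R j t x := by rw [tsum_mul_left, nonlin, ← hS]
    rw [h1, ← Summable.tsum_sub (hs.mul_left _) hsn]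
    refine tsum_congr fun j => ?_
    rw [nonlin]; push_cast; ring
  rw [e]
  refine Waves.tsum_interaction_le (α := α) (y := 1) hw (by positivity) (by linarith) fun j => ?_
  rw [norm_mul, Complex.norm_real, Real.norm_eq_abs]
  have h1 := hB.abs_sub_le (2 * δ) (by linarith) (by linarith) hδα S (R j t x)
    ((hR.norm_tsum_le_D hw (by linarith) hD t x).trans hDM)
    ((hR.norm_le_D hw hD j t x).trans hDM)
  have h2 := h1.trans (hR.interaction_term_le hw hδ hδα hD hC ht x j)
  have hV := hw.envelope_pos t x
  have hj := hw.pos j t x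
  calc _ ≤ (C * ((2 * D) ^ (α - 2 * δ) * D ^ (2 * δ)) * Real.exp (-(lam * t)) *
        envelope δ w t x ^ (α - δ) * w j t x ^ (-δ)) * (D * w j t x) :=
        mul_le_mul h2 (hR.norm_le j t x) (norm_nonneg _) (by positivity)
    _ = _ := by rw [Real.rpow_one]; ring

/-- Termwise differentiation, with `f'(T)∇R_j` paired against `f'(R_j)∇R_j`, keeps the cancellation
between `T` and `R_j` in the derivative. -/
theorem Waves.hasFDerivAt_interactionError (hF : AssumptionF d g C₀ α₁ α₂) (hR : Waves κ D l w R)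
    (hw : Bumps δ lam B w) (hδ : δ ≤ 1) (hκ : δ ≤ κ) (hD : 0 ≤ D) (hl : 0 ≤ l) (hC : 0 ≤ C)
    (hα : 0 ≤ α) (hB : NonlinBounds g α M C) (hDM : D ≤ M) (t : ℝ) (x : Space d) :
    HasFDerivAt (interactionError g R t)
      (∑' j, (dnonlin g (∑' k, R k t x) - dnonlin g (R j t x)).comp (fderiv ℝ (R j t) x)) x := by
  have hs := hR.summable hw hδ hD t x
  have hsn := hR.summable_nonlin hw hδ hD hC hα hB hDM t x
  have hb : ∀ j y, ‖(dnonlin g (R j t y)).comp (fderiv ℝ (R j t) y)‖ ≤ C * D ^ α * (l * B j) := by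
    intro j y
    refine (ContinuousLinearMap.opNorm_comp_le _ _).trans ?_
    have h1 := hR.norm_le_D hw hD j t y
    have h2 := hB.norm_dnonlin_le _ (h1.trans hDM)
    exact mul_le_mul (h2.trans (by gcongr)) (hR.norm_fderiv_le_bound hw hκ hl j t y)
      (norm_nonneg _) (by positivity)
  have hu := (hw.summable_bound.mul_left l).mul_left (C * D ^ α)
  have h2 := _root_.hasFDerivAt_tsum hu (fun j y =>
    (hF.hasFDerivAt_nonlin (R j t y)).comp y (hR.differentiable j t y).hasFDerivAt) hb hsn x
  have h1 := (hF.hasFDerivAt_nonlin (∑' k, R k t x)).comp x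
    (hR.hasFDerivAt_tsum hw hδ hκ hD hl t x)
  refine (h1.sub h2).congr_fderiv ?_
  have hsf : Summable fun j => fderiv ℝ (R j t) x :=
    Summable.of_norm_bounded (hw.summable_bound.mul_left l) fun j =>
      hR.norm_fderiv_le_bound hw hκ hl j t x
  have e : (dnonlin g (∑' k, R k t x)).comp (∑' j, fderiv ℝ (R j t) x) =
      ∑' j, (dnonlin g (∑' k, R k t x)).comp (fderiv ℝ (R j t) x) :=
    ((ContinuousLinearMap.compL ℝ (Space d) ℂ ℂ) (dnonlin g (∑' k, R k t x))).map_tsum hsf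
  have hs1 : Summable fun j => (dnonlin g (∑' k, R k t x)).comp (fderiv ℝ (R j t) x) :=
    ((ContinuousLinearMap.compL ℝ (Space d) ℂ ℂ) (dnonlin g (∑' k, R k t x))).summable hsf
  rw [e, ← Summable.tsum_sub hs1 (Summable.of_norm_bounded hu fun j => hb j x)]
  refine tsum_congr fun j => ?_
  rw [ContinuousLinearMap.sub_comp]

theorem Waves.norm_fderiv_interactionError_le (hR : Waves κ D l w R) (hw : Bumps δ lam B w)
    (hδ : δ ≤ 1 / 2) (hδα : 2 * δ ≤ α) (hκ : 2 * δ ≤ κ) (hD : 0 ≤ D) (hl : 0 ≤ l) (hC : 0 ≤ C)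
    (hB : NonlinBounds g α M C) (hDM : D ≤ M) {t : ℝ} (ht : 0 ≤ t) (x : Space d) :
    ‖∑' j, (dnonlin g (∑' k, R k t x) - dnonlin g (R j t x)).comp (fderiv ℝ (R j t) x)‖ ≤
      C * ((2 * D) ^ (α - 2 * δ) * D ^ (2 * δ)) * l * Real.exp (-(lam * t)) *
        envelope δ w t x ^ (α + κ - 2 * δ) := by
  have hδ0 := hw.exponent_pos
  refine Waves.tsum_interaction_le (α := α) hw (by positivity) hκ fun j => ?_
  refine (ContinuousLinearMap.opNorm_comp_le _ _).trans ?_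
  have h1 := hB.norm_dnonlin_sub_le (2 * δ) (by linarith) (by linarith) hδα
    (∑' k, R k t x) (R j t x) ((hR.norm_tsum_le_D hw (by linarith) hD t x).trans hDM)
    ((hR.norm_le_D hw hD j t x).trans hDM)
  have h2 := h1.trans (hR.interaction_term_le hw hδ hδα hD hC ht x j)
  have hV := hw.envelope_pos t x
  have hj := hw.pos j t x
  calc _ ≤ (C * ((2 * D) ^ (α - 2 * δ) * D ^ (2 * δ)) * Real.exp (-(lam * t)) *
        envelope δ w t x ^ (α - δ) * w j t x ^ (-δ)) * (l * w j t x ^ κ) :=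
        mul_le_mul h2 (hR.norm_fderiv_le j t x) (norm_nonneg _) (by positivity)
    _ = _ := by ring

end Waves

end

end SolitonTrain

/-! ### From waves and bumps to the background estimates. -/

namespace SolitonTrain

noncomputable section

variable {d : ℕ} {g : ℝ → ℝ} {C₀ α₁ α₂ : ℝ}

section Background

variable {δ lam κ D l : ℝ} {B : ℕ → ℝ} {w : ℕ → ℝ → Space d → ℝ} {R : ℕ → ℝ → Space d → ℂ}
  {M C α β : ℝ}

theorem Bumps.continuous_envelope_apply (hw : Bumps δ lam B w) (t : ℝ) :
    Continuous (envelope δ w t) := hw.continuous_envelope.comp (Continuous.prodMk_right t)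

theorem Bumps.aestronglyMeasurable_envelope_rpow (hw : Bumps δ lam B w) (t y : ℝ) :
    AEStronglyMeasurable (fun x => envelope δ w t x ^ y) volume :=
  ((hw.continuous_envelope_apply t).rpow_const
    fun x => Or.inl (hw.envelope_pos t x).ne').aestronglyMeasurable

/-- The background structure of a sum of waves whose envelope has small norms. -/
theorem Waves.background (hF : AssumptionF d g C₀ α₁ α₂) (hR : Waves κ D l w R)
    (hw : Bumps δ lam B w) (hδ : δ ≤ 1 / 2) (hδα : 2 * δ ≤ α) (hδκ : 2 * δ ≤ κ) (hD : 0 < D)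
    (hl : 0 < l) (hC : 0 < C) (hB : NonlinBounds g α M C) (hDM : D ≤ M)
    (hα : ∀ t b, b = 0 ∨ b = β → eLpNorm (fun x => envelope δ w t x ^ α) (lexp b) volume ≤ 1)
    (hmid : ∀ t b, b = 0 ∨ b = β → eLpNorm (fun x => envelope δ w t x ^ (α - β + κ))
      (lexp (1 + b - β)) volume ≤ ENNReal.ofReal (l * 3 ^ κ)⁻¹)
    (hlow : ∀ t b, b = 0 ∨ b = β → eLpNorm (fun x => envelope δ w t x ^ κ)
      (lexp (1 + b - min α (1 + b))) volume ≤ ENNReal.ofReal (l * 3 ^ κ)⁻¹)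
    (hH : ∀ t, eLpNorm (fun x => envelope δ w t x ^ (α + 1 - 2 * δ)) 2 volume ≤
      ENNReal.ofReal (C * ((2 * D) ^ (α - 2 * δ) * D ^ (2 * δ)) * D)⁻¹)
    (hH' : ∀ t b, b = 0 ∨ b = β →
      eLpNorm (fun x => envelope δ w t x ^ (α + κ - 2 * δ)) (lexp (1 + b)) volume ≤
        ENNReal.ofReal
          (C * ((2 * D) ^ (α - 2 * δ) * D ^ (2 * δ)) * l * 3 ^ (α + κ - 2 * δ))⁻¹) :
    Background α κ β D lam (l * 3 ^ κ) (fun t x => ∑' j, R j t x) (interactionError g R)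
      (envelope δ w) where
  continuous_T := hR.continuous_tsum hw (by linarith) hD.le
  continuous_H := hR.continuous_interactionError hF hw (by linarith) hD.le hC.le
    (by linarith [hw.exponent_pos]) hB hDM
  continuous_V := hw.continuous_envelope_apply
  V_nonneg t x := (hw.envelope_pos t x).le
  V_le_one := hw.envelope_le_one
  V_shift := hw.envelope_shift
  T_le := hR.norm_tsum_le hw (by linarith) hD.le
  T_diff t x h hh := by
    have hδ0 := hw.exponent_pos
    have := hw.norm_sub_le_of_fderiv_le hl.le (by linarith)
      (hR.hasFDerivAt_tsum hw (by linarith) (by linarith) hD.le hl.le t)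
      (hR.norm_tsum_fderiv_le hw (by linarith) hl.le t) x h hh
    refine this.trans (le_of_eq (by ring))
  norm_V_alpha := hα
  norm_V_mid := hmid
  norm_V_low := hlow
  norm_H t ht := by
    set c := C * ((2 * D) ^ (α - 2 * δ) * D ^ (2 * δ)) * D with hc
    have hc0 : 0 < c := by positivity
    refine (eLpNorm_mono_real (g := fun x => c * Real.exp (-(lam * t)) *
      envelope δ w t x ^ (α + 1 - 2 * δ)) fun x =>
        hR.norm_interactionError_le hw hδ hδα hD.le hC.le hB hDM ht x).trans ?_
    refine (eLpNorm_const_mul_le_ofReal (by positivity) (hH t)).trans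
      (ENNReal.ofReal_le_ofReal (le_of_eq ?_))
    field_simp
  norm_H_diff t ht b hb h hh := by
    have hδ0 := hw.exponent_pos
    set c := C * ((2 * D) ^ (α - 2 * δ) * D ^ (2 * δ)) with hc
    have hc0 : 0 < c := by positivity
    have hpt : ∀ x, ‖interactionError g R t (x + h) - interactionError g R t x‖ ≤
        (c * l * Real.exp (-(lam * t)) * 3 ^ (α + κ - 2 * δ) * ‖h‖) *
          envelope δ w t x ^ (α + κ - 2 * δ) := by
      intro x
      have := hw.norm_sub_le_of_fderiv_le (by positivity) (by linarith)
        (hR.hasFDerivAt_interactionError hF hw (by linarith) (by linarith) hD.le hl.le hC.le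
          (by linarith) hB hDM t)
        (hR.norm_fderiv_interactionError_le hw hδ hδα hδκ hD.le hl.le hC.le hB hDM ht) x h hh
      exact this.trans (le_of_eq (by ring))
    refine (eLpNorm_mono_real hpt).trans ?_
    refine (eLpNorm_const_mul_le_ofReal (by positivity) (hH' t b hb)).trans
      (ENNReal.ofReal_le_ofReal (le_of_eq ?_))
    field_simp
  tendsto_H t ht := by
    have hδ0 := hw.exponent_pos
    set c := C * ((2 * D) ^ (α - 2 * δ) * D ^ (2 * δ)) * D with hc
    have hc0 : 0 < c := by positivity
    obtain ⟨Q, hQ, hQt⟩ := hw.envelope_time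
    have hHc := hR.continuous_interactionError hF hw (by linarith) hD.le hC.le
      (by linarith) hB hDM
    set M' := α + 1 - 2 * δ with hM'
    have hM0 : 0 ≤ M' := by linarith
    -- The comparability of envelopes at times at distance at most one provides a single square
    -- integrable majorant for all nearby times.
    have hbd : ∀ s, 0 ≤ s → |s - t| ≤ 1 → ∀ x, ‖interactionError g R s x‖ ≤
        (c * Real.exp (|lam| * (t + 1)) * Q ^ M') * envelope δ w t x ^ M' := by
      intro s hs hst x
      refine (hR.norm_interactionError_le hw hδ hδα hD.le hC.le hB hDM hs x).trans ?_
      have e1 : Real.exp (-(lam * s)) ≤ Real.exp (|lam| * (t + 1)) := by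
        gcongr
        have h1 := neg_abs_le lam
        have h2 := (abs_le.1 hst).2
        nlinarith [abs_nonneg lam]
      have e2 : envelope δ w s x ^ M' ≤ Q ^ M' * envelope δ w t x ^ M' := by
        rw [← Real.mul_rpow hQ.le (hw.envelope_pos t x).le]
        exact Real.rpow_le_rpow (hw.envelope_pos s x).le (hQt s t x hst) hM0
      calc _ ≤ c * Real.exp (|lam| * (t + 1)) * (Q ^ M' * envelope δ w t x ^ M') := by
            have := hw.envelope_pos s x
            gcongr
        _ = _ := by ring
    set b := c * Real.exp (|lam| * (t + 1)) * Q ^ M' with hb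
    have hmem : MemLp (fun x => envelope δ w t x ^ M') 2 volume :=
      ⟨hw.aestronglyMeasurable_envelope_rpow t M', (hH t).trans_lt ENNReal.ofReal_lt_top⟩
    have hHm : ∀ s, AEStronglyMeasurable (interactionError g R s) volume := fun s =>
      (hHc.comp (Continuous.prodMk_right s)).aestronglyMeasurable
    refine tendsto_eLpNorm_two_of_dominated (B := fun x => (2 * b) * envelope δ w t x ^ M')
      (hmem.const_mul _) (Eventually.of_forall hHm) (hHm t) ?_ (Eventually.of_forall fun x => ?_)
    · have h1 : ∀ᶠ s in 𝓝[Set.Ici 0] t, |s - t| ≤ 1 := by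
        refine eventually_nhdsWithin_of_eventually_nhds ?_
        filter_upwards [Metric.closedBall_mem_nhds t one_pos] with s hs
        rwa [Metric.mem_closedBall, Real.dist_eq] at hs
      filter_upwards [h1, eventually_mem_nhdsWithin] with s hs1 hs0
      refine Eventually.of_forall fun x => (norm_sub_le _ _).trans ?_
      have e1 := hbd s hs0 hs1 x
      have e2 := hbd t ht (by simp) x
      linarith
    · exact ((hHc.comp (Continuous.prodMk_left x)).tendsto t).mono_left nhdsWithin_le_nhds

end Background

end

end SolitonTrain

/-! ### Explicit travelling bumps with geometric frequencies. -/

namespace SolitonTrain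

noncomputable section

variable {d : ℕ}

theorem integrable_exp_neg_mul_norm {c : ℝ} (hc : 0 < c) :
    Integrable (fun x : Space d => Real.exp (-(c * ‖x‖))) volume := by
  set n := d + 1 with hn
  have h1 : Integrable (fun x : Space d => (1 + ‖x‖) ^ (-(n : ℝ))) volume :=
    integrable_one_add_norm (by simp [hn])
  refine (h1.const_mul ((n.factorial : ℝ) / c ^ n * Real.exp c)).mono'
    (by fun_prop : Continuous fun x : Space d => Real.exp (-(c * ‖x‖))).aestronglyMeasurable
    (Eventually.of_forall fun x => ?_)
  rw [Real.norm_of_nonneg (Real.exp_pos _).le]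
  have hx := norm_nonneg x
  have h2 := Real.pow_div_factorial_le_exp (c * (1 + ‖x‖)) (by positivity) n
  have hf : (0 : ℝ) < n.factorial := by positivity
  rw [div_le_iff₀ hf, mul_pow, mul_add, mul_one, Real.exp_add] at h2
  rw [Real.rpow_neg (by positivity), Real.rpow_natCast, Real.exp_neg, ← div_eq_mul_inv,
    inv_eq_one_div, div_le_div_iff₀ (Real.exp_pos _) (by positivity)]
  have hcn : 0 < c ^ n := by positivity
  have h3 : (1 + ‖x‖) ^ n ≤ Real.exp c * Real.exp (c * ‖x‖) * n.factorial / c ^ n := by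
    rw [le_div_iff₀ hcn]; linarith
  rw [one_mul]
  exact h3.trans (le_of_eq (by ring))

/-- Translation invariance and the scaling `x ↦ μ x` reduce to a fixed exponential; its `L^{2/b}`
norm scales like `μ^{-db/2}`. -/
theorem exists_eLpNorm_exp_le {k b : ℝ} (hk : 0 < k) (hb : 0 ≤ b) :
    ∃ c : ℝ, 0 < c ∧ ∀ (μ : ℝ) (y : Space d), 0 < μ →
      eLpNorm (fun x : Space d => Real.exp (-(k * μ * ‖x - y‖))) (lexp b) volume ≤
        ENNReal.ofReal (c * μ ^ (-(d * b / 2))) := by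
  have htr : ∀ (μ : ℝ) (y : Space d) (p : ℝ≥0∞),
      eLpNorm (fun x : Space d => Real.exp (-(k * μ * ‖x - y‖))) p volume =
        eLpNorm (fun x : Space d => Real.exp (-(k * μ * ‖x‖))) p volume := by
    intro μ y p
    exact eLpNorm_comp_measurePreserving (g := fun x : Space d => Real.exp (-(k * μ * ‖x‖)))
      (by fun_prop : Continuous fun x : Space d => Real.exp (-(k * μ * ‖x‖))).aestronglyMeasurable
      (measurePreserving_sub_right volume y)
  rcases hb.eq_or_lt with rfl | hb
  · refine ⟨1, one_pos, fun μ y hμ => ?_⟩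
    rw [lexp_zero, eLpNorm_exponent_top]
    refine eLpNormEssSup_le_of_ae_bound (Eventually.of_forall fun x => ?_)
    rw [Real.norm_of_nonneg (Real.exp_pos _).le]
    simp only [mul_zero, zero_div, neg_zero, Real.rpow_zero, mul_one]
    exact Real.exp_le_one_iff.2 (by have := norm_nonneg (x - y); simp only [Left.neg_nonpos_iff]; positivity)
  · set q := 2 * k / b with hq
    have hq0 : 0 < q := by positivity
    set I := ∫ x : Space d, Real.exp (-(q * ‖x‖)) with hI
    have hI0 : 0 ≤ I := integral_nonneg fun x => (Real.exp_pos _).le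
    refine ⟨I ^ (b / 2) + 1, by positivity, fun μ y hμ => ?_⟩
    rw [htr]
    have e1 : (fun x : Space d => Real.exp (-(k * μ * ‖x‖))) =
        fun x : Space d => ‖Real.exp (-(q * μ * ‖x‖))‖ ^ (b / 2) := by
      ext x
      rw [Real.norm_of_nonneg (Real.exp_pos _).le, ← Real.exp_mul]
      congr 1
      rw [hq]; field_simp
    have e2 : lexp b = lexp (2 * (b / 2)) := by congr 1; ring
    rw [e1, e2, eLpNorm_rpow_lexp _ (by norm_num) (by positivity), lexp_two,
      eLpNorm_one_eq_lintegral_enorm]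
    have hint := integrable_exp_neg_mul_norm (d := d) (by positivity : 0 < q * μ)
    have e3 : ∫⁻ x : Space d, ‖Real.exp (-(q * μ * ‖x‖))‖ₑ =
        ENNReal.ofReal (∫ x : Space d, Real.exp (-(q * μ * ‖x‖))) := by
      rw [ofReal_integral_eq_lintegral_ofReal hint
        (Eventually.of_forall fun x => (Real.exp_pos _).le)]
      refine lintegral_congr fun x => ?_
      rw [Real.enorm_of_nonneg (Real.exp_pos _).le]
    have e4 : ∫ x : Space d, Real.exp (-(q * μ * ‖x‖)) = μ ^ (-(d : ℝ)) * I := by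
      have := Measure.integral_comp_smul (volume : Measure (Space d))
        (fun x : Space d => Real.exp (-(q * ‖x‖))) μ
      simp only [norm_smul, Real.norm_of_nonneg hμ.le, finrank_euclideanSpace, Fintype.card_fin,
        smul_eq_mul, ← mul_assoc] at this
      rw [this, abs_of_nonneg (by positivity), Real.rpow_neg hμ.le, Real.rpow_natCast]
    rw [e3, e4, ENNReal.ofReal_rpow_of_nonneg (by positivity) (by positivity)]
    refine ENNReal.ofReal_le_ofReal ?_
    rw [Real.mul_rpow (by positivity) hI0, ← Real.rpow_mul hμ.le, mul_comm]
    have e5 : -(d : ℝ) * (b / 2) = -(d * b / 2) := by ring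
    rw [e5]
    gcongr
    linarith

/-- The square roots of the frequencies. -/
def rootFreq (e : ℝ) (j : ℕ) : ℝ := e * (1 / 2) ^ j

/-- The profile of a travelling soliton of frequency `μ_j²`. -/
def bump (α a e Λ : ℝ) (n : Space d) (j : ℕ) (t : ℝ) (x : Space d) : ℝ :=
  rootFreq e j ^ (2 / α) *
    Real.exp (-(a * rootFreq e j * ‖x - (t * (Λ / rootFreq e j)) • n‖))

section Bump

variable {α a e Λ δ : ℝ} {n : Space d}

theorem rootFreq_pos (he : 0 < e) (j : ℕ) : 0 < rootFreq e j := by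
  unfold rootFreq; positivity

theorem rootFreq_le (he : 0 < e) (j : ℕ) : rootFreq e j ≤ e := by
  have : (1 / 2 : ℝ) ^ j ≤ 1 := pow_le_one₀ (by norm_num) (by norm_num)
  unfold rootFreq
  nlinarith

theorem rootFreq_le_half (he : 0 < e) {j k : ℕ} (hjk : j < k) :
    rootFreq e k ≤ rootFreq e j / 2 := by
  have : (1 / 2 : ℝ) ^ k ≤ (1 / 2) ^ (j + 1) :=
    pow_le_pow_of_le_one (by norm_num) (by norm_num) hjk
  rw [pow_succ] at this
  unfold rootFreq
  nlinarith

theorem rootFreq_rpow (he : 0 < e) (s : ℝ) (j : ℕ) :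
    rootFreq e j ^ s = e ^ s * ((1 / 2 : ℝ) ^ s) ^ j := by
  rw [rootFreq, Real.mul_rpow he.le (by positivity), ← Real.rpow_natCast, ← Real.rpow_natCast,
    ← Real.rpow_mul (by norm_num), ← Real.rpow_mul (by norm_num), mul_comm (j : ℝ)]

theorem half_rpow_lt_one {s : ℝ} (hs : 0 < s) : (1 / 2 : ℝ) ^ s < 1 :=
  Real.rpow_lt_one (by norm_num) (by norm_num) hs

theorem hasSum_rootFreq_rpow (he : 0 < e) {s : ℝ} (hs : 0 < s) :
    HasSum (fun j => rootFreq e j ^ s) (e ^ s * (1 - (1 / 2 : ℝ) ^ s)⁻¹) := by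
  simp only [rootFreq_rpow he]
  exact (hasSum_geometric_of_lt_one (by positivity) (half_rpow_lt_one hs)).mul_left _

theorem bump_pos (he : 0 < e) (j : ℕ) (t : ℝ) (x : Space d) : 0 < bump α a e Λ n j t x := by
  have := rootFreq_pos he j
  unfold bump
  positivity

theorem bump_rpow (he : 0 < e) (s : ℝ) (j : ℕ) (t : ℝ) (x : Space d) :
    bump α a e Λ n j t x ^ s = rootFreq e j ^ (2 / α * s) *
      Real.exp (-(a * s * rootFreq e j * ‖x - (t * (Λ / rootFreq e j)) • n‖)) := by
  have := rootFreq_pos he j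
  rw [bump, Real.mul_rpow (by positivity) (Real.exp_pos _).le, ← Real.rpow_mul this.le,
    ← Real.exp_mul]
  ring_nf

theorem bump_rpow_le (he : 0 < e) (ha : 0 ≤ a) {s : ℝ} (hs : 0 ≤ s) (j : ℕ) (t : ℝ) (x : Space d) :
    bump α a e Λ n j t x ^ s ≤ rootFreq e j ^ (2 / α * s) := by
  have := rootFreq_pos he j
  rw [bump_rpow he]
  refine mul_le_of_le_one_right (by positivity) (Real.exp_le_one_iff.2 ?_)
  simp only [Left.neg_nonpos_iff]
  positivity

theorem bump_le_mul (he : 0 < e) (ha : 0 ≤ a) {j : ℕ} {s t q : ℝ} {x y : Space d}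
    (h : rootFreq e j * ‖(y - (t * (Λ / rootFreq e j)) • n) - (x - (s * (Λ / rootFreq e j)) • n)‖ ≤ q) :
    bump α a e Λ n j s x ≤ Real.exp (a * q) * bump α a e Λ n j t y := by
  have hμ := rootFreq_pos he j
  have h1 := norm_sub_norm_le (y - (t * (Λ / rootFreq e j)) • n) (x - (s * (Λ / rootFreq e j)) • n)
  rw [bump, bump, mul_left_comm, ← Real.exp_add]
  gcongr
  set A := ‖y - (t * (Λ / rootFreq e j)) • n‖
  set B := ‖x - (s * (Λ / rootFreq e j)) • n‖
  have h2 : rootFreq e j * (A - B) ≤ q := (mul_le_mul_of_nonneg_left h1 hμ.le).trans h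
  have h3 := mul_le_mul_of_nonneg_left h2 ha
  nlinarith

/-- The centres are at distance `tΛ(1/ν - 1/μ)` with `ν ≤ μ/2`. Multiplied by the smaller root
frequency `ν` this is at least `tΛ/2`. Velocities inversely proportional to root frequencies thus
give a rate independent of the pair, although the widths are unbounded. -/
theorem bump_mul_le (he : 0 < e) (he1 : e ≤ 1) (hα : 0 < α) (ha : 0 ≤ a) (hΛ : 0 ≤ Λ) (hn : ‖n‖ = 1)
    {j k : ℕ} (hjk : j < k) {t : ℝ} (ht : 0 ≤ t) (x : Space d) :
    bump α a e Λ n j t x * bump α a e Λ n k t x ≤ Real.exp (-(a * Λ * t / 2)) := by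
  have hj := rootFreq_pos he j
  have hk := rootFreq_pos he k
  have hkj := rootFreq_le_half he hjk
  have h1 : ∀ i, rootFreq e i ^ (2 / α) ≤ 1 := fun i =>
    Real.rpow_le_one (rootFreq_pos he i).le ((rootFreq_le he i).trans he1) (by positivity)
  set μ := rootFreq e j with hμ
  set ν := rootFreq e k with hν
  set A := ‖x - (t * (Λ / μ)) • n‖ with hA
  set B := ‖x - (t * (Λ / ν)) • n‖ with hB
  have h2 : t * Λ / 2 ≤ μ * A + ν * B := by
    have e1 : ‖(x - (t * (Λ / μ)) • n) - (x - (t * (Λ / ν)) • n)‖ ≤ A + B := norm_sub_le _ _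
    have e2 : (x - (t * (Λ / μ)) • n) - (x - (t * (Λ / ν)) • n) =
        (t * (Λ / ν) - t * (Λ / μ)) • n := by rw [sub_smul]; abel
    rw [e2, norm_smul, hn, mul_one, Real.norm_eq_abs] at e1
    have e3 := (le_abs_self _).trans e1
    have e4 : ν * (t * (Λ / ν) - t * (Λ / μ)) = t * Λ * (1 - ν / μ) := by field_simp
    have e5 : ν / μ ≤ 1 / 2 := by rw [div_le_iff₀ hj]; linarith
    have e6 := mul_le_mul_of_nonneg_left e3 hk.le
    rw [e4] at e6
    have e7 : ν * A ≤ μ * A := by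
      have : 0 ≤ A := norm_nonneg _
      gcongr
      linarith
    have e8 : t * Λ * (1 / 2) ≤ t * Λ * (1 - ν / μ) := by gcongr; linarith
    linarith
  have e9 : bump α a e Λ n j t x * bump α a e Λ n k t x =
      (μ ^ (2 / α) * ν ^ (2 / α)) * Real.exp (-(a * (μ * A + ν * B))) := by
    rw [bump, bump, show -(a * (μ * A + ν * B)) = -(a * μ * A) + -(a * ν * B) by ring, Real.exp_add]
    ring
  rw [e9]
  calc _ ≤ (1 * 1) * Real.exp (-(a * (t * Λ / 2))) := by
        gcongr
        · exact h1 j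
        · exact h1 k
    _ = _ := by ring_nf

theorem bumps_bump (he : 0 < e) (he1 : e ≤ 1) (hα : 0 < α) (ha : 0 < a) (ha1 : a ≤ 1) (hΛ : 0 ≤ Λ)
    (hn : ‖n‖ = 1) (hδ : 0 < δ) (hsum : ∑' j, rootFreq e j ^ (2 / α * δ) ≤ 1) :
    Bumps δ (a * Λ / 2 * δ) (fun j => rootFreq e j ^ (2 / α * δ)) (bump α a e Λ n) where
  exponent_pos := hδ
  pos := bump_pos he
  le_bound := bump_rpow_le he ha.le hδ.le
  summable_bound := (hasSum_rootFreq_rpow he (by positivity)).summable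
  tsum_bound := hsum
  continuous j := by
    unfold bump
    fun_prop
  shift j t x h hh := by
    refine (bump_le_mul (q := 1) he ha.le (t := t) (y := x) ?_).trans ?_
    · have : (x - (t * (Λ / rootFreq e j)) • n) - (x + h - (t * (Λ / rootFreq e j)) • n) = -h := by
        abel
      rw [this, norm_neg]
      exact mul_le_one₀ ((rootFreq_le he j).trans he1) (norm_nonneg h) hh
    · have h1 : Real.exp (a * 1) ≤ 3 := by
        calc Real.exp (a * 1) ≤ Real.exp 1 := by gcongr; linarith
          _ ≤ 3 := by have := Real.exp_one_lt_d9; linarith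
      have := bump_pos (α := α) (a := a) (Λ := Λ) (n := n) he j t x
      gcongr
  time := by
    -- Root frequency times speed is `Λ` for every index, which makes the time comparison uniform in
    -- `j`.
    refine ⟨Real.exp (a * Λ), Real.exp_pos _, fun j s t x hst => bump_le_mul he ha.le ?_⟩
    have hμ := rootFreq_pos he j
    have : (x - (t * (Λ / rootFreq e j)) • n) - (x - (s * (Λ / rootFreq e j)) • n) =
        ((s - t) * (Λ / rootFreq e j)) • n := by rw [sub_mul, sub_smul]; abel
    rw [this, norm_smul, hn, mul_one, norm_mul, Real.norm_eq_abs, Real.norm_of_nonneg (by positivity)]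
    calc rootFreq e j * (|s - t| * (Λ / rootFreq e j)) = |s - t| * Λ := by field_simp
      _ ≤ 1 * Λ := by gcongr
      _ = Λ := one_mul Λ
  interaction := by
    have key : ∀ j k, j < k → ∀ t, 0 ≤ t → ∀ x,
        (bump α a e Λ n j t x * bump α a e Λ n k t x) ^ δ ≤ Real.exp (-(a * Λ / 2 * δ * t)) := by
      intro j k hjk t ht x
      have h0 := bump_pos (α := α) (a := a) (Λ := Λ) (n := n) he j t x
      have h1 := bump_pos (α := α) (a := a) (Λ := Λ) (n := n) he k t x
      calc _ ≤ Real.exp (-(a * Λ * t / 2)) ^ δ :=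
            Real.rpow_le_rpow (by positivity) (bump_mul_le he he1 hα ha.le hΛ hn hjk ht x) hδ.le
        _ = _ := by rw [← Real.exp_mul]; ring_nf
    intro j k hjk t ht x
    rcases lt_or_gt_of_ne hjk with h | h
    · exact key j k h t ht x
    · rw [mul_comm (bump α a e Λ n j t x)]
      exact key k j h t ht x

/-- Powers of the envelope of the bumps have small norms, for small frequencies. -/
theorem eventually_eLpNorm_envelope_le (hα : 0 < α) (ha : 0 < a) (hδ : 0 < δ) {c M τ : ℝ}
    (hc : 0 ≤ c) (hc2 : c ≤ 2) (hM : δ ≤ M) (hMc : d * c / 4 < M / α) (hτ : 0 < τ) :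
    ∀ᶠ e in 𝓝[>] (0 : ℝ), ∀ (Λ : ℝ) (n : Space d) (t : ℝ),
      eLpNorm (fun x => envelope δ (bump α a e Λ n) t x ^ M) (lexp c) volume ≤ ENNReal.ofReal τ := by
  have hM0 : 0 < M := hδ.trans_le hM
  -- `V^M` is the power `M/δ` of `∑ w_j^δ`, so its norm in `lexp c` is that power of the norm of the
  -- sum in `lexp b`.
  set b := c * δ / M with hb
  have hb0 : 0 ≤ b := by positivity
  have hb2 : b ≤ 2 := by
    rw [hb, div_le_iff₀ hM0]
    nlinarith
  obtain ⟨q, hq0, hq⟩ := exists_eLpNorm_exp_le (d := d) (k := a * δ) (by positivity) hb0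
  -- The norm of `w_j^δ` in `lexp b` is of order `μ_j^s`. Positivity of `s` is the hypothesis `d c/4
  -- < M/α` rewritten; it gives both summability over `j` and smallness as `e → 0`.
  set s := 2 / α * δ - d * b / 2 with hs
  have hs0 : 0 < s := by
    have : s = 2 * δ / M * (M / α - d * c / 4) := by rw [hs, hb]; field_simp; ring
    rw [this]
    have := sub_pos.2 hMc
    positivity
  set G := (1 - (1 / 2 : ℝ) ^ s)⁻¹ with hG
  have hG0 : 0 < G := inv_pos.2 (sub_pos.2 (half_rpow_lt_one hs0))
  have hlim : Tendsto (fun e : ℝ => (q * (e ^ s * G)) ^ (M / δ)) (𝓝[>] 0) (𝓝 0) := by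
    have h1 : Continuous fun e : ℝ => (q * (e ^ s * G)) ^ (M / δ) := by
      refine Continuous.rpow_const ?_ fun _ => Or.inr (by positivity)
      exact (((Real.continuous_rpow_const hs0.le)).mul_const G).const_mul q
    have h2 := h1.tendsto 0
    rw [Real.zero_rpow hs0.ne', zero_mul, mul_zero, Real.zero_rpow (by positivity)] at h2
    exact h2.mono_left nhdsWithin_le_nhds
  filter_upwards [hlim.eventually_le_const hτ, self_mem_nhdsWithin] with e he he0 Λ n t
  have he0 : 0 < e := he0
  have hsm : ∀ x, Summable fun j => bump α a e Λ n j t x ^ δ := fun x =>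
    Summable.of_nonneg_of_le (fun j => Real.rpow_nonneg (bump_pos he0 j t x).le _)
      (fun j => bump_rpow_le he0 ha.le hδ.le j t x)
      (hasSum_rootFreq_rpow he0 (by positivity)).summable
  have hpos : ∀ x, 0 ≤ ∑' j, bump α a e Λ n j t x ^ δ := fun x =>
    tsum_nonneg fun j => Real.rpow_nonneg (bump_pos he0 j t x).le _
  have h1 : eLpNorm (fun x => ∑' j, bump α a e Λ n j t x ^ δ) (lexp b) volume ≤
      ENNReal.ofReal (q * (e ^ s * G)) := by
    have hsum := (hasSum_rootFreq_rpow he0 hs0).mul_left q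
    rw [← hsum.tsum_eq]
    refine eLpNorm_tsum_le (one_le_lexp hb2) (fun j => ?_) hsum.summable (fun j => ?_) (fun j => ?_) hsm
    · have := rootFreq_pos he0 j
      positivity
    · have : Continuous fun x => bump α a e Λ n j t x ^ δ := by
        simp only [bump_rpow he0]
        fun_prop
      exact this.aestronglyMeasurable
    · have hμ := rootFreq_pos he0 j
      simp only [bump_rpow he0]
      refine (eLpNorm_const_mul_le_ofReal (by positivity) (hq (rootFreq e j) _ hμ)).trans
        (ENNReal.ofReal_le_ofReal (le_of_eq ?_))
      rw [mul_left_comm, ← Real.rpow_add hμ, hs]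
      ring_nf
  have e1 : (fun x => envelope δ (bump α a e Λ n) t x ^ M) =
      fun x => ‖∑' j, bump α a e Λ n j t x ^ δ‖ ^ (M / δ) := by
    ext x
    rw [Real.norm_of_nonneg (hpos x), envelope, ← Real.rpow_mul (hpos x)]
    ring_nf
  have e2 : lexp c = lexp (b * (M / δ)) := by
    congr 1
    rw [hb]; field_simp
  rw [e1, e2, eLpNorm_rpow_lexp _ hb0 (by positivity)]
  calc _ ≤ ENNReal.ofReal (q * (e ^ s * G)) ^ (M / δ) := by gcongr
    _ = ENNReal.ofReal ((q * (e ^ s * G)) ^ (M / δ)) :=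
      ENNReal.ofReal_rpow_of_nonneg (by positivity) (by positivity)
    _ ≤ _ := ENNReal.ofReal_le_ofReal he

end Bump

end

end SolitonTrain

/-! ### Choice of the soliton train for a given decay rate. -/

namespace SolitonTrain

noncomputable section

variable {d : ℕ} {g : ℝ → ℝ} {C₀ α₁ α₂ ωs a D : ℝ}

theorem rpow_of_sq {μ : ℝ} (hμ : 0 ≤ μ) (s : ℝ) : (μ ^ 2) ^ s = μ ^ (2 * s) := by
  rw [← Real.rpow_natCast, ← Real.rpow_mul hμ]; norm_num

theorem HasDecay.bounds {φ : Space d → ℝ} {μ : ℝ} (hφ : HasDecay d α₁ a D (μ ^ 2) φ) (hμ : 0 < μ)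
    (x : Space d) :
    |φ x| ≤ D * (μ ^ (2 / α₁) * Real.exp (-(a * μ * ‖x‖))) ∧
      ‖fderiv ℝ φ x‖ ≤ D * μ * (μ ^ (2 / α₁) * Real.exp (-(a * μ * ‖x‖))) := by
  have h := hφ x
  have hg : ‖gradient φ x‖ = ‖fderiv ℝ φ x‖ := by
    rw [gradient]; exact LinearIsometryEquiv.norm_map _ _
  rw [rpow_of_sq hμ.le, rpow_of_sq hμ.le, rpow_of_sq hμ.le, hg] at h
  have e1 : μ ^ (2 * -(1 / 2 : ℝ)) = μ⁻¹ := by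
    rw [show (2 * -(1 / 2 : ℝ)) = -1 by norm_num, Real.rpow_neg_one]
  have e2 : μ ^ (2 * (1 / 2 : ℝ)) = μ := by norm_num
  have e3 : μ ^ (2 * (1 / α₁)) = μ ^ (2 / α₁) := by congr 1; ring
  rw [e1, e2, e3] at h
  have h1 : 0 ≤ μ⁻¹ * ‖fderiv ℝ φ x‖ := by positivity
  have h2 := abs_nonneg (φ x)
  constructor
  · linarith
  · have h3 : μ⁻¹ * ‖fderiv ℝ φ x‖ ≤ D * (μ ^ (2 / α₁) * Real.exp (-(a * μ * ‖x‖))) := by linarith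
    rw [inv_mul_le_iff₀ hμ] at h3
    linarith

section Soliton

variable {φ : Space d → ℝ} {ω : ℝ} {v : Space d}

theorem norm_soliton (φ : Space d → ℝ) (ω : ℝ) (v x₀ : Space d) (γ t : ℝ) (x : Space d) :
    ‖soliton φ ω v x₀ γ t x‖ = |φ (x - x₀ - t • v)| := by
  rw [soliton, norm_mul, mul_comm Complex.I, Complex.norm_exp_ofReal_mul_I, one_mul,
    Complex.norm_real, Real.norm_eq_abs]

theorem continuous_soliton (hφ : Continuous φ) (ω : ℝ) (v x₀ : Space d) (γ : ℝ) :
    Continuous fun z : ℝ × Space d => soliton φ ω v x₀ γ z.1 z.2 := by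
  unfold soliton
  fun_prop

theorem hasFDerivAt_soliton (hφ : Differentiable ℝ φ) (ω : ℝ) (v x₀ : Space d) (γ t : ℝ)
    (x : Space d) : ∃ R' : Space d →L[ℝ] ℂ, HasFDerivAt (soliton φ ω v x₀ γ t) R' x ∧
      ‖R'‖ ≤ |φ (x - x₀ - t • v)| * (‖v‖ / 2) + ‖fderiv ℝ φ (x - x₀ - t • v)‖ := by
  set θ : Space d → ℝ := fun x => ω * t + (1 / 2) * inner ℝ v x - (1 / 4) * ‖v‖ ^ 2 * t + γ with hθ
  have h1 : HasFDerivAt θ ((1 / 2 : ℝ) • innerSL ℝ v) x := by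
    have := ((((innerSL ℝ v).hasFDerivAt (x := x)).const_mul (1 / 2)).const_add (ω * t)).sub_const
      ((1 / 4) * ‖v‖ ^ 2 * t) |>.add_const γ
    exact this
  have h2 := ((Complex.ofRealCLM.hasFDerivAt (x := θ x)).comp x h1).const_mul Complex.I
  have h3 := h2.cexp
  have h4 : HasFDerivAt (fun x => φ (x - x₀ - t • v)) (fderiv ℝ φ (x - x₀ - t • v)) x := by
    have h5 : HasFDerivAt (fun x : Space d => x - x₀ - t • v) (ContinuousLinearMap.id ℝ (Space d)) x :=
      ((hasFDerivAt_id x).sub_const x₀).sub_const (t • v)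
    exact (hφ _).hasFDerivAt.comp x h5
  have h6 := (Complex.ofRealCLM.hasFDerivAt (x := φ (x - x₀ - t • v))).comp x h4
  have h7 := h3.mul h6
  refine ⟨_, h7, ContinuousLinearMap.opNorm_le_bound _ (by positivity) fun k => ?_⟩
  have hexp : ‖Complex.exp (Complex.I * (θ x : ℂ))‖ = 1 := by
    rw [mul_comm, Complex.norm_exp_ofReal_mul_I]
  have hin : |inner ℝ v k| ≤ ‖v‖ * ‖k‖ := abs_real_inner_le_norm v k
  have hfd := (fderiv ℝ φ (x - x₀ - t • v)).le_opNorm k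
  simp only [Function.comp, Complex.ofRealCLM_apply, add_apply, smul_apply,
    ContinuousLinearMap.comp_apply, innerSL_apply_apply, smul_eq_mul]
  refine (norm_add_le _ _).trans ?_
  simp only [norm_mul, hexp, Complex.norm_real, Complex.norm_I, one_mul, Real.norm_eq_abs] at hfd ⊢
  have h8 : |(1 / 2 : ℝ)| = 1 / 2 := abs_of_pos (by norm_num)
  rw [h8]
  have h9 : |φ (x - x₀ - t • v)| * (1 / 2 * |inner ℝ v k|) ≤
      |φ (x - x₀ - t • v)| * (1 / 2 * (‖v‖ * ‖k‖)) := by gcongr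
  linarith

end Soliton

/-- The derivative of a soliton is at most `(|v|/2 + μ)` times its bump, with `|v| = Λ/μ`. The loss
`1/μ` lowers the power of the amplitude `μ^{2/α₁}` to `1 - α₁/2`; the exponential decay is weakened
accordingly. -/
theorem waves_soliton (hα : 0 < α₁) (ha : 0 ≤ a) (hD : 0 ≤ D) {e Λ : ℝ} (he : 0 < e)
    (he1 : e ≤ 1) (hΛ : 0 ≤ Λ) {n : Space d} (hn : ‖n‖ = 1) {φ : ℕ → Space d → ℝ}
    (hφ : ∀ j, Differentiable ℝ (φ j)) (hdec : ∀ j, HasDecay d α₁ a D (rootFreq e j ^ 2) (φ j)) :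
    Waves (1 - α₁ / 2) D (D * (1 + Λ)) (bump α₁ a e Λ n)
      (fun j => soliton (φ j) (rootFreq e j ^ 2) ((Λ / rootFreq e j) • n) 0 0) := by
  have hb : ∀ j t (x : Space d), x - 0 - t • ((Λ / rootFreq e j) • n) =
      x - (t * (Λ / rootFreq e j)) • n := fun j t x => by rw [sub_zero, smul_smul]
  have hfd : ∀ j t x, ∃ R' : Space d →L[ℝ] ℂ, HasFDerivAt
      (soliton (φ j) (rootFreq e j ^ 2) ((Λ / rootFreq e j) • n) 0 0 t) R' x ∧
      ‖R'‖ ≤ D * (1 + Λ) * bump α₁ a e Λ n j t x ^ (1 - α₁ / 2) := by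
    intro j t x
    obtain ⟨R', h1, h2⟩ := hasFDerivAt_soliton (hφ j) (rootFreq e j ^ 2)
      ((Λ / rootFreq e j) • n) 0 0 t x
    refine ⟨R', h1, h2.trans ?_⟩
    have hμ := rootFreq_pos he j
    have hμ1 := (rootFreq_le he j).trans he1
    obtain ⟨h3, h4⟩ := (hdec j).bounds hμ (x - 0 - t • ((Λ / rootFreq e j) • n))
    rw [bump_rpow he, norm_smul, hn, mul_one, Real.norm_of_nonneg (by positivity)]
    rw [hb] at h3 h4 ⊢
    set μ := rootFreq e j
    set z := ‖x - (t * (Λ / μ)) • n‖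
    have hz : 0 ≤ z := norm_nonneg _
    have e1 : μ ^ (2 / α₁ * (1 - α₁ / 2)) = μ ^ (2 / α₁) / μ := by
      rw [show 2 / α₁ * (1 - α₁ / 2) = 2 / α₁ - 1 by field_simp, Real.rpow_sub hμ, Real.rpow_one]
    have e2 : Real.exp (-(a * μ * z)) ≤ Real.exp (-(a * (1 - α₁ / 2) * μ * z)) := by
      gcongr
      nlinarith [mul_nonneg ha hα.le]
    rw [e1]
    set E := Real.exp (-(a * μ * z))
    have hE : 0 ≤ E := (Real.exp_pos _).le
    have e3 : μ ≤ 1 / μ := by rw [le_div_iff₀ hμ]; nlinarith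
    have hp : 0 ≤ D * (μ ^ (2 / α₁) * E) := by positivity
    calc _ ≤ D * (μ ^ (2 / α₁) * E) * (Λ / μ / 2) + D * μ * (μ ^ (2 / α₁) * E) := by gcongr
      _ = D * (μ ^ (2 / α₁) * E) * (Λ / μ / 2 + μ) := by ring
      _ ≤ D * (μ ^ (2 / α₁) * E) * (Λ / μ + 1 / μ) := by
          have : 0 ≤ Λ / μ := by positivity
          exact mul_le_mul_of_nonneg_left (by linarith) hp
      _ = D * (1 + Λ) * (μ ^ (2 / α₁) / μ * E) := by field_simp; ring
      _ ≤ _ := by gcongr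
  refine ⟨fun j => continuous_soliton (hφ j).continuous _ _ _ _, fun j t x => ?_,
    fun j t x => ?_, fun j t x => ?_⟩
  · rw [norm_soliton, hb]
    exact ((hdec j).bounds (rootFreq_pos he j) _).1
  · obtain ⟨R', h1, -⟩ := hfd j t x
    exact h1.differentiableAt
  · obtain ⟨R', h1, h2⟩ := hfd j t x
    rw [h1.fderiv]
    exact h2

theorem isTrainData_rootFreq (hα : 0 < α₁) {e Λ : ℝ} (he : 0 < e)
    (he1 : e ≤ 1) (heω : e < ωs) (hΛ : 0 < Λ) {n : Space d} (hn : ‖n‖ = 1) {φ : ℕ → Space d → ℝ}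
    (hφ : ∀ j, IsBoundState d g (rootFreq e j ^ 2) (φ j) ∧
      HasDecay d α₁ a D (rootFreq e j ^ 2) (φ j)) :
    IsTrainData d g α₁ ωs a D φ (fun j => rootFreq e j ^ 2) (fun j => (Λ / rootFreq e j) • n) where
  freq_pos j := pow_pos (rootFreq_pos he j) 2
  freq_lt j := by
    have h1 := rootFreq_pos he j
    have h2 := rootFreq_le he j
    nlinarith
  boundState j := (hφ j).1
  decay j := (hφ j).2
  summable := by
    have : (fun j => (rootFreq e j ^ 2) ^ (1 / α₁)) = fun j => rootFreq e j ^ (2 / α₁) := by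
      ext j
      rw [rpow_of_sq (rootFreq_pos he j).le]
      ring_nf
    rw [this]
    exact (hasSum_rootFreq_rpow he (by positivity)).summable
  separated := by
    -- For `j < k` the separation is at least `Λ(1 - μ_k/μ_j)/2`, and the ratio of root frequencies
    -- is at most one half.
    refine ⟨Λ / 4, by positivity, fun j k hjk => ?_⟩
    have hj := rootFreq_pos he j
    have hk := rootFreq_pos he k
    have hkj := rootFreq_le_half he hjk
    have hk1 := (rootFreq_le he k).trans he1
    have e1 : ∀ i, (rootFreq e i ^ 2) ^ (1 / 2 : ℝ) = rootFreq e i := fun i => by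
      rw [rpow_of_sq (rootFreq_pos he i).le]; norm_num
    rw [e1, e1, min_eq_right (by linarith : rootFreq e k ≤ rootFreq e j), min_eq_right hk1, ← sub_smul,
      norm_smul, hn, mul_one, Real.norm_eq_abs, abs_sub_comm]
    have e2 := le_abs_self (Λ / rootFreq e k - Λ / rootFreq e j)
    have e3 : rootFreq e k / rootFreq e j ≤ 1 / 2 := by rw [div_le_iff₀ hj]; linarith
    calc Λ / 4 ≤ 1 / 2 * (Λ * (1 - rootFreq e k / rootFreq e j)) := by nlinarith
      _ = 1 / 2 * rootFreq e k * (Λ / rootFreq e k - Λ / rootFreq e j) := by field_simp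
      _ ≤ _ := by gcongr

/-- For each decay rate there is an infinite soliton train with the properties needed for the
construction of the remainder. -/
theorem AssumptionT.exists_background (hT : AssumptionT d g α₁ ωs a D)
    (hF : AssumptionF d g C₀ α₁ α₂) (hd : 1 ≤ d) (hα2 : α₁ < 2) {β κ : ℝ} (hκ : κ = 1 - α₁ / 2)
    (hβ : 0 < β) (hβ1 : β ≤ 1) (hβα : β ≤ α₁)
    (h1 : d * (1 + β) / 4 < (α₁ + κ) / α₁) (h2 : d * β / 4 < 1)
    (h3 : ∀ b, b = 0 ∨ b = β → d * (1 + b - β) / 4 < (α₁ - β + κ) / α₁)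
    (h4 : ∀ b, b = 0 ∨ b = β → d * (1 + b - min α₁ (1 + b)) / 4 < κ / α₁) {lam : ℝ}
    (hlam : 0 < lam) :
    ∃ (φ : ℕ → Space d → ℝ) (ω : ℕ → ℝ) (v : ℕ → Space d) (l δ L : ℝ) (B : ℕ → ℝ)
      (w : ℕ → ℝ → Space d → ℝ), IsTrainData d g α₁ ωs a D φ ω v ∧ δ ≤ 1 / 2 ∧ 0 < L ∧
      Bumps δ lam B w ∧ Waves κ D l w (fun j => soliton (φ j) (ω j) (v j) 0 0) ∧
      Background α₁ κ β D lam L (trainProfile φ ω v 0)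
        (interactionError g fun j => soliton (φ j) (ω j) (v j) 0 0) (envelope δ w) := by
  have hα := hF.exponent_pos
  have ha := hT.rate_pos
  have hD := hT.const_pos
  have hκ0 : 0 < κ := by rw [hκ]; linarith
  -- The interaction estimate costs `2δ` powers of the envelope; the strict inequality `h1` leaves
  -- room for this loss. The choice of `δ` does not involve `lam`.
  obtain ⟨δ, hδ0, hδ1, hδα, hδκ, hδs⟩ : ∃ δ : ℝ, 0 < δ ∧ δ ≤ 1 / 2 ∧ 2 * δ ≤ α₁ ∧ 2 * δ ≤ κ ∧
      d * (1 + β) / 4 < (α₁ + κ - 2 * δ) / α₁ := by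
    have hlim : Tendsto (fun δ : ℝ => (α₁ + κ - 2 * δ) / α₁) (𝓝[>] 0) (𝓝 ((α₁ + κ) / α₁)) := by
      have : Continuous fun δ : ℝ => (α₁ + κ - 2 * δ) / α₁ := by fun_prop
      have h := this.tendsto 0
      rw [mul_zero, sub_zero] at h
      exact h.mono_left nhdsWithin_le_nhds
    have hle : ∀ y : ℝ, 0 < y → ∀ᶠ δ in 𝓝[>] (0 : ℝ), δ ≤ y := fun y hy =>
      eventually_nhdsWithin_of_eventually_nhds (eventually_le_nhds hy)
    obtain ⟨δ, k1, k2, k3, k4, k5⟩ := ((hlim.eventually (lt_mem_nhds h1)).and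
      ((hle (1 / 2) (by norm_num)).and ((hle (α₁ / 2) (by positivity)).and
      ((hle (κ / 2) (by positivity)).and self_mem_nhdsWithin)))).exists
    exact ⟨δ, k5, k2, by linarith, by linarith, k1⟩
  obtain ⟨C, hC, hB⟩ := hF.exists_nonlinBounds hD
  -- Calibrated so that the interaction rate `aΛδ/2` of the bumps equals `lam`.
  set Λ := 2 * lam / (a * δ) with hΛ
  have hΛ0 : 0 < Λ := by positivity
  set l := D * (1 + Λ) with hl
  have hl0 : 0 < l := by positivity
  have hβb : ∀ b, b = 0 ∨ b = β → 0 ≤ b ∧ b ≤ β := by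
    rintro b (rfl | rfl) <;> constructor <;> linarith
  -- The scale `e` is the last parameter chosen, after `lam`, `Λ` and `l`. Each tolerance `τ` may
  -- therefore be as small as the inverse of the large gradient constant demands.
  have small : ∀ {M c : ℝ → ℝ} (τ : ℝ), (∀ b, b = 0 ∨ b = β → 0 ≤ c b) →
      (∀ b, b = 0 ∨ b = β → c b ≤ 2) → (∀ b, b = 0 ∨ b = β → δ ≤ M b) →
      (∀ b, b = 0 ∨ b = β → d * c b / 4 < M b / α₁) → 0 < τ →
      ∀ᶠ e in 𝓝[>] (0 : ℝ), ∀ (n : Space d) (t : ℝ) (b : ℝ), (b = 0 ∨ b = β) →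
        eLpNorm (fun x => envelope δ (bump α₁ a e Λ n) t x ^ M b) (lexp (c b)) volume ≤
          ENNReal.ofReal τ := by
    intro M c τ c0 c1 c2 c3 hτ
    filter_upwards [eventually_eLpNorm_envelope_le (d := d) hα ha hδ0 (c0 0 (Or.inl rfl))
        (c1 0 (Or.inl rfl)) (c2 0 (Or.inl rfl)) (c3 0 (Or.inl rfl)) hτ,
      eventually_eLpNorm_envelope_le (d := d) hα ha hδ0 (c0 β (Or.inr rfl))
        (c1 β (Or.inr rfl)) (c2 β (Or.inr rfl)) (c3 β (Or.inr rfl)) hτ] with e k1 k2 n t b hb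
    rcases hb with rfl | rfl
    · exact k1 Λ n t
    · exact k2 Λ n t
  have s1 := small (M := fun _ => α₁) (c := fun b => b) 1 (fun b hb => (hβb b hb).1)
    (fun b hb => by linarith [(hβb b hb).2]) (fun _ _ => by linarith)
    (fun b hb => by
      rw [div_self hα.ne']
      have : (d : ℝ) * b ≤ d * β := by gcongr; exact (hβb b hb).2
      linarith) one_pos
  have s2 := small (M := fun _ => α₁ - β + κ) (c := fun b => 1 + b - β) (l * 3 ^ κ)⁻¹
    (fun b hb => by linarith [(hβb b hb).1]) (fun b hb => by linarith [(hβb b hb).2])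
    (fun _ _ => by linarith) h3 (by positivity)
  have s3 := small (M := fun _ => κ) (c := fun b => 1 + b - min α₁ (1 + b)) (l * 3 ^ κ)⁻¹
    (fun b hb => by linarith [min_le_right α₁ (1 + b)])
    (fun b hb => by
      have : 0 ≤ min α₁ (1 + b) := le_min hα.le (by linarith [(hβb b hb).1])
      linarith [(hβb b hb).2])
    (fun _ _ => by linarith) h4 (by positivity)
  have hd0 : (0 : ℝ) ≤ d := by positivity
  have s4 := small (M := fun _ => α₁ + 1 - 2 * δ) (c := fun _ => 1)
    (C * ((2 * D) ^ (α₁ - 2 * δ) * D ^ (2 * δ)) * D)⁻¹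
    (fun b hb => zero_le_one) (fun b hb => one_le_two) (fun _ _ => by linarith)
    (fun b hb => by
      have k1 : (d : ℝ) * 1 / 4 ≤ d * (1 + β) / 4 := by gcongr; linarith
      have k2 : (α₁ + κ - 2 * δ) / α₁ ≤ (α₁ + 1 - 2 * δ) / α₁ := by gcongr; linarith
      linarith) (by positivity)
  have s5 := small (M := fun _ => α₁ + κ - 2 * δ) (c := fun b => 1 + b)
    (C * ((2 * D) ^ (α₁ - 2 * δ) * D ^ (2 * δ)) * l * 3 ^ (α₁ + κ - 2 * δ))⁻¹
    (fun b hb => by linarith [(hβb b hb).1]) (fun b hb => by linarith [(hβb b hb).2])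
    (fun _ _ => by linarith)
    (fun b hb => by
      have k1 : (d : ℝ) * (1 + b) / 4 ≤ d * (1 + β) / 4 := by
        gcongr
        exact (hβb b hb).2
      linarith) (by positivity)
  have s6 : ∀ᶠ e in 𝓝[>] (0 : ℝ),
      e ^ (2 / α₁ * δ) * (1 - (1 / 2 : ℝ) ^ (2 / α₁ * δ))⁻¹ ≤ 1 := by
    have hs : 0 < 2 / α₁ * δ := by positivity
    have h1 : Continuous fun e : ℝ => e ^ (2 / α₁ * δ) * (1 - (1 / 2 : ℝ) ^ (2 / α₁ * δ))⁻¹ :=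
      (Real.continuous_rpow_const hs.le).mul_const _
    have h2 := h1.tendsto 0
    rw [Real.zero_rpow hs.ne', zero_mul] at h2
    exact (h2.mono_left nhdsWithin_le_nhds).eventually_le_const one_pos
  have hle : ∀ y : ℝ, 0 < y → ∀ᶠ e in 𝓝[>] (0 : ℝ), e < y := fun y hy =>
    eventually_nhdsWithin_of_eventually_nhds (eventually_lt_nhds hy)
  obtain ⟨e, ⟨⟨⟨⟨⟨⟨⟨⟨k1, k2⟩, k3⟩, k4⟩, k5⟩, k6⟩, k7⟩, k8⟩, he⟩⟩ :=
    ((((((((s1.and s2).and s3).and s4).and s5).and s6).and (hle 1 one_pos)).and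
      (hle ωs hT.freq_pos)).and self_mem_nhdsWithin).exists
  have he : 0 < e := he
  set n : Space d := EuclideanSpace.single ⟨0, hd⟩ 1 with hn
  have hn1 : ‖n‖ = 1 := by simp [hn]
  have hex : ∀ j, ∃ φ : Space d → ℝ, IsBoundState d g (rootFreq e j ^ 2) φ ∧
      HasDecay d α₁ a D (rootFreq e j ^ 2) φ := by
    intro j
    have q1 := rootFreq_pos he j
    have q2 := rootFreq_le he j
    exact hT.exists_boundState _ (by positivity) (by nlinarith)
  choose φ hφ using hex
  have hbumps := bumps_bump (d := d) (n := n) he k7.le hα ha hT.rate_lt_one.le hΛ0.le hn1 hδ0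
    (by rw [(hasSum_rootFreq_rpow he (by positivity)).tsum_eq]; exact k6)
  have hlamΛ : a * Λ / 2 * δ = lam := by rw [hΛ]; field_simp
  rw [hlamΛ] at hbumps
  have hwaves := waves_soliton (d := d) hα ha.le hD.le he k7.le hΛ0.le hn1
    (fun j => (hφ j).1.differentiable) (fun j => (hφ j).2)
  rw [← hκ] at hwaves
  refine ⟨φ, fun j => rootFreq e j ^ 2, fun j => (Λ / rootFreq e j) • n, l, δ, l * 3 ^ κ, _, _,
    isTrainData_rootFreq hα he k7.le k8 hΛ0 hn1 hφ, hδ1, by positivity, hbumps, hwaves, ?_⟩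
  exact hwaves.background hF hbumps hδ1 hδα hδκ hD hl0 hC hB le_rfl
    (fun t b hb => by simpa using k1 n t b hb) (fun t b hb => k2 n t b hb)
    (fun t b hb => k3 n t b hb) (fun t => by simpa [lexp_one] using k4 n t 0 (Or.inl rfl))
    (fun t b hb => k5 n t b hb)

end

end SolitonTrain

/-! ### Test functions, Galilei invariance and the equation for one soliton. -/

namespace SolitonTrain

noncomputable section

open Complex (I)

variable {d : ℕ}

/-- Directional derivative in space-time. -/
def pd (u : ℝ × Space d) (ψ : ℝ × Space d → ℂ) (z : ℝ × Space d) : ℂ := fderiv ℝ ψ z u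

/-- The time direction. -/
def dirT (d : ℕ) : ℝ × Space d := (1, 0)

/-- The coordinate directions of space. -/
def dirX (i : Fin d) : ℝ × Space d := (0, EuclideanSpace.single i 1)

/-- The adjoint `-i∂ₜ + Δ` of the free Schrödinger operator. -/
def testOp (ψ : ℝ × Space d → ℂ) (z : ℝ × Space d) : ℂ :=
  -(I * pd (dirT d) ψ z) + ∑ i, pd (dirX i) (pd (dirX i) ψ) z

section TestFunctions

variable {ψ : ℝ × Space d → ℂ}

theorem contDiff_pd (hψ : ContDiff ℝ (⊤ : ℕ∞) ψ) (u : ℝ × Space d) :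
    ContDiff ℝ (⊤ : ℕ∞) (pd u ψ) :=
  (hψ.fderiv_right (m := ((⊤ : ℕ∞) : WithTop ℕ∞)) (by norm_cast)).clm_apply contDiff_const

theorem hasCompactSupport_pd (hψ : HasCompactSupport ψ) (u : ℝ × Space d) :
    HasCompactSupport (pd u ψ) := hψ.fderiv_apply (𝕜 := ℝ) u

theorem contDiff_testOp (hψ : ContDiff ℝ (⊤ : ℕ∞) ψ) : ContDiff ℝ (⊤ : ℕ∞) (testOp ψ) :=
  ((contDiff_const.mul (contDiff_pd hψ _)).neg).add
    (ContDiff.sum fun _ _ => contDiff_pd (contDiff_pd hψ _) _)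

theorem hasCompactSupport_testOp (hψ : HasCompactSupport ψ) : HasCompactSupport (testOp ψ) := by
  have h1 : HasCompactSupport fun z => -(I * pd (dirT d) ψ z) :=
    ((hasCompactSupport_pd hψ _).mul_left).neg
  have h2 : HasCompactSupport fun z => ∑ i, pd (dirX i) (pd (dirX i) ψ) z := by
    have : ∀ s : Finset (Fin d), HasCompactSupport fun z => ∑ i ∈ s, pd (dirX i) (pd (dirX i) ψ) z := by
      intro s
      induction s using Finset.induction_on with
      | empty =>
        simp only [Finset.sum_empty]
        exact HasCompactSupport.zero
      | insert i s his ih =>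
        simp only [Finset.sum_insert his]
        exact (hasCompactSupport_pd (hasCompactSupport_pd hψ _) _).add ih
    exact this _
  exact h1.add h2

theorem differentiable_of_contDiff_top (hψ : ContDiff ℝ (⊤ : ℕ∞) ψ) : Differentiable ℝ ψ :=
  hψ.differentiable (by simp)

theorem hasDerivAt_time (hψ : ContDiff ℝ (⊤ : ℕ∞) ψ) (t : ℝ) (x : Space d) :
    HasDerivAt (fun s => ψ (s, x)) (pd (dirT d) ψ (t, x)) t := by
  have h1 : HasDerivAt (fun s : ℝ => (s, x)) (dirT d) t := by
    exact (hasDerivAt_id t).prodMk (hasDerivAt_const t x)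
  exact (differentiable_of_contDiff_top hψ (t, x)).hasFDerivAt.comp_hasDerivAt t h1

theorem laplacian_eq_sum_fderiv {f : Space d → ℂ} (hf : ContDiff ℝ (⊤ : ℕ∞) f) (x : Space d) :
    Laplacian.laplacian f x = ∑ i, fderiv ℝ (fun y => fderiv ℝ f y (EuclideanSpace.single i 1)) x
      (EuclideanSpace.single i 1) := by
  rw [InnerProductSpace.laplacian_eq_iteratedFDeriv_orthonormalBasis f
    (EuclideanSpace.basisFun (Fin d) ℝ)]
  refine Finset.sum_congr rfl fun i _ => ?_
  have h2 : Differentiable ℝ (fderiv ℝ f) :=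
    (hf.fderiv_right (m := 1) (by norm_cast)).differentiable (by norm_num)
  rw [iteratedFDeriv_two_apply, fderiv_clm_apply (h2 x) (differentiableAt_const _)]
  simp

theorem fderiv_slice {ψ : ℝ × Space d → ℂ} (hψ : ContDiff ℝ (⊤ : ℕ∞) ψ) (t : ℝ) (x e : Space d) :
    fderiv ℝ (fun y => ψ (t, y)) x e = pd (0, e) ψ (t, x) := by
  have h1 : HasFDerivAt (fun y : Space d => (t, y)) (ContinuousLinearMap.inr ℝ ℝ (Space d)) x :=
    hasFDerivAt_prodMk_right t x
  have h2 := (differentiable_of_contDiff_top hψ (t, x)).hasFDerivAt.comp x h1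
  have h3 : fderiv ℝ (fun y => ψ (t, y)) x = _ := h2.fderiv
  rw [h3]
  rfl

theorem contDiff_slice (hψ : ContDiff ℝ (⊤ : ℕ∞) ψ) (t : ℝ) :
    ContDiff ℝ (⊤ : ℕ∞) fun y : Space d => ψ (t, y) :=
  hψ.comp (contDiff_const.prodMk contDiff_id)

theorem laplacian_slice (hψ : ContDiff ℝ (⊤ : ℕ∞) ψ) (t : ℝ) (x : Space d) :
    Laplacian.laplacian (fun y => ψ (t, y)) x = ∑ i, pd (dirX i) (pd (dirX i) ψ) (t, x) := by
  rw [laplacian_eq_sum_fderiv (contDiff_slice hψ t)]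
  refine Finset.sum_congr rfl fun i _ => ?_
  simp only [fderiv_slice hψ]
  exact fderiv_slice (contDiff_pd hψ _) t x _

theorem testOp_eq (hψ : ContDiff ℝ (⊤ : ℕ∞) ψ) (z : ℝ × Space d) :
    testOp ψ z = -(I * deriv (fun s => ψ (s, z.2)) z.1) +
      Laplacian.laplacian (fun y => ψ (z.1, y)) z.2 := by
  rw [testOp, (hasDerivAt_time hψ z.1 z.2).deriv, laplacian_slice hψ]

theorem hasCompactSupport_slice (hψ : HasCompactSupport ψ) (t : ℝ) :
    HasCompactSupport fun y : Space d => ψ (t, y) := by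
  refine HasCompactSupport.intro (hψ.isCompact.image continuous_snd) fun x hx => ?_
  by_contra h
  exact hx ⟨(t, x), subset_tsupport ψ h, rfl⟩

theorem hasCompactSupport_slice_time (hψ : HasCompactSupport ψ) (x : Space d) :
    HasCompactSupport fun t : ℝ => ψ (t, x) := by
  refine HasCompactSupport.intro (hψ.isCompact.image continuous_fst) fun t ht => ?_
  by_contra h
  exact ht ⟨(t, x), subset_tsupport ψ h, rfl⟩

end TestFunctions

section Galilei

/-- The shear `(t, y) ↦ (t, y + t v)` of space-time. -/
def shear (v : Space d) : (ℝ × Space d) ≃L[ℝ] (ℝ × Space d) :=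
  ContinuousLinearEquiv.equivOfInverse
    ((ContinuousLinearMap.fst ℝ ℝ (Space d)).prod
      (ContinuousLinearMap.snd ℝ ℝ (Space d) +
        (ContinuousLinearMap.fst ℝ ℝ (Space d)).smulRight v))
    ((ContinuousLinearMap.fst ℝ ℝ (Space d)).prod
      (ContinuousLinearMap.snd ℝ ℝ (Space d) -
        (ContinuousLinearMap.fst ℝ ℝ (Space d)).smulRight v))
    (fun z => by simp) (fun z => by simp)

theorem shear_apply (v : Space d) (z : ℝ × Space d) : shear v z = (z.1, z.2 + z.1 • v) := rfl

theorem measurePreserving_shear (v : Space d) :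
    MeasurePreserving (shear v : ℝ × Space d → ℝ × Space d) volume volume := by
  have := (MeasurePreserving.id (volume : Measure ℝ)).skew_product (μc := (volume : Measure (Space d)))
    (μd := (volume : Measure (Space d))) (g := fun t y => y + t • v) (by fun_prop)
    (Eventually.of_forall fun t => (measurePreserving_add_right volume (t • v)).map_eq)
  exact this

theorem integral_shear (v : Space d) (F : ℝ × Space d → ℂ) :
    ∫ z, F (shear v z) = ∫ z, F z :=
  (measurePreserving_shear v).integral_comp (shear v).toHomeomorph.measurableEmbedding F

/-- The phase of a soliton in the moving frame. -/
def framePhase (ω : ℝ) (v : Space d) : ℝ × Space d →L[ℝ] ℝ :=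
  (ω + ‖v‖ ^ 2 / 4) • ContinuousLinearMap.fst ℝ ℝ (Space d) +
    (1 / 2 : ℝ) • (innerSL ℝ v).comp (ContinuousLinearMap.snd ℝ ℝ (Space d))

theorem framePhase_apply (ω : ℝ) (v : Space d) (z : ℝ × Space d) :
    framePhase ω v z = (ω + ‖v‖ ^ 2 / 4) * z.1 + 1 / 2 * inner ℝ v z.2 := by
  simp [framePhase]

/-- The test function seen in the moving frame. -/
def boost (ω : ℝ) (v : Space d) (ψ : ℝ × Space d → ℂ) (z : ℝ × Space d) : ℂ :=
  Complex.exp (I * (framePhase ω v z : ℂ)) * ψ (shear v z)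

variable {ω : ℝ} {v : Space d} {ψ : ℝ × Space d → ℂ}

theorem contDiff_boost (hψ : ContDiff ℝ (⊤ : ℕ∞) ψ) : ContDiff ℝ (⊤ : ℕ∞) (boost ω v ψ) := by
  have h1 : ContDiff ℝ (⊤ : ℕ∞) fun z : ℝ × Space d => (framePhase ω v z : ℂ) :=
    Complex.ofRealCLM.contDiff.comp (framePhase ω v).contDiff
  exact (contDiff_const.mul h1).cexp.mul (hψ.comp (shear v).contDiff)

theorem hasCompactSupport_boost (hψ : HasCompactSupport ψ) : HasCompactSupport (boost ω v ψ) :=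
  (hψ.comp_homeomorph (shear v).toHomeomorph).mul_left

theorem pd_boost (hψ : ContDiff ℝ (⊤ : ℕ∞) ψ) (u : ℝ × Space d) :
    pd u (boost ω v ψ) =
      boost ω v (fun z => I * (framePhase ω v u : ℂ) * ψ z + pd (shear v u) ψ z) := by
  ext z
  have h1 := ((Complex.ofRealCLM.hasFDerivAt (x := framePhase ω v z)).comp z
    (framePhase ω v).hasFDerivAt).const_mul I
  have h2 := (differentiable_of_contDiff_top hψ (shear v z)).hasFDerivAt.comp z
    ((shear v : (ℝ × Space d) →L[ℝ] (ℝ × Space d)).hasFDerivAt (x := z))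
  have h3 := h1.cexp.mul h2
  have h4 : fderiv ℝ (boost ω v ψ) z = _ := h3.fderiv
  rw [pd, h4]
  simp only [boost, pd, Function.comp, Complex.ofRealCLM_apply, add_apply, smul_apply,
    ContinuousLinearMap.comp_apply, smul_eq_mul, ContinuousLinearEquiv.coe_coe]
  ring

theorem pd_add_const_mul {F G : ℝ × Space d → ℂ} (hF : ContDiff ℝ (⊤ : ℕ∞) F)
    (hG : ContDiff ℝ (⊤ : ℕ∞) G) (c : ℂ) (u z : ℝ × Space d) :
    pd u (fun z => c * F z + G z) z = c * pd u F z + pd u G z := by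
  have h := (((differentiable_of_contDiff_top hF z).hasFDerivAt.const_mul c).add
    (differentiable_of_contDiff_top hG z).hasFDerivAt).fderiv
  rw [pd]
  have h' : fderiv ℝ (fun z => c * F z + G z) z = _ := h
  rw [h']
  simp [pd]

theorem pd_shear_dirT (v : Space d) (ψ : ℝ × Space d → ℂ) (z : ℝ × Space d) :
    pd (shear v (dirT d)) ψ z = pd (dirT d) ψ z + ∑ i, (v i : ℂ) * pd (dirX i) ψ z := by
  have h : shear v (dirT d) = dirT d + ∑ i, v i • dirX i := by
    have h1 : ∑ i, v i • (dirX i : ℝ × Space d) = ((0 : ℝ), v) := by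
      refine Prod.ext ?_ ?_
      · rw [Prod.fst_sum]; simp [dirX]
      · rw [Prod.snd_sum]
        simp only [dirX, Prod.smul_mk]
        ext j
        simp [Pi.single_apply]
    rw [h1]
    simp [shear_apply, dirT]
  rw [pd, h, map_add, map_sum]
  simp [pd]

/-- Galilei covariance of the adjoint operator: the transport term from the shear cancels the cross
terms from the phase, and the two contributions of `|v|²/4` cancel, leaving only `ω`. -/
theorem testOp_boost (hψ : ContDiff ℝ (⊤ : ℕ∞) ψ) (z : ℝ × Space d) :
    testOp (boost ω v ψ) z - ω * boost ω v ψ z = boost ω v (testOp ψ) z := by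
  have hX : ∀ i, shear v (dirX i) = dirX i := fun i => by simp [shear_apply, dirX]
  have hfX : ∀ i, framePhase ω v (dirX i) = v i / 2 := fun i => by
    rw [framePhase_apply]
    simp [dirX, EuclideanSpace.inner_single_right]
    ring
  have hfT : framePhase ω v (dirT d) = ω + ‖v‖ ^ 2 / 4 := by
    rw [framePhase_apply]; simp [dirT]
  have h2 : ∀ i, pd (dirX i) (pd (dirX i) (boost ω v ψ)) z =
      Complex.exp (I * (framePhase ω v z : ℂ)) * (-((v i : ℂ) ^ 2 / 4) * ψ (shear v z) +
        I * v i * pd (dirX i) ψ (shear v z) + pd (dirX i) (pd (dirX i) ψ) (shear v z)) := by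
    intro i
    have hs : ContDiff ℝ (⊤ : ℕ∞) fun z => I * (framePhase ω v (dirX i) : ℂ) * ψ z +
        pd (shear v (dirX i)) ψ z := (contDiff_const.mul hψ).add (contDiff_pd hψ _)
    rw [pd_boost hψ, pd_boost hs, boost, pd_add_const_mul hψ (contDiff_pd hψ _)]
    simp only [hX, hfX]
    push_cast
    linear_combination Complex.exp (I * (framePhase ω v z : ℂ)) * (v i : ℂ) ^ 2 / 4 *
      ψ (shear v z) * Complex.I_sq
  have hv : ((‖v‖ ^ 2 : ℝ) : ℂ) = ∑ i, (v i : ℂ) ^ 2 := by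
    rw [EuclideanSpace.real_norm_sq_eq]; push_cast; rfl
  simp only [testOp, h2]
  rw [pd_boost hψ, ← Finset.mul_sum]
  simp only [boost, hfT, pd_shear_dirT, testOp]
  simp only [Finset.sum_add_distrib, ← Finset.sum_mul, Finset.sum_neg_distrib, ← Finset.sum_div,
    ← hv, mul_assoc, ← Finset.mul_sum]
  push_cast
  linear_combination (-Complex.exp (I * (framePhase ω v z : ℂ)) * (ω + (‖v‖ : ℂ) ^ 2 / 4) *
      ψ (shear v z)) * Complex.I_sq

theorem soliton_shear (φ : Space d → ℝ) (ω : ℝ) (v : Space d) (z : ℝ × Space d) :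
    soliton φ ω v 0 0 (shear v z).1 (shear v z).2 =
      Complex.exp (I * (framePhase ω v z : ℂ)) * φ z.2 := by
  rw [soliton, shear_apply, framePhase_apply]
  simp only [inner_add_right, inner_smul_right, real_inner_self_eq_norm_sq]
  congr 2
  · congr 1
    push_cast
    ring
  · simp

end Galilei

section SolitonEquation

variable {g : ℝ → ℝ} {C₀ α₁ α₂ : ℝ}

/-- The equation of a bound state with complex valued test functions. -/
theorem IsBoundState.integral_eq_zero (hF : AssumptionF d g C₀ α₁ α₂) {ω : ℝ} {φ : Space d → ℝ}
    (hφ : IsBoundState d g ω φ) {χ : Space d → ℂ} (hχ : ContDiff ℝ (⊤ : ℕ∞) χ)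
    (hχc : HasCompactSupport χ) :
    ∫ x, (φ x * (Laplacian.laplacian χ x - ω * χ x) + (g (φ x ^ 2) * φ x : ℝ) * χ x) = 0 := by
  have hφc : Continuous φ := hφ.differentiable.continuous
  have hgc : Continuous fun x => g (φ x ^ 2) := hF.continuous_sq.comp hφc
  have hlap : Laplacian.laplacian χ = fun x => ∑ i, fderiv ℝ (fun y => fderiv ℝ χ y
      (EuclideanSpace.single i 1)) x (EuclideanSpace.single i 1) :=
    funext fun x => laplacian_eq_sum_fderiv hχ x
  have hd : ∀ {F : Space d → ℂ}, ContDiff ℝ (⊤ : ℕ∞) F → ∀ e : Space d,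
      ContDiff ℝ (⊤ : ℕ∞) fun y => fderiv ℝ F y e := fun hF e =>
    (hF.fderiv_right (m := ((⊤ : ℕ∞) : WithTop ℕ∞)) (by norm_cast)).clm_apply contDiff_const
  have hlapc : Continuous (Laplacian.laplacian χ) := by
    rw [hlap]
    exact continuous_finsetSum _ fun i _ => (hd (hd hχ _) _).continuous
  have hlaps : HasCompactSupport (Laplacian.laplacian χ) := by
    refine HasCompactSupport.intro (K := tsupport χ) hχc fun x hx => ?_
    have hz : χ =ᶠ[𝓝 x] fun _ => 0 := notMem_tsupport_iff_eventuallyEq.1 hx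
    rw [(InnerProductSpace.laplacian_congr_nhds hz).eq_of_nhds]
    simp
  set F : Space d → ℂ := fun x => φ x * (Laplacian.laplacian χ x - ω * χ x) +
    (g (φ x ^ 2) * φ x : ℝ) * χ x with hFdef
  have hFc : Continuous F := by
    exact ((Complex.continuous_ofReal.comp hφc).mul
      (hlapc.sub (continuous_const.mul hχ.continuous))).add
      ((Complex.continuous_ofReal.comp (hgc.mul hφc)).mul hχ.continuous)
  have hFs : HasCompactSupport F :=
    ((hlaps.sub hχc.mul_left).mul_left).add hχc.mul_left
  have hFi : Integrable F := hFc.integrable_of_hasCompactSupport hFs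
  -- The bound state equation admits only real test functions; real and imaginary parts are obtained
  -- by applying real functionals.
  have key : ∀ L : ℂ →L[ℝ] ℝ, L (∫ x, F x) = 0 := by
    intro L
    rw [← L.integral_comp_comm hFi]
    have h1 : ContDiff ℝ (⊤ : ℕ∞) (L ∘ χ) := L.contDiff.comp hχ
    have h2 := hφ.equation (L ∘ χ) h1 (hχc.comp_left (map_zero L))
    rw [← neg_eq_zero, ← integral_neg, ← h2]
    refine integral_congr_ae (Eventually.of_forall fun x => ?_)
    have h3 : Laplacian.laplacian (L ∘ χ) x = L (Laplacian.laplacian χ x) :=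
      (hχ.contDiffAt.of_le (by norm_cast)).laplacian_CLM_comp_left
    have h4 : ∀ (r : ℝ) (w : ℂ), L ((r : ℂ) * w) = r * L w := fun r w => by
      rw [← Complex.real_smul, map_smul, smul_eq_mul]
    simp only [hFdef, map_add, map_sub, h4, h3, Function.comp]
    ring
  refine Complex.ext ?_ ?_
  · simpa using key Complex.reCLM
  · simpa using key Complex.imCLM

/-- In the moving frame the soliton is a phase times the stationary profile, and the phase is
transferred to the test function. The time derivative integrates to zero along each line of fixed
position; what remains is the bound state equation on each time slice. -/
theorem IsBoundState.integral_soliton (hF : AssumptionF d g C₀ α₁ α₂) {ω : ℝ} {φ : Space d → ℝ}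
    (hφ : IsBoundState d g ω φ) (v : Space d) {ψ : ℝ × Space d → ℂ} (hψ : ContDiff ℝ (⊤ : ℕ∞) ψ)
    (hψc : HasCompactSupport ψ) :
    ∫ z : ℝ × Space d, (soliton φ ω v 0 0 z.1 z.2 * testOp ψ z +
      nonlin g (soliton φ ω v 0 0 z.1 z.2) * ψ z) = 0 := by
  have hφc : Continuous φ := hφ.differentiable.continuous
  have hgc : Continuous fun x => g (φ x ^ 2) := hF.continuous_sq.comp hφc
  rw [← integral_shear v]
  set χ := boost ω v ψ with hχdef
  have hχ : ContDiff ℝ (⊤ : ℕ∞) χ := contDiff_boost hψ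
  have hχc : HasCompactSupport χ := hasCompactSupport_boost hψc
  set lap : ℝ × Space d → ℂ := fun z => ∑ i, pd (dirX i) (pd (dirX i) χ) z with hlap
  have hlapd : lap = fun z => testOp χ z - -(I * pd (dirT d) χ z) := by
    ext z; simp [hlap, testOp]
  set A : ℝ × Space d → ℂ := fun z => φ z.2 * (-(I * pd (dirT d) χ z)) with hA
  set B : ℝ × Space d → ℂ := fun z => φ z.2 * (lap z - ω * χ z) +
    (g (φ z.2 ^ 2) * φ z.2 : ℝ) * χ z with hB
  have hsum : ∀ z : ℝ × Space d, soliton φ ω v 0 0 (shear v z).1 (shear v z).2 * testOp ψ (shear v z) +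
      nonlin g (soliton φ ω v 0 0 (shear v z).1 (shear v z).2) * ψ (shear v z) = A z + B z := by
    intro z
    have h1 : boost ω v (testOp ψ) z = testOp χ z - ω * χ z := (testOp_boost hψ z).symm
    have h2 : ‖soliton φ ω v 0 0 (shear v z).1 (shear v z).2‖ ^ 2 = φ z.2 ^ 2 := by
      rw [soliton_shear, norm_mul, mul_comm I, Complex.norm_exp_ofReal_mul_I, one_mul,
        Complex.norm_real, Real.norm_eq_abs, sq_abs]
    rw [nonlin, h2, soliton_shear]
    simp only [hA, hB, hlapd]
    rw [boost] at h1
    have h3 : χ z = Complex.exp (I * (framePhase ω v z : ℂ)) * ψ (shear v z) := rfl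
    push_cast
    linear_combination (φ z.2 : ℂ) * h1 - (g (φ z.2 ^ 2) : ℂ) * φ z.2 * h3
  simp only [hsum]
  have hcT := (contDiff_pd hχ (dirT d)).continuous
  have hsT := hasCompactSupport_pd hχc (dirT d)
  have hcO := (contDiff_testOp hχ).continuous
  have hsO := hasCompactSupport_testOp hχc
  have hcχ := hχ.continuous
  have hAi : Integrable A := by
    refine Continuous.integrable_of_hasCompactSupport (by simp only [hA]; fun_prop) ?_
    exact (hsT.mul_left.neg).mul_left
  have hlapc : Continuous lap := by rw [hlapd]; fun_prop
  have hlaps : HasCompactSupport lap := by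
    rw [hlapd]; exact hsO.sub hsT.mul_left.neg
  have hBi : Integrable B := by
    have hBc : Continuous B := ((Complex.continuous_ofReal.comp (hφc.comp continuous_snd)).mul
      (hlapc.sub (continuous_const.mul hcχ))).add
      ((Complex.continuous_ofReal.comp ((hgc.mul hφc).comp continuous_snd)).mul hcχ)
    refine hBc.integrable_of_hasCompactSupport ?_
    exact ((hlaps.sub hχc.mul_left).mul_left).add hχc.mul_left
  rw [integral_add hAi hBi]
  have hB0 : ∫ z, B z = 0 := by
    rw [Measure.volume_eq_prod, integral_prod B (by rwa [Measure.volume_eq_prod] at hBi)]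
    refine integral_eq_zero_of_ae (Eventually.of_forall fun t => ?_)
    have h1 := hφ.integral_eq_zero hF (contDiff_slice hχ t) (hasCompactSupport_slice hχc t)
    simp only [laplacian_slice hχ] at h1
    exact h1
  have hA0 : ∫ z, A z = 0 := by
    rw [Measure.volume_eq_prod, integral_prod_symm A (by rwa [Measure.volume_eq_prod] at hAi)]
    refine integral_eq_zero_of_ae (Eventually.of_forall fun x => ?_)
    have h1 : ∫ t, pd (dirT d) χ (t, x) = 0 := by
      refine integral_eq_zero_of_hasDerivAt_of_integrable (fun t => hasDerivAt_time hχ t x) ?_ ?_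
      · exact (hcT.comp (Continuous.prodMk_left x)).integrable_of_hasCompactSupport
          (hasCompactSupport_slice_time hsT x)
      · exact (hcχ.comp (Continuous.prodMk_left x)).integrable_of_hasCompactSupport
          (hasCompactSupport_slice_time hχc x)
    simp only [hA, Pi.zero_apply]
    rw [integral_const_mul, integral_neg, integral_const_mul, h1]
    simp
  rw [hA0, hB0, add_zero]

end SolitonEquation

end

end SolitonTrain

/-! ### Time slices of test functions as curves in `L²`. -/

namespace SolitonTrain

noncomputable section

open Complex (I)
open scoped ComplexConjugate

variable {d : ℕ}

/-- The time slices of a function on space-time, as elements of `L²`. -/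
def sliceL2 (Φ : ℝ × Space d → ℂ) (t : ℝ) : L2 d :=
  open scoped Classical in
  if h : MemLp (fun x => Φ (t, x)) 2 volume then h.toLp else 0

/-- The Laplacian in the space variables. -/
def lapX (Φ : ℝ × Space d → ℂ) (z : ℝ × Space d) : ℂ := ∑ i, pd (dirX i) (pd (dirX i) Φ) z

section Slices

variable {Φ : ℝ × Space d → ℂ}

theorem memLp_slice (hc : Continuous Φ) (hs : HasCompactSupport Φ) (t : ℝ) :
    MemLp (fun x => Φ (t, x)) 2 volume :=
  (hc.comp (by fun_prop : Continuous fun x : Space d => (t, x))).memLp_of_hasCompactSupport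
    (hasCompactSupport_slice hs t)

theorem coeFn_sliceL2 (hc : Continuous Φ) (hs : HasCompactSupport Φ) (t : ℝ) :
    sliceL2 Φ t =ᵐ[volume] fun x => Φ (t, x) := by
  rw [sliceL2, dif_pos (memLp_slice hc hs t)]
  exact (memLp_slice hc hs t).coeFn_toLp

theorem exists_slice_bound (hc : Continuous Φ) (hs : HasCompactSupport Φ) :
    ∃ B : Space d → ℝ, MemLp B 2 volume ∧ ∀ t x, ‖Φ (t, x)‖ ≤ B x := by
  obtain ⟨C, hC⟩ := hc.bounded_above_of_compact_support hs
  have hK : IsCompact (Prod.snd '' tsupport Φ) := hs.isCompact.image continuous_snd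
  refine ⟨(Prod.snd '' tsupport Φ).indicator fun _ => C,
    memLp_indicator_const 2 hK.measurableSet C (Or.inr hK.measure_lt_top.ne), fun t x => ?_⟩
  by_cases hx : x ∈ Prod.snd '' tsupport Φ
  · rw [Set.indicator_of_mem hx]
    exact hC _
  · rw [Set.indicator_of_notMem hx]
    by_contra h
    exact hx ⟨(t, x), subset_tsupport Φ fun h0 => h (by rw [h0, norm_zero]), rfl⟩

theorem continuous_sliceL2 (hc : Continuous Φ) (hs : HasCompactSupport Φ) :
    Continuous (sliceL2 Φ) := by
  obtain ⟨B, hB, hle⟩ := exists_slice_bound hc hs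
  rw [continuous_iff_continuousAt]
  intro t
  refine tendsto_L2_of_dominated (B := fun x => 2 * B x) (hB.const_mul 2)
    (fun s => coeFn_sliceL2 hc hs s) (coeFn_sliceL2 hc hs t)
    (Eventually.of_forall fun s => Eventually.of_forall fun x => ?_)
    (Eventually.of_forall fun x => ?_)
  · exact (norm_sub_le _ _).trans (by linarith [hle s x, hle t x])
  · exact (hc.comp (by fun_prop : Continuous fun s : ℝ => (s, x))).tendsto t

theorem exists_norm_sliceL2_le (hc : Continuous Φ) (hs : HasCompactSupport Φ) :
    ∃ C, ∀ t, ‖sliceL2 Φ t‖ ≤ C := by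
  obtain ⟨B, hB, hle⟩ := exists_slice_bound hc hs
  refine ⟨‖hB.toLp B‖, fun t => Lp.norm_le_norm_of_ae_le ?_⟩
  filter_upwards [coeFn_sliceL2 hc hs t, hB.coeFn_toLp] with x h1 h2
  rw [h1, h2]
  exact (hle t x).trans (le_abs_self _)

theorem hasDerivAt_sliceL2 (hΦ : ContDiff ℝ (⊤ : ℕ∞) Φ) (hs : HasCompactSupport Φ) (t : ℝ) :
    HasDerivAt (sliceL2 Φ) (sliceL2 (pd (dirT d) Φ) t) t := by
  have hc := hΦ.continuous
  have hc' := (contDiff_pd hΦ (dirT d)).continuous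
  have hs' := hasCompactSupport_pd hs (dirT d)
  obtain ⟨B, hB, hle⟩ := exists_slice_bound hc' hs'
  rw [hasDerivAt_iff_tendsto_slope]
  refine tendsto_L2_of_dominated (B := fun x => 2 * B x) (hB.const_mul 2)
    (F' := fun s x => slope (fun s => Φ (s, x)) t s) (fun s => ?_) (coeFn_sliceL2 hc' hs' t)
    (Eventually.of_forall fun s => Eventually.of_forall fun x => ?_)
    (Eventually.of_forall fun x => (hasDerivAt_iff_tendsto_slope.1 (hasDerivAt_time hΦ t x)))
  · simp only [slope_def_module]
    filter_upwards [coeFn_sliceL2 hc hs s, coeFn_sliceL2 hc hs t,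
      Lp.coeFn_smul (s - t)⁻¹ (sliceL2 Φ s - sliceL2 Φ t),
      Lp.coeFn_sub (sliceL2 Φ s) (sliceL2 Φ t)] with x h1 h2 h3 h4
    rw [h3, Pi.smul_apply, h4, Pi.sub_apply, h1, h2]
  · have hB0 : 0 ≤ B x := (norm_nonneg _).trans (hle t x)
    have h1 : ‖Φ (s, x) - Φ (t, x)‖ ≤ B x * ‖s - t‖ :=
      convex_univ.norm_image_sub_le_of_norm_hasDerivWithin_le (f := fun s => Φ (s, x))
        (fun u _ => (hasDerivAt_time hΦ u x).hasDerivWithinAt) (fun u _ => hle u x)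
        (Set.mem_univ t) (Set.mem_univ s)
    have h2 : ‖slope (fun s => Φ (s, x)) t s‖ ≤ B x := by
      rw [slope_def_module, norm_smul, norm_inv]
      rcases eq_or_ne s t with rfl | hst
      · simpa using hB0
      · rw [inv_mul_le_iff₀ (norm_pos_iff.2 (sub_ne_zero.2 hst)), mul_comm]
        exact h1
    exact (norm_sub_le _ _).trans (by linarith [hle t x])

/-- A product rule for a family differentiable only on the single vector `P t`: joint continuity
handles the slope of `P`, so no differentiability in operator norm is needed. -/
theorem hasDerivAt_isometry_comp {E : Type*} [NormedAddCommGroup E] [NormedSpace ℂ E]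
    {S : ℝ → E →ₗᵢ[ℂ] E} (hS : Continuous fun p : ℝ × E => S p.1 p.2) {P : ℝ → E} {P' Q : E} {t : ℝ}
    (hP : HasDerivAt P P' t) (hQ : HasDerivAt (fun s => S s (P t)) Q (-t)) :
    HasDerivAt (fun s => S (-s) (P s)) (S (-t) P' - Q) t := by
  have h1 : HasDerivAt (fun s => S (-s) (P t)) (-Q) t := by
    have := hQ.scomp t (hasDerivAt_neg t)
    rwa [neg_one_smul] at this
  rw [hasDerivAt_iff_tendsto_slope] at hP h1 ⊢
  have hneg : Tendsto (fun s : ℝ => -s) (𝓝[≠] t) (𝓝 (-t)) :=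
    (continuous_neg.tendsto t).mono_left nhdsWithin_le_nhds
  have h2 : Tendsto (fun s => S (-s) (slope P t s)) (𝓝[≠] t) (𝓝 (S (-t) P')) :=
    (hS.tendsto (-t, P')).comp (hneg.prodMk_nhds hP)
  rw [sub_eq_add_neg]
  refine (h2.add h1).congr fun s => ?_
  have h3 : ∀ c : ℝ, ∀ x, S (-s) (c • x) = c • S (-s) x := fun c x =>
    (S (-s)).toLinearMap.map_smul_of_tower c x
  rw [slope_def_module, slope_def_module, slope_def_module, h3, map_sub, ← smul_add]
  congr 1
  abel

theorem hasDerivAt_schrodinger_sliceL2 (hΦ : ContDiff ℝ (⊤ : ℕ∞) Φ) (hs : HasCompactSupport Φ)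
    (t : ℝ) : HasDerivAt (fun s => schrodinger (-s) (sliceL2 Φ s))
      (schrodinger (-t) (sliceL2 (fun z => pd (dirT d) Φ z - I * lapX Φ z) t)) t := by
  have hlap : ∀ z, lapX Φ z = Laplacian.laplacian (fun y => Φ (z.1, y)) z.2 := fun z =>
    (laplacian_slice hΦ z.1 z.2).symm
  let f : SchwartzMap (Space d) ℂ :=
    (hasCompactSupport_slice hs t).toSchwartzMap (contDiff_slice hΦ t)
  have hf : (f.toLp 2 : L2 d) = sliceL2 Φ t := by
    refine Lp.ext ?_
    filter_upwards [f.coeFn_toLp 2 volume, coeFn_sliceL2 hΦ.continuous hs t] with x h1 h2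
    rw [h1, h2]
    rfl
  have hD := hasDerivAt_schrodinger f (-t)
  rw [hf] at hD
  have hcl : Continuous (lapX Φ) := continuous_finsetSum _ fun i _ =>
    (contDiff_pd (contDiff_pd hΦ _) _).continuous
  have hlz : ∀ z ∉ tsupport Φ, lapX Φ z = 0 := by
    intro z hz
    refine Finset.sum_eq_zero fun i _ => ?_
    have h0 : pd (dirX i) Φ =ᶠ[𝓝 z] fun _ => 0 := by
      have : Φ =ᶠ[𝓝 z] fun _ => 0 := notMem_tsupport_iff_eventuallyEq.1 hz
      filter_upwards [this.fderiv (𝕜 := ℝ)] with y hy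
      simp [pd, hy]
    rw [pd, h0.fderiv_eq]
    simp
  have hsl : HasCompactSupport (lapX Φ) := HasCompactSupport.intro hs.isCompact hlz
  have hc2 : Continuous fun z => pd (dirT d) Φ z - I * lapX Φ z :=
    (contDiff_pd hΦ _).continuous.sub (continuous_const.mul hcl)
  have hs2 : HasCompactSupport fun z => pd (dirT d) Φ z - I * lapX Φ z :=
    (hasCompactSupport_pd hs _).sub hsl.mul_left
  have hY : sliceL2 (fun z => pd (dirT d) Φ z - I * lapX Φ z) t =
      sliceL2 (pd (dirT d) Φ) t - I • ((Laplacian.laplacian f).toLp 2 : L2 d) := by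
    refine Lp.ext ?_
    filter_upwards [coeFn_sliceL2 hc2 hs2 t, (Laplacian.laplacian f).coeFn_toLp 2 volume,
      coeFn_sliceL2 (contDiff_pd hΦ (dirT d)).continuous (hasCompactSupport_pd hs _) t,
      Lp.coeFn_sub (sliceL2 (pd (dirT d) Φ) t) (I • ((Laplacian.laplacian f).toLp 2 : L2 d)),
      Lp.coeFn_smul I ((Laplacian.laplacian f).toLp 2 : L2 d)] with x h1 h2 h3 h4 h5
    rw [h1, h4, Pi.sub_apply, h3, h5, Pi.smul_apply, h2, SchwartzMap.laplacian_apply, hlap,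
      smul_eq_mul]
    rfl
  have := hasDerivAt_isometry_comp continuous_schrodinger (hasDerivAt_sliceL2 hΦ hs t) hD
  rwa [← map_smul, ← map_sub, ← hY] at this

theorem pd_conj {ψ : ℝ × Space d → ℂ} (hψ : Differentiable ℝ ψ) (u : ℝ × Space d)
    (z : ℝ × Space d) : pd u (fun z => conj (ψ z)) z = conj (pd u ψ z) := by
  have := (Complex.conjCLE.toContinuousLinearMap.hasFDerivAt).comp z (hψ z).hasFDerivAt
  have h2 : fderiv ℝ (fun z => conj (ψ z)) z = _ := this.fderiv
  rw [pd, h2]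
  rfl

/-- The inner product is conjugate linear in its first slot, where the test function is placed, so
its conjugate is what evolves in the interaction picture. -/
theorem testOp_conj {ψ : ℝ × Space d → ℂ} (hψ : ContDiff ℝ (⊤ : ℕ∞) ψ) (z : ℝ × Space d) :
    pd (dirT d) (fun z => conj (ψ z)) z - I * lapX (fun z => conj (ψ z)) z =
      conj (I * testOp ψ z) := by
  have h1 : ∀ u, pd u (fun z => conj (ψ z)) = fun z => conj (pd u ψ z) := fun u =>
    funext fun z => pd_conj (differentiable_of_contDiff_top hψ) u z
  have h2 : ∀ u w, pd w (pd u fun z => conj (ψ z)) z = conj (pd w (pd u ψ) z) := fun u w => by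
    rw [h1, pd_conj (differentiable_of_contDiff_top (contDiff_pd hψ u))]
  simp only [lapX, h2]
  simp only [testOp, h1, map_mul, map_add, map_neg, map_sum, Complex.conj_I]
  linear_combination conj (pd (dirT d) ψ z) * Complex.I_mul_I

theorem contDiff_conj {ψ : ℝ × Space d → ℂ} (hψ : ContDiff ℝ (⊤ : ℕ∞) ψ) :
    ContDiff ℝ (⊤ : ℕ∞) fun z => conj (ψ z) :=
  Complex.conjCLE.contDiff.comp hψ

theorem hasCompactSupport_conj {ψ : ℝ × Space d → ℂ} (hψ : HasCompactSupport ψ) :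
    HasCompactSupport fun z => conj (ψ z) :=
  hψ.comp_left (g := conj) (map_zero _)

end Slices

theorem testOp_eq_zero {ψ : ℝ × Space d → ℂ} {z : ℝ × Space d} (hz : z ∉ tsupport ψ) :
    testOp ψ z = 0 := by
  have h : ψ =ᶠ[𝓝 z] fun _ => 0 := notMem_tsupport_iff_eventuallyEq.1 hz
  have h1 : ∀ u, pd u ψ =ᶠ[𝓝 z] fun _ => 0 := fun u => by
    filter_upwards [h.fderiv (𝕜 := ℝ)] with y hy
    simp [pd, hy]
  have h2 : ∀ u w, pd w (pd u ψ) z = 0 := fun u w => by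
    rw [pd, (h1 u).fderiv_eq]
    simp
  rw [testOp, (h1 (dirT d)).eq_of_nhds]
  simp [h2]

theorem inner_schrodinger (t : ℝ) (U V : L2 d) :
    inner ℂ U (schrodinger t V) = inner ℂ (schrodinger (-t) U) V := by
  have : schrodinger (-t) (schrodinger t V) = V := by
    rw [← schrodinger_add, neg_add_cancel, schrodinger_zero]
  rw [← (schrodinger (-t)).inner_map_map U, this]

end

end SolitonTrain

/-! ### The Duhamel integral as a weak solution. -/

namespace SolitonTrain

noncomputable section

open Complex (I)
open scoped ComplexConjugate

variable {d : ℕ}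

/-- The Duhamel integral need not be differentiable in `L²`. Moving the group onto the smooth curve
`P` leaves an integral whose dependence on time is differentiable. -/
theorem hasDerivAt_inner_duhamel {N P Y : ℝ → L2 d} {A lam : ℝ} (hlam : 0 < lam)
    (hNc : ContinuousOn N (Set.Ici 0))
    (hN : ∀ t, 0 ≤ t → ‖N t‖ ≤ A * Real.exp (-(lam * t)))
    (hP : ∀ t, HasDerivAt (fun s => schrodinger (-s) (P s)) (schrodinger (-t) (Y t)) t)
    {t : ℝ} (ht : 0 < t) :
    HasDerivAt (fun s => inner ℂ (P s) (duhamel N s))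
      (I * inner ℂ (P t) (N t) + inner ℂ (Y t) (duhamel N t)) t := by
  have hG : ContinuousOn (fun s => schrodinger (-s) (N s)) (Set.Ici 0) := by
    simpa only [zero_sub] using continuousOn_schrodinger_comp hNc 0
  have hGi : IntegrableOn (fun s => schrodinger (-s) (N s)) (Set.Ioi 0) volume := by
    simpa only [zero_sub] using integrableOn_duhamel hlam hNc hN le_rfl 0
  have hξ := (hasDerivWithinAt_integral_Ioi hG hGi ht.le).hasDerivAt (Ici_mem_nhds ht)
  have heq : ∀ (Q : L2 d) (s : ℝ), inner ℂ Q (duhamel N s) =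
      -I * inner ℂ (schrodinger (-s) Q) (∫ u in Set.Ioi s, schrodinger (-u) (N u)) := by
    intro Q s
    rw [duhamel_eq, inner_smul_right, inner_schrodinger]
  simp only [heq]
  refine (((hP t).inner ℂ hξ).const_mul (-I)).congr_deriv ?_
  rw [inner_neg_right, (schrodinger (-t)).inner_map_map]
  ring

/-- Fundamental theorem of calculus on the half line: the boundary term at zero vanishes with `P 0`,
the one at infinity by exponential decay. -/
theorem integral_inner_duhamel {N P Y : ℝ → L2 d} {A C lam : ℝ} (hlam : 0 < lam)
    (hNc : ContinuousOn N (Set.Ici 0))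
    (hN : ∀ t, 0 ≤ t → ‖N t‖ ≤ A * Real.exp (-(lam * t)))
    (hPc : Continuous P) (hYc : Continuous Y) (hPb : ∀ t, ‖P t‖ ≤ C) (hYb : ∀ t, ‖Y t‖ ≤ C)
    (hP0 : P 0 = 0)
    (hP : ∀ t, HasDerivAt (fun s => schrodinger (-s) (P s)) (schrodinger (-t) (Y t)) t) :
    ∫ t in Set.Ioi (0 : ℝ), (I * inner ℂ (P t) (N t) + inner ℂ (Y t) (duhamel N t)) = 0 := by
  have hC : 0 ≤ C := (norm_nonneg _).trans (hPb 0)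
  have hDc := continuousOn_duhamel hlam hNc hN
  have hDb := fun t (ht : 0 ≤ t) => norm_duhamel_le hlam hN ht
  have hb : ∀ {Q V : ℝ → L2 d} {B : ℝ}, (∀ t, ‖Q t‖ ≤ C) →
      (∀ t, 0 ≤ t → ‖V t‖ ≤ B * Real.exp (-(lam * t))) → ∀ t, 0 ≤ t →
      ‖(inner ℂ (Q t) (V t) : ℂ)‖ ≤ C * (B * Real.exp (-(lam * t))) := by
    intro Q V B hQ hV t ht
    exact (norm_inner_le_norm _ _).trans
      (mul_le_mul (hQ t) (hV t ht) (norm_nonneg _) hC)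
  have hint : IntegrableOn
      (fun t => I * inner ℂ (P t) (N t) + inner ℂ (Y t) (duhamel N t)) (Set.Ioi 0) volume := by
    have hm : ContinuousOn (fun t => I * inner ℂ (P t) (N t) + inner ℂ (Y t) (duhamel N t))
        (Set.Ici (0 : ℝ)) :=
      (continuousOn_const.mul (hPc.continuousOn.inner hNc)).add (hYc.continuousOn.inner hDc)
    refine ((integrableOn_exp_neg hlam (C * A) 0).add
      (integrableOn_exp_neg hlam (C * (A / lam)) 0)).mono'
      ((hm.mono Set.Ioi_subset_Ici_self).aestronglyMeasurable measurableSet_Ioi) ?_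
    filter_upwards [ae_restrict_mem measurableSet_Ioi] with t ht
    have ht' : (0 : ℝ) ≤ t := (Set.mem_Ioi.1 ht).le
    refine (norm_add_le _ _).trans ?_
    rw [norm_mul, Complex.norm_I, one_mul, Pi.add_apply]
    have h1 := hb hPb hN t ht'
    have h2 := hb hYb hDb t ht'
    linarith
  have hcont : ContinuousWithinAt (fun s => (inner ℂ (P s) (duhamel N s) : ℂ)) (Set.Ici 0) 0 :=
    hPc.continuousWithinAt.inner (hDc 0 Set.self_mem_Ici)
  have hlim : Tendsto (fun s => (inner ℂ (P s) (duhamel N s) : ℂ)) atTop (𝓝 0) := by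
    have h0 : Tendsto (fun t => C * (A / lam * Real.exp (-(lam * t)))) atTop (𝓝 0) := by
      have : Tendsto (fun t : ℝ => Real.exp (-(lam * t))) atTop (𝓝 0) :=
        Real.tendsto_exp_neg_atTop_nhds_zero.comp (tendsto_id.const_mul_atTop hlam)
      simpa using (this.const_mul (A / lam)).const_mul C
    refine squeeze_zero_norm' ?_ h0
    filter_upwards [eventually_ge_atTop 0] with t ht
    exact hb hPb hDb t ht
  rw [integral_Ioi_of_hasDerivAt_of_tendsto hcont
    (fun t ht => hasDerivAt_inner_duhamel hlam hNc hN hP ht) hint hlim, hP0, inner_zero_left,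
    sub_zero]

theorem inner_sliceL2 {ψ : ℝ × Space d → ℂ} (hc : Continuous ψ) (hs : HasCompactSupport ψ)
    {V : L2 d} {w : Space d → ℂ} (hV : V =ᵐ[volume] w) (t : ℝ) :
    (inner ℂ (sliceL2 (fun z => conj (ψ z)) t) V : ℂ) = ∫ x, w x * ψ (t, x) := by
  rw [L2.inner_def]
  refine integral_congr_ae ?_
  filter_upwards [hV, coeFn_sliceL2 (Complex.continuous_conj.comp hc) (hasCompactSupport_conj hs) t]
    with x h1 h2
  rw [h1]
  erw [h2]
  simp

/-- The backward Duhamel integral solves the inhomogeneous Schrödinger equation weakly. -/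
theorem integral_duhamel {N : ℝ → L2 d} {A lam : ℝ} (hlam : 0 < lam)
    (hNc : ContinuousOn N (Set.Ici 0))
    (hN : ∀ t, 0 ≤ t → ‖N t‖ ≤ A * Real.exp (-(lam * t)))
    {η F : ℝ → Space d → ℂ} (hη : Continuous fun z : ℝ × Space d => η z.1 z.2)
    (hF : Continuous fun z : ℝ × Space d => F z.1 z.2)
    (hηU : ∀ t, 0 ≤ t → duhamel N t =ᵐ[volume] η t) (hFN : ∀ t, 0 ≤ t → N t =ᵐ[volume] F t)
    {ψ : ℝ × Space d → ℂ} (hψ : ContDiff ℝ (⊤ : ℕ∞) ψ) (hψc : HasCompactSupport ψ)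
    (hψs : tsupport ψ ⊆ Set.Ioi 0 ×ˢ Set.univ) :
    ∫ z : ℝ × Space d, (η z.1 z.2 * testOp ψ z + F z.1 z.2 * ψ z) = 0 := by
  have hTc := (contDiff_testOp hψ).continuous
  have hTs := hasCompactSupport_testOp hψc
  have hI : Integrable (fun z : ℝ × Space d => η z.1 z.2 * testOp ψ z + F z.1 z.2 * ψ z) volume :=
    ((hη.mul hTc).add (hF.mul hψ.continuous)).integrable_of_hasCompactSupport
      (hTs.mul_left.add hψc.mul_left)
  have hIc : Continuous fun z => I * testOp ψ z := continuous_const.mul hTc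
  have hIs : HasCompactSupport fun z => I * testOp ψ z := hTs.mul_left
  have hout : ∀ t, t ≤ 0 → ∀ x, (t, x) ∉ tsupport ψ := fun t ht x hx =>
    absurd (hψs hx).1 (not_lt.2 ht)
  obtain ⟨C₁, hC₁⟩ := exists_norm_sliceL2_le (contDiff_conj hψ).continuous
    (hasCompactSupport_conj hψc)
  obtain ⟨C₂, hC₂⟩ := exists_norm_sliceL2_le (Complex.continuous_conj.comp hIc)
    (hasCompactSupport_conj hIs)
  have key := integral_inner_duhamel (P := sliceL2 fun z => conj (ψ z))
    (Y := sliceL2 fun z => conj (I * testOp ψ z)) (C := max C₁ C₂) hlam hNc hN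
    (continuous_sliceL2 (contDiff_conj hψ).continuous (hasCompactSupport_conj hψc))
    (continuous_sliceL2 (Complex.continuous_conj.comp hIc) (hasCompactSupport_conj hIs))
    (fun t => (hC₁ t).trans (le_max_left _ _)) (fun t => (hC₂ t).trans (le_max_right _ _))
    (by
      refine Lp.ext ?_
      filter_upwards [coeFn_sliceL2 (contDiff_conj hψ).continuous (hasCompactSupport_conj hψc) 0,
        Lp.coeFn_zero ℂ 2 (volume : Measure (Space d))] with x h1 h2
      rw [h1, h2, Pi.zero_apply, image_eq_zero_of_notMem_tsupport (hout 0 le_rfl x), map_zero])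
    (fun t => by
      have := hasDerivAt_schrodinger_sliceL2 (contDiff_conj hψ) (hasCompactSupport_conj hψc) t
      simpa only [testOp_conj hψ] using this)
  rw [Measure.volume_eq_prod, integral_prod _ hI,
    ← setIntegral_eq_integral_of_forall_compl_eq_zero (s := Set.Ioi 0) fun t ht => ?_]
  · have h2 : ∀ t ∈ Set.Ioi (0 : ℝ), ∫ x, (η t x * testOp ψ (t, x) + F t x * ψ (t, x)) =
        -I * (I * inner ℂ (sliceL2 (fun z => conj (ψ z)) t) (N t) +
          inner ℂ (sliceL2 (fun z => conj (I * testOp ψ z)) t) (duhamel N t)) := by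
      intro t ht
      have ht' : (0 : ℝ) ≤ t := (Set.mem_Ioi.1 ht).le
      have hsl : Continuous fun x : Space d => (t, x) := by fun_prop
      have i1 : Integrable (fun x => η t x * testOp ψ (t, x)) volume :=
        ((hη.comp hsl).mul (hTc.comp hsl)).integrable_of_hasCompactSupport
          (hasCompactSupport_slice hTs t).mul_left
      have i2 : Integrable (fun x => F t x * ψ (t, x)) volume :=
        ((hF.comp hsl).mul (hψ.continuous.comp hsl)).integrable_of_hasCompactSupport
          (hasCompactSupport_slice hψc t).mul_left
      rw [inner_sliceL2 hψ.continuous hψc (hFN t ht'), inner_sliceL2 hIc hIs (hηU t ht'),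
        integral_add i1 i2]
      have h3 : ∫ x, η t x * (I * testOp ψ (t, x)) = I * ∫ x, η t x * testOp ψ (t, x) := by
        rw [← integral_const_mul]
        exact integral_congr_ae (Eventually.of_forall fun x => by ring)
      rw [h3]
      linear_combination ((∫ x, F t x * ψ (t, x)) + ∫ x, η t x * testOp ψ (t, x)) *
        Complex.I_mul_I
    rw [setIntegral_congr_fun measurableSet_Ioi h2, integral_const_mul, key, mul_zero]
  · have : ∀ x, η t x * testOp ψ (t, x) + F t x * ψ (t, x) = 0 := fun x => by
      have hx := hout t (not_lt.1 ht) x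
      rw [testOp_eq_zero hx, image_eq_zero_of_notMem_tsupport hx, mul_zero, mul_zero, add_zero]
    simp [this]

end

end SolitonTrain

/-! ### Assembly of the solution `T + η`. -/

namespace SolitonTrain

noncomputable section

variable {d : ℕ} {g : ℝ → ℝ} {C₀ α₁ α₂ : ℝ}

/-- A convergent superposition of exact solutions of the nonlinear equation solves the equation with
the sum of the nonlinearities. -/
theorem Waves.integral_tsum {δ lam κ D l M C : ℝ} {B : ℕ → ℝ} {w : ℕ → ℝ → Space d → ℝ}
    {R : ℕ → ℝ → Space d → ℂ} (hF : AssumptionF d g C₀ α₁ α₂) (hR : Waves κ D l w R)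
    (hw : Bumps δ lam B w) (hδ : δ ≤ 1) (hD : 0 ≤ D) (hC : 0 ≤ C) (hB : NonlinBounds g α₁ M C)
    (hDM : D ≤ M) {ψ : ℝ × Space d → ℂ} (hψ : ContDiff ℝ (⊤ : ℕ∞) ψ) (hψc : HasCompactSupport ψ)
    (h0 : ∀ j, ∫ z : ℝ × Space d, (R j z.1 z.2 * testOp ψ z + nonlin g (R j z.1 z.2) * ψ z) = 0) :
    ∫ z : ℝ × Space d, ((∑' j, R j z.1 z.2) * testOp ψ z +
      (∑' j, nonlin g (R j z.1 z.2)) * ψ z) = 0 := by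
  have hα := hF.exponent_pos.le
  have hTc := (contDiff_testOp hψ).continuous
  have hTs := hasCompactSupport_testOp hψc
  have hTi : Integrable (fun z => ‖testOp ψ z‖) volume :=
    (hTc.integrable_of_hasCompactSupport hTs).norm
  have hψi : Integrable (fun z => ‖ψ z‖) volume :=
    (hψ.continuous.integrable_of_hasCompactSupport hψc).norm
  have hint : ∀ j, Integrable
      (fun z : ℝ × Space d => R j z.1 z.2 * testOp ψ z + nonlin g (R j z.1 z.2) * ψ z) volume :=
    fun j => (((hR.continuous j).mul hTc).add
      ((hF.continuous_nonlin.comp (hR.continuous j)).mul hψ.continuous)).integrable_of_hasCompactSupport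
        (hTs.mul_left.add hψc.mul_left)
  have hle : ∀ j (z : ℝ × Space d), ‖R j z.1 z.2 * testOp ψ z + nonlin g (R j z.1 z.2) * ψ z‖ ≤
      D * B j * ‖testOp ψ z‖ + C * D ^ α₁ * (D * B j) * ‖ψ z‖ := by
    intro j z
    refine (norm_add_le _ _).trans ?_
    rw [norm_mul, norm_mul]
    exact add_le_add
      (mul_le_mul_of_nonneg_right (hR.norm_le_bound hw hδ hD j z.1 z.2) (norm_nonneg _))
      (mul_le_mul_of_nonneg_right (hR.norm_nonlin_le hw hδ hD hC hα hB hDM j z.1 z.2)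
        (norm_nonneg _))
  have hsum : Summable fun j => ∫ z : ℝ × Space d,
      ‖R j z.1 z.2 * testOp ψ z + nonlin g (R j z.1 z.2) * ψ z‖ := by
    refine Summable.of_nonneg_of_le (fun j => integral_nonneg fun z => norm_nonneg _) (fun j => ?_)
      (hw.summable_bound.mul_left
        (D * (∫ z, ‖testOp ψ z‖) + C * D ^ α₁ * D * ∫ z, ‖ψ z‖))
    refine (integral_mono (hint j).norm ((hTi.const_mul (D * B j)).add
      (hψi.const_mul (C * D ^ α₁ * (D * B j)))) (hle j)).trans (le_of_eq ?_)
    simp only [Pi.add_apply]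
    rw [integral_add (hTi.const_mul _) (hψi.const_mul _), integral_const_mul, integral_const_mul]
    ring
  have h1 := hasSum_integral_of_summable_integral_norm hint hsum
  simp only [h0] at h1
  have h2 := h1.unique hasSum_zero
  refine Eq.trans (integral_congr_ae (Eventually.of_forall fun z => ?_)) h2
  have s1 := hR.summable hw hδ hD z.1 z.2
  have s2 := hR.summable_nonlin hw hδ hD hC hα hB hDM z.1 z.2
  simp only
  rw [← tsum_mul_right, ← tsum_mul_right, (s1.mul_right _).tsum_add (s2.mul_right _)]

/-- An exact solution of the equation for the remainder yields a solution of the nonlinear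
Schrödinger equation. -/
theorem isNLSSolution_add {δ lam κ D l A : ℝ} {B : ℕ → ℝ} {w : ℕ → ℝ → Space d → ℝ}
    {R : ℕ → ℝ → Space d → ℂ} (hF : AssumptionF d g C₀ α₁ α₂) (hR : Waves κ D l w R)
    (hw : Bumps δ lam B w) (hδ : δ ≤ 1) (hD : 0 < D)
    (h0 : ∀ j, ∀ ψ : ℝ × Space d → ℂ, ContDiff ℝ (⊤ : ℕ∞) ψ → HasCompactSupport ψ →
      ∫ z : ℝ × Space d, (R j z.1 z.2 * testOp ψ z + nonlin g (R j z.1 z.2) * ψ z) = 0)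
    (hlam : 0 < lam) {T : ℝ → Space d → ℂ} (hTR : ∀ t x, T t x = ∑' j, R j t x)
    {N : ℝ → L2 d} (hNc : ContinuousOn N (Set.Ici 0))
    (hNb : ∀ t, 0 ≤ t → ‖N t‖ ≤ A * Real.exp (-(lam * t)))
    {η : ℝ → Space d → ℂ} (hη : Continuous fun z : ℝ × Space d => η z.1 z.2)
    (hηN : ∀ t, 0 ≤ t → duhamel N t =ᵐ[volume] η t)
    (hN : ∀ t, 0 ≤ t → N t =ᵐ[volume] remainderFun g (T t) (interactionError g R t) (η t)) :
    IsNLSSolution d g fun t x => T t x + η t x := by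
  obtain ⟨C, hC, hB⟩ := hF.exists_nonlinBounds hD
  have hTc : Continuous fun z : ℝ × Space d => T z.1 z.2 := by
    simp only [hTR]
    exact hR.continuous_tsum hw hδ hD.le
  have hHc := hR.continuous_interactionError hF hw hδ hD.le hC.le hF.exponent_pos.le hB le_rfl
  have huc : Continuous fun z : ℝ × Space d => T z.1 z.2 + η z.1 z.2 := hTc.add hη
  have hfc : Continuous fun z : ℝ × Space d => nonlin g (T z.1 z.2 + η z.1 z.2) :=
    hF.continuous_nonlin.comp huc
  refine ⟨huc.locallyIntegrable.locallyIntegrableOn _,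
    hfc.locallyIntegrable.locallyIntegrableOn _, fun ψ hψ hψc hψs => ?_⟩
  simp only [← testOp_eq hψ]
  have hTo := (contDiff_testOp hψ).continuous
  have hTs := hasCompactSupport_testOp hψc
  have hNl : Continuous fun z : ℝ × Space d => remainderFun g (T z.1) (interactionError g R z.1)
      (η z.1) z.2 := (hfc.sub (hF.continuous_nonlin.comp hTc)).add hHc
  have e1 := integral_duhamel hlam hNc hNb hη hNl hηN hN hψ hψc hψs
  have e2 := hR.integral_tsum hF hw hδ hD.le hC.le hB le_rfl hψ hψc fun j => h0 j ψ hψ hψc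
  have hS : Continuous fun z : ℝ × Space d => ∑' j, nonlin g (R j z.1 z.2) := by
    have := (hF.continuous_nonlin.comp hTc).sub hHc
    refine this.congr fun z => ?_
    simp only [Pi.sub_apply, interactionError, Function.comp, hTR]
    ring
  have i1 : Integrable (fun z : ℝ × Space d => η z.1 z.2 * testOp ψ z +
      remainderFun g (T z.1) (interactionError g R z.1) (η z.1) z.2 * ψ z) volume :=
    ((hη.mul hTo).add (hNl.mul hψ.continuous)).integrable_of_hasCompactSupport
      (hTs.mul_left.add hψc.mul_left)
  have i2 : Integrable (fun z : ℝ × Space d => (∑' j, R j z.1 z.2) * testOp ψ z +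
      (∑' j, nonlin g (R j z.1 z.2)) * ψ z) volume := by
    simp only [← hTR]
    exact ((hTc.mul hTo).add (hS.mul hψ.continuous)).integrable_of_hasCompactSupport
      (hTs.mul_left.add hψc.mul_left)
  -- The equations for `η` and `T` are added: the source of the first plus `∑ f(R_j)` is exactly
  -- `f(T + η)`.
  have e3 := integral_add i1 i2
  rw [e1, e2, add_zero] at e3
  rw [← e3]
  refine integral_congr_ae (Eventually.of_forall fun z => ?_)
  simp only [remainderFun, interactionError, hTR]
  ring

theorem weighted_sum_le {K a b : ℝ} (hK : 0 ≤ K) {X Y : ℝ≥0∞}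
    (hX : X ≤ ENNReal.ofReal (K * Real.exp (-a)))
    (hY : Y ≤ ENNReal.ofReal (d * (K * Real.exp (-b)))) :
    ENNReal.ofReal (Real.exp a) * X + ENNReal.ofReal (Real.exp b) * Y ≤
      ENNReal.ofReal (K + d * K) := by
  refine (add_le_add (mul_le_mul_right hX _) (mul_le_mul_right hY _)).trans (le_of_eq ?_)
  rw [← ENNReal.ofReal_mul (Real.exp_pos _).le, ← ENNReal.ofReal_mul (Real.exp_pos _).le,
    ← ENNReal.ofReal_add (by positivity) (by positivity), Real.exp_neg, Real.exp_neg]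
  congr 1
  field_simp

theorem exists_rep (hd3 : d ≤ 3) {r : ℝ≥0∞} (hr : 1 ≤ r) (hdr : (d : ℝ) * (1 / r.toReal) < 1)
    {K : ℝ} (hK : 0 ≤ K) {U : ℝ → L2 d} (hUc : Continuous U) (hU : ∀ t, U t ∈ DiffBound r K) :
    ∃ η : ℝ → Space d → ℂ, (Continuous fun z : ℝ × Space d => η z.1 z.2) ∧
      ∀ t, η t =ᵐ[volume] U t :=
  ⟨fun t => rep (U t), continuous_rep hd3 hr hdr hK hUc hU, fun t => rep_ae_eq hd3 hr hdr hK (hU t)⟩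

/-- A continuous curve in `L²` whose values have bounded difference quotients is represented by a
jointly continuous function with weak gradients in `L² ∩ L^r`. -/
theorem exists_continuous_representative (hd3 : d ≤ 3) {r : ℝ≥0∞} (hr : 1 ≤ r)
    (hdr : (d : ℝ) * (1 / r.toReal) < 1) {K lam β : ℝ} (hK : 0 ≤ K) (hβ : 0 ≤ β * lam)
    {U : ℝ → L2 d} (hUc : Continuous U)
    (hU : ∀ t, 0 ≤ t → U t ∈ decaySet d r K lam (β * lam) t) :
    ∃ (η : ℝ → Space d → ℂ) (Dη : ℝ → Space d → EuclideanSpace ℂ (Fin d)),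
      (Continuous fun z : ℝ × Space d => η z.1 z.2) ∧ (∀ t, 0 ≤ t → η t =ᵐ[volume] U t) ∧
      (∀ t : ℝ, 0 ≤ t → MemLp (η t) 2 volume ∧ HasWeakGradient (η t) (Dη t) ∧
        MemLp (Dη t) 2 volume ∧ MemLp (Dη t) r volume) ∧
      (∀ t : ℝ, 0 ≤ t →
        Tendsto (fun s => eLpNorm (η s - η t) 2 volume) (𝓝[Set.Ici 0] t) (𝓝 0)) ∧
      ∀ t : ℝ, 0 ≤ t →
        ENNReal.ofReal (Real.exp (lam * t)) * eLpNorm (η t) 2 volume +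
          ENNReal.ofReal (Real.exp (β * lam * t)) *
            max (eLpNorm (Dη t) 2 volume) (eLpNorm (Dη t) r volume) ≤
          ENNReal.ofReal (K + d * K) := by
  -- Bounds are known only for nonnegative times; reflecting nothing and freezing the curve before
  -- zero gives a representative continuous on all of space-time.
  have hm : Continuous fun t : ℝ => U (max t 0) := hUc.comp (by fun_prop)
  have hUr : ∀ t : ℝ, U (max t 0) ∈ DiffBound r K := by
    intro t
    have h0 : 0 ≤ max t 0 := le_max_right _ _
    refine diffBound_mono (mul_le_of_le_one_right hK (Real.exp_le_one_iff.2 ?_)) (hU _ h0).2.2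
    exact neg_nonpos.2 (mul_nonneg hβ h0)
  obtain ⟨η, hηc, hηU⟩ := exists_rep hd3 hr hdr hK hm hUr
  have hηU' : ∀ t, 0 ≤ t → η t =ᵐ[volume] U t := fun t ht => by
    have := hηU t
    rwa [max_eq_left ht] at this
  have hgrad : ∀ t, ∃ G : Space d → EuclideanSpace ℂ (Fin d), 0 ≤ t →
      HasWeakGradient (η t) G ∧ AEStronglyMeasurable G volume ∧
      eLpNorm G 2 volume ≤ ENNReal.ofReal (d * (K * Real.exp (-(β * lam * t)))) ∧
      eLpNorm G r volume ≤ ENNReal.ofReal (d * (K * Real.exp (-(β * lam * t)))) := by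
    intro t
    by_cases ht : 0 ≤ t
    · obtain ⟨G, hG⟩ := exists_hasWeakGradient hr (hU t ht).2.1 (hU t ht).2.2 (hηU' t ht)
      exact ⟨G, fun _ => hG⟩
    · exact ⟨0, fun h => absurd h ht⟩
  choose Dη hDη using hgrad
  refine ⟨η, Dη, hηc, hηU', fun t ht => ?_, fun t ht => ?_, fun t ht => ?_⟩
  · obtain ⟨hG, hm, hG2, hGr⟩ := hDη t ht
    exact ⟨(memLp_congr_ae (hηU t)).2 (Lp.memLp _), hG,
      ⟨hm, hG2.trans_lt ENNReal.ofReal_lt_top⟩, ⟨hm, hGr.trans_lt ENNReal.ofReal_lt_top⟩⟩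
  · have hc : Tendsto (fun s : ℝ => U (max s 0)) (𝓝[Set.Ici 0] t) (𝓝 (U (max t 0))) :=
      (hm.tendsto t).mono_left nhdsWithin_le_nhds
    rw [Lp.tendsto_Lp_iff_tendsto_eLpNorm'] at hc
    exact hc.congr fun s => eLpNorm_congr_ae ((hηU s).symm.sub (hηU t).symm)
  · obtain ⟨hG, hm, hG2, hGr⟩ := hDη t ht
    have hη2 : eLpNorm (η t) 2 volume ≤ ENNReal.ofReal (K * Real.exp (-(lam * t))) := by
      rw [eLpNorm_congr_ae (hηU' t ht), eLpNorm_two_le_iff (by positivity)]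
      exact (hU t ht).1
    exact weighted_sum_le hK hη2 (max_le hG2 hGr)

/-- Construction of a train of solitons with a remainder whose gradient lies in `L² ∩ L^r`. -/
theorem AssumptionT.existsTrain {ωs a D : ℝ} (hT : AssumptionT d g α₁ ωs a D)
    (hF : AssumptionF d g C₀ α₁ α₂) (hd : 1 ≤ d) (hd3 : d ≤ 3) (hα2 : α₁ < 2) {r : ℝ≥0∞}
    (hr : 1 ≤ r) (hdr : (d : ℝ) * (1 / r.toReal) < 1) {β κ σ Cd : ℝ} (hκ : κ = 1 - α₁ / 2)
    (hβ : 0 < β) (hβ1 : β ≤ 1) (hβα : β ≤ α₁) (hσ : σ < 1) (hCd : 0 < Cd)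
    (hdisp : DispersiveBound d (lexp (1 + β)) r σ Cd)
    (h1 : d * (1 + β) / 4 < (α₁ + κ) / α₁) (h2 : d * β / 4 < 1)
    (h3 : ∀ b, b = 0 ∨ b = β → d * (1 + b - β) / 4 < (α₁ - β + κ) / α₁)
    (h4 : ∀ b, b = 0 ∨ b = β → d * (1 + b - min α₁ (1 + b)) / 4 < κ / α₁) {ρ : ℝ} (hρ : 0 < ρ) :
    ∃ lam₀ : ℝ, 0 < lam₀ ∧ ∀ lam, lam₀ ≤ lam → ExistsTrain d g α₁ ωs a D r ρ lam β := by
  have hD := hT.const_pos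
  have hd0 : (0 : ℝ) < 1 + d := by positivity
  -- The function contributes `K` and its gradient `d K`, one `K` per coordinate.
  obtain ⟨K, hK0, hKρ⟩ : ∃ K : ℝ, 0 < K ∧ K + d * K = ρ :=
    ⟨ρ / (1 + d), by positivity, by field_simp⟩
  have hκ0 : 0 ≤ κ := by rw [hκ]; linarith
  obtain ⟨lam₀, hlam₀, H⟩ := hF.exists_remainder hd3 hr hdr hβ hβ1 hβα hκ0 hD.le hK0 hσ hCd hdisp
  refine ⟨lam₀, hlam₀, fun lam hlam => ?_⟩
  have hlam0 : 0 < lam := hlam₀.trans_le hlam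
  obtain ⟨φ, ω, v, l, δ, L, B, w, hdata, hδ, hL, hw, hR, hbg⟩ :=
    hT.exists_background hF hd hα2 hκ hβ hβ1 hβα h1 h2 h3 h4 hlam0
  obtain ⟨U, N, A, hUc, hU, hNc, hNb, hNe, hUN⟩ := H lam hlam L _ _ _ hL hbg
  obtain ⟨η, Dη, hη, hηU, hreg, hcont, hbound⟩ := exists_continuous_representative hd3 hr hdr hK0.le
    (mul_nonneg hβ.le hlam0.le) hUc hU
  rw [hKρ] at hbound
  refine ⟨φ, ω, v, 0, η, Dη, hdata, ?_, hreg, hcont, hbound⟩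
  refine isNLSSolution_add (T := trainProfile φ ω v 0) hF hR hw (by linarith) hD (fun j ψ hψ hψc =>
    (hdata.boundState j).integral_soliton hF (v j) hψ hψc) hlam0 (fun t x => rfl) hNc hNb hη
    (fun t ht => ?_) (fun t ht => ?_)
  · rw [← hUN t ht]
    exact (hηU t ht).symm
  · filter_upwards [hNe t ht, hηU t ht] with x h1 h2
    rw [h1, remainderFun, remainderFun, h2]

end

end SolitonTrain

/-! ### Choice of exponents and conclusion. -/

namespace SolitonTrain

/-- Choice of the Hölder exponent of the gradient in dimension `d ≤ 3`. -/
theorem exists_holder_exponent {d : ℕ} (hd : 1 ≤ d) (hd3 : d ≤ 3) {α : ℝ} (hα0 : 0 < α)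
    (hα : 2 * (1 / 2 - 1 / (d : ℝ)) < α) (hα2 : α < 2) :
    ∃ β : ℝ, max 0 (1 - 2 / (d : ℝ)) < β ∧ β ≤ 1 ∧ β ≤ α ∧ d * β / 2 < 1 ∧
      d * (1 + β) / 4 < (α + (1 - α / 2)) / α ∧
      (∀ b, b = 0 ∨ b = β → d * (1 + b - β) / 4 < (α - β + (1 - α / 2)) / α) ∧
      ∀ b, b = 0 ∨ b = β → d * (1 + b - min α (1 + b)) / 4 < (1 - α / 2) / α := by
  have hinv : 1 / 2 < 1 / α := one_div_lt_one_div_of_lt hα0 hα2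
  have hq : ∀ c : ℝ, (c + (1 - α / 2)) / α = c / α + 1 / α - 1 / 2 := fun c => by
    field_simp; ring
  have hq' : (1 - α / 2) / α = 1 / α - 1 / 2 := by field_simp
  have e : ∀ {b₀ : ℝ} {f h : ℝ → ℝ}, Continuous f → Continuous h → f b₀ < h b₀ →
      ∀ᶠ β in 𝓝[>] b₀, f β < h β := fun hf hh hlt =>
    (hf.continuousAt.eventually_lt hh.continuousAt hlt).filter_mono nhdsWithin_le_nhds
  -- All requirements are strict and continuous in the exponent, so it is enough to check them at
  -- the endpoint and move slightly to the right.
  suffices H : ∃ b₀ : ℝ, b₀ = max 0 (1 - 2 / (d : ℝ)) ∧ b₀ < 1 ∧ b₀ < α ∧ d * b₀ / 2 < 1 ∧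
      d * (1 + b₀) / 4 < 1 / α + 1 / 2 ∧
      d * (1 + 0 - b₀) / 4 < (α - b₀) / α + 1 / α - 1 / 2 ∧
      (d : ℝ) / 4 < (α - b₀) / α + 1 / α - 1 / 2 ∧
      d * (1 + 0 - min α (1 + 0)) / 4 < 1 / α - 1 / 2 ∧
      d * (1 + b₀ - min α (1 + b₀)) / 4 < 1 / α - 1 / 2 by
    obtain ⟨b₀, hb₀, k1, k2, k3, k4, k5, k6, k7, k8⟩ := H
    obtain ⟨β, h0, h1, h2, h3, h4, h5, h6, h8⟩ :=
      (eventually_mem_nhdsWithin.and <|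
      (e (f := fun β => β) (h := fun _ => 1) (by fun_prop) (by fun_prop) k1).and <|
      (e (f := fun β => β) (h := fun _ => α) (by fun_prop) (by fun_prop) k2).and <|
      (e (f := fun β => d * β / 2) (h := fun _ => 1) (by fun_prop) (by fun_prop) k3).and <|
      (e (f := fun β => d * (1 + β) / 4) (h := fun _ => 1 / α + 1 / 2) (by fun_prop)
        (by fun_prop) k4).and <|
      (e (f := fun β => d * (1 + 0 - β) / 4) (h := fun β => (α - β) / α + 1 / α - 1 / 2)
        (by fun_prop) (by fun_prop) k5).and <|
      (e (f := fun _ => d / 4) (h := fun β => (α - β) / α + 1 / α - 1 / 2)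
        (by fun_prop) (by fun_prop) k6).and <|
      (e (f := fun β => d * (1 + β - min α (1 + β)) / 4) (h := fun _ => 1 / α - 1 / 2)
        (by fun_prop) (by fun_prop) k8)).exists
    refine ⟨β, hb₀ ▸ h0, h1.le, h2.le, h3, ?_, ?_, ?_⟩
    · rw [hq, div_self hα0.ne']
      linarith
    · rintro b (rfl | rfl)
      · rw [hq]; exact h5
      · rw [hq, add_sub_cancel_right, mul_one]; exact h6
    · rintro b (rfl | rfl)
      · rw [hq']; exact k7
      · rw [hq']; exact h8
  have hz : ∀ c : ℝ, (α - c) / α = 1 - c * (1 / α) := fun c => by field_simp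
  interval_cases d
  · refine ⟨0, by norm_num, one_pos, hα0, by norm_num, ?_, ?_, ?_, ?_, ?_⟩ <;>
      simp only [hz, Nat.cast_one, add_zero] <;> try linarith
    all_goals
      rcases le_total α 1 with h | h
      · rw [min_eq_left h]
        have : 1 ≤ 1 / α := one_le_one_div hα0 h
        linarith
      · rw [min_eq_right h]; linarith
  · refine ⟨0, by norm_num, one_pos, hα0, by norm_num, ?_, ?_, ?_, ?_, ?_⟩ <;>
      simp only [hz, Nat.cast_ofNat, add_zero] <;> try linarith
    all_goals
      rcases le_total α 1 with h | h
      · rw [min_eq_left h]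
        have : 1 ≤ 1 / α := one_le_one_div hα0 h
        linarith
      · rw [min_eq_right h]; linarith
  -- In dimension three the endpoint is `1/3`, and `b₀ < α` is exactly the lower bound assumed on
  -- `α`.
  · have h13 : 1 / 3 < α := by norm_num at hα; linarith
    refine ⟨1 / 3, by norm_num, by norm_num, h13, by norm_num, ?_, ?_, ?_, ?_, ?_⟩ <;>
      simp only [hz, Nat.cast_ofNat, add_zero] <;> try linarith
    · rcases le_total α 1 with h | h
      · rw [min_eq_left h]
        have : 1 ≤ 1 / α := one_le_one_div hα0 h
        linarith
      · rw [min_eq_right h]; linarith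
    · rcases le_total α (1 + 1 / 3) with h | h
      · rw [min_eq_left h]
        -- After multiplication by `α` this reads `3/4 (α - 1)² + 1/4 > 0`.
        have : 3 / 2 - 3 / 4 * α < 1 / α := by
          rw [lt_div_iff₀ hα0]
          nlinarith [sq_nonneg (α - 1)]
        linarith
      · rw [min_eq_right h]; linarith

end SolitonTrain

theorem theorem3p3 (d : ℕ) (hd : 1 ≤ d) (hd3 : d ≤ 3) (g : ℝ → ℝ) (C₀ α₁ α₂ ωs a D : ℝ)
    (hF : SolitonTrain.AssumptionF d g C₀ α₁ α₂)
    (hT : SolitonTrain.AssumptionT d g α₁ ωs a D)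
    (hα : 2 * (1 / 2 - 1 / (d : ℝ)) < α₁) (hα2 : α₁ < 2) (ρ : ℝ) (hρ : 0 < ρ) :
    (∃ (r : ℝ) (lam₀ c₁ : ℝ), (d : ℝ) < r ∧ 0 < lam₀ ∧ 0 < c₁ ∧ c₁ ≤ 1 ∧
      ∀ lam : ℝ, lam₀ ≤ lam →
        SolitonTrain.ExistsTrain d g α₁ ωs a D (ENNReal.ofReal r) ρ lam c₁) ∧
    (d = 1 → 1 ≤ α₁ →
      ∃ (lam₀ c₁ : ℝ), 0 < lam₀ ∧ 0 < c₁ ∧ c₁ ≤ 1 ∧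
        ∀ lam : ℝ, lam₀ ≤ lam →
          SolitonTrain.ExistsTrain d g α₁ ωs a D ⊤ ρ lam c₁) := by
  have hα0 := hF.exponent_pos
  have hd0 : (0 : ℝ) < d := by exact_mod_cast hd
  constructor
  · obtain ⟨β, hβ0, hβ1, hβα, hβd, h1, h3, h4⟩ :=
      SolitonTrain.exists_holder_exponent hd hd3 hα0 hα hα2
    -- The gap below `β` is the loss in the interpolation, and `θ > 1 - 2/d` means `2/(1 - θ) > d`.
    obtain ⟨θ, hθ0, hθβ⟩ := exists_between hβ0
    have hθ : 0 < θ := (le_max_left _ _).trans_lt hθ0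
    have hθd : 1 - 2 / (d : ℝ) < θ := (le_max_right _ _).trans_lt hθ0
    have hβ : 0 < β := hθ.trans hθβ
    have hθ1 : 0 < 1 - θ := by linarith
    obtain ⟨Cd, hCd, hdisp⟩ := SolitonTrain.exists_dispersiveBound (d := d) hθ hθβ hβ1
    rw [SolitonTrain.lexp_of_pos hθ1] at hdisp
    have hdr : (d : ℝ) < 2 / (1 - θ) := by
      rw [lt_div_iff₀ hθ1]
      have : (1 - θ) * d < 2 / d * d := mul_lt_mul_of_pos_right (by linarith) hd0
      rw [div_mul_cancel₀ _ hd0.ne'] at this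
      linarith
    have hr0 : 0 < 2 / (1 - θ) := by positivity
    have hr1 : 1 ≤ 2 / (1 - θ) := by rw [le_div_iff₀ hθ1]; linarith
    obtain ⟨lam₀, hlam₀, H⟩ := hT.existsTrain hF hd hd3 hα2 (r := ENNReal.ofReal (2 / (1 - θ)))
      (by rwa [ENNReal.one_le_ofReal])
      (by
        rw [ENNReal.toReal_ofReal hr0.le, mul_one_div, div_lt_one hr0]
        exact hdr) rfl hβ hβ1 hβα
      (by nlinarith) hCd hdisp h1 (by linarith) h3 h4 hρ
    exact ⟨2 / (1 - θ), lam₀, β, hdr, hlam₀, hβ, hβ1, H⟩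
  · rintro rfl h1
    -- At `β = 1` the source is `L¹` and the target `L^∞`, so no interpolation is needed; the time
    -- singularity `|t|^{-1/2}` is integrable.
    have hdisp := SolitonTrain.dispersiveBound_one_top (d := 1)
    have hinv : 1 / 2 < 1 / α₁ := one_div_lt_one_div_of_lt hα0 hα2
    have hq' : (1 - α₁ / 2) / α₁ = 1 / α₁ - 1 / 2 := by field_simp
    have hq : (α₁ - 1 + (1 - α₁ / 2)) / α₁ = 1 / 2 := by field_simp; ring
    obtain ⟨lam₀, hlam₀, H⟩ := hT.existsTrain hF hd hd3 hα2 (r := ⊤) (β := 1) le_top (by simp) rfl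
      one_pos le_rfl h1 (σ := ((1 : ℕ) : ℝ) / 2) (by norm_num) one_pos
      (by rwa [one_add_one_eq_two, SolitonTrain.lexp_two])
      (by
        rw [lt_div_iff₀ hα0]
        norm_num
        linarith)
      (by norm_num)
      (by rintro b (rfl | rfl) <;> rw [hq] <;> norm_num)
      (by
        rintro b (rfl | rfl)
        · rw [add_zero, min_eq_right h1, hq']
          norm_num at hinv ⊢
          linarith
        · rw [one_add_one_eq_two, min_eq_left hα2.le, lt_div_iff₀ hα0]
          norm_num
          nlinarith) hρ
    exact ⟨lam₀, 1, hlam₀, one_pos, le_rfl, H⟩
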